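/- Let $G\subset S^1$ be a finite subgroup and let $g=e^{2\pi i/|G|}\in G$ be its standard generator. An $RO(G)$-graded $G$-Mackey functor $\underline{M}_\star$ is a family of $G$-Mackey functors $\underline{M}_\alpha$, $\alpha\in RO(G)$, with box product $(\underline{M}\,\Box\,\underline{N})_\gamma=\bigoplus_{\alpha+\beta=\gamma}\underline{M}_\alpha\,\Box\,\underline{N}_\beta$ and with the symmetry $\tau(a\otimes b)=\sigma(|b|,|a|)\,b\otimes a$, where $\sigma(\alpha,\beta)\in A(G)$ is the element of the Burnside ring given by the switch map $S^\alpha\wedge S^\beta\to S^\beta\wedge S^\alpha$. (These elements depend on coherent identifications $S^\alpha\wedge S^\beta\cong S^{\alpha+\beta}$. The statement holds for every choice of elements with $\sigma(\alpha+\alpha',\beta)=\sigma(\alpha,\beta)\sigma(\alpha',\beta)$, $\sigma(\alpha,\beta+\beta')=\sigma(\alpha,\beta)\sigma(\alpha,\beta')$, $\sigma(\alpha,\beta)\sigma(\beta,\alpha)=1$ and such that, for every finite-dimensional real representation $V$ and every subgroup $H\le G$, the mark of $\sigma(V,V)$ at $H$ is the degree $(-1)^{\dim V^H}$ of the switch map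 of $S^{V^H}\wedge S^{V^H}$.) Every $h\in G$ acts on $\underline{M}_\alpha$ levelwise, through the Weyl group $G/H$ on $\underline{M}_\alpha(G/H)$. Let $\underline{R}_\star$ be a commutative $RO(G)$-graded Green functor (a monoid for $\Box$ with $\mu\tau=\mu$) on which $g$ acts trivially. An associative $\underline{R}_\star$-algebra is a monoid $\underline{M}_\star$ with a unital multiplicative map $\eta:\underline{R}_\star\to\underline{M}_\star$ that is central, i.e. $\eta(r)\,m=\sigma(|m|,|r|)\,m\,\eta(r)$. Let ${}^g\underline{M}_\star$ be the $\underline{M}_\star$-bimodule $\underline{M}_\star$ with the usual right action and the left action $m\cdot x=(gm)x$. The twisted Hochschild homology $\underline{HH}^{\underline{R}_\star,G}_*(\underline{M}_\star)$ is the homology of the simplicial $RO(G)$-graded Mackey functor whose $q$-simplices are the $(q+1)$-fold relative box product ${}^g\underline{M}_\star\,\Box_{\underline{R}_\star}\underline{M}_\star\,\Box_{\underline{R}_\star}\cdots\Box_{\underline{R}_\star}\underline{M}_\star$, with face maps $d_i$ for $0\le i<q$ multiplying the $i$-th and $(i+1)$-st factors (counted from $0$), and with $d_q$ moving the last factor to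 the front by means of $\tau$, letting $g$ act on it, and multiplying it with the factor next to it. The enveloping algebra is $\underline{M}^e_\star=\underline{M}_\star\,\Box_{\underline{R}_\star}\,\underline{M}^{op}_\star$, where $\underline{M}^{op}_\star$ has the multiplication $a*b=\sigma(|b|,|a|)\,ba$; bimodules over $\underline{M}_\star$ on which $\underline{R}_\star$ acts centrally are regarded as left or right $\underline{M}^e_\star$-modules. Let $\mathrm{Tor}^{\underline{M}^e_\star}_{i,\star}(\underline{M}_\star,{}^g\underline{M}_\star)$ be the $i$-th homology of $P_\bullet\,\Box_{\underline{M}^e_\star}{}^g\underline{M}_\star$ for a projective resolution $P_\bullet$ of the right $\underline{M}^e_\star$-module $\underline{M}_\star$; such resolutions exist. If $\underline{M}_\star$ is flat as an $\underline{R}_\star$-module, that is, if $-\,\Box_{\underline{R}_\star}\underline{M}_\star$ preserves monomorphisms of right $\underline{R}_\star$-modules, then for every $i\ge0$ there is an isomorphism of $RO(G)$-graded Mackey functors $$\underline{HH}^{\underline{R}_\star,G}_i(\underline{M}_\star)\;\cong\;\mathrm{Tor}^{\underline{M}_\star\Box_{\underline{R}_\star}\underline{M}^{op}_\star}_{i,\star}(\underline{M}_\star,{}^g\underline{M}_\star).$$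 These isomorphisms are natural: for every map $\varphi:\underline{M}_\star\to\underline{M}'_\star$ of flat associative $\underline{R}_\star$-algebras and all projective resolutions $P_\bullet$ of $\underline{M}_\star$ and $P'_\bullet$ of $\underline{M}'_\star$, there are chain maps $P_\bullet\to P'_\bullet$ over $\varphi$ that are semilinear over $\varphi\,\Box\,\varphi$, and for each of them the isomorphisms commute with the maps induced on Hochschild homology and on $\mathrm{Tor}$. -/

import Mathlib

universe u

noncomputable section

/-! ### Finite `G`-sets -/

/-- A finite `G`-set, with underlying set `{0, …, card - 1}`. Every finite `G`-set is isomorphic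
to one of these, so this is a small model of the category of finite `G`-sets. -/
structure FinGSet (G : Type) [Group G] where
  card : ℕ
  act : MulAction G (Fin card)

namespace FinGSet

variable {G : Type} [Group G]

/-- The underlying set of a finite `G`-set. -/
def El (X : FinGSet G) : Type := Fin X.card

instance (X : FinGSet G) : Finite X.El := inferInstanceAs (Finite (Fin X.card))

instance (X : FinGSet G) : MulAction G X.El := X.act

/-- Equivariant maps. -/
abbrev Hom (X Y : FinGSet G) : Type := X.El →[G] Y.El

/-- The identity map. -/
abbrev idHom (X : FinGSet G) : Hom X X := MulActionHom.id G

/-- The finite `G`-set of the small model that is isomorphic to a given one. -/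
def of (α : Type) [Finite α] [MulAction G α] : FinGSet G where
  card := Nat.card α
  act :=
    { smul := fun g x => Finite.equivFin α (g • (Finite.equivFin α).symm x)
      one_smul := fun x => by
        change Finite.equivFin α ((1 : G) • (Finite.equivFin α).symm x) = x
        simp
      mul_smul := fun g h x => by
        change Finite.equivFin α ((g * h) • (Finite.equivFin α).symm x) =
          Finite.equivFin α (g • (Finite.equivFin α).symm
            (Finite.equivFin α (h • (Finite.equivFin α).symm x)))
        simp [mul_smul] }

/-- The underlying set of `of α` is identified with `α`. -/
def ofEquiv (α : Type) [Finite α] [MulAction G α] : (of (G := G) α).El ≃ α :=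
  (Finite.equivFin α).symm

theorem ofEquiv_smul (α : Type) [Finite α] [MulAction G α] (g : G) (x : (of (G := G) α).El) :
    ofEquiv α (g • x) = g • ofEquiv α x := by
  change (Finite.equivFin α).symm (Finite.equivFin α (g • (Finite.equivFin α).symm x)) = _
  rw [Equiv.symm_apply_apply]
  rfl

/-- The equivariant map from `of α` to `α`. -/
def out (α : Type) [Finite α] [MulAction G α] : (of (G := G) α).El →[G] α where
  toFun := ofEquiv α
  map_smul' := ofEquiv_smul α

theorem out_bijective (α : Type) [Finite α] [MulAction G α] :
    Function.Bijective (out (G := G) α) := (ofEquiv α).bijective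

/-- A commutative square `f ∘ a = k ∘ b` of finite `G`-sets is a pullback square. -/
def IsPullbackSq {W X Z Y : FinGSet G} (a : Hom W X) (b : Hom W Z) (f : Hom X Y) (k : Hom Z Y) :
    Prop :=
  (∀ w, f (a w) = k (b w)) ∧ ∀ x z, f x = k z → ∃! w, a w = x ∧ b w = z

/-- `i : X → Z` and `j : Y → Z` exhibit `Z` as the disjoint union of `X` and `Y`. -/
def IsDisjUnion {X Y Z : FinGSet G} (i : Hom X Z) (j : Hom Y Z) : Prop :=
  Function.Bijective (Sum.elim i j)

theorem IsPullbackSq.symm {W X Z Y : FinGSet G} {a : Hom W X} {b : Hom W Z} {f : Hom X Y}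
    {k : Hom Z Y} (h : IsPullbackSq a b f k) : IsPullbackSq b a k f := by
  refine ⟨fun w => (h.1 w).symm, fun x z e => ?_⟩
  obtain ⟨w, h1, h2⟩ := h.2 z x e.symm
  exact ⟨w, ⟨h1.2, h1.1⟩, fun y hy => h2 y ⟨hy.2, hy.1⟩⟩

/-- The set-theoretic fibre product. -/
def FibreProd {X Z Y : FinGSet G} (f : Hom X Y) (k : Hom Z Y) : Type :=
  {p : X.El × Z.El // f p.1 = k p.2}

instance {X Z Y : FinGSet G} (f : Hom X Y) (k : Hom Z Y) : Finite (FibreProd f k) :=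
  inferInstanceAs (Finite {p : X.El × Z.El // f p.1 = k p.2})

instance {X Z Y : FinGSet G} (f : Hom X Y) (k : Hom Z Y) : MulAction G (FibreProd f k) where
  smul g p := ⟨g • p.1, by
    have := p.2
    rw [Prod.smul_fst, Prod.smul_snd, map_smul, map_smul, this]⟩
  one_smul p := Subtype.ext (one_smul G p.1)
  mul_smul g h p := Subtype.ext (mul_smul g h p.1)

/-- The chosen pullback. -/
abbrev pb {X Z Y : FinGSet G} (f : Hom X Y) (k : Hom Z Y) : FinGSet G := of (FibreProd f k)

/-- First projection of the chosen pullback. -/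
def pbFst {X Z Y : FinGSet G} (f : Hom X Y) (k : Hom Z Y) : Hom (pb f k) X where
  toFun w := (out (FibreProd f k) w).1.1
  map_smul' g w := by rw [map_smul]; rfl

/-- Second projection of the chosen pullback. -/
def pbSnd {X Z Y : FinGSet G} (f : Hom X Y) (k : Hom Z Y) : Hom (pb f k) Z where
  toFun w := (out (FibreProd f k) w).1.2
  map_smul' g w := by rw [map_smul]; rfl

theorem pb_isPullbackSq {X Z Y : FinGSet G} (f : Hom X Y) (k : Hom Z Y) :
    IsPullbackSq (pbFst f k) (pbSnd f k) f k := by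
  refine ⟨fun w => (out (FibreProd f k) w).2, fun x z e => ?_⟩
  obtain ⟨w, hw⟩ := (out_bijective (G := G) (FibreProd f k)).2 ⟨(x, z), e⟩
  refine ⟨w, ⟨?_, ?_⟩, fun y hy => (out_bijective (FibreProd f k)).1 ?_⟩
  · change (out (FibreProd f k) w).1.1 = x
    rw [hw]
  · change (out (FibreProd f k) w).1.2 = z
    rw [hw]
  · rw [hw]
    exact Subtype.ext (Prod.ext hy.1 hy.2)

/-- The unique equivariant map into a pullback. -/
theorem IsPullbackSq.exists_lift {W X Z Y V : FinGSet G} {a : Hom W X} {b : Hom W Z}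
    {f : Hom X Y} {k : Hom Z Y} (h : IsPullbackSq a b f k) (x : Hom V X) (z : Hom V Z)
    (e : ∀ v, f (x v) = k (z v)) :
    ∃ l : Hom V W, (∀ v, a (l v) = x v) ∧ ∀ v, b (l v) = z v := by
  choose l hl hu using fun v => h.2 (x v) (z v) (e v)
  refine ⟨⟨l, fun g v => ?_⟩, fun v => (hl v).1, fun v => (hl v).2⟩
  refine (hu (g • v) (g • l v) ⟨?_, ?_⟩).symm
  · rw [map_smul, (hl v).1, map_smul]
  · rw [map_smul, (hl v).2, map_smul]

/-- Two finite `G`-sets are isomorphic. -/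
def Iso (X Y : FinGSet G) : Prop := ∃ f : Hom X Y, Function.Bijective f

/-- The inverse of a bijective equivariant map. -/
theorem exists_inverse {X Y : FinGSet G} (f : Hom X Y) (hf : Function.Bijective f) :
    ∃ k : Hom Y X, (∀ x, k (f x) = x) ∧ ∀ y, f (k y) = y := by
  let e := Equiv.ofBijective f hf
  refine ⟨⟨e.symm, fun g y => ?_⟩, fun x => e.symm_apply_apply x, fun y => e.apply_symm_apply y⟩
  apply e.injective
  rw [Equiv.apply_symm_apply]
  change g • y = f (g • e.symm y)
  rw [map_smul]
  exact congrArg (g • ·) (e.apply_symm_apply y).symm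

variable (G) in
/-- Isomorphism as a setoid. -/
def isoSetoid : Setoid (FinGSet G) where
  r := Iso
  iseqv :=
    { refl := fun X => ⟨idHom X, Function.bijective_id⟩
      symm := fun {X Y} ⟨f, hf⟩ => by
        obtain ⟨k, h1, h2⟩ := exists_inverse f hf
        exact ⟨k, Function.bijective_iff_has_inverse.2 ⟨f, h2, h1⟩⟩
      trans := fun {X Y Z} ⟨f, hf⟩ ⟨k, hk⟩ => ⟨k.comp f, hk.comp hf⟩ }

/-- The cartesian product. -/
abbrev prod (X Y : FinGSet G) : FinGSet G := of (X.El × Y.El)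

/-- First projection. -/
def fst (X Y : FinGSet G) : Hom (prod X Y) X where
  toFun w := (out (X.El × Y.El) w).1
  map_smul' g w := by rw [map_smul]; rfl

/-- Second projection. -/
def snd (X Y : FinGSet G) : Hom (prod X Y) Y where
  toFun w := (out (X.El × Y.El) w).2
  map_smul' g w := by rw [map_smul]; rfl

/-- `p` and `q` exhibit `P` as the product of `X` and `Y`. -/
def IsProd {P X Y : FinGSet G} (p : Hom P X) (q : Hom P Y) : Prop :=
  ∀ x y, ∃! w, p w = x ∧ q w = y

theorem prod_isProd (X Y : FinGSet G) : IsProd (fst X Y) (snd X Y) := by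
  intro x y
  obtain ⟨w, hw⟩ := (out_bijective (G := G) (X.El × Y.El)).2 (x, y)
  refine ⟨w, ⟨?_, ?_⟩, fun y hy => (out_bijective (X.El × Y.El)).1 ?_⟩
  · change (out (X.El × Y.El) w).1 = x
    rw [hw]
  · change (out (X.El × Y.El) w).2 = _
    rw [hw]
  · rw [hw]
    exact Prod.ext hy.1 hy.2

theorem IsProd.exists_lift {P X Y V : FinGSet G} {p : Hom P X} {q : Hom P Y} (h : IsProd p q)
    (x : Hom V X) (y : Hom V Y) :
    ∃ l : Hom V P, (∀ v, p (l v) = x v) ∧ ∀ v, q (l v) = y v := by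
  choose l hl hu using fun v => h (x v) (y v)
  refine ⟨⟨l, fun g v => ?_⟩, fun v => (hl v).1, fun v => (hl v).2⟩
  refine (hu (g • v) (g • l v) ⟨?_, ?_⟩).symm
  · rw [map_smul, (hl v).1, map_smul]
  · rw [map_smul, (hl v).2, map_smul]

/-- The one-point `G`-set. -/
def pt (G : Type) [Group G] : FinGSet G := of PUnit

end FinGSet

/-! ### The Burnside ring -/

/-- Isomorphism classes of finite `G`-sets. -/
def GSetClass (G : Type) [Group G] : Type := Quotient (FinGSet.isoSetoid G)

namespace GSetClass

variable {G : Type} [Group G]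

/-- The isomorphism class of a finite `G`-set. -/
def mk (X : FinGSet G) : GSetClass G := Quotient.mk (FinGSet.isoSetoid G) X

/-- The isomorphism class of a finite `G`-set that need not belong to the small model. -/
def cls (G : Type) [Group G] (α : Type) [Finite α] [MulAction G α] : GSetClass G :=
  mk (FinGSet.of α)

theorem cls_eq {α β : Type} [Finite α] [MulAction G α] [Finite β] [MulAction G β] (e : α ≃ β)
    (he : ∀ (g : G) x, e (g • x) = g • e x) : cls G α = cls G β := by
  refine Quotient.sound ⟨⟨fun x => (FinGSet.ofEquiv β).symm (e (FinGSet.ofEquiv α x)), ?_⟩, ?_⟩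
  · intro g x
    apply (FinGSet.ofEquiv (G := G) β).injective
    simp [FinGSet.ofEquiv_smul, he]
  · exact ((FinGSet.ofEquiv α).trans (e.trans (FinGSet.ofEquiv β).symm)).bijective

theorem mk_eq_cls (X : FinGSet G) : mk X = cls G X.El :=
  Quotient.sound <| (FinGSet.isoSetoid G).symm
    ⟨FinGSet.out X.El, FinGSet.out_bijective X.El⟩

/-- Cartesian product of isomorphism classes. -/
instance : Mul (GSetClass G) where
  mul := Quotient.map₂ (sa := FinGSet.isoSetoid G) (sb := FinGSet.isoSetoid G)
    (sc := FinGSet.isoSetoid G) FinGSet.prod (by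
      rintro X X' ⟨f, hf⟩ Y Y' ⟨k, hk⟩
      exact Quotient.exact (cls_eq
        (Equiv.prodCongr (Equiv.ofBijective f hf) (Equiv.ofBijective k hk))
        (fun g x => Prod.ext (map_smul f g x.1) (map_smul k g x.2))))

theorem mk_mul_mk (X Y : FinGSet G) : mk X * mk Y = cls G (X.El × Y.El) := rfl

theorem cls_mul_cls (α β : Type) [Finite α] [MulAction G α] [Finite β] [MulAction G β] :
    cls G α * cls G β = cls G (α × β) :=
  cls_eq (Equiv.prodCongr (FinGSet.ofEquiv α) (FinGSet.ofEquiv β))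
    (fun g x => Prod.ext (FinGSet.ofEquiv_smul α g x.1) (FinGSet.ofEquiv_smul β g x.2))

instance : CommMonoid (GSetClass G) where
  one := cls G PUnit
  mul_assoc := by
    rintro ⟨X⟩ ⟨Y⟩ ⟨Z⟩
    change mk X * mk Y * mk Z = mk X * (mk Y * mk Z)
    simp only [mk_eq_cls, cls_mul_cls]
    exact cls_eq (Equiv.prodAssoc _ _ _) (fun _ _ => rfl)
  one_mul := by
    rintro ⟨X⟩
    change cls G PUnit * mk X = mk X
    simp only [mk_eq_cls, cls_mul_cls]
    exact cls_eq (Equiv.punitProd _) (fun _ _ => rfl)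
  mul_one := by
    rintro ⟨X⟩
    change mk X * cls G PUnit = mk X
    simp only [mk_eq_cls, cls_mul_cls]
    exact cls_eq (Equiv.prodPUnit _) (fun _ _ => rfl)
  mul_comm := by
    rintro ⟨X⟩ ⟨Y⟩
    change mk X * mk Y = mk Y * mk X
    simp only [mk_eq_cls, cls_mul_cls]
    exact cls_eq (Equiv.prodComm _ _) (fun _ _ => rfl)

theorem one_def : (1 : GSetClass G) = mk (FinGSet.pt G) := rfl

end GSetClass

/-- The ideal of relations `[X ⊔ Y] = [X] + [Y]`. -/
def burnsideIdeal (G : Type) [Group G] : Ideal (FreeAbelianGroup (GSetClass G)) :=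
  Ideal.span {x | ∃ (X Y Z : FinGSet G) (i : FinGSet.Hom X Z) (j : FinGSet.Hom Y Z),
    FinGSet.IsDisjUnion i j ∧
      x = FreeAbelianGroup.of (GSetClass.mk Z) -
        (FreeAbelianGroup.of (GSetClass.mk X) + FreeAbelianGroup.of (GSetClass.mk Y))}

/-- The Burnside ring `A(G)`: the group completion of the isomorphism classes of finite `G`-sets
under disjoint union, with multiplication given by the cartesian product. -/
abbrev BurnsideRing (G : Type) [Group G] : Type :=
  FreeAbelianGroup (GSetClass G) ⧸ burnsideIdeal G

namespace BurnsideRing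

variable {G : Type} [Group G]

/-- Ring homomorphisms out of the Burnside ring. -/
def lift {S : Type*} [Ring S] (φ : GSetClass G →* S)
    (h : ∀ (X Y Z : FinGSet G) (i : FinGSet.Hom X Z) (j : FinGSet.Hom Y Z),
      FinGSet.IsDisjUnion i j → φ (.mk Z) = φ (.mk X) + φ (.mk Y)) : BurnsideRing G →+* S :=
  Ideal.Quotient.lift (burnsideIdeal G) (FreeAbelianGroup.liftMonoid φ) (by
    have : burnsideIdeal G ≤ RingHom.ker (FreeAbelianGroup.liftMonoid φ) := by
      rw [burnsideIdeal, Ideal.span_le]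
      rintro x ⟨X, Y, Z, i, j, hij, rfl⟩
      simp [RingHom.mem_ker, FreeAbelianGroup.liftMonoid_coe, h X Y Z i j hij]
    exact fun a ha => RingHom.mem_ker.1 (this ha))

theorem closure_ring (P : BurnsideRing G → Prop)
    (hof : ∀ X : FinGSet G, P (Ideal.Quotient.mk _ (FreeAbelianGroup.of (.mk X))))
    (hadd : ∀ x y, P x → P y → P (x + y)) (hneg : ∀ x, P x → P (-x)) (h0 : P 0) : ∀ x, P x := by
  intro x
  obtain ⟨y, rfl⟩ := Ideal.Quotient.mk_surjective x
  induction y using FreeAbelianGroup.induction_on with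
  | zero => simpa using h0
  | of c => obtain ⟨X⟩ := c; exact hof X
  | neg c h => rw [map_neg]; exact hneg _ h
  | add a b ha hb => rw [map_add]; exact hadd _ _ ha hb

/-- The class in `A(G)` of a finite `G`-set. -/
def of (X : FinGSet G) : BurnsideRing G :=
  Ideal.Quotient.mk _ (FreeAbelianGroup.of (.mk X))

theorem lift_of {S : Type*} [Ring S] (φ : GSetClass G →* S) (h) (X : FinGSet G) :
    lift φ h (of X) = φ (.mk X) := by
  rw [lift, of, Ideal.Quotient.lift_mk, FreeAbelianGroup.liftMonoid_coe,
    FreeAbelianGroup.lift_apply_of]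

/-- The number of `H`-fixed points, on isomorphism classes. -/
def fixedCard (H : Subgroup G) : GSetClass G →* ℤ where
  toFun := Quotient.lift (s := FinGSet.isoSetoid G)
    (fun X => (Nat.card {x : X.El // ∀ h ∈ H, h • x = x} : ℤ)) (by
      rintro X Y ⟨f, hf⟩
      have : Nat.card {x : X.El // ∀ h ∈ H, h • x = x} =
          Nat.card {x : Y.El // ∀ h ∈ H, h • x = x} := by
        refine Nat.card_congr (Equiv.subtypeEquiv (Equiv.ofBijective f hf) fun x => ?_)
        refine forall₂_congr fun h _ => ?_
        change _ ↔ h • f x = f x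
        rw [← map_smul, hf.1.eq_iff]
      exact_mod_cast this)
  map_one' := by
    change (Nat.card {x : (FinGSet.of (G := G) PUnit).El // ∀ h ∈ H, h • x = x} : ℤ) = 1
    have : Nat.card {x : (FinGSet.of (G := G) PUnit).El // ∀ h ∈ H, h • x = x} = 1 := by
      rw [Nat.card_eq_one_iff_unique]
      have hs : ∀ x y : (FinGSet.of (G := G) PUnit).El, x = y := fun x y =>
        (FinGSet.ofEquiv PUnit).injective rfl
      exact ⟨⟨fun x y => Subtype.ext (hs _ _)⟩,
        ⟨⟨(FinGSet.ofEquiv PUnit).symm PUnit.unit, fun h _ => hs _ _⟩⟩⟩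
    exact_mod_cast this
  map_mul' := by
    rintro ⟨X⟩ ⟨Y⟩
    change (Nat.card {x : (FinGSet.of (G := G) (X.El × Y.El)).El // ∀ h ∈ H, h • x = x} : ℤ) =
      (Nat.card {x : X.El // ∀ h ∈ H, h • x = x} : ℤ) *
        (Nat.card {x : Y.El // ∀ h ∈ H, h • x = x} : ℤ)
    rw [← Nat.cast_mul, ← Nat.card_prod]
    congr 1
    refine Nat.card_congr (Equiv.trans (Equiv.subtypeEquiv (FinGSet.ofEquiv (X.El × Y.El))
      (q := fun p => (∀ h ∈ H, h • p.1 = p.1) ∧ ∀ h ∈ H, h • p.2 = p.2) fun x => ?_)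
      (Equiv.subtypeProdEquivProd (p := fun x : X.El => ∀ h ∈ H, h • x = x)
        (q := fun x : Y.El => ∀ h ∈ H, h • x = x)))
    rw [← forall₂_and]
    refine forall₂_congr fun h _ => ?_
    rw [← (FinGSet.ofEquiv (X.El × Y.El)).injective.eq_iff, FinGSet.ofEquiv_smul, Prod.ext_iff]
    rfl

/-- The mark homomorphism `A(G) → ℤ` of a subgroup `H`, sending a finite `G`-set to the number of
its `H`-fixed points. For a stable self-map of a sphere it is the degree on `H`-fixed points. -/
def mark (H : Subgroup G) : BurnsideRing G →+* ℤ :=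
  lift (fixedCard H) (by
    intro X Y Z i j hij
    change (Nat.card {x : Z.El // ∀ h ∈ H, h • x = x} : ℤ) =
      (Nat.card {x : X.El // ∀ h ∈ H, h • x = x} : ℤ) +
        (Nat.card {x : Y.El // ∀ h ∈ H, h • x = x} : ℤ)
    rw [← Nat.cast_add, ← Nat.card_sum]
    congr 1
    refine Nat.card_congr (Equiv.symm (Equiv.trans
      (Equiv.subtypeSum (α := X.El) (β := Y.El) (p := fun s => ∀ h ∈ H, h • s = s)
        |>.trans ?_ |>.symm)
      (Equiv.subtypeEquiv (Equiv.ofBijective _ hij) fun s => ?_)))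
    · refine Equiv.sumCongr (Equiv.subtypeEquivRight fun x => ?_)
        (Equiv.subtypeEquivRight fun x => ?_)
      · exact forall₂_congr fun h _ => Sum.inl_injective.eq_iff
      · exact forall₂_congr fun h _ => Sum.inr_injective.eq_iff
    · refine forall₂_congr fun h _ => ?_
      rw [← hij.1.eq_iff]
      cases s
      · exact (congrArg (· = _) (map_smul i h _)).to_iff
      · exact (congrArg (· = _) (map_smul j h _)).to_iff)

end BurnsideRing

/-! ### Mackey functors -/

/-- A Mackey functor for the finite group `G`: a covariant functor (transfers) and a contravariant
functor (restrictions) from finite `G`-sets to abelian groups with the same values, satisfying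
the base change formula for pullback squares, and taking disjoint unions to direct sums. -/
structure Mackey (G : Type) [Group G] where
  obj : FinGSet G → Type u
  [grp : ∀ X, AddCommGroup (obj X)]
  res : ∀ {X Y : FinGSet G}, FinGSet.Hom X Y → obj Y →+ obj X
  tr : ∀ {X Y : FinGSet G}, FinGSet.Hom X Y → obj X →+ obj Y
  res_id : ∀ {X : FinGSet G} (m : obj X), res (FinGSet.idHom X) m = m
  tr_id : ∀ {X : FinGSet G} (m : obj X), tr (FinGSet.idHom X) m = m
  res_comp : ∀ {X Y Z : FinGSet G} (f : FinGSet.Hom X Y) (k : FinGSet.Hom Y Z) (m : obj Z),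
    res (k.comp f) m = res f (res k m)
  tr_comp : ∀ {X Y Z : FinGSet G} (f : FinGSet.Hom X Y) (k : FinGSet.Hom Y Z) (m : obj X),
    tr (k.comp f) m = tr k (tr f m)
  res_tr : ∀ {W X Z Y : FinGSet G} (a : FinGSet.Hom W X) (b : FinGSet.Hom W Z)
    (f : FinGSet.Hom X Y) (k : FinGSet.Hom Z Y), FinGSet.IsPullbackSq a b f k →
    ∀ m : obj X, res k (tr f m) = tr b (res a m)
  /- Additivity. Together with base change this says that `obj Z` is the direct sum of `obj X` and
  `obj Y`, see `Mackey.res_bijective`. -/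
  tr_res_add : ∀ {X Y Z : FinGSet G} (i : FinGSet.Hom X Z) (j : FinGSet.Hom Y Z),
    FinGSet.IsDisjUnion i j → ∀ m : obj Z, tr i (res i m) + tr j (res j m) = m

attribute [instance] Mackey.grp

namespace Mackey

variable {G : Type} [Group G]

theorem res_tr_of_injective (M : Mackey.{u} G) {X Y : FinGSet G} (f : FinGSet.Hom X Y)
    (hf : Function.Injective f) (m : M.obj X) : M.res f (M.tr f m) = m := by
  rw [M.res_tr (FinGSet.idHom X) (FinGSet.idHom X) f f, M.res_id, M.tr_id]
  exact ⟨fun _ => rfl, fun x z e => ⟨x, ⟨rfl, hf e⟩, fun y hy => hy.1⟩⟩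

theorem tr_res_of_bijective (M : Mackey.{u} G) {X Y : FinGSet G} (f : FinGSet.Hom X Y)
    (hf : Function.Bijective f) (m : M.obj Y) : M.tr f (M.res f m) = m := by
  rw [← M.res_tr f f (FinGSet.idHom Y) (FinGSet.idHom Y), M.res_id, M.tr_id]
  refine ⟨fun _ => rfl, fun x z e => ?_⟩
  obtain ⟨w, rfl⟩ := hf.2 x
  exact ⟨w, ⟨rfl, e⟩, fun y hy => hf.1 hy.1⟩

/-- A Mackey functor vanishes on the empty `G`-set. -/
theorem eq_zero_of_isEmpty (M : Mackey.{u} G) {X : FinGSet G} [IsEmpty X.El] (m : M.obj X) :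
    m = 0 := by
  have h := M.tr_res_add (FinGSet.idHom X) (FinGSet.idHom X)
    ⟨fun x => isEmptyElim (Sum.elim (fun y : X.El => y) (fun y : X.El => y) x),
      fun x => isEmptyElim x⟩ m
  simpa [M.res_id, M.tr_id] using h

theorem res_tr_disjoint (M : Mackey.{u} G) {X Y Z : FinGSet G} (i : FinGSet.Hom X Z)
    (j : FinGSet.Hom Y Z) (h : FinGSet.IsDisjUnion i j) (m : M.obj X) :
    M.res j (M.tr i m) = 0 := by
  have hne : ∀ x y, i x ≠ j y := fun x y e => by
    have := @h.1 (Sum.inl x) (Sum.inr y) e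
    cases this
  have : IsEmpty (FinGSet.pb i j).El :=
    ⟨fun w => hne _ _ ((FinGSet.pb_isPullbackSq i j).1 w)⟩
  rw [M.res_tr _ _ i j (FinGSet.pb_isPullbackSq i j), M.eq_zero_of_isEmpty (M.res _ m), map_zero]

/-- A Mackey functor takes disjoint unions to direct sums. -/
theorem res_bijective (M : Mackey.{u} G) {X Y Z : FinGSet G} (i : FinGSet.Hom X Z)
    (j : FinGSet.Hom Y Z) (h : FinGSet.IsDisjUnion i j) :
    Function.Bijective (fun m : M.obj Z => (M.res i m, M.res j m)) := by
  have hsymm : FinGSet.IsDisjUnion j i := by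
    have : (Sum.elim j i) = (Sum.elim i j) ∘ Equiv.sumComm _ _ := by
      ext (x | x) <;> rfl
    rw [FinGSet.IsDisjUnion, this]
    exact h.comp (Equiv.sumComm _ _).bijective
  have hi : Function.Injective i := h.1.comp Sum.inl_injective
  have hj : Function.Injective j := h.1.comp Sum.inr_injective
  refine ⟨fun m n e => ?_, fun p => ⟨M.tr i p.1 + M.tr j p.2, ?_⟩⟩
  · obtain ⟨e1, e2⟩ := Prod.ext_iff.1 e
    dsimp only at e1 e2
    rw [← M.tr_res_add i j h m, e1, e2, M.tr_res_add i j h n]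
  · ext
    · simp [M.res_tr_of_injective i hi, M.res_tr_disjoint j i hsymm]
    · simp [M.res_tr_of_injective j hj, M.res_tr_disjoint i j h]

/-- A map of Mackey functors. -/
structure Hom (M N : Mackey.{u} G) where
  app : ∀ X : FinGSet G, M.obj X →+ N.obj X
  app_res : ∀ {X Y : FinGSet G} (f : FinGSet.Hom X Y) (m : M.obj Y),
    app X (M.res f m) = N.res f (app Y m)
  app_tr : ∀ {X Y : FinGSet G} (f : FinGSet.Hom X Y) (m : M.obj X),
    app Y (M.tr f m) = N.tr f (app X m)

/-- The endomorphism `m ↦ tr_p (res_p m)` of `M(X)`, for the projection `p : X × S → X`. -/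
def classEnd (M : Mackey.{u} G) (X S : FinGSet G) : AddMonoid.End (M.obj X) :=
  (M.tr (FinGSet.fst X S)).comp (M.res (FinGSet.fst X S))

theorem classEnd_apply (M : Mackey.{u} G) {X S P : FinGSet G} (p : FinGSet.Hom P X)
    (q : FinGSet.Hom P S) (h : FinGSet.IsProd p q) (m : M.obj X) :
    M.classEnd X S m = M.tr p (M.res p m) := by
  obtain ⟨l, h1, h2⟩ := (FinGSet.prod_isProd X S).exists_lift p q
  have hl : Function.Bijective l := by
    refine ⟨fun v w e => ?_, fun w => ?_⟩
    · obtain ⟨_, _, hu⟩ := h (p v) (q v)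
      rw [hu v ⟨rfl, rfl⟩, hu w ⟨by rw [← h1, ← h1, e], by rw [← h2, ← h2, e]⟩]
    · obtain ⟨v, hv, _⟩ := h (FinGSet.fst X S w) (FinGSet.snd X S w)
      obtain ⟨_, _, hu⟩ := FinGSet.prod_isProd X S (FinGSet.fst X S w) (FinGSet.snd X S w)
      refine ⟨v, ?_⟩
      rw [hu (l v) ⟨by rw [h1, hv.1], by rw [h2, hv.2]⟩, hu w ⟨rfl, rfl⟩]
  have e : p = (FinGSet.fst X S).comp l := MulActionHom.ext fun v => (h1 v).symm
  rw [e, M.tr_comp, M.res_comp, M.tr_res_of_bijective l hl]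
  rfl

theorem classEnd_mul (M : Mackey.{u} G) (X S T : FinGSet G) (m : M.obj X) :
    M.classEnd X S (M.classEnd X T m) = M.classEnd X (FinGSet.prod S T) m := by
  let p := FinGSet.fst X S
  let q := FinGSet.fst X T
  let a := FinGSet.pbFst q p
  let b := FinGSet.pbSnd q p
  have hpb : FinGSet.IsPullbackSq a b q p := FinGSet.pb_isPullbackSq q p
  obtain ⟨l, h1, h2⟩ := (FinGSet.prod_isProd S T).exists_lift ((FinGSet.snd X S).comp b)
    ((FinGSet.snd X T).comp a)
  have hprod : FinGSet.IsProd (p.comp b) l := by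
    intro x y
    obtain ⟨w, hw, hwu⟩ := FinGSet.prod_isProd X S x (FinGSet.fst S T y)
    obtain ⟨v, hv, hvu⟩ := FinGSet.prod_isProd X T x (FinGSet.snd S T y)
    obtain ⟨z, hz, hzu⟩ := hpb.2 v w (hv.1.trans hw.1.symm)
    obtain ⟨_, _, hyu⟩ := FinGSet.prod_isProd S T (FinGSet.fst S T y) (FinGSet.snd S T y)
    refine ⟨z, ⟨?_, ?_⟩, fun z' hz' => hzu z' ⟨hvu _ ⟨?_, ?_⟩, hwu _ ⟨?_, ?_⟩⟩⟩
    · exact (congrArg p hz.2).trans hw.1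
    · rw [hyu (l z) ⟨?_, ?_⟩, hyu y ⟨rfl, rfl⟩]
      · rw [h1]
        exact (congrArg (FinGSet.snd X S) hz.2).trans hw.2
      · rw [h2]
        exact (congrArg (FinGSet.snd X T) hz.1).trans hv.2
    · exact (hpb.1 z').trans hz'.1
    · rw [← hz'.2, h2]
      rfl
    · exact hz'.1
    · rw [← hz'.2, h1]
      rfl
  rw [M.classEnd_apply (p.comp b) l hprod, M.tr_comp, M.res_comp]
  change M.tr p (M.res p (M.tr q (M.res q m))) = _
  rw [M.res_tr a b q p hpb, ← M.res_comp, ← M.res_comp]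
  have : p.comp b = q.comp a := MulActionHom.ext fun w => (hpb.1 w).symm
  rw [this]

/-- The action of the Burnside ring on the values of a Mackey functor. -/
def burnsideAction (M : Mackey.{u} G) (X : FinGSet G) :
    BurnsideRing G →+* AddMonoid.End (M.obj X) :=
  BurnsideRing.lift
    { toFun := Quotient.lift (s := FinGSet.isoSetoid G) (M.classEnd X) (by
        rintro S T ⟨f, hf⟩
        ext m
        refine M.classEnd_apply (FinGSet.fst X T) (FinGSet.snd X T)
          (FinGSet.prod_isProd X T) m ▸ ?_
        obtain ⟨k, hk1, hk2⟩ := FinGSet.exists_inverse f hf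
        refine M.classEnd_apply _ (k.comp (FinGSet.snd X T)) (fun x s => ?_) m
        obtain ⟨w, hw, hu⟩ := FinGSet.prod_isProd X T x (f s)
        refine ⟨w, ⟨hw.1, ?_⟩, fun y hy => hu y ⟨hy.1, ?_⟩⟩
        · exact (congrArg k hw.2).trans (hk1 s)
        · rw [← hy.2]
          exact (hk2 _).symm)
      map_one' := by
        ext m
        refine (M.classEnd_apply (FinGSet.idHom X)
          (⟨fun _ => (FinGSet.ofEquiv PUnit).symm PUnit.unit,
            fun _ _ => (FinGSet.ofEquiv PUnit).injective rfl⟩ : FinGSet.Hom X (FinGSet.pt G))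
          (fun x s => ⟨x, ⟨rfl, (FinGSet.ofEquiv PUnit).injective rfl⟩, fun y hy => hy.1⟩)
          m).trans ?_
        rw [M.res_id, M.tr_id]
        rfl
      map_mul' := by
        rintro ⟨S⟩ ⟨T⟩
        ext m
        exact (M.classEnd_mul X S T m).symm }
    (by
      intro S T Z i j hij
      ext m
      change M.classEnd X Z m = M.classEnd X S m + M.classEnd X T m
      obtain ⟨a, ha1, ha2⟩ := (FinGSet.prod_isProd X Z).exists_lift (FinGSet.fst X S)
        (i.comp (FinGSet.snd X S))
      obtain ⟨b, hb1, hb2⟩ := (FinGSet.prod_isProd X Z).exists_lift (FinGSet.fst X T)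
        (j.comp (FinGSet.snd X T))
      have ha : FinGSet.fst X S = (FinGSet.fst X Z).comp a :=
        MulActionHom.ext fun v => (ha1 v).symm
      have hb : FinGSet.fst X T = (FinGSet.fst X Z).comp b :=
        MulActionHom.ext fun v => (hb1 v).symm
      have hab : FinGSet.IsDisjUnion a b := by
        have key : ∀ s : (FinGSet.prod X S).El ⊕ (FinGSet.prod X T).El,
            FinGSet.fst X Z (Sum.elim a b s) =
              Sum.elim (FinGSet.fst X S) (FinGSet.fst X T) s ∧
            FinGSet.snd X Z (Sum.elim a b s) =
              Sum.elim i j (Sum.map (FinGSet.snd X S) (FinGSet.snd X T) s) := by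
          rintro (s | s)
          · exact ⟨ha1 s, ha2 s⟩
          · exact ⟨hb1 s, hb2 s⟩
        constructor
        · intro s t e
          have e1 := (key s).1.symm.trans ((congrArg (FinGSet.fst X Z) e).trans (key t).1)
          have e2 := hij.1
            ((key s).2.symm.trans ((congrArg (FinGSet.snd X Z) e).trans (key t).2))
          rcases s with s | s <;> rcases t with t | t
          · obtain ⟨_, _, hu⟩ := FinGSet.prod_isProd X S (FinGSet.fst X S s)
              (FinGSet.snd X S s)
            rw [hu s ⟨rfl, rfl⟩, hu t ⟨e1.symm, (Sum.inl_injective e2).symm⟩]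
          · cases e2
          · cases e2
          · obtain ⟨_, _, hu⟩ := FinGSet.prod_isProd X T (FinGSet.fst X T s)
              (FinGSet.snd X T s)
            rw [hu s ⟨rfl, rfl⟩, hu t ⟨e1.symm, (Sum.inr_injective e2).symm⟩]
        · intro w
          obtain ⟨_, _, hu⟩ := FinGSet.prod_isProd X Z (FinGSet.fst X Z w) (FinGSet.snd X Z w)
          obtain ⟨z, hz⟩ := hij.2 (FinGSet.snd X Z w)
          rcases z with z | z
          · obtain ⟨v, hv, _⟩ := FinGSet.prod_isProd X S (FinGSet.fst X Z w) z
            refine ⟨Sum.inl v, ?_⟩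
            rw [hu w ⟨rfl, rfl⟩]
            exact hu _ ⟨(ha1 v).trans hv.1, (ha2 v).trans ((congrArg i hv.2).trans hz)⟩
          · obtain ⟨v, hv, _⟩ := FinGSet.prod_isProd X T (FinGSet.fst X Z w) z
            refine ⟨Sum.inr v, ?_⟩
            rw [hu w ⟨rfl, rfl⟩]
            exact hu _ ⟨(hb1 v).trans hv.1, (hb2 v).trans ((congrArg j hv.2).trans hz)⟩
      change M.tr _ (M.res _ m) = M.tr _ (M.res _ m) + M.tr _ (M.res _ m)
      rw [ha, hb, M.tr_comp, M.tr_comp, M.res_comp, M.res_comp, ← map_add,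
        M.tr_res_add a b hab])

instance (M : Mackey.{u} G) (X : FinGSet G) : Module (BurnsideRing G) (M.obj X) :=
  Module.compHom (M.obj X) (M.burnsideAction X)

theorem smul_def (M : Mackey.{u} G) {X : FinGSet G} (s : BurnsideRing G) (m : M.obj X) :
    s • m = M.burnsideAction X s m := rfl

theorem of_smul (M : Mackey.{u} G) {X : FinGSet G} (S : FinGSet G) (m : M.obj X) :
    BurnsideRing.of S • m = M.tr (FinGSet.fst X S) (M.res (FinGSet.fst X S) m) := by
  rw [smul_def, burnsideAction, BurnsideRing.lift_of]
  rfl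

/-- A family of additive maps that commutes with the classes of `G`-sets is linear over the
Burnside ring. -/
theorem map_smul_of {A B : Type*} [AddCommGroup A] [AddCommGroup B] [Module (BurnsideRing G) A]
    [Module (BurnsideRing G) B] (φ : A →+ B)
    (h : ∀ (S : FinGSet G) a, φ (BurnsideRing.of S • a) = BurnsideRing.of S • φ a)
    (s : BurnsideRing G) (a : A) : φ (s • a) = s • φ a := by
  revert a
  refine BurnsideRing.closure_ring (fun s => ∀ a, φ (s • a) = s • φ a) h ?_ ?_ ?_ s
  · intro x y hx hy a
    rw [add_smul, map_add, hx, hy, add_smul]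
  · intro x hx a
    rw [neg_smul, map_neg, hx, neg_smul]
  · intro a
    rw [zero_smul, zero_smul, map_zero]

theorem Hom.map_smul {M N : Mackey.{u} G} (φ : Hom M N) {X : FinGSet G} (s : BurnsideRing G)
    (m : M.obj X) : φ.app X (s • m) = s • φ.app X m :=
  map_smul_of (φ.app X) (fun S a => by rw [of_smul, of_smul, φ.app_tr, φ.app_res]) s m

theorem fst_square {X Y : FinGSet G} (S : FinGSet G) (f : FinGSet.Hom X Y) :
    ∃ l : FinGSet.Hom (FinGSet.prod X S) (FinGSet.prod Y S),
      FinGSet.IsPullbackSq (FinGSet.fst X S) l f (FinGSet.fst Y S) := by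
  obtain ⟨l, h1, h2⟩ := (FinGSet.prod_isProd Y S).exists_lift (f.comp (FinGSet.fst X S))
    (FinGSet.snd X S)
  refine ⟨l, fun w => (h1 w).symm, fun x z e => ?_⟩
  obtain ⟨w, hw, hu⟩ := FinGSet.prod_isProd X S x (FinGSet.snd Y S z)
  obtain ⟨_, _, hz⟩ := FinGSet.prod_isProd Y S (FinGSet.fst Y S z) (FinGSet.snd Y S z)
  refine ⟨w, ⟨hw.1, ?_⟩, fun y hy => hu y ⟨hy.1, ?_⟩⟩
  · rw [hz z ⟨rfl, rfl⟩]
    exact hz _ ⟨(h1 w).trans ((congrArg f hw.1).trans e), (h2 w).trans hw.2⟩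
  · rw [← hy.2, h2]

theorem res_smul (M : Mackey.{u} G) {X Y : FinGSet G} (f : FinGSet.Hom X Y)
    (s : BurnsideRing G) (m : M.obj Y) : M.res f (s • m) = s • M.res f m :=
  map_smul_of (M.res f) (fun S a => by
    obtain ⟨l, hl⟩ := fst_square S f
    have e : f.comp (FinGSet.fst X S) = (FinGSet.fst Y S).comp l := MulActionHom.ext hl.1
    rw [of_smul, of_smul, M.res_tr l (FinGSet.fst X S) (FinGSet.fst Y S) f hl.symm,
      ← M.res_comp, ← M.res_comp, e]) s m

theorem tr_smul (M : Mackey.{u} G) {X Y : FinGSet G} (f : FinGSet.Hom X Y)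
    (s : BurnsideRing G) (m : M.obj X) : M.tr f (s • m) = s • M.tr f m :=
  map_smul_of (M.tr f) (fun S a => by
    obtain ⟨l, hl⟩ := fst_square S f
    have e : f.comp (FinGSet.fst X S) = (FinGSet.fst Y S).comp l := MulActionHom.ext hl.1
    rw [of_smul, of_smul, M.res_tr (FinGSet.fst X S) l f (FinGSet.fst Y S) hl,
      ← M.tr_comp, ← M.tr_comp, e]) s m

end Mackey

/-! ### Graded Mackey functors and pairings -/

/-- A `Γ`-graded Mackey functor. -/
abbrev GrMackey (Γ G : Type) [Group G] : Type _ := Γ → Mackey.{u} G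

/-- A map of graded Mackey functors. -/
abbrev GrHom {Γ G : Type} [Group G] (M N : GrMackey.{u} Γ G) : Type u :=
  ∀ α : Γ, Mackey.Hom (M α) (N α)

/-- Bimultiplicative commutation signs in the Burnside ring. -/
structure SignRule (Γ G : Type) [AddCommGroup Γ] [Group G] where
  s : Γ → Γ → BurnsideRing G
  add_left : ∀ α β γ, s (α + β) γ = s α γ * s β γ
  add_right : ∀ α β γ, s α (β + γ) = s α β * s α γ
  symm : ∀ α β, s α β * s β α = 1

namespace SignRule

variable {Γ G : Type} [AddCommGroup Γ] [Group G] (σ : SignRule Γ G)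

theorem zero_left (β : Γ) : σ.s 0 β = 1 := by
  have h1 := σ.add_left 0 0 β
  rw [add_zero] at h1
  have h2 := σ.symm 0 β
  calc σ.s 0 β = σ.s 0 β * (σ.s 0 β * σ.s β 0) := by rw [h2, mul_one]
    _ = σ.s 0 β * σ.s 0 β * σ.s β 0 := by ring
    _ = 1 := by rw [← h1, h2]

theorem zero_right (β : Γ) : σ.s β 0 = 1 := by
  have h := σ.symm 0 β
  rwa [σ.zero_left, one_mul] at h

end SignRule

section Graded

variable {Γ G : Type} [AddCommGroup Γ] [Group G]

/-- A pairing of graded Mackey functors: biadditive maps `N_α(X) × P_β(X) → Q_{α+β}(X)` compatible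
with restrictions and satisfying Frobenius reciprocity. Pairings `N, P → Q` are the same thing as
maps `N □ P → Q` out of the graded box product. -/
structure Pairing (N P Q : GrMackey.{u} Γ G) where
  f : ∀ {α β γ : Γ}, α + β = γ → ∀ {X : FinGSet G},
    (N α).obj X →+ (P β).obj X →+ (Q γ).obj X
  res : ∀ {α β γ : Γ} (h : α + β = γ) {X Y : FinGSet G} (k : FinGSet.Hom X Y)
    (n : (N α).obj Y) (p : (P β).obj Y),
    (Q γ).res k (f h n p) = f h ((N α).res k n) ((P β).res k p)
  tr_left : ∀ {α β γ : Γ} (h : α + β = γ) {X Y : FinGSet G} (k : FinGSet.Hom X Y)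
    (n : (N α).obj X) (p : (P β).obj Y),
    f h ((N α).tr k n) p = (Q γ).tr k (f h n ((P β).res k p))
  tr_right : ∀ {α β γ : Γ} (h : α + β = γ) {X Y : FinGSet G} (k : FinGSet.Hom X Y)
    (n : (N α).obj Y) (p : (P β).obj X),
    f h n ((P β).tr k p) = (Q γ).tr k (f h ((N α).res k n) p)

namespace Pairing

variable {N P Q : GrMackey.{u} Γ G}

theorem smul_left (φ : Pairing N P Q) {α β γ : Γ} (h : α + β = γ) {X : FinGSet G}
    (s : BurnsideRing G) (n : (N α).obj X) (p : (P β).obj X) :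
    φ.f h (s • n) p = s • φ.f h n p :=
  Mackey.map_smul_of ((φ.f h).flip p) (fun S a => by
    simp only [AddMonoidHom.flip_apply]
    rw [Mackey.of_smul, Mackey.of_smul, φ.tr_left, φ.res]) s n

theorem smul_right (φ : Pairing N P Q) {α β γ : Γ} (h : α + β = γ) {X : FinGSet G}
    (s : BurnsideRing G) (n : (N α).obj X) (p : (P β).obj X) :
    φ.f h n (s • p) = s • φ.f h n p :=
  Mackey.map_smul_of (φ.f h n) (fun S a => by
    rw [Mackey.of_smul, Mackey.of_smul, φ.tr_right, φ.res]) s p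

/-- The pairing with the two arguments interchanged (without a sign). -/
def flip (φ : Pairing N P Q) : Pairing P N Q where
  f h := (φ.f ((add_comm _ _).trans h)).flip
  res _ _ _ k n p := φ.res _ k p n
  tr_left _ _ _ k n p := φ.tr_right _ k p n
  tr_right _ _ _ k n p := φ.tr_left _ k p n

theorem flip_f (φ : Pairing N P Q) {α β γ : Γ} (h : α + β = γ) {X : FinGSet G}
    (p : (P α).obj X) (n : (N β).obj X) :
    φ.flip.f h p n = φ.f ((add_comm _ _).trans h) n p := rfl

/-- The pairing multiplied by signs depending on the degrees. -/
def twist (φ : Pairing N P Q) (s : Γ → Γ → BurnsideRing G) : Pairing N P Q where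
  f {α β γ} h {X} := (AddMonoidHom.compHom (DistribSMul.toAddMonoidHom ((Q γ).obj X) (s α β))).comp
    (φ.f h)
  res h _ _ k n p := ((Q _).res_smul _ _ _).trans (congrArg _ (φ.res h k n p))
  tr_left h _ _ k n p := (congrArg (s _ _ • ·) (φ.tr_left h k n p)).trans
    ((Q _).tr_smul _ _ _).symm
  tr_right h _ _ k n p := (congrArg (s _ _ • ·) (φ.tr_right h k n p)).trans
    ((Q _).tr_smul _ _ _).symm

theorem twist_f (φ : Pairing N P Q) (s : Γ → Γ → BurnsideRing G) {α β γ : Γ} (h : α + β = γ)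
    {X : FinGSet G} (n : (N α).obj X) (p : (P β).obj X) :
    (φ.twist s).f h n p = s α β • φ.f h n p := rfl

/-- Precomposition in the first variable. -/
def compLeft {N' : GrMackey.{u} Γ G} (φ : Pairing N P Q) (u : GrHom N' N) : Pairing N' P Q where
  f h := (φ.f h).comp ((u _).app _)
  res h _ _ k n p := by
    simp only [AddMonoidHom.comp_apply]
    rw [φ.res, (u _).app_res]
  tr_left h _ _ k n p := by
    simp only [AddMonoidHom.comp_apply]
    rw [(u _).app_tr, φ.tr_left]
  tr_right h _ _ k n p := by
    simp only [AddMonoidHom.comp_apply]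
    rw [φ.tr_right, (u _).app_res]

theorem compLeft_f {N' : GrMackey.{u} Γ G} (φ : Pairing N P Q) (u : GrHom N' N) {α β γ : Γ}
    (h : α + β = γ) {X : FinGSet G} (n : (N' α).obj X) (p : (P β).obj X) :
    (φ.compLeft u).f h n p = φ.f h ((u α).app X n) p := rfl

end Pairing

/-- A pairing of three graded Mackey functors. -/
structure Pairing₃ (A N P Q : GrMackey.{u} Γ G) where
  f : ∀ {α β γ δ : Γ}, α + (β + γ) = δ → ∀ {X : FinGSet G},
    (A α).obj X →+ (N β).obj X →+ (P γ).obj X →+ (Q δ).obj X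
  res : ∀ {α β γ δ : Γ} (h : α + (β + γ) = δ) {X Y : FinGSet G} (k : FinGSet.Hom X Y)
    (a : (A α).obj Y) (n : (N β).obj Y) (p : (P γ).obj Y),
    (Q δ).res k (f h a n p) = f h ((A α).res k a) ((N β).res k n) ((P γ).res k p)
  tr_one : ∀ {α β γ δ : Γ} (h : α + (β + γ) = δ) {X Y : FinGSet G} (k : FinGSet.Hom X Y)
    (a : (A α).obj X) (n : (N β).obj Y) (p : (P γ).obj Y),
    f h ((A α).tr k a) n p = (Q δ).tr k (f h a ((N β).res k n) ((P γ).res k p))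
  tr_two : ∀ {α β γ δ : Γ} (h : α + (β + γ) = δ) {X Y : FinGSet G} (k : FinGSet.Hom X Y)
    (a : (A α).obj Y) (n : (N β).obj X) (p : (P γ).obj Y),
    f h a ((N β).tr k n) p = (Q δ).tr k (f h ((A α).res k a) n ((P γ).res k p))
  tr_three : ∀ {α β γ δ : Γ} (h : α + (β + γ) = δ) {X Y : FinGSet G} (k : FinGSet.Hom X Y)
    (a : (A α).obj Y) (n : (N β).obj Y) (p : (P γ).obj X),
    f h a n ((P γ).tr k p) = (Q δ).tr k (f h ((A α).res k a) ((N β).res k n) p)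

/-! ### Graded Green functors and modules -/

/-- A graded Green functor: an associative and unital monoid for the graded box product. -/
structure GrGreen (Γ G : Type) [AddCommGroup Γ] [Group G] where
  C : GrMackey.{u} Γ G
  mul : Pairing C C C
  one : ∀ X : FinGSet G, (C 0).obj X
  res_one : ∀ {X Y : FinGSet G} (k : FinGSet.Hom X Y), (C 0).res k (one Y) = one X
  one_mul : ∀ {α : Γ} (h : 0 + α = α) {X : FinGSet G} (a : (C α).obj X), mul.f h (one X) a = a
  mul_one : ∀ {α : Γ} (h : α + 0 = α) {X : FinGSet G} (a : (C α).obj X), mul.f h a (one X) = a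
  mul_assoc : ∀ {α β γ δ ε ζ : Γ} (h₁ : δ + γ = ζ) (h₂ : α + β = δ) (h₃ : α + ε = ζ)
    (h₄ : β + γ = ε) {X : FinGSet G} (a : (C α).obj X) (b : (C β).obj X) (c : (C γ).obj X),
    mul.f h₁ (mul.f h₂ a b) c = mul.f h₃ a (mul.f h₄ b c)

/-- Commutativity `μ ∘ τ = μ`, for the rotating isomorphism `τ (a ⊗ b) = σ(|b|, |a|) (b ⊗ a)`. -/
def GrGreen.IsComm (σ : SignRule Γ G) (A : GrGreen.{u} Γ G) : Prop :=
  ∀ {α β γ : Γ} (h : α + β = γ) (h' : β + α = γ) {X : FinGSet G} (a : (A.C α).obj X)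
    (b : (A.C β).obj X), σ.s β α • A.mul.f h' b a = A.mul.f h a b

/-- A left module over a graded Green functor. -/
structure LMod (A : GrGreen.{u} Γ G) where
  C : GrMackey.{u} Γ G
  act : Pairing A.C C C
  one_act : ∀ {α : Γ} (h : 0 + α = α) {X : FinGSet G} (n : (C α).obj X),
    act.f h (A.one X) n = n
  mul_act : ∀ {α β γ δ ε ζ : Γ} (h₁ : δ + γ = ζ) (h₂ : α + β = δ) (h₃ : α + ε = ζ)
    (h₄ : β + γ = ε) {X : FinGSet G} (a : (A.C α).obj X) (b : (A.C β).obj X) (n : (C γ).obj X),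
    act.f h₁ (A.mul.f h₂ a b) n = act.f h₃ a (act.f h₄ b n)

/-- A right module over a graded Green functor. -/
structure RMod (A : GrGreen.{u} Γ G) where
  C : GrMackey.{u} Γ G
  act : Pairing C A.C C
  act_one : ∀ {α : Γ} (h : α + 0 = α) {X : FinGSet G} (n : (C α).obj X),
    act.f h n (A.one X) = n
  act_mul : ∀ {α β γ δ ε ζ : Γ} (h₁ : α + ε = ζ) (h₂ : β + γ = ε) (h₃ : δ + γ = ζ)
    (h₄ : α + β = δ) {X : FinGSet G} (n : (C α).obj X) (a : (A.C β).obj X) (b : (A.C γ).obj X),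
    act.f h₁ n (A.mul.f h₂ a b) = act.f h₃ (act.f h₄ n a) b

/-- A map of right modules. -/
structure RMod.Hom {A : GrGreen.{u} Γ G} (N N' : RMod A) where
  u : GrHom N.C N'.C
  map_act : ∀ {α β γ : Γ} (h : α + β = γ) {X : FinGSet G} (n : (N.C α).obj X)
    (a : (A.C β).obj X), (u γ).app X (N.act.f h n a) = N'.act.f h ((u α).app X n) a

/-! ### The relative box product -/

namespace Box

/-- A generator of `(N □ P)_γ(T)`: a finite `G`-set `U` over `T` with elements `n ∈ N_α(U)` and
`p ∈ P_β(U)`, where `α + β = γ`. -/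
structure Gen (N P : GrMackey.{u} Γ G) (γ : Γ) (T : FinGSet G) where
  U : FinGSet G
  h : FinGSet.Hom U T
  α : Γ
  β : Γ
  e : α + β = γ
  n : (N α).obj U
  p : (P β).obj U

variable {A : GrGreen.{u} Γ G} (N : RMod A) (P : LMod A)

/-- A generator, as an element of the free abelian group. -/
def gen (γ : Γ) (T : FinGSet G) {U : FinGSet G} (h : FinGSet.Hom U T) {α β : Γ} (e : α + β = γ)
    (n : (N.C α).obj U) (p : (P.C β).obj U) : FreeAbelianGroup (Gen N.C P.C γ T) :=
  FreeAbelianGroup.of ⟨U, h, α, β, e, n, p⟩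

/-- The relations between the generators: biadditivity, Frobenius reciprocity (these define the box
product of graded Mackey functors), and `n a ⊗ p = n ⊗ a p` for `a` in the Green functor. -/
inductive Rel (γ : Γ) (T : FinGSet G) : FreeAbelianGroup (Gen N.C P.C γ T) → Prop
  | add_left {U : FinGSet G} (h : FinGSet.Hom U T) {α β : Γ} (e : α + β = γ)
      (n n' : (N.C α).obj U) (p : (P.C β).obj U) :
      Rel γ T (gen N P γ T h e (n + n') p - (gen N P γ T h e n p + gen N P γ T h e n' p))
  | add_right {U : FinGSet G} (h : FinGSet.Hom U T) {α β : Γ} (e : α + β = γ)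
      (n : (N.C α).obj U) (p p' : (P.C β).obj U) :
      Rel γ T (gen N P γ T h e n (p + p') - (gen N P γ T h e n p + gen N P γ T h e n p'))
  | frob_left {U V : FinGSet G} (k : FinGSet.Hom U V) (h : FinGSet.Hom V T) {α β : Γ}
      (e : α + β = γ) (n : (N.C α).obj U) (p : (P.C β).obj V) :
      Rel γ T (gen N P γ T h e ((N.C α).tr k n) p -
        gen N P γ T (h.comp k) e n ((P.C β).res k p))
  | frob_right {U V : FinGSet G} (k : FinGSet.Hom U V) (h : FinGSet.Hom V T) {α β : Γ}
      (e : α + β = γ) (n : (N.C α).obj V) (p : (P.C β).obj U) :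
      Rel γ T (gen N P γ T h e n ((P.C β).tr k p) -
        gen N P γ T (h.comp k) e ((N.C α).res k n) p)
  | balanced {U : FinGSet G} (h : FinGSet.Hom U T) {α β δ ε ζ : Γ} (e : ε + β = γ)
      (e' : α + ζ = γ) (e₁ : α + δ = ε) (e₂ : δ + β = ζ) (n : (N.C α).obj U)
      (a : (A.C δ).obj U) (p : (P.C β).obj U) :
      Rel γ T (gen N P γ T h e (N.act.f e₁ n a) p - gen N P γ T h e' n (P.act.f e₂ a p))

/-- The value of the relative box product. -/
def Obj (γ : Γ) (T : FinGSet G) : Type u :=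
  FreeAbelianGroup (Gen N.C P.C γ T) ⧸ AddSubgroup.closure {x | Rel N P γ T x}

instance (γ : Γ) (T : FinGSet G) : AddCommGroup (Obj N P γ T) :=
  inferInstanceAs (AddCommGroup
    (FreeAbelianGroup (Gen N.C P.C γ T) ⧸ AddSubgroup.closure {x | Rel N P γ T x}))

variable {N P}

/-- The class of a generator. -/
def mk {γ : Γ} {T U : FinGSet G} (h : FinGSet.Hom U T) {α β : Γ} (e : α + β = γ)
    (n : (N.C α).obj U) (p : (P.C β).obj U) : Obj N P γ T :=
  QuotientAddGroup.mk' _ (gen N P γ T h e n p)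

theorem mk_rel {γ : Γ} {T : FinGSet G} {x y : FreeAbelianGroup (Gen N.C P.C γ T)}
    (h : Rel N P γ T (x - y)) :
    (QuotientAddGroup.mk' _ x : Obj N P γ T) = QuotientAddGroup.mk' _ y := by
  rw [← sub_eq_zero, ← map_sub]
  exact (QuotientAddGroup.eq_zero_iff _).2 (AddSubgroup.subset_closure h)

theorem mk_add_left {γ : Γ} {T U : FinGSet G} (h : FinGSet.Hom U T) {α β : Γ} (e : α + β = γ)
    (n n' : (N.C α).obj U) (p : (P.C β).obj U) :
    (mk h e (n + n') p : Obj N P γ T) = mk h e n p + mk h e n' p :=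
  (mk_rel (.add_left h e n n' p)).trans (map_add _ _ _)

theorem mk_add_right {γ : Γ} {T U : FinGSet G} (h : FinGSet.Hom U T) {α β : Γ} (e : α + β = γ)
    (n : (N.C α).obj U) (p p' : (P.C β).obj U) :
    (mk h e n (p + p') : Obj N P γ T) = mk h e n p + mk h e n p' :=
  (mk_rel (.add_right h e n p p')).trans (map_add _ _ _)

theorem mk_frob_left {γ : Γ} {T U V : FinGSet G} (k : FinGSet.Hom U V) (h : FinGSet.Hom V T)
    {α β : Γ} (e : α + β = γ) (n : (N.C α).obj U) (p : (P.C β).obj V) :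
    (mk h e ((N.C α).tr k n) p : Obj N P γ T) = mk (h.comp k) e n ((P.C β).res k p) :=
  mk_rel (.frob_left k h e n p)

theorem mk_frob_right {γ : Γ} {T U V : FinGSet G} (k : FinGSet.Hom U V) (h : FinGSet.Hom V T)
    {α β : Γ} (e : α + β = γ) (n : (N.C α).obj V) (p : (P.C β).obj U) :
    (mk h e n ((P.C β).tr k p) : Obj N P γ T) = mk (h.comp k) e ((N.C α).res k n) p :=
  mk_rel (.frob_right k h e n p)

theorem mk_balanced {γ : Γ} {T U : FinGSet G} (h : FinGSet.Hom U T) {α β δ ε ζ : Γ}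
    (e : ε + β = γ) (e' : α + ζ = γ) (e₁ : α + δ = ε) (e₂ : δ + β = ζ) (n : (N.C α).obj U)
    (a : (A.C δ).obj U) (p : (P.C β).obj U) :
    (mk h e (N.act.f e₁ n a) p : Obj N P γ T) = mk h e' n (P.act.f e₂ a p) :=
  mk_rel (.balanced h e e' e₁ e₂ n a p)

/-- Additive maps out of a value of the relative box product. -/
def liftObj {γ : Γ} {T : FinGSet G} {B : Type*} [AddCommGroup B]
    (φ : ∀ {U : FinGSet G} (_ : FinGSet.Hom U T) {α β : Γ} (_ : α + β = γ), (N.C α).obj U →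
      (P.C β).obj U → B)
    (h₁ : ∀ {U : FinGSet G} (h : FinGSet.Hom U T) {α β : Γ} (e : α + β = γ)
      (n n' : (N.C α).obj U) (p : (P.C β).obj U), φ h e (n + n') p = φ h e n p + φ h e n' p)
    (h₂ : ∀ {U : FinGSet G} (h : FinGSet.Hom U T) {α β : Γ} (e : α + β = γ)
      (n : (N.C α).obj U) (p p' : (P.C β).obj U), φ h e n (p + p') = φ h e n p + φ h e n p')
    (h₃ : ∀ {U V : FinGSet G} (k : FinGSet.Hom U V) (h : FinGSet.Hom V T) {α β : Γ}
      (e : α + β = γ) (n : (N.C α).obj U) (p : (P.C β).obj V),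
      φ h e ((N.C α).tr k n) p = φ (h.comp k) e n ((P.C β).res k p))
    (h₄ : ∀ {U V : FinGSet G} (k : FinGSet.Hom U V) (h : FinGSet.Hom V T) {α β : Γ}
      (e : α + β = γ) (n : (N.C α).obj V) (p : (P.C β).obj U),
      φ h e n ((P.C β).tr k p) = φ (h.comp k) e ((N.C α).res k n) p)
    (h₅ : ∀ {U : FinGSet G} (h : FinGSet.Hom U T) {α β δ ε ζ : Γ}
      (e : ε + β = γ) (e' : α + ζ = γ) (e₁ : α + δ = ε) (e₂ : δ + β = ζ) (n : (N.C α).obj U)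
      (a : (A.C δ).obj U) (p : (P.C β).obj U),
      φ h e (N.act.f e₁ n a) p = φ h e' n (P.act.f e₂ a p)) : Obj N P γ T →+ B :=
  QuotientAddGroup.lift _ (FreeAbelianGroup.lift fun x => φ x.h x.e x.n x.p) (by
    rw [AddSubgroup.closure_le]
    rintro x hx
    rw [SetLike.mem_coe, AddMonoidHom.mem_ker]
    cases hx with
    | add_left h e n n' p => simp only [gen, map_sub, map_add, FreeAbelianGroup.lift_apply_of]
                             rw [h₁, sub_self]
    | add_right h e n p p' => simp only [gen, map_sub, map_add, FreeAbelianGroup.lift_apply_of]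
                              rw [h₂, sub_self]
    | frob_left k h e n p => simp only [gen, map_sub, FreeAbelianGroup.lift_apply_of]
                             rw [h₃, sub_self]
    | frob_right k h e n p => simp only [gen, map_sub, FreeAbelianGroup.lift_apply_of]
                              rw [h₄, sub_self]
    | balanced h e e' e₁ e₂ n a p => simp only [gen, map_sub, FreeAbelianGroup.lift_apply_of]
                                     rw [h₅ h e e' e₁ e₂, sub_self])

theorem liftObj_mk {γ : Γ} {T : FinGSet G} {B : Type*} [AddCommGroup B]
    (φ : ∀ {U : FinGSet G} (_ : FinGSet.Hom U T) {α β : Γ} (_ : α + β = γ), (N.C α).obj U →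
      (P.C β).obj U → B) (h₁ h₂ h₃ h₄ h₅) {U : FinGSet G} (h : FinGSet.Hom U T) {α β : Γ}
    (e : α + β = γ) (n : (N.C α).obj U) (p : (P.C β).obj U) :
    liftObj φ h₁ h₂ h₃ h₄ h₅ (mk h e n p : Obj N P γ T) = φ h e n p :=
  FreeAbelianGroup.lift_apply_of _ _

theorem mk_zero_left {γ : Γ} {T U : FinGSet G} (h : FinGSet.Hom U T) {α β : Γ} (e : α + β = γ)
    (p : (P.C β).obj U) : (mk h e 0 p : Obj N P γ T) = 0 := by
  have := mk_add_left h e (0 : (N.C α).obj U) 0 p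
  simpa using this

theorem induction {γ : Γ} {T : FinGSet G} {R : Obj N P γ T → Prop} (x : Obj N P γ T)
    (h0 : R 0)
    (hmk : ∀ {U : FinGSet G} (h : FinGSet.Hom U T) {α β : Γ} (e : α + β = γ)
      (n : (N.C α).obj U) (p : (P.C β).obj U), R (mk h e n p))
    (hadd : ∀ x y, R x → R y → R (x + y)) : R x := by
  obtain ⟨y, rfl⟩ := QuotientAddGroup.mk'_surjective _ x
  induction y using FreeAbelianGroup.induction_on with
  | zero => rw [map_zero]; exact h0
  | of c => exact hmk c.h c.e c.n c.p
  | neg c _ =>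
    have : QuotientAddGroup.mk' (AddSubgroup.closure {x | Rel N P γ T x})
        (-FreeAbelianGroup.of c) = (mk c.h c.e (-c.n) c.p : Obj N P γ T) := by
      rw [map_neg]
      refine neg_eq_of_add_eq_zero_right ?_
      refine (mk_add_left c.h c.e c.n (-c.n) c.p).symm.trans ?_
      rw [add_neg_cancel, mk_zero_left]
      rfl
    rw [this]
    exact hmk _ _ _ _
  | add a b ha hb => rw [map_add]; exact hadd _ _ ha hb

/-- A generator may be replaced by an isomorphic one. -/
theorem mk_iso {γ : Γ} {T U V : FinGSet G} (k : FinGSet.Hom U V) (hk : Function.Bijective k)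
    (h : FinGSet.Hom V T) {α β : Γ} (e : α + β = γ) (n : (N.C α).obj V) (p : (P.C β).obj V) :
    (mk (h.comp k) e ((N.C α).res k n) ((P.C β).res k p) : Obj N P γ T) = mk h e n p := by
  rw [← mk_frob_left, (N.C α).tr_res_of_bijective k hk]

variable (N P) in
/-- Transfers of the relative box product: `(U → T) ↦ (U → T → T')`. -/
def tr (γ : Γ) {T T' : FinGSet G} (f : FinGSet.Hom T T') : Obj N P γ T →+ Obj N P γ T' :=
  liftObj (fun h _ _ e n p => mk (f.comp h) e n p)
    (fun _ _ _ e n n' p => mk_add_left _ e n n' p) (fun _ _ _ e n p p' => mk_add_right _ e n p p')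
    (fun k h _ _ e n p => mk_frob_left k (f.comp h) e n p)
    (fun k h _ _ e n p => mk_frob_right k (f.comp h) e n p)
    (fun _ _ _ _ _ _ e e' e₁ e₂ n a p => mk_balanced _ e e' e₁ e₂ n a p)

theorem tr_mk (γ : Γ) {T T' U : FinGSet G} (f : FinGSet.Hom T T') (h : FinGSet.Hom U T) {α β : Γ}
    (e : α + β = γ) (n : (N.C α).obj U) (p : (P.C β).obj U) :
    tr N P γ f (mk h e n p) = mk (f.comp h) e n p := liftObj_mk _ _ _ _ _ _ h e n p

theorem pb_square {U V T T' : FinGSet G} (k : FinGSet.Hom U V) (h : FinGSet.Hom V T)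
    (f : FinGSet.Hom T' T) :
    ∃ l : FinGSet.Hom (FinGSet.pb (h.comp k) f) (FinGSet.pb h f),
      FinGSet.IsPullbackSq (FinGSet.pbFst (h.comp k) f) l k (FinGSet.pbFst h f) ∧
      (FinGSet.pbSnd h f).comp l = FinGSet.pbSnd (h.comp k) f := by
  have H := FinGSet.pb_isPullbackSq h f
  have K := FinGSet.pb_isPullbackSq (h.comp k) f
  obtain ⟨l, h1, h2⟩ := H.exists_lift (k.comp (FinGSet.pbFst (h.comp k) f))
    (FinGSet.pbSnd (h.comp k) f) K.1
  refine ⟨l, ⟨fun w => (h1 w).symm, fun x z e => ?_⟩, MulActionHom.ext h2⟩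
  obtain ⟨w, hw, hu⟩ := K.2 x (FinGSet.pbSnd h f z) ((congrArg h e).trans (H.1 z))
  refine ⟨w, ⟨hw.1, ?_⟩, fun y hy => hu y ⟨hy.1, ?_⟩⟩
  · obtain ⟨_, _, hz⟩ := H.2 _ _ (H.1 z)
    rw [hz z ⟨rfl, rfl⟩]
    exact hz _ ⟨(h1 w).trans ((congrArg k hw.1).trans e), (h2 w).trans hw.2⟩
  · rw [← hy.2, h2]

variable (N P) in
/-- Restrictions of the relative box product: pull `U → T` back along `T' → T`. -/
def res (γ : Γ) {T T' : FinGSet G} (f : FinGSet.Hom T' T) : Obj N P γ T →+ Obj N P γ T' :=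
  liftObj (fun h _ _ e n p => mk (FinGSet.pbSnd h f) e ((N.C _).res (FinGSet.pbFst h f) n)
      ((P.C _).res (FinGSet.pbFst h f) p))
    (fun h _ _ e n n' p => by rw [map_add, mk_add_left])
    (fun h _ _ e n p p' => by rw [map_add, mk_add_right])
    (fun k h α β e n p => by
      obtain ⟨l, hl, hl'⟩ := pb_square k h f
      have ek : (FinGSet.pbFst h f).comp l = k.comp (FinGSet.pbFst (h.comp k) f) :=
        MulActionHom.ext fun w => (hl.1 w).symm
      rw [(N.C α).res_tr _ _ _ _ hl, mk_frob_left, hl', ← (P.C β).res_comp, ← (P.C β).res_comp]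
      rw [ek])
    (fun k h α β e n p => by
      obtain ⟨l, hl, hl'⟩ := pb_square k h f
      have ek : (FinGSet.pbFst h f).comp l = k.comp (FinGSet.pbFst (h.comp k) f) :=
        MulActionHom.ext fun w => (hl.1 w).symm
      rw [(P.C β).res_tr _ _ _ _ hl, mk_frob_right, hl', ← (N.C α).res_comp, ← (N.C α).res_comp]
      rw [ek])
    (fun h _ _ _ _ _ e e' e₁ e₂ n a p => by
      rw [N.act.res, P.act.res]
      exact mk_balanced _ e e' e₁ e₂ _ _ _)

/-- The restriction of a generator can be computed with any pullback square. -/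
theorem res_mk (γ : Γ) {T T' U W : FinGSet G} (f : FinGSet.Hom T' T) (h : FinGSet.Hom U T)
    (a : FinGSet.Hom W U) (b : FinGSet.Hom W T') (H : FinGSet.IsPullbackSq a b h f) {α β : Γ}
    (e : α + β = γ) (n : (N.C α).obj U) (p : (P.C β).obj U) :
    res N P γ f (mk h e n p) = mk b e ((N.C α).res a n) ((P.C β).res a p) := by
  refine (liftObj_mk _ _ _ _ _ _ h e n p).trans ?_
  have K := FinGSet.pb_isPullbackSq h f
  obtain ⟨l, h1, h2⟩ := K.exists_lift a b H.1
  have hl : Function.Bijective l := by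
    refine ⟨fun v w e => ?_, fun w => ?_⟩
    · obtain ⟨_, _, hu⟩ := H.2 _ _ (H.1 v)
      rw [hu v ⟨rfl, rfl⟩, hu w ⟨by rw [← h1, ← h1, e], by rw [← h2, ← h2, e]⟩]
    · obtain ⟨v, hv, _⟩ := H.2 _ _ (K.1 w)
      obtain ⟨_, _, hu⟩ := K.2 _ _ (K.1 w)
      refine ⟨v, ?_⟩
      rw [hu (l v) ⟨(h1 v).trans hv.1, (h2 v).trans hv.2⟩, hu w ⟨rfl, rfl⟩]
  have ea : a = (FinGSet.pbFst h f).comp l := MulActionHom.ext fun v => (h1 v).symm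
  have eb : b = (FinGSet.pbSnd h f).comp l := MulActionHom.ext fun v => (h2 v).symm
  rw [ea, eb, (N.C α).res_comp, (P.C β).res_comp, mk_iso l hl]

end Box

/-- The relative box product `N □_A P` of a right and a left module over the graded Green functor
`A`, a graded Mackey functor. -/
def Box {A : GrGreen.{u} Γ G} (N : RMod A) (P : LMod A) : GrMackey.{u} Γ G := fun γ =>
  { obj := Box.Obj N P γ
    res := Box.res N P γ
    tr := Box.tr N P γ
    res_id := fun {X} m => by
      induction m using Box.induction with
      | h0 => rw [map_zero]
      | hmk h e n p =>
        rw [Box.res_mk γ _ h (FinGSet.idHom _) h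
          ⟨fun _ => rfl, fun x z e => ⟨x, ⟨rfl, e⟩, fun y hy => hy.1⟩⟩, (N.C _).res_id,
          (P.C _).res_id]
      | hadd x y hx hy => rw [map_add, hx, hy]
    tr_id := fun {X} m => by
      induction m using Box.induction with
      | h0 => rw [map_zero]
      | hmk h e n p => rw [Box.tr_mk]; rfl
      | hadd x y hx hy => rw [map_add, hx, hy]
    res_comp := fun {X Y Z} f k m => by
      induction m using Box.induction with
      | h0 => simp only [map_zero]
      | hmk h e n p =>
        have H := FinGSet.pb_isPullbackSq h k
        have K := FinGSet.pb_isPullbackSq (FinGSet.pbSnd h k) f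
        have HK : FinGSet.IsPullbackSq
            ((FinGSet.pbFst h k).comp (FinGSet.pbFst (FinGSet.pbSnd h k) f))
            (FinGSet.pbSnd (FinGSet.pbSnd h k) f) h (k.comp f) := by
          refine ⟨fun w => (H.1 _).trans (congrArg k (K.1 w)), fun x z e => ?_⟩
          obtain ⟨v, hv, hvu⟩ := H.2 x (f z) e
          obtain ⟨w, hw, hwu⟩ := K.2 v z hv.2
          refine ⟨w, ⟨(congrArg (FinGSet.pbFst h k) hw.1).trans hv.1, hw.2⟩, fun y hy => ?_⟩
          refine hwu y ⟨hvu _ ⟨hy.1, ?_⟩, hy.2⟩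
          rw [K.1, hy.2]
        rw [Box.res_mk γ _ h _ _ HK, Box.res_mk γ _ h _ _ H, Box.res_mk γ _ _ _ _ K,
          (N.C _).res_comp, (P.C _).res_comp]
      | hadd x y hx hy => simp only [map_add, hx, hy]
    tr_comp := fun {X Y Z} f k m => by
      induction m using Box.induction with
      | h0 => simp only [map_zero]
      | hmk h e n p => rw [Box.tr_mk, Box.tr_mk, Box.tr_mk]; rfl
      | hadd x y hx hy => simp only [map_add, hx, hy]
    res_tr := fun {W X Z Y} a b f k H m => by
      induction m using Box.induction with
      | h0 => simp only [map_zero]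
      | hmk h e n p =>
        have K := FinGSet.pb_isPullbackSq h a
        have HK : FinGSet.IsPullbackSq (FinGSet.pbFst h a) (b.comp (FinGSet.pbSnd h a))
            (f.comp h) k := by
          refine ⟨fun w => (congrArg f (K.1 w)).trans (H.1 _), fun x z e => ?_⟩
          obtain ⟨v, hv, hvu⟩ := H.2 (h x) z e
          obtain ⟨w, hw, hwu⟩ := K.2 x v hv.1.symm
          refine ⟨w, ⟨hw.1, (congrArg b hw.2).trans hv.2⟩, fun y hy => ?_⟩
          refine hwu y ⟨hy.1, hvu _ ⟨?_, hy.2⟩⟩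
          rw [← K.1, hy.1]
        rw [Box.tr_mk, Box.res_mk γ _ _ _ _ HK, Box.res_mk γ _ _ _ _ K, Box.tr_mk]
      | hadd x y hx hy => simp only [map_add, hx, hy]
    tr_res_add := fun {X Y Z} i j H m => by
      induction m using Box.induction with
      | h0 => simp only [map_zero, add_zero]
      | hmk h e n p =>
        rename_i U α β
        have Ki := FinGSet.pb_isPullbackSq h i
        have Kj := FinGSet.pb_isPullbackSq h j
        have ei : i.comp (FinGSet.pbSnd h i) = h.comp (FinGSet.pbFst h i) :=
          MulActionHom.ext fun w => (Ki.1 w).symm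
        have ej : j.comp (FinGSet.pbSnd h j) = h.comp (FinGSet.pbFst h j) :=
          MulActionHom.ext fun w => (Kj.1 w).symm
        have hU : FinGSet.IsDisjUnion (FinGSet.pbFst h i) (FinGSet.pbFst h j) := by
          have key : ∀ s : (FinGSet.pb h i).El ⊕ (FinGSet.pb h j).El,
              h (Sum.elim (FinGSet.pbFst h i) (FinGSet.pbFst h j) s) =
                Sum.elim i j (Sum.map (FinGSet.pbSnd h i) (FinGSet.pbSnd h j) s) := by
            rintro (s | s)
            · exact Ki.1 s
            · exact Kj.1 s
          constructor
          · intro s t est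
            have e2 := H.1 ((key s).symm.trans ((congrArg h est).trans (key t)))
            rcases s with s | s <;> rcases t with t | t
            · obtain ⟨_, _, hu⟩ := Ki.2 _ _ (Ki.1 s)
              rw [hu s ⟨rfl, rfl⟩, hu t ⟨est.symm, (Sum.inl_injective e2).symm⟩]
            · cases e2
            · cases e2
            · obtain ⟨_, _, hu⟩ := Kj.2 _ _ (Kj.1 s)
              rw [hu s ⟨rfl, rfl⟩, hu t ⟨est.symm, (Sum.inr_injective e2).symm⟩]
          · intro x
            obtain ⟨z, hz⟩ := H.2 (h x)
            rcases z with z | z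
            · obtain ⟨w, hw, _⟩ := Ki.2 x z hz.symm
              exact ⟨Sum.inl w, hw.1⟩
            · obtain ⟨w, hw, _⟩ := Kj.2 x z hz.symm
              exact ⟨Sum.inr w, hw.1⟩
        rw [Box.res_mk γ i h _ _ Ki, Box.res_mk γ j h _ _ Kj, Box.tr_mk, Box.tr_mk, ei, ej,
          ← Box.mk_frob_right, ← Box.mk_frob_right, ← Box.mk_add_right,
          (P.C β).tr_res_add _ _ hU]
      | hadd x y hx hy =>
        simp only [map_add]
        rw [add_add_add_comm, hx, hy] }

end Graded

section Constructions

/-- A biadditive map from a function of two variables. -/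
def addHom₂ {A B C : Type*} [AddCommGroup A] [AddCommGroup B] [AddCommGroup C] (φ : A → B → C)
    (h₁ : ∀ a a' b, φ (a + a') b = φ a b + φ a' b)
    (h₂ : ∀ a b b', φ a (b + b') = φ a b + φ a b') : A →+ B →+ C :=
  AddMonoidHom.mk' (fun a => AddMonoidHom.mk' (φ a) (h₂ a))
    (fun a a' => AddMonoidHom.ext fun b => h₁ a a' b)

/-- A triadditive map from a function of three variables. -/
def addHom₃ {A B C D : Type*} [AddCommGroup A] [AddCommGroup B] [AddCommGroup C]
    [AddCommGroup D] (φ : A → B → C → D)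
    (h₁ : ∀ a a' b c, φ (a + a') b c = φ a b c + φ a' b c)
    (h₂ : ∀ a b b' c, φ a (b + b') c = φ a b c + φ a b' c)
    (h₃ : ∀ a b c c', φ a b (c + c') = φ a b c + φ a b c') : A →+ B →+ C →+ D :=
  AddMonoidHom.mk' (fun a => addHom₂ (φ a) (h₂ a) (h₃ a))
    (fun a a' => AddMonoidHom.ext fun b => AddMonoidHom.ext fun c => h₁ a a' b c)

variable {Γ G : Type} [AddCommGroup Γ] [Group G]

namespace Pairing₃

variable {A N P Q S : GrMackey.{u} Γ G}

/-- The triple pairing `(a, n, p) ↦ g (f (a, n), p)`. -/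
def comp₁ (f : Pairing A N S) (g : Pairing S P Q) : Pairing₃ A N P Q where
  f {α β γ _} h := (g.f ((add_assoc α β γ).trans h)).compHom.comp (f.f rfl)
  res h _ _ k a n p := (g.res _ k _ p).trans (by rw [f.res]; rfl)
  tr_one h _ _ k a n p := by
    change g.f _ (f.f rfl _ n) p = _
    rw [f.tr_left, g.tr_left]
    rfl
  tr_two h _ _ k a n p := by
    change g.f _ (f.f rfl _ _) p = _
    rw [f.tr_right, g.tr_left]
    rfl
  tr_three h _ _ k a n p := by
    change g.f _ (f.f rfl _ _) _ = _
    rw [g.tr_right, f.res]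
    rfl

theorem comp₁_f (f : Pairing A N S) (g : Pairing S P Q) {α β γ δ : Γ} (h : α + (β + γ) = δ)
    {X : FinGSet G} (a : (A α).obj X) (n : (N β).obj X) (p : (P γ).obj X) :
    (comp₁ f g).f h a n p = g.f ((add_assoc α β γ).trans h) (f.f rfl a n) p := rfl

theorem deg₂ {α β γ δ : Γ} (h : α + (β + γ) = δ) : β + (γ + α) = δ := by
  rw [← h]
  abel

/-- The triple pairing `(a, n, p) ↦ g (n, f (p, a))`. -/
def comp₂ (f : Pairing P A S) (g : Pairing N S Q) : Pairing₃ A N P Q where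
  f {α _ γ _} h {_} := addHom₃ (fun a n p => g.f (deg₂ h) n (f.f (rfl : γ + α = γ + α) p a))
    (fun a a' n p => by rw [map_add, map_add])
    (fun a n n' p => by rw [map_add, AddMonoidHom.add_apply])
    (fun a n p p' => by rw [map_add, AddMonoidHom.add_apply, map_add])
  res h _ _ k a n p := (g.res _ k n _).trans (by rw [f.res]; rfl)
  tr_one h _ _ k a n p := by
    change g.f _ n (f.f rfl p _) = _
    rw [f.tr_right, g.tr_right]
    rfl
  tr_two h _ _ k a n p := by
    change g.f _ _ (f.f rfl p a) = _
    rw [g.tr_left, f.res]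
    rfl
  tr_three h _ _ k a n p := by
    change g.f _ n (f.f rfl _ a) = _
    rw [f.tr_left, g.tr_right]
    rfl

theorem comp₂_f (f : Pairing P A S) (g : Pairing N S Q) {α β γ δ : Γ} (h : α + (β + γ) = δ)
    {X : FinGSet G} (a : (A α).obj X) (n : (N β).obj X) (p : (P γ).obj X) :
    (comp₂ f g).f h a n p = g.f (deg₂ h) n (f.f rfl p a) := rfl

/-- A triple pairing multiplied by signs depending on the degrees. -/
def twist (φ : Pairing₃ A N P Q) (s : Γ → Γ → Γ → BurnsideRing G) : Pairing₃ A N P Q where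
  f {α β γ _} h {_} := addHom₃ (fun a n p => s α β γ • φ.f h a n p)
    (fun a a' n p => by
      rw [map_add, AddMonoidHom.add_apply, AddMonoidHom.add_apply, smul_add])
    (fun a n n' p => by rw [map_add, AddMonoidHom.add_apply, smul_add])
    (fun a n p p' => by rw [map_add, smul_add])
  res h _ _ k a n p := ((Q _).res_smul _ _ _).trans (congrArg _ (φ.res h k a n p))
  tr_one h _ _ k a n p := (congrArg (s _ _ _ • ·) (φ.tr_one h k a n p)).trans
    ((Q _).tr_smul _ _ _).symm
  tr_two h _ _ k a n p := (congrArg (s _ _ _ • ·) (φ.tr_two h k a n p)).trans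
    ((Q _).tr_smul _ _ _).symm
  tr_three h _ _ k a n p := (congrArg (s _ _ _ • ·) (φ.tr_three h k a n p)).trans
    ((Q _).tr_smul _ _ _).symm

theorem twist_f (φ : Pairing₃ A N P Q) (s : Γ → Γ → Γ → BurnsideRing G) {α β γ δ : Γ}
    (h : α + (β + γ) = δ) {X : FinGSet G} (a : (A α).obj X) (n : (N β).obj X)
    (p : (P γ).obj X) : (φ.twist s).f h a n p = s α β γ • φ.f h a n p := rfl

end Pairing₃

namespace Box

variable {A : GrGreen.{u} Γ G} {N : RMod A} {P : LMod A}

variable (N P) in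
/-- The universal pairing `(n, p) ↦ n ⊗ p`. -/
def tmul : Pairing N.C P.C (Box N P) where
  f {α β γ} h {X} := AddMonoidHom.mk' (fun n => AddMonoidHom.mk'
      (fun p => (mk (FinGSet.idHom X) h n p : Obj N P γ X)) (fun p p' => mk_add_right _ _ _ _ _))
      (fun n n' => by ext p; exact mk_add_left _ _ _ _ _)
  res h X Y k n p := res_mk _ k (FinGSet.idHom Y) k (FinGSet.idHom X)
    ⟨fun _ => rfl, fun x z e => ⟨z, ⟨e.symm, rfl⟩, fun y hy => hy.2⟩⟩ h n p
  tr_left h X Y k n p := (mk_frob_left k (FinGSet.idHom Y) h n p).trans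
    (tr_mk _ k (FinGSet.idHom X) h _ _).symm
  tr_right h X Y k n p := (mk_frob_right k (FinGSet.idHom Y) h n p).trans
    (tr_mk _ k (FinGSet.idHom X) h _ _).symm

theorem mk_eq {γ : Γ} {T U : FinGSet G} (h : FinGSet.Hom U T) {α β : Γ} (e : α + β = γ)
    (n : (N.C α).obj U) (p : (P.C β).obj U) :
    (mk h e n p : Obj N P γ T) = (Box N P γ).tr h ((tmul N P).f e n p) :=
  (tr_mk γ h (FinGSet.idHom U) e n p).symm

theorem tmul_balanced {γ : Γ} {X : FinGSet G} {α β δ ε ζ : Γ}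
    (e : ε + β = γ) (e' : α + ζ = γ) (e₁ : α + δ = ε) (e₂ : δ + β = ζ) (n : (N.C α).obj X)
    (a : (A.C δ).obj X) (p : (P.C β).obj X) :
    (tmul N P).f e (N.act.f e₁ n a) p = (tmul N P).f e' n (P.act.f e₂ a p) :=
  mk_balanced _ e e' e₁ e₂ n a p

theorem ind {γ : Γ} {T : FinGSet G} {R : ((Box N P) γ).obj T → Prop} (x : ((Box N P) γ).obj T)
    (h0 : R 0)
    (ht : ∀ {U : FinGSet G} (h : FinGSet.Hom U T) {α β : Γ} (e : α + β = γ)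
      (n : (N.C α).obj U) (p : (P.C β).obj U), R ((Box N P γ).tr h ((tmul N P).f e n p)))
    (hadd : ∀ x y, R x → R y → R (x + y)) : R x :=
  induction x h0 (fun h _ _ e n p => mk_eq h e n p ▸ ht h e n p) hadd

/-- A pairing is balanced over the graded Green functor. -/
def Balanced {Q : GrMackey.{u} Γ G} (φ : Pairing N.C P.C Q) : Prop :=
  ∀ {γ : Γ} {X : FinGSet G} {α β δ ε ζ : Γ} (e : ε + β = γ) (e' : α + ζ = γ) (e₁ : α + δ = ε)
    (e₂ : δ + β = ζ) (n : (N.C α).obj X) (a : (A.C δ).obj X) (p : (P.C β).obj X),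
    φ.f e (N.act.f e₁ n a) p = φ.f e' n (P.act.f e₂ a p)

/-- Additive maps out of a value of the relative box product. -/
def liftB {γ : Γ} {T : FinGSet G} {B : Type*} [AddCommGroup B]
    (φ : ∀ {U : FinGSet G} (_ : FinGSet.Hom U T) {α β : Γ} (_ : α + β = γ), (N.C α).obj U →
      (P.C β).obj U → B)
    (h₁ : ∀ {U : FinGSet G} (h : FinGSet.Hom U T) {α β : Γ} (e : α + β = γ)
      (n n' : (N.C α).obj U) (p : (P.C β).obj U), φ h e (n + n') p = φ h e n p + φ h e n' p)
    (h₂ : ∀ {U : FinGSet G} (h : FinGSet.Hom U T) {α β : Γ} (e : α + β = γ)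
      (n : (N.C α).obj U) (p p' : (P.C β).obj U), φ h e n (p + p') = φ h e n p + φ h e n p')
    (h₃ : ∀ {U V : FinGSet G} (k : FinGSet.Hom U V) (h : FinGSet.Hom V T) {α β : Γ}
      (e : α + β = γ) (n : (N.C α).obj U) (p : (P.C β).obj V),
      φ h e ((N.C α).tr k n) p = φ (h.comp k) e n ((P.C β).res k p))
    (h₄ : ∀ {U V : FinGSet G} (k : FinGSet.Hom U V) (h : FinGSet.Hom V T) {α β : Γ}
      (e : α + β = γ) (n : (N.C α).obj V) (p : (P.C β).obj U),
      φ h e n ((P.C β).tr k p) = φ (h.comp k) e ((N.C α).res k n) p)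
    (h₅ : ∀ {U : FinGSet G} (h : FinGSet.Hom U T) {α β δ ε ζ : Γ}
      (e : ε + β = γ) (e' : α + ζ = γ) (e₁ : α + δ = ε) (e₂ : δ + β = ζ) (n : (N.C α).obj U)
      (a : (A.C δ).obj U) (p : (P.C β).obj U),
      φ h e (N.act.f e₁ n a) p = φ h e' n (P.act.f e₂ a p)) : (Box N P γ).obj T →+ B :=
  liftObj φ h₁ h₂ h₃ h₄ h₅

theorem liftB_tmul {γ : Γ} {T : FinGSet G} {B : Type*} [AddCommGroup B]
    (φ : ∀ {U : FinGSet G} (_ : FinGSet.Hom U T) {α β : Γ} (_ : α + β = γ), (N.C α).obj U →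
      (P.C β).obj U → B) (h₁ h₂ h₃ h₄ h₅) {U : FinGSet G} (h : FinGSet.Hom U T) {α β : Γ}
    (e : α + β = γ) (n : (N.C α).obj U) (p : (P.C β).obj U) :
    liftB φ h₁ h₂ h₃ h₄ h₅ ((Box N P γ).tr h ((tmul N P).f e n p)) = φ h e n p := by
  rw [← mk_eq]
  exact liftObj_mk _ _ _ _ _ _ h e n p

/-- The map out of the relative box product induced by a balanced pairing. -/
def lift {Q : GrMackey.{u} Γ G} (φ : Pairing N.C P.C Q) (hφ : Balanced φ) :
    GrHom (Box N P) Q := fun γ =>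
  { app := fun T => liftB (fun h _ _ e n p => (Q γ).tr h (φ.f e n p))
      (fun h _ _ e n n' p => by rw [map_add, AddMonoidHom.add_apply, map_add])
      (fun h _ _ e n p p' => by rw [map_add, map_add])
      (fun k h _ _ e n p => by rw [φ.tr_left, (Q γ).tr_comp])
      (fun k h _ _ e n p => by rw [φ.tr_right, (Q γ).tr_comp])
      (fun h _ _ _ _ _ e e' e₁ e₂ n a p => by rw [hφ e e' e₁ e₂])
    app_res := fun {X Y} f m => by
      induction m using ind with
      | h0 => simp only [map_zero]
      | ht h e n p =>
        have H := FinGSet.pb_isPullbackSq h f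
        rw [(Box N P γ).res_tr _ _ _ _ H, (tmul N P).res, liftB_tmul, liftB_tmul,
          (Q γ).res_tr _ _ _ _ H, φ.res]
      | hadd x y hx hy => simp only [map_add, hx, hy]
    app_tr := fun {X Y} f m => by
      induction m using ind with
      | h0 => simp only [map_zero]
      | ht h e n p => rw [← (Box N P γ).tr_comp, liftB_tmul, liftB_tmul, (Q γ).tr_comp]
      | hadd x y hx hy => simp only [map_add, hx, hy] }

theorem lift_tmul {Q : GrMackey.{u} Γ G} (φ : Pairing N.C P.C Q) (hφ : Balanced φ) {α β γ : Γ}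
    (h : α + β = γ) {X : FinGSet G} (n : (N.C α).obj X) (p : (P.C β).obj X) :
    (lift φ hφ γ).app X ((tmul N P).f h n p) = φ.f h n p := by
  have := liftB_tmul (N := N) (P := P) (T := X) (fun h _ _ e n p => (Q γ).tr h (φ.f e n p))
      (fun h _ _ e n n' p => by rw [map_add, AddMonoidHom.add_apply, map_add])
      (fun h _ _ e n p p' => by rw [map_add, map_add])
      (fun k h _ _ e n p => by rw [φ.tr_left, (Q γ).tr_comp])
      (fun k h _ _ e n p => by rw [φ.tr_right, (Q γ).tr_comp])
      (fun h _ _ _ _ _ e e' e₁ e₂ n a p => by rw [hφ e e' e₁ e₂]) (FinGSet.idHom X) h n p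
  rw [(Box N P γ).tr_id, (Q γ).tr_id] at this
  exact this

/-- A triple pairing is balanced over the graded Green functor in the last two variables. -/
def Balanced₃ {B Q : GrMackey.{u} Γ G} (θ : Pairing₃ B N.C P.C Q) : Prop :=
  ∀ {γ κ : Γ} {X : FinGSet G} {α β δ ε ζ : Γ} (e : κ + (ε + β) = γ) (e' : κ + (α + ζ) = γ)
    (e₁ : α + δ = ε) (e₂ : δ + β = ζ) (b : (B κ).obj X) (n : (N.C α).obj X)
    (a : (A.C δ).obj X) (p : (P.C β).obj X),
    θ.f e b (N.act.f e₁ n a) p = θ.f e' b n (P.act.f e₂ a p)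

theorem deg₃ {α β γ δ ε : Γ} (h : α + β = γ) (e : δ + ε = β) : α + (δ + ε) = γ := by
  rw [e, h]

/-- The map on values of the pairing `Box.lift₃`. -/
def lift₃Obj {B Q : GrMackey.{u} Γ G} (θ : Pairing₃ B N.C P.C Q) (hθ : Balanced₃ θ)
    {α β γ : Γ} (h : α + β = γ) {X : FinGSet G} (b : (B α).obj X) :
    (Box N P β).obj X →+ (Q γ).obj X :=
  liftB (fun k _ _ e n p => (Q γ).tr k (θ.f (deg₃ h e) ((B α).res k b) n p))
    (fun k _ _ e n n' p => by rw [map_add, AddMonoidHom.add_apply, map_add])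
    (fun k _ _ e n p p' => by rw [map_add, map_add])
    (fun k l _ _ e n p => by rw [θ.tr_two, (Q γ).tr_comp, (B α).res_comp])
    (fun k l _ _ e n p => by rw [θ.tr_three, (Q γ).tr_comp, (B α).res_comp])
    (fun k _ _ _ _ _ e e' e₁ e₂ n a p => by rw [hθ _ (deg₃ h e') e₁ e₂])

theorem lift₃Obj_tmul {B Q : GrMackey.{u} Γ G} (θ : Pairing₃ B N.C P.C Q) (hθ : Balanced₃ θ)
    {α β γ : Γ} (h : α + β = γ) {X U : FinGSet G} (b : (B α).obj X) (k : FinGSet.Hom U X)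
    {δ ε : Γ} (e : δ + ε = β) (n : (N.C δ).obj U) (p : (P.C ε).obj U) :
    lift₃Obj θ hθ h b ((Box N P β).tr k ((tmul N P).f e n p)) =
      (Q γ).tr k (θ.f (deg₃ h e) ((B α).res k b) n p) :=
  liftB_tmul _ _ _ _ _ _ _ _ _ _

theorem lift₃Obj_add {B Q : GrMackey.{u} Γ G} (θ : Pairing₃ B N.C P.C Q) (hθ : Balanced₃ θ)
    {α β γ : Γ} (h : α + β = γ) {X : FinGSet G} (b b' : (B α).obj X) (x : (Box N P β).obj X) :
    lift₃Obj θ hθ h (b + b') x = lift₃Obj θ hθ h b x + lift₃Obj θ hθ h b' x := by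
  induction x using ind with
  | h0 => simp only [map_zero, add_zero]
  | ht k e n p =>
    rw [lift₃Obj_tmul, lift₃Obj_tmul, lift₃Obj_tmul, map_add, map_add,
      AddMonoidHom.add_apply, AddMonoidHom.add_apply, map_add]
  | hadd x y hx hy => rw [map_add, map_add, map_add, hx, hy, add_add_add_comm]

theorem lift₃Obj_res {B Q : GrMackey.{u} Γ G} (θ : Pairing₃ B N.C P.C Q) (hθ : Balanced₃ θ)
    {α β γ : Γ} (h : α + β = γ) {X Y : FinGSet G} (k : FinGSet.Hom X Y) (b : (B α).obj Y)
    (x : (Box N P β).obj Y) : (Q γ).res k (lift₃Obj θ hθ h b x) =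
      lift₃Obj θ hθ h ((B α).res k b) ((Box N P β).res k x) := by
  induction x using ind with
  | h0 => simp only [map_zero]
  | ht l e n p =>
    have H := FinGSet.pb_isPullbackSq l k
    have ek : l.comp (FinGSet.pbFst l k) = k.comp (FinGSet.pbSnd l k) := MulActionHom.ext H.1
    rw [(Box N P β).res_tr _ _ _ _ H, (tmul N P).res, lift₃Obj_tmul, lift₃Obj_tmul,
      (Q γ).res_tr _ _ _ _ H, θ.res, ← (B α).res_comp, ← (B α).res_comp, ek]
  | hadd x y hx hy => simp only [map_add, hx, hy]

theorem lift₃Obj_tr_left {B Q : GrMackey.{u} Γ G} (θ : Pairing₃ B N.C P.C Q)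
    (hθ : Balanced₃ θ) {α β γ : Γ} (h : α + β = γ) {X Y : FinGSet G} (k : FinGSet.Hom X Y)
    (b : (B α).obj X) (x : (Box N P β).obj Y) : lift₃Obj θ hθ h ((B α).tr k b) x =
      (Q γ).tr k (lift₃Obj θ hθ h b ((Box N P β).res k x)) := by
  induction x using ind with
  | h0 => simp only [map_zero]
  | ht l e n p =>
    have H := FinGSet.pb_isPullbackSq l k
    have ek : l.comp (FinGSet.pbFst l k) = k.comp (FinGSet.pbSnd l k) := MulActionHom.ext H.1
    rw [(Box N P β).res_tr _ _ _ _ H, (tmul N P).res, lift₃Obj_tmul, lift₃Obj_tmul,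
      (B α).res_tr _ _ _ _ H.symm, θ.tr_one, ← (Q γ).tr_comp, ← (Q γ).tr_comp, ek]
  | hadd x y hx hy => simp only [map_add, hx, hy]

theorem lift₃Obj_tr_right {B Q : GrMackey.{u} Γ G} (θ : Pairing₃ B N.C P.C Q)
    (hθ : Balanced₃ θ) {α β γ : Γ} (h : α + β = γ) {X Y : FinGSet G} (k : FinGSet.Hom X Y)
    (b : (B α).obj Y) (x : (Box N P β).obj X) : lift₃Obj θ hθ h b ((Box N P β).tr k x) =
      (Q γ).tr k (lift₃Obj θ hθ h ((B α).res k b) x) := by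
  induction x using ind with
  | h0 => simp only [map_zero]
  | ht l e n p =>
    rw [← (Box N P β).tr_comp, lift₃Obj_tmul, lift₃Obj_tmul, (Q γ).tr_comp, (B α).res_comp]
  | hadd x y hx hy => simp only [map_add, hx, hy]

/-- The pairing with the relative box product induced by a balanced triple pairing. -/
def lift₃ {B Q : GrMackey.{u} Γ G} (θ : Pairing₃ B N.C P.C Q) (hθ : Balanced₃ θ) :
    Pairing B (Box N P) Q where
  f h := addHom₂ (fun b x => lift₃Obj θ hθ h b x) (lift₃Obj_add θ hθ h)
    (fun b => map_add (lift₃Obj θ hθ h b))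
  res h _ _ k b x := lift₃Obj_res θ hθ h k b x
  tr_left h _ _ k b x := lift₃Obj_tr_left θ hθ h k b x
  tr_right h _ _ k b x := lift₃Obj_tr_right θ hθ h k b x

theorem lift₃_tmul {B Q : GrMackey.{u} Γ G} (θ : Pairing₃ B N.C P.C Q) (hθ : Balanced₃ θ)
    {α β γ δ ε : Γ} (h : α + β = γ) (e : δ + ε = β) {X : FinGSet G} (b : (B α).obj X)
    (n : (N.C δ).obj X) (p : (P.C ε).obj X) :
    (lift₃ θ hθ).f h b ((tmul N P).f e n p) = θ.f (deg₃ h e) b n p := by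
  have := lift₃Obj_tmul θ hθ h b (FinGSet.idHom X) e n p
  rw [(Box N P β).tr_id, (Q γ).tr_id, (B α).res_id] at this
  exact this

end Box

/-! ### Algebras over a commutative graded Green functor -/

/-- An associative algebra over the graded Green functor `R`: a graded Green functor `A` with a
central unit map `R → A`, where `η(r) a = σ(|a|, |r|) a η(r)`. -/
structure Alg (σ : SignRule Γ G) (R : GrGreen.{u} Γ G) where
  A : GrGreen.{u} Γ G
  η : GrHom R.C A.C
  η_one : ∀ X : FinGSet G, (η 0).app X (R.one X) = A.one X
  η_mul : ∀ {α β γ : Γ} (h : α + β = γ) {X : FinGSet G} (r : (R.C α).obj X)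
    (r' : (R.C β).obj X),
    (η γ).app X (R.mul.f h r r') = A.mul.f h ((η α).app X r) ((η β).app X r')
  central : ∀ {α β γ : Γ} (h : α + β = γ) (h' : β + α = γ) {X : FinGSet G} (r : (R.C α).obj X)
    (a : (A.C β).obj X),
    A.mul.f h ((η α).app X r) a = σ.s β α • A.mul.f h' a ((η α).app X r)

variable {σ : SignRule Γ G} {R : GrGreen.{u} Γ G}

namespace Alg

theorem central_symm (M : Alg σ R) {α β γ : Γ} (h : α + β = γ) (h' : β + α = γ) {X : FinGSet G}
    (r : (R.C α).obj X) (a : (M.A.C β).obj X) :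
    σ.s α β • M.A.mul.f h ((M.η α).app X r) a = M.A.mul.f h' a ((M.η α).app X r) := by
  rw [M.central h h', smul_smul, σ.symm, one_smul]

/-- The underlying left module over the base. -/
abbrev toLMod (M : Alg σ R) : LMod R where
  C := M.A.C
  act := M.A.mul.compLeft M.η
  one_act h _ n := by rw [Pairing.compLeft_f, M.η_one, M.A.one_mul]
  mul_act h₁ h₂ h₃ h₄ _ a b n := by
    rw [Pairing.compLeft_f, M.η_mul, M.A.mul_assoc h₁ h₂ h₃ h₄]
    rfl

/-- The opposite of the underlying graded Green functor, with multiplication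
`a * b = σ(|b|, |a|) b a`. -/
def opA (M : Alg σ R) : GrGreen.{u} Γ G where
  C := M.A.C
  mul := M.A.mul.flip.twist fun α β => σ.s β α
  one := M.A.one
  res_one := M.A.res_one
  one_mul := fun h _ a => by
    rw [Pairing.twist_f, Pairing.flip_f, M.A.mul_one, σ.zero_right, one_smul]
  mul_one := fun h _ a => by
    rw [Pairing.twist_f, Pairing.flip_f, M.A.one_mul, σ.zero_left, one_smul]
  mul_assoc := fun {α β γ δ ε ζ} h₁ h₂ h₃ h₄ _ a b c => by
    have e₁ : γ + δ = ζ := by rw [add_comm]; exact h₁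
    have e₂ : β + α = δ := by rw [add_comm]; exact h₂
    have e₃ : ε + α = ζ := by rw [add_comm]; exact h₃
    have e₄ : γ + β = ε := by rw [add_comm]; exact h₄
    have key := M.A.mul_assoc e₃ e₄ e₁ e₂ c b a
    simp only [Pairing.twist_f, Pairing.flip_f]
    rw [Pairing.smul_right, Pairing.smul_left, smul_smul, smul_smul, key]
    congr 1
    rw [← h₂, ← h₄, σ.add_right, σ.add_left]
    ring

theorem opA_mul (M : Alg σ R) {α β γ : Γ} (h : α + β = γ) (h' : β + α = γ) {X : FinGSet G}
    (a : (M.A.C α).obj X) (b : (M.A.C β).obj X) :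
    M.opA.mul.f h a b = σ.s β α • M.A.mul.f h' b a := rfl

/-- The opposite algebra. -/
def op (M : Alg σ R) : Alg σ R where
  A := M.opA
  η := M.η
  η_one := M.η_one
  η_mul {α β γ} h _ r r' := by
    have h' : β + α = γ := by rw [add_comm]; exact h
    exact (M.η_mul h r r').trans (M.central h h' r _)
  central {α β γ} h h' _ r a := by
    have e : M.opA.mul.f h' a ((M.η α).app _ r) = M.A.mul.f h' a ((M.η α).app _ r) :=
      (M.opA_mul h' h a _).trans (M.central_symm h h' r a)
    exact (M.opA_mul h h' _ a).trans (congrArg (σ.s β α • ·) e.symm)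

/-- A map of algebras. -/
structure Hom (M M' : Alg σ R) where
  u : GrHom M.A.C M'.A.C
  map_one : ∀ X : FinGSet G, (u 0).app X (M.A.one X) = M'.A.one X
  map_mul : ∀ {α β γ : Γ} (h : α + β = γ) {X : FinGSet G} (a : (M.A.C α).obj X)
    (b : (M.A.C β).obj X),
    (u γ).app X (M.A.mul.f h a b) = M'.A.mul.f h ((u α).app X a) ((u β).app X b)
  map_η : ∀ {α : Γ} {X : FinGSet G} (r : (R.C α).obj X),
    (u α).app X ((M.η α).app X r) = (M'.η α).app X r

end Alg
end Constructions

section Bimodules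

variable {Γ G : Type} [AddCommGroup Γ] [Group G]

/-- Precomposition of a pairing in the second variable. -/
def Pairing.compRight {N P P' Q : GrMackey.{u} Γ G} (φ : Pairing N P Q) (u : GrHom P' P) :
    Pairing N P' Q := (φ.flip.compLeft u).flip

theorem Pairing.compRight_f {N P P' Q : GrMackey.{u} Γ G} (φ : Pairing N P Q) (u : GrHom P' P)
    {α β γ : Γ} (h : α + β = γ) {X : FinGSet G} (n : (N α).obj X) (p : (P' β).obj X) :
    (φ.compRight u).f h n p = φ.f h n ((u β).app X p) := rfl

variable {σ : SignRule Γ G} {R : GrGreen.{u} Γ G}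

/-- A bimodule over an algebra `M`, on which the base `R` acts centrally. -/
structure BiMod (M : Alg σ R) where
  C : GrMackey.{u} Γ G
  l : Pairing M.A.C C C
  r : Pairing C M.A.C C
  one_l : ∀ {α : Γ} (h : 0 + α = α) {X : FinGSet G} (x : (C α).obj X), l.f h (M.A.one X) x = x
  mul_l : ∀ {α β γ δ ε ζ : Γ} (h₁ : δ + γ = ζ) (h₂ : α + β = δ) (h₃ : α + ε = ζ)
    (h₄ : β + γ = ε) {X : FinGSet G} (a : (M.A.C α).obj X) (b : (M.A.C β).obj X)
    (x : (C γ).obj X), l.f h₁ (M.A.mul.f h₂ a b) x = l.f h₃ a (l.f h₄ b x)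
  r_one : ∀ {α : Γ} (h : α + 0 = α) {X : FinGSet G} (x : (C α).obj X), r.f h x (M.A.one X) = x
  r_mul : ∀ {α β γ δ ε ζ : Γ} (h₁ : α + ε = ζ) (h₂ : β + γ = ε) (h₃ : δ + γ = ζ)
    (h₄ : α + β = δ) {X : FinGSet G} (x : (C α).obj X) (a : (M.A.C β).obj X)
    (b : (M.A.C γ).obj X), r.f h₁ x (M.A.mul.f h₂ a b) = r.f h₃ (r.f h₄ x a) b
  assoc : ∀ {α β γ δ ε ζ : Γ} (h₁ : δ + γ = ζ) (h₂ : α + β = δ) (h₃ : α + ε = ζ)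
    (h₄ : β + γ = ε) {X : FinGSet G} (a : (M.A.C α).obj X) (x : (C β).obj X)
    (b : (M.A.C γ).obj X), r.f h₁ (l.f h₂ a x) b = l.f h₃ a (r.f h₄ x b)
  central : ∀ {α β γ : Γ} (h : α + β = γ) (h' : β + α = γ) {X : FinGSet G} (s : (R.C α).obj X)
    (x : (C β).obj X), l.f h ((M.η α).app X s) x = σ.s β α • r.f h' x ((M.η α).app X s)

/-- The underlying right module over the base. -/
abbrev BiMod.toRMod {M : Alg σ R} (X : BiMod M) : RMod R where
  C := X.C
  act := X.r.compRight M.η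
  act_one h _ n := by rw [Pairing.compRight_f, M.η_one, X.r_one]
  act_mul h₁ h₂ h₃ h₄ _ n a b := by
    rw [Pairing.compRight_f, M.η_mul h₂, X.r_mul h₁ h₂ h₃ h₄]
    rfl

/-- An algebra as a bimodule over itself. -/
def Alg.self (M : Alg σ R) : BiMod M where
  C := M.A.C
  l := M.A.mul
  r := M.A.mul
  one_l := M.A.one_mul
  mul_l := M.A.mul_assoc
  r_one := M.A.mul_one
  r_mul h₁ h₂ h₃ h₄ _ x a b := (M.A.mul_assoc h₃ h₄ h₁ h₂ x a b).symm
  assoc := M.A.mul_assoc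
  central := M.central

/-- The underlying right module over the base. -/
abbrev Alg.toRMod (M : Alg σ R) : RMod R := M.self.toRMod

namespace BiMod

variable {M : Alg σ R} (X : BiMod M)

/-- The underlying graded Mackey functor of `X □_R M`. -/
abbrev stepC : GrMackey.{u} Γ G := Box X.toRMod M.toLMod

/-- The map `x ⊗ m` of `X □_R M`. -/
abbrev tm : Pairing X.C M.A.C X.stepC := Box.tmul X.toRMod M.toLMod

theorem tm_balanced {γ : Γ} {T : FinGSet G} {α β δ ε ζ : Γ}
    (e : ε + β = γ) (e' : α + ζ = γ) (e₁ : α + δ = ε) (e₂ : δ + β = ζ) (x : (X.C α).obj T)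
    (s : (R.C δ).obj T) (m : (M.A.C β).obj T) :
    X.tm.f e (X.r.f e₁ x ((M.η δ).app T s)) m =
      X.tm.f e' x (M.A.mul.f e₂ ((M.η δ).app T s) m) :=
  Box.tmul_balanced (N := X.toRMod) (P := M.toLMod) e e' e₁ e₂ x s m

theorem stepL_balanced : Box.Balanced₃ (N := X.toRMod) (P := M.toLMod)
    (Pairing₃.comp₁ X.l X.tm) := by
  refine fun {γ κ T α β δ ε ζ} e e' e₁ e₂ (b : (M.A.C κ).obj T) (x : (X.C α).obj T)
    (s : (R.C δ).obj T) (m : (M.A.C β).obj T) => ?_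
  subst e₁ e₂ e
  change X.tm.f _ (X.l.f rfl b (X.r.f rfl x ((M.η δ).app T s))) m =
    X.tm.f _ (X.l.f rfl b x) (M.A.mul.f rfl ((M.η δ).app T s) m)
  rw [← X.assoc (add_assoc κ α δ) rfl rfl rfl, X.tm_balanced]

theorem stepR_balanced : Box.Balanced₃ (N := X.toRMod) (P := M.toLMod)
    (Pairing₃.comp₂ M.A.mul X.tm) := by
  refine fun {γ κ T α β δ ε ζ} e e' e₁ e₂ (b : (M.A.C κ).obj T) (x : (X.C α).obj T)
    (s : (R.C δ).obj T) (m : (M.A.C β).obj T) => ?_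
  subst e₁ e₂ e
  change X.tm.f _ (X.r.f rfl x ((M.η δ).app T s)) (M.A.mul.f rfl m b) =
    X.tm.f _ x (M.A.mul.f rfl (M.A.mul.f rfl ((M.η δ).app T s) m) b)
  rw [M.A.mul_assoc rfl rfl (add_assoc δ β κ).symm rfl, X.tm_balanced]

theorem ind {γ : Γ} {T : FinGSet G} {P : (X.stepC γ).obj T → Prop} (x : (X.stepC γ).obj T)
    (h0 : P 0)
    (ht : ∀ {U : FinGSet G} (k : FinGSet.Hom U T) {α β : Γ} (e : α + β = γ)
      (x : (X.C α).obj U) (m : (M.A.C β).obj U), P ((X.stepC γ).tr k (X.tm.f e x m)))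
    (hadd : ∀ x y, P x → P y → P (x + y)) : P x :=
  Box.ind (N := X.toRMod) (P := M.toLMod) x h0 (fun k _ _ e n p => ht k e n p) hadd

/-- The left action `a (x ⊗ m) = a x ⊗ m`. -/
def stepL : Pairing M.A.C X.stepC X.stepC := Box.lift₃ _ X.stepL_balanced

/-- The right action `(x ⊗ m) b = x ⊗ m b`. -/
def stepR : Pairing X.stepC M.A.C X.stepC := (Box.lift₃ _ X.stepR_balanced).flip

theorem stepL_tm {α β γ δ ε ζ : Γ} (h : α + β = γ) (e : δ + ε = β) (h₁ : α + δ = ζ)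
    (h₂ : ζ + ε = γ) {T : FinGSet G} (a : (M.A.C α).obj T) (x : (X.C δ).obj T)
    (m : (M.A.C ε).obj T) :
    X.stepL.f h a (X.tm.f e x m) = X.tm.f h₂ (X.l.f h₁ a x) m := by
  subst h₁
  exact Box.lift₃_tmul _ X.stepL_balanced h e a x m

theorem stepR_tm {α β γ δ ε ζ : Γ} (h : α + β = γ) (e : δ + ε = α) (h₁ : ε + β = ζ)
    (h₂ : δ + ζ = γ) {T : FinGSet G} (x : (X.C δ).obj T) (m : (M.A.C ε).obj T)
    (b : (M.A.C β).obj T) :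
    X.stepR.f h (X.tm.f e x m) b = X.tm.f h₂ x (M.A.mul.f h₁ m b) := by
  subst h₁
  exact Box.lift₃_tmul _ X.stepR_balanced ((add_comm _ _).trans h) e b x m

/-- The bimodule `X □_R M`, with the outer actions. -/
def step : BiMod M where
  C := X.stepC
  l := X.stepL
  r := X.stepR
  one_l h T x := by
    induction x using X.ind with
    | h0 => rw [map_zero]
    | ht k e n p =>
      rw [X.stepL.tr_right, M.A.res_one, X.stepL_tm h e (zero_add _) e, X.one_l]
    | hadd x y hx hy => rw [map_add, hx, hy]
  mul_l {α β γ δ ε ζ} h₁ h₂ h₃ h₄ T a b x := by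
    induction x using X.ind with
    | h0 => simp only [map_zero]
    | @ht U k μ ν e n p =>
      have e₁ : δ + μ + ν = ζ := by rw [add_assoc, e, h₁]
      have e₂ : β + μ + ν = ε := by rw [add_assoc, e, h₄]
      have e₃ : α + (β + μ) = δ + μ := by rw [← add_assoc, h₂]
      rw [X.stepL.tr_right, X.stepL.tr_right, X.stepL.tr_right, M.A.mul.res,
        X.stepL_tm h₁ e rfl e₁, X.stepL_tm h₄ e rfl e₂, X.stepL_tm h₃ e₂ e₃ e₁,
        X.mul_l rfl h₂ e₃ rfl]
    | hadd x y hx hy => simp only [map_add, hx, hy]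
  r_one h T x := by
    induction x using X.ind with
    | h0 => rw [map_zero, AddMonoidHom.zero_apply]
    | ht k e n p =>
      rw [X.stepR.tr_left, M.A.res_one, X.stepR_tm h e (add_zero _) e, M.A.mul_one]
    | hadd x y hx hy => rw [map_add, AddMonoidHom.add_apply, hx, hy]
  r_mul {α β γ δ ε ζ} h₁ h₂ h₃ h₄ T x a b := by
    induction x using X.ind with
    | h0 => simp only [map_zero, AddMonoidHom.zero_apply]
    | @ht U k μ ν e n p =>
      have e₁ : μ + (ν + ε) = ζ := by rw [← add_assoc, e, h₁]
      have e₂ : μ + (ν + β) = δ := by rw [← add_assoc, e, h₄]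
      have e₃ : ν + β + γ = ν + ε := by rw [add_assoc, h₂]
      rw [X.stepR.tr_left, X.stepR.tr_left, X.stepR.tr_left, M.A.mul.res,
        X.stepR_tm h₁ e rfl e₁, X.stepR_tm h₄ e rfl e₂, X.stepR_tm h₃ e₂ e₃ e₁,
        M.A.mul_assoc e₃ rfl rfl h₂]
    | hadd x y hx hy => simp only [map_add, AddMonoidHom.add_apply, hx, hy]
  assoc {α β γ δ ε ζ} h₁ h₂ h₃ h₄ T a x b := by
    induction x using X.ind with
    | h0 => simp only [map_zero, AddMonoidHom.zero_apply]
    | @ht U k μ ν e n p =>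
      have e₁ : α + μ + ν = δ := by rw [add_assoc, e, h₂]
      have e₂ : μ + (ν + γ) = ε := by rw [← add_assoc, e, h₄]
      have e₃ : α + μ + (ν + γ) = ζ := by rw [← add_assoc, e₁, h₁]
      rw [X.stepL.tr_right, X.stepR.tr_left, X.stepR.tr_left, X.stepL.tr_right,
        X.stepL_tm h₂ e rfl e₁, X.stepR_tm h₁ e₁ rfl e₃, X.stepR_tm h₄ e rfl e₂,
        X.stepL_tm h₃ e₂ rfl e₃]
    | hadd x y hx hy => simp only [map_add, AddMonoidHom.add_apply, hx, hy]
  central {α β γ} h h' T s x := by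
    induction x using X.ind with
    | h0 => simp only [map_zero, AddMonoidHom.zero_apply, smul_zero]
    | @ht U k μ ν e n p =>
      have e₁ : α + μ + ν = γ := by rw [add_assoc, e, h]
      have e₂ : μ + (ν + α) = γ := by rw [← add_assoc, e, h']
      rw [X.stepL.tr_right, X.stepR.tr_left, ← (M.η α).app_res, X.stepL_tm h e rfl e₁,
        X.stepR_tm h' e rfl e₂, X.central rfl (add_comm μ α), ← M.central_symm (add_comm α ν) rfl,
        X.tm.smul_left, X.tm.smul_right, ← e, σ.add_left, (X.stepC γ).tr_smul, (X.stepC γ).tr_smul,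
        smul_smul, mul_assoc, σ.symm, mul_one, X.tm_balanced e₁ e₂ (add_comm μ α) (add_comm α ν)]
    | hadd x y hx hy => simp only [map_add, AddMonoidHom.add_apply, smul_add, hx, hy]

end BiMod
end Bimodules

section Enveloping

variable {Γ G : Type} [AddCommGroup Γ] [Group G] {σ : SignRule Γ G} {R : GrGreen.{u} Γ G}

namespace Alg

variable (M N : Alg σ R)

/-- The underlying graded Mackey functor of `M □_R N`. -/
abbrev tensorC : GrMackey.{u} Γ G := Box M.toRMod N.toLMod

/-- The map `m ⊗ n` of `M □_R N`. -/
abbrev tt : Pairing M.A.C N.A.C (M.tensorC N) := Box.tmul M.toRMod N.toLMod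

variable {M N}

theorem tt_balanced {γ : Γ} {T : FinGSet G} {α β δ ε ζ : Γ}
    (e : ε + β = γ) (e' : α + ζ = γ) (e₁ : α + δ = ε) (e₂ : δ + β = ζ) (m : (M.A.C α).obj T)
    (s : (R.C δ).obj T) (n : (N.A.C β).obj T) :
    (M.tt N).f e (M.A.mul.f e₁ m ((M.η δ).app T s)) n =
      (M.tt N).f e' m (N.A.mul.f e₂ ((N.η δ).app T s) n) :=
  Box.tmul_balanced (N := M.toRMod) (P := N.toLMod) e e' e₁ e₂ m s n

theorem tensor_ind {γ : Γ} {T : FinGSet G} {P : (M.tensorC N γ).obj T → Prop}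
    (x : (M.tensorC N γ).obj T) (h0 : P 0)
    (ht : ∀ {U : FinGSet G} (k : FinGSet.Hom U T) {α β : Γ} (e : α + β = γ)
      (m : (M.A.C α).obj U) (n : (N.A.C β).obj U),
      P ((M.tensorC N γ).tr k ((M.tt N).f e m n)))
    (hadd : ∀ x y, P x → P y → P (x + y)) : P x :=
  Box.ind (N := M.toRMod) (P := N.toLMod) x h0 (fun k _ _ e n p => ht k e n p) hadd

end Alg

/-- A graded Mackey functor with left actions of two algebras `M` and `N` that commute up to the
rotating isomorphism and agree on the base. -/
structure LL (M N : Alg σ R) where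
  C : GrMackey.{u} Γ G
  l₁ : Pairing M.A.C C C
  l₂ : Pairing N.A.C C C
  one_l₁ : ∀ {α : Γ} (h : 0 + α = α) {X : FinGSet G} (x : (C α).obj X),
    l₁.f h (M.A.one X) x = x
  mul_l₁ : ∀ {α β γ δ ε ζ : Γ} (h₁ : δ + γ = ζ) (h₂ : α + β = δ) (h₃ : α + ε = ζ)
    (h₄ : β + γ = ε) {X : FinGSet G} (a : (M.A.C α).obj X) (b : (M.A.C β).obj X)
    (x : (C γ).obj X), l₁.f h₁ (M.A.mul.f h₂ a b) x = l₁.f h₃ a (l₁.f h₄ b x)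
  one_l₂ : ∀ {α : Γ} (h : 0 + α = α) {X : FinGSet G} (x : (C α).obj X),
    l₂.f h (N.A.one X) x = x
  mul_l₂ : ∀ {α β γ δ ε ζ : Γ} (h₁ : δ + γ = ζ) (h₂ : α + β = δ) (h₃ : α + ε = ζ)
    (h₄ : β + γ = ε) {X : FinGSet G} (a : (N.A.C α).obj X) (b : (N.A.C β).obj X)
    (x : (C γ).obj X), l₂.f h₁ (N.A.mul.f h₂ a b) x = l₂.f h₃ a (l₂.f h₄ b x)
  comm : ∀ {α β γ δ ε ζ : Γ} (h₁ : β + δ = ζ) (h₂ : α + γ = δ) (h₃ : α + ε = ζ)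
    (h₄ : β + γ = ε) {X : FinGSet G} (m : (M.A.C α).obj X) (n : (N.A.C β).obj X)
    (x : (C γ).obj X), l₂.f h₁ n (l₁.f h₂ m x) = σ.s α β • l₁.f h₃ m (l₂.f h₄ n x)
  agree : ∀ {α β γ : Γ} (h : α + β = γ) {X : FinGSet G} (s : (R.C α).obj X)
    (x : (C β).obj X), l₁.f h ((M.η α).app X s) x = l₂.f h ((N.η α).app X s) x

/-- A graded Mackey functor with right actions of two algebras `M` and `N` that commute up to the
rotating isomorphism and agree on the base. -/
structure RR (M N : Alg σ R) where
  C : GrMackey.{u} Γ G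
  r₁ : Pairing C M.A.C C
  r₂ : Pairing C N.A.C C
  r₁_one : ∀ {α : Γ} (h : α + 0 = α) {X : FinGSet G} (x : (C α).obj X),
    r₁.f h x (M.A.one X) = x
  r₁_mul : ∀ {α β γ δ ε ζ : Γ} (h₁ : α + ε = ζ) (h₂ : β + γ = ε) (h₃ : δ + γ = ζ)
    (h₄ : α + β = δ) {X : FinGSet G} (x : (C α).obj X) (a : (M.A.C β).obj X)
    (b : (M.A.C γ).obj X), r₁.f h₁ x (M.A.mul.f h₂ a b) = r₁.f h₃ (r₁.f h₄ x a) b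
  r₂_one : ∀ {α : Γ} (h : α + 0 = α) {X : FinGSet G} (x : (C α).obj X),
    r₂.f h x (N.A.one X) = x
  r₂_mul : ∀ {α β γ δ ε ζ : Γ} (h₁ : α + ε = ζ) (h₂ : β + γ = ε) (h₃ : δ + γ = ζ)
    (h₄ : α + β = δ) {X : FinGSet G} (x : (C α).obj X) (a : (N.A.C β).obj X)
    (b : (N.A.C γ).obj X), r₂.f h₁ x (N.A.mul.f h₂ a b) = r₂.f h₃ (r₂.f h₄ x a) b
  comm : ∀ {α β γ δ ε ζ : Γ} (h₁ : δ + α = ζ) (h₂ : γ + β = δ) (h₃ : ε + β = ζ)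
    (h₄ : γ + α = ε) {X : FinGSet G} (m : (M.A.C α).obj X) (n : (N.A.C β).obj X)
    (x : (C γ).obj X), r₁.f h₁ (r₂.f h₂ x n) m = σ.s α β • r₂.f h₃ (r₁.f h₄ x m) n
  agree : ∀ {α β γ : Γ} (h : β + α = γ) {X : FinGSet G} (s : (R.C α).obj X)
    (x : (C β).obj X), r₁.f h x ((M.η α).app X s) = r₂.f h x ((N.η α).app X s)

namespace LL

variable {M N : Alg σ R}

theorem act_balanced (P : LL M N) : Box.Balanced₃ (N := M.toRMod) (P := N.toLMod)
    (Pairing₃.comp₂ P.l₂ P.l₁) := by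
  refine fun {γ κ T α β δ ε ζ} e e' e₁ e₂ (x : (P.C κ).obj T) (m : (M.A.C α).obj T)
    (s : (R.C δ).obj T) (n : (N.A.C β).obj T) => ?_
  subst e₁ e₂ e
  change P.l₁.f _ (M.A.mul.f rfl m ((M.η δ).app T s)) (P.l₂.f rfl n x) =
    P.l₁.f _ m (P.l₂.f rfl (N.A.mul.f rfl ((N.η δ).app T s) n) x)
  have e₂ : δ + (β + κ) = δ + β + κ := (add_assoc _ _ _).symm
  have e₁ : α + (δ + β + κ) = κ + (α + δ + β) := by abel
  rw [P.mul_l₁ _ rfl e₁ e₂, P.agree, P.mul_l₂ rfl rfl e₂ rfl]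

/-- The action `(m ⊗ n) x = m (n x)` of `M □_R N`. -/
def act (P : LL M N) : Pairing (M.tensorC N) P.C P.C := (Box.lift₃ _ P.act_balanced).flip

theorem act_tt (P : LL M N) {α β γ δ ε ζ : Γ} (h : α + β = γ) (e : δ + ε = α) (h₁ : δ + ζ = γ)
    (h₂ : ε + β = ζ) {T : FinGSet G} (m : (M.A.C δ).obj T) (n : (N.A.C ε).obj T)
    (x : (P.C β).obj T) :
    P.act.f h ((M.tt N).f e m n) x = P.l₁.f h₁ m (P.l₂.f h₂ n x) := by
  subst h₂
  exact Box.lift₃_tmul _ P.act_balanced ((add_comm _ _).trans h) e x m n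

end LL

namespace Alg

variable (M N : Alg σ R)

theorem tensor₁_balanced : Box.Balanced₃ (N := M.toRMod) (P := N.toLMod)
    (Pairing₃.comp₁ M.A.mul (M.tt N)) := by
  refine fun {γ κ T α β δ ε ζ} e e' e₁ e₂ (b : (M.A.C κ).obj T) (m : (M.A.C α).obj T)
    (s : (R.C δ).obj T) (n : (N.A.C β).obj T) => ?_
  subst e₁ e₂ e
  change (M.tt N).f _ (M.A.mul.f rfl b (M.A.mul.f rfl m ((M.η δ).app T s))) n =
    (M.tt N).f _ (M.A.mul.f rfl b m) (N.A.mul.f rfl ((N.η δ).app T s) n)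
  rw [← M.A.mul_assoc (add_assoc κ α δ) rfl rfl rfl, tt_balanced]

theorem tensor₂_balanced : Box.Balanced₃ (N := M.toRMod) (P := N.toLMod)
    ((Pairing₃.comp₂ N.A.mul.flip (M.tt N)).twist fun α β _ => σ.s β α) := by
  refine fun {γ κ T α β δ ε ζ} e e' e₁ e₂ (b : (N.A.C κ).obj T) (m : (M.A.C α).obj T)
    (s : (R.C δ).obj T) (n : (N.A.C β).obj T) => ?_
  subst e₁ e₂ e
  change σ.s (α + δ) κ • (M.tt N).f _ (M.A.mul.f rfl m ((M.η δ).app T s))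
      (N.A.mul.f (add_comm _ _) b n) =
    σ.s α κ • (M.tt N).f _ m (N.A.mul.f (add_comm _ _) b (N.A.mul.f rfl ((N.η δ).app T s) n))
  rw [← N.A.mul_assoc (δ := κ + δ) (by abel) rfl _ rfl, ← N.central_symm (add_comm δ κ) rfl,
    (N.A.mul).smul_left, (M.tt N).smul_right, smul_smul, σ.add_left,
    N.A.mul_assoc (ε := β + κ) (by abel) _ (by abel) (add_comm κ β), tt_balanced]

/-- The left action `m' (m ⊗ n) = m' m ⊗ n` of `M` on `M □_R N`. -/
def tensor₁ : Pairing M.A.C (M.tensorC N) (M.tensorC N) := Box.lift₃ _ (M.tensor₁_balanced N)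

/-- The left action `n' (m ⊗ n) = σ(|m|, |n'|) (m ⊗ n' n)` of `N` on `M □_R N`. -/
def tensor₂ : Pairing N.A.C (M.tensorC N) (M.tensorC N) := Box.lift₃ _ (M.tensor₂_balanced N)

variable {M N}

theorem tensor₁_tt {α β γ δ ε ζ : Γ} (h : α + β = γ) (e : δ + ε = β) (h₁ : α + δ = ζ)
    (h₂ : ζ + ε = γ) {T : FinGSet G} (a : (M.A.C α).obj T) (m : (M.A.C δ).obj T)
    (n : (N.A.C ε).obj T) :
    (M.tensor₁ N).f h a ((M.tt N).f e m n) = (M.tt N).f h₂ (M.A.mul.f h₁ a m) n := by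
  subst h₁
  exact Box.lift₃_tmul _ (M.tensor₁_balanced N) h e a m n

theorem tensor₂_tt {α β γ δ ε ζ : Γ} (h : α + β = γ) (e : δ + ε = β) (h₁ : α + ε = ζ)
    (h₂ : δ + ζ = γ) {T : FinGSet G} (a : (N.A.C α).obj T) (m : (M.A.C δ).obj T)
    (n : (N.A.C ε).obj T) :
    (M.tensor₂ N).f h a ((M.tt N).f e m n) =
      σ.s δ α • (M.tt N).f h₂ m (N.A.mul.f h₁ a n) := by
  have h₁' : ε + α = ζ := by rw [add_comm, h₁]
  subst h₁'
  exact Box.lift₃_tmul _ (M.tensor₂_balanced N) h e a m n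

end Alg
end Enveloping

section EnvelopingAlgebra

variable {Γ G : Type} [AddCommGroup Γ] [Group G] {σ : SignRule Γ G} {R : GrGreen.{u} Γ G}

variable {M N : Alg σ R}

variable (M N) in
/-- The two left actions on `M □_R N`. -/
abbrev LL.self : LL M N where
  C := M.tensorC N
  l₁ := M.tensor₁ N
  l₂ := M.tensor₂ N
  one_l₁ h T x := by
    induction x using Alg.tensor_ind with
    | h0 => rw [map_zero]
    | ht k e m n =>
      rw [(M.tensor₁ N).tr_right, M.A.res_one, Alg.tensor₁_tt h e (zero_add _) e, M.A.one_mul]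
    | hadd x y hx hy => rw [map_add, hx, hy]
  mul_l₁ {α β γ δ ε ζ} h₁ h₂ h₃ h₄ T a b x := by
    induction x using Alg.tensor_ind with
    | h0 => simp only [map_zero]
    | @ht U k μ ν e m n =>
      have e₁ : δ + μ + ν = ζ := by rw [add_assoc, e, h₁]
      have e₂ : β + μ + ν = ε := by rw [add_assoc, e, h₄]
      have e₃ : α + (β + μ) = δ + μ := by rw [← add_assoc, h₂]
      rw [(M.tensor₁ N).tr_right, (M.tensor₁ N).tr_right, (M.tensor₁ N).tr_right, M.A.mul.res,
        Alg.tensor₁_tt h₁ e rfl e₁, Alg.tensor₁_tt h₄ e rfl e₂, Alg.tensor₁_tt h₃ e₂ e₃ e₁,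
        M.A.mul_assoc rfl h₂ e₃ rfl]
    | hadd x y hx hy => simp only [map_add, hx, hy]
  one_l₂ h T x := by
    induction x using Alg.tensor_ind with
    | h0 => rw [map_zero]
    | ht k e m n =>
      rw [(M.tensor₂ N).tr_right, N.A.res_one, Alg.tensor₂_tt h e (zero_add _) e, N.A.one_mul,
        σ.zero_right, one_smul]
    | hadd x y hx hy => rw [map_add, hx, hy]
  mul_l₂ {α β γ δ ε ζ} h₁ h₂ h₃ h₄ T a b x := by
    induction x using Alg.tensor_ind with
    | h0 => simp only [map_zero]
    | @ht U k μ ν e m n =>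
      have e₁ : μ + (δ + ν) = ζ := by rw [← h₁, ← e]; abel
      have e₂ : μ + (β + ν) = ε := by rw [← h₄, ← e]; abel
      have e₃ : α + (β + ν) = δ + ν := by rw [← add_assoc, h₂]
      rw [(M.tensor₂ N).tr_right, (M.tensor₂ N).tr_right, (M.tensor₂ N).tr_right, N.A.mul.res,
        Alg.tensor₂_tt h₁ e rfl e₁, Alg.tensor₂_tt h₄ e rfl e₂, (M.tensor₂ N).smul_right,
        Alg.tensor₂_tt h₃ e₂ e₃ e₁, N.A.mul_assoc rfl h₂ e₃ rfl, smul_smul]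
      congr 2
      rw [← h₂, σ.add_right, mul_comm]
    | hadd x y hx hy => simp only [map_add, hx, hy]
  comm {α β γ δ ε ζ} h₁ h₂ h₃ h₄ T a b x := by
    induction x using Alg.tensor_ind with
    | h0 => simp only [map_zero, smul_zero]
    | @ht U k μ ν e m n =>
      have e₁ : α + μ + ν = δ := by rw [← h₂, ← e]; abel
      have e₂ : μ + (β + ν) = ε := by rw [← h₄, ← e]; abel
      have e₃ : α + μ + (β + ν) = ζ := by rw [← h₃, ← e₂]; abel
      rw [(M.tensor₁ N).tr_right, (M.tensor₂ N).tr_right, (M.tensor₂ N).tr_right,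
        (M.tensor₁ N).tr_right, Alg.tensor₁_tt h₂ e rfl e₁, Alg.tensor₂_tt h₁ e₁ rfl e₃,
        Alg.tensor₂_tt h₄ e rfl e₂, (M.tensor₁ N).smul_right, Alg.tensor₁_tt h₃ e₂ rfl e₃,
        σ.add_left, ← (M.tensorC N _).tr_smul, smul_smul]
    | hadd x y hx hy => simp only [map_add, smul_add, hx, hy]
  agree {α β γ} h T s x := by
    induction x using Alg.tensor_ind with
    | h0 => simp only [map_zero]
    | @ht U k μ ν e m n =>
      have e₁ : α + μ + ν = γ := by rw [← h, ← e]; abel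
      have e₂ : μ + (α + ν) = γ := by rw [← h, ← e]; abel
      rw [(M.tensor₁ N).tr_right, (M.tensor₂ N).tr_right, ← (M.η α).app_res,
        ← (N.η α).app_res, Alg.tensor₁_tt h e rfl e₁, Alg.tensor₂_tt h e rfl e₂,
        M.central rfl (add_comm μ α), (M.tt N).smul_left,
        Alg.tt_balanced e₁ e₂ (add_comm μ α) rfl]
    | hadd x y hx hy => simp only [map_add, hx, hy]

namespace LL

theorem act_l₁ (P : LL M N) {α β γ δ ε ζ : Γ} (h₁ : δ + γ = ζ) (h₂ : α + β = δ) (h₃ : α + ε = ζ)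
    (h₄ : β + γ = ε) {T : FinGSet G} (m : (M.A.C α).obj T) (y : (M.tensorC N β).obj T)
    (x : (P.C γ).obj T) :
    P.act.f h₁ ((M.tensor₁ N).f h₂ m y) x = P.l₁.f h₃ m (P.act.f h₄ y x) := by
  induction y using Alg.tensor_ind with
  | h0 => simp only [map_zero, AddMonoidHom.zero_apply]
  | @ht U k μ ν e a b =>
    have e₁ : α + μ + ν = δ := by rw [add_assoc, e, h₂]
    have e₂ : α + μ + (ν + γ) = ζ := by rw [← h₁, ← e₁]; abel
    have e₃ : μ + (ν + γ) = ε := by rw [← h₄, ← e]; abel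
    rw [(M.tensor₁ N).tr_right, P.act.tr_left, P.act.tr_left, P.l₁.tr_right,
      Alg.tensor₁_tt h₂ e rfl e₁, P.act_tt h₁ e₁ e₂ rfl, P.act_tt h₄ e e₃ rfl,
      P.mul_l₁ e₂ rfl h₃ e₃]
  | hadd x y hx hy => simp only [map_add, AddMonoidHom.add_apply, hx, hy]

theorem act_l₂ (P : LL M N) {α β γ δ ε ζ : Γ} (h₁ : δ + γ = ζ) (h₂ : α + β = δ) (h₃ : α + ε = ζ)
    (h₄ : β + γ = ε) {T : FinGSet G} (n : (N.A.C α).obj T) (y : (M.tensorC N β).obj T)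
    (x : (P.C γ).obj T) :
    P.act.f h₁ ((M.tensor₂ N).f h₂ n y) x = P.l₂.f h₃ n (P.act.f h₄ y x) := by
  induction y using Alg.tensor_ind with
  | h0 => simp only [map_zero, AddMonoidHom.zero_apply]
  | @ht U k μ ν e a b =>
    have e₁ : μ + (α + ν) = δ := by rw [← h₂, ← e]; abel
    have e₂ : μ + (α + ν + γ) = ζ := by rw [← h₁, ← e₁]; abel
    have e₃ : μ + (ν + γ) = ε := by rw [← h₄, ← e]; abel
    have e₄ : α + (ν + γ) = α + ν + γ := by abel
    rw [(M.tensor₂ N).tr_right, P.act.tr_left, P.act.tr_left, P.l₂.tr_right,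
      Alg.tensor₂_tt h₂ e rfl e₁, P.act.smul_left, P.act_tt h₁ e₁ e₂ rfl, P.act_tt h₄ e e₃ rfl,
      P.comm h₃ e₃ e₂ e₄, P.mul_l₂ rfl rfl e₄ rfl]
  | hadd x y hx hy => simp only [map_add, AddMonoidHom.add_apply, hx, hy]

theorem act_act (P : LL M N) {α β γ δ ε ζ : Γ} (h₁ : δ + γ = ζ) (h₂ : α + β = δ)
    (h₃ : α + ε = ζ) (h₄ : β + γ = ε) {T : FinGSet G} (z : (M.tensorC N α).obj T)
    (y : (M.tensorC N β).obj T) (x : (P.C γ).obj T) :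
    P.act.f h₁ ((LL.self M N).act.f h₂ z y) x = P.act.f h₃ z (P.act.f h₄ y x) := by
  induction z using Alg.tensor_ind with
  | h0 => simp only [map_zero, AddMonoidHom.zero_apply]
  | @ht U k μ ν e a b =>
    have e₁ : μ + (ν + β) = δ := by rw [← add_assoc, e, h₂]
    have e₂ : μ + (ν + ε) = ζ := by rw [← add_assoc, e, h₃]
    have e₃ : ν + β + γ = ν + ε := by rw [add_assoc, h₄]
    rw [(LL.self M N).act.tr_left, P.act.tr_left, P.act.tr_left, (LL.self M N).act_tt h₂ e e₁ rfl,
      P.act_tt h₃ e e₂ rfl, P.act_l₁ h₁ e₁ e₂ e₃, P.act_l₂ e₃ rfl rfl h₄, P.act.res]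
  | hadd x y hx hy => simp only [map_add, AddMonoidHom.add_apply, hx, hy]

theorem one_act (P : LL M N) {α : Γ} (h : 0 + α = α) {T : FinGSet G} (x : (P.C α).obj T) :
    P.act.f h ((M.tt N).f (add_zero 0) (M.A.one T) (N.A.one T)) x = x := by
  rw [P.act_tt h (add_zero 0) h h, P.one_l₁, P.one_l₂]

end LL

variable (M N) in
/-- The algebra `M □_R N`, with `(m ⊗ n) (m' ⊗ n') = σ(|m'|, |n|) (m m' ⊗ n n')`. -/
abbrev Alg.tensor : GrGreen.{u} Γ G where
  C := M.tensorC N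
  mul := (LL.self M N).act
  one T := (M.tt N).f (add_zero 0) (M.A.one T) (N.A.one T)
  res_one k := by rw [(M.tt N).res, M.A.res_one, N.A.res_one]
  one_mul h T x := (LL.self M N).one_act h x
  mul_one {α} h T x := by
    induction x using Alg.tensor_ind with
    | h0 => rw [map_zero, AddMonoidHom.zero_apply]
    | @ht U k μ ν e m n =>
      rw [(LL.self M N).act.tr_left, (M.tt N).res, M.A.res_one, N.A.res_one,
        (LL.self M N).act_tt h e e (add_zero ν),
        Alg.tensor₂_tt (add_zero ν) (add_zero 0) (add_zero ν) (zero_add ν), N.A.mul_one,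
        σ.zero_left, one_smul, Alg.tensor₁_tt e (zero_add ν) (add_zero μ) e, M.A.mul_one]
    | hadd x y hx hy => rw [map_add, AddMonoidHom.add_apply, hx, hy]
  mul_assoc h₁ h₂ h₃ h₄ _ a b c := (LL.self M N).act_act h₁ h₂ h₃ h₄ a b c

theorem Alg.tensor_mul_tt {α β γ μ ν μ' ν' κ κ' : Γ} (h : α + β = γ) (e : μ + ν = α)
    (e' : μ' + ν' = β) (h₁ : μ + μ' = κ) (h₂ : ν + ν' = κ') (h₃ : κ + κ' = γ) {T : FinGSet G}
    (m : (M.A.C μ).obj T) (n : (N.A.C ν).obj T) (m' : (M.A.C μ').obj T) (n' : (N.A.C ν').obj T) :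
    (M.tensor N).mul.f h ((M.tt N).f e m n) ((M.tt N).f e' m' n') =
      σ.s μ' ν • (M.tt N).f h₃ (M.A.mul.f h₁ m m') (N.A.mul.f h₂ n n') := by
  have e₁ : μ' + κ' = ν + β := by rw [← h₂, ← e']; abel
  have e₂ : μ + (ν + β) = γ := by rw [← add_assoc, e, h]
  rw [(LL.self M N).act_tt h e e₂ rfl, Alg.tensor₂_tt rfl e' h₂ e₁, Pairing.smul_right,
    Alg.tensor₁_tt e₂ e₁ h₁ h₃]

/-- The left module over `M □_R N` given by two left actions. -/
abbrev LL.toLMod (P : LL M N) : LMod (M.tensor N) where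
  C := P.C
  act := P.act
  one_act h _ x := P.one_act h x
  mul_act h₁ h₂ h₃ h₄ _ a b x := P.act_act h₁ h₂ h₃ h₄ a b x

namespace RR

theorem act_balanced (P : RR M N) : Box.Balanced₃ (N := M.toRMod) (P := N.toLMod)
    (Pairing₃.comp₁ P.r₁ P.r₂) := by
  refine fun {γ κ T α β δ ε ζ} e e' e₁ e₂ (x : (P.C κ).obj T) (m : (M.A.C α).obj T)
    (s : (R.C δ).obj T) (n : (N.A.C β).obj T) => ?_
  subst e₁ e₂ e
  change P.r₂.f _ (P.r₁.f rfl x (M.A.mul.f rfl m ((M.η δ).app T s))) n =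
    P.r₂.f _ (P.r₁.f rfl x m) (N.A.mul.f rfl ((N.η δ).app T s) n)
  have e₂ : κ + α + δ = κ + (α + δ) := add_assoc _ _ _
  have e₃ : κ + (α + δ) + β = κ + (α + δ + β) := by abel
  rw [P.r₁_mul _ rfl e₂ rfl, P.agree, P.r₂_mul _ rfl e₃ e₂]

/-- The action `x (m ⊗ n) = (x m) n` of `M □_R N`. -/
def act (P : RR M N) : Pairing P.C (M.tensorC N) P.C := Box.lift₃ _ P.act_balanced

theorem act_tt (P : RR M N) {α β γ δ ε ζ : Γ} (h : α + β = γ) (e : δ + ε = β) (h₁ : α + δ = ζ)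
    (h₂ : ζ + ε = γ) {T : FinGSet G} (x : (P.C α).obj T) (m : (M.A.C δ).obj T)
    (n : (N.A.C ε).obj T) :
    P.act.f h x ((M.tt N).f e m n) = P.r₂.f h₂ (P.r₁.f h₁ x m) n := by
  subst h₁
  exact Box.lift₃_tmul _ P.act_balanced h e x m n

theorem act_act (P : RR M N) {α β γ δ ε ζ : Γ} (h₁ : α + ε = ζ) (h₂ : β + γ = ε)
    (h₃ : δ + γ = ζ) (h₄ : α + β = δ) {T : FinGSet G} (x : (P.C α).obj T)
    (y : (M.tensorC N β).obj T) (z : (M.tensorC N γ).obj T) :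
    P.act.f h₁ x ((M.tensor N).mul.f h₂ y z) = P.act.f h₃ (P.act.f h₄ x y) z := by
  induction y using Alg.tensor_ind with
  | h0 => simp only [map_zero, AddMonoidHom.zero_apply]
  | @ht U k μ ν e m n =>
    rw [(M.tensor N).mul.tr_left, P.act.tr_right, P.act.tr_right, P.act.tr_left]
    generalize (P.C α).res k x = x'
    generalize (M.tensorC N γ).res k z = z'
    congr 1
    induction z' using Alg.tensor_ind with
    | h0 => simp only [map_zero]
    | @ht V l μ' ν' e' m' n' =>
      have e₁ : μ + μ' + (ν + ν') = ε := by rw [← h₂, ← e, ← e']; abel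
      have e₂ : α + (μ + μ') + (ν + ν') = ζ := by rw [← h₁, ← e₁]; abel
      have e₃ : α + μ + ν = δ := by rw [add_assoc, e, h₄]
      have e₄ : δ + μ' + ν' = ζ := by rw [← h₃, ← e']; abel
      have e₅ : α + μ + μ' = α + (μ + μ') := by abel
      have e₆ : α + (μ + μ') + ν = δ + μ' := by rw [← e₃]; abel
      rw [(M.tensor N).mul.tr_right, P.act.tr_right, P.act.tr_right, (M.tt N).res, P.act.res,
        (M.tt N).res, Alg.tensor_mul_tt h₂ e e' rfl rfl e₁, P.act.smul_right,
        P.act_tt h₁ e₁ rfl e₂, P.act_tt h₄ e rfl e₃, P.act_tt h₃ e' rfl e₄,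
        P.comm rfl e₃ e₆ e₅, P.r₂.smul_left, P.r₁_mul rfl rfl e₅ rfl, P.r₂_mul e₂ rfl e₄ e₆]
    | hadd x y hx hy => simp only [map_add, hx, hy]
  | hadd x y hx hy => simp only [map_add, AddMonoidHom.add_apply, hx, hy]

/-- The right module over `M □_R N` given by two right actions. -/
abbrev toRMod (P : RR M N) : RMod (M.tensor N) where
  C := P.C
  act := P.act
  act_one h T x := by rw [P.act_tt h (add_zero 0) h h, P.r₁_one, P.r₂_one]
  act_mul h₁ h₂ h₃ h₄ _ x a b := P.act_act h₁ h₂ h₃ h₄ x a b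

end RR

variable (M) in
/-- The enveloping algebra `M □_R M^op`. -/
abbrev Alg.env : GrGreen.{u} Γ G := M.tensor M.op

end EnvelopingAlgebra

/-! ### The twisted bimodule and the twisted cyclic bar construction -/

section Twist

variable {Γ G : Type} [Group G]

/-- The translation `x ↦ g x`, for a commutative group. -/
def FinGSet.translate [IsMulCommutative G] (g : G) (X : FinGSet G) : FinGSet.Hom X X where
  toFun x := g • x
  map_smul' h x := by
    change g • h • x = h • g • x
    rw [smul_smul, smul_smul, mul_comm']

theorem FinGSet.translate_square [IsMulCommutative G] (g : G) {X Y : FinGSet G}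
    (k : FinGSet.Hom X Y) :
    FinGSet.IsPullbackSq k (FinGSet.translate g X) (FinGSet.translate g Y) k := by
  refine ⟨fun x => (map_smul k g x).symm, fun y x e => ⟨g⁻¹ • x, ⟨?_, smul_inv_smul g x⟩, ?_⟩⟩
  · rw [map_smul, ← e]
    exact inv_smul_smul g y
  · rintro z ⟨_, hz⟩
    rw [← hz]
    exact (inv_smul_smul g z).symm

/-- The action of `g` on a graded Mackey functor. On `M(G/H)` it is the action of `g ∈ G` through
the Weyl group `G/H`. -/
def gHom [IsMulCommutative G] (g : G) (M : GrMackey.{u} Γ G) : GrHom M M := fun α =>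
  { app := fun X => (M α).res (FinGSet.translate g X)
    app_res := fun {X Y} k m => by
      rw [← (M α).res_comp, ← (M α).res_comp]
      congr 2
      exact MulActionHom.ext fun x => map_smul k g x
    app_tr := fun {X Y} k m => (M α).res_tr _ _ _ _ (FinGSet.translate_square g k).symm m }

/-- The composite of two maps. -/
def GrHom.comp {A B C : GrMackey.{u} Γ G} (f : GrHom B C) (k : GrHom A B) : GrHom A C := fun α =>
  { app := fun X => ((f α).app X).comp ((k α).app X)
    app_res := fun h m => by
      simp only [AddMonoidHom.comp_apply]
      rw [(k α).app_res, (f α).app_res]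
    app_tr := fun h m => by
      simp only [AddMonoidHom.comp_apply]
      rw [(k α).app_tr, (f α).app_tr] }

/-- The identity map. -/
def GrHom.id (A : GrMackey.{u} Γ G) : GrHom A A := fun _ =>
  { app := fun _ => AddMonoidHom.id _
    app_res := fun _ _ => rfl
    app_tr := fun _ _ => rfl }

/-- The alternating sum `∑_{i < n} (-1)^i f_i`. -/
def GrHom.altSum {A B : GrMackey.{u} Γ G} (n : ℕ) (f : ℕ → GrHom A B) : GrHom A B := fun α =>
  { app := fun X => ∑ i ∈ Finset.range n, (-1 : ℤ) ^ i • (f i α).app X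
    app_res := fun h m => by
      simp only [AddMonoidHom.finsetSum_apply, AddMonoidHom.smul_apply, map_sum, map_zsmul,
        (f _ α).app_res]
    app_tr := fun h m => by
      simp only [AddMonoidHom.finsetSum_apply, AddMonoidHom.smul_apply, map_sum, map_zsmul,
        (f _ α).app_tr] }

theorem GrHom.altSum_app {A B : GrMackey.{u} Γ G} (n : ℕ) (f : ℕ → GrHom A B) {α : Γ}
    {X : FinGSet G} (a : (A α).obj X) : (GrHom.altSum n f α).app X a =
      ∑ i ∈ Finset.range n, (-1 : ℤ) ^ i • (f i α).app X a := by
  simp only [altSum, AddMonoidHom.finsetSum_apply, AddMonoidHom.smul_apply]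

end Twist

section Bar

variable {Γ G : Type} [AddCommGroup Γ] [Group G] {σ : SignRule Γ G} {R : GrGreen.{u} Γ G}

/-- `g` acts trivially. -/
def GTrivial [IsMulCommutative G] (g : G) (R : GrGreen.{u} Γ G) : Prop :=
  ∀ (α : Γ) (X : FinGSet G) (r : (R.C α).obj X), (gHom g R.C α).app X r = r

namespace Alg

variable (M : Alg σ R)

/-- `M` as a right module over `M □_R M^op`, by `x (m ⊗ b) = σ(|b|, |x| + |m|) b x m`. -/
def rr : RR M M.op where
  C := M.A.C
  r₁ := M.A.mul
  r₂ := M.opA.mul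
  r₁_one := M.A.mul_one
  r₁_mul h₁ h₂ h₃ h₄ _ x a b := (M.A.mul_assoc h₃ h₄ h₁ h₂ x a b).symm
  r₂_one := M.opA.mul_one
  r₂_mul h₁ h₂ h₃ h₄ _ x a b := (M.opA.mul_assoc h₃ h₄ h₁ h₂ x a b).symm
  comm {α β γ δ ε ζ} h₁ h₂ h₃ h₄ T m n x := by
    have h₂' : β + γ = δ := by rw [add_comm]; exact h₂
    have h₃' : β + ε = ζ := by rw [add_comm]; exact h₃
    change (M.A.C β).obj T at n
    change M.A.mul.f h₁ (σ.s β γ • M.A.mul.f h₂' n x) m =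
      σ.s α β • σ.s β ε • M.A.mul.f h₃' n (M.A.mul.f h₄ x m)
    rw [M.A.mul.smul_left, M.A.mul_assoc h₁ h₂' h₃' h₄, smul_smul]
    congr 1
    rw [← h₄, σ.add_right, mul_left_comm, σ.symm, mul_one]
  agree {α β γ} h T s x := by
    have h' : α + β = γ := by rw [add_comm]; exact h
    exact (M.central_symm h' h s x).symm

/-- `M` as a right module over its enveloping algebra. -/
abbrev rightEnv : RMod M.env := M.rr.toRMod

variable [IsMulCommutative G]

/-- The twisted bimodule `ᵍM` as a left module over `M □_R M^op`, by
`(m ⊗ b) x = σ(|x|, |b|) (g m) x b`. -/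
def ll (g : G) (hg : GTrivial g R) : LL M M.op where
  C := M.A.C
  l₁ := M.A.mul.compLeft (gHom g M.A.C)
  l₂ := M.opA.mul
  one_l₁ h T x := by
    rw [Pairing.compLeft_f]
    exact (congrArg (fun y => M.A.mul.f h y x) (M.A.res_one _)).trans (M.A.one_mul h x)
  mul_l₁ h₁ h₂ h₃ h₄ T a b x := by
    simp only [Pairing.compLeft_f]
    exact (congrArg (fun y => M.A.mul.f h₁ y x) (M.A.mul.res h₂ _ a b)).trans
      (M.A.mul_assoc h₁ h₂ h₃ h₄ _ _ _)
  one_l₂ := M.opA.one_mul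
  mul_l₂ := M.opA.mul_assoc
  comm {α β γ δ ε ζ} h₁ h₂ h₃ h₄ T m n x := by
    have h₁' : δ + β = ζ := by rw [add_comm]; exact h₁
    have h₄' : γ + β = ε := by rw [add_comm]; exact h₄
    change (M.A.C β).obj T at n
    change σ.s δ β • M.A.mul.f h₁' (M.A.mul.f h₂ ((gHom g M.A.C α).app T m) x) n =
      σ.s α β • M.A.mul.f h₃ ((gHom g M.A.C α).app T m) (σ.s γ β • M.A.mul.f h₄' x n)
    rw [M.A.mul.smul_right, M.A.mul_assoc h₁' h₂ h₃ h₄', smul_smul]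
    congr 1
    rw [← h₂, σ.add_left]
  agree {α β γ} h T s x := by
    have h' : β + α = γ := by rw [add_comm]; exact h
    have e : (gHom g M.A.C α).app T ((M.η α).app T s) = (M.η α).app T s :=
      ((M.η α).app_res _ _).symm.trans (congrArg _ (hg α T s))
    rw [Pairing.compLeft_f, e]
    exact M.central h h' s x

/-- `ᵍM` as a left module over the enveloping algebra. -/
abbrev leftEnv (g : G) (hg : GTrivial g R) : LMod M.env := (M.ll g hg).toLMod

end Alg

/-- The identity map of an algebra. -/
def Alg.Hom.id (M : Alg σ R) : Alg.Hom M M where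
  u := GrHom.id _
  map_one _ := rfl
  map_mul _ _ _ _ := rfl
  map_η _ := rfl

/-- A map of bimodules, semilinear over a map of algebras. -/
structure BiMod.SHom {M M' : Alg σ R} (φ : Alg.Hom M M') (X : BiMod M) (Y : BiMod M') where
  u : GrHom X.C Y.C
  map_l : ∀ {α β γ : Γ} (h : α + β = γ) {T : FinGSet G} (a : (M.A.C α).obj T)
    (x : (X.C β).obj T), (u γ).app T (X.l.f h a x) = Y.l.f h ((φ.u α).app T a) ((u β).app T x)
  map_r : ∀ {α β γ : Γ} (h : α + β = γ) {T : FinGSet G} (x : (X.C α).obj T)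
    (a : (M.A.C β).obj T), (u γ).app T (X.r.f h x a) = Y.r.f h ((u α).app T x) ((φ.u β).app T a)

namespace BiMod

section

variable {M M' : Alg σ R} {φ : Alg.Hom M M'} {X : BiMod M} {Y : BiMod M'}

theorem SHom.step_balanced (f : SHom φ X Y) : Box.Balanced (N := X.toRMod) (P := M.toLMod)
    ((Y.tm.compLeft f.u).compRight φ.u) := by
  refine fun {γ T α β δ ε ζ} e e' e₁ e₂ (x : (X.C α).obj T) (s : (R.C δ).obj T)
    (m : (M.A.C β).obj T) => ?_
  change Y.tm.f e ((f.u ε).app T (X.r.f e₁ x ((M.η δ).app T s))) ((φ.u β).app T m) =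
    Y.tm.f e' ((f.u α).app T x) ((φ.u ζ).app T (M.A.mul.f e₂ ((M.η δ).app T s) m))
  rw [f.map_r, φ.map_mul, φ.map_η, Y.tm_balanced e e' e₁ e₂]

/-- The map `f □ φ : X □_R M → Y □_R M'`. -/
def SHom.stepU (f : SHom φ X Y) : GrHom X.stepC Y.stepC := Box.lift _ f.step_balanced

theorem SHom.stepU_tm (f : SHom φ X Y) {α β γ : Γ} (h : α + β = γ) {T : FinGSet G}
    (x : (X.C α).obj T) (m : (M.A.C β).obj T) : (f.stepU γ).app T (X.tm.f h x m) =
      Y.tm.f h ((f.u α).app T x) ((φ.u β).app T m) :=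
  Box.lift_tmul _ f.step_balanced h x m

/-- The map `f □ φ` of bimodules. -/
def SHom.step (f : SHom φ X Y) : SHom φ X.step Y.step where
  u := f.stepU
  map_l {α β γ} h T a x := by
    change (f.stepU γ).app T (X.stepL.f h a x) = Y.stepL.f h _ ((f.stepU β).app T x)
    induction x using X.ind with
    | h0 => simp only [map_zero]
    | @ht U k μ ν e x m =>
      have e₁ : α + μ + ν = γ := by rw [add_assoc, e, h]
      rw [X.stepL.tr_right, (f.stepU γ).app_tr, (f.stepU β).app_tr, Y.stepL.tr_right,
        X.stepL_tm h e rfl e₁, f.stepU_tm, f.stepU_tm, f.map_l, Y.stepL_tm h e rfl e₁,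
        ← (φ.u α).app_res]
    | hadd x y hx hy => simp only [map_add, hx, hy]
  map_r {α β γ} h T x a := by
    change (f.stepU γ).app T (X.stepR.f h x a) = Y.stepR.f h ((f.stepU α).app T x) _
    induction x using X.ind with
    | h0 => simp only [map_zero, AddMonoidHom.zero_apply]
    | @ht U k μ ν e x m =>
      have e₁ : μ + (ν + β) = γ := by rw [← add_assoc, e, h]
      rw [X.stepR.tr_left, (f.stepU γ).app_tr, (f.stepU α).app_tr, Y.stepR.tr_left,
        X.stepR_tm h e rfl e₁, f.stepU_tm, f.stepU_tm, φ.map_mul, Y.stepR_tm h e rfl e₁,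
        ← (φ.u β).app_res]
    | hadd x y hx hy => simp only [map_add, AddMonoidHom.add_apply, hx, hy]

end

section

variable {M : Alg σ R} (X : BiMod M)

theorem act_balanced : Box.Balanced (N := X.toRMod) (P := M.toLMod) X.r := by
  refine fun {γ T α β δ ε ζ} e e' e₁ e₂ (x : (X.C α).obj T) (s : (R.C δ).obj T)
    (m : (M.A.C β).obj T) => ?_
  exact (X.r_mul e' e₂ e e₁ x ((M.η δ).app T s) m).symm

/-- The map `X □_R M → X`, `x ⊗ m ↦ x m`. -/
def actU : GrHom X.stepC X.C := Box.lift _ X.act_balanced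

theorem actU_tm {α β γ : Γ} (h : α + β = γ) {T : FinGSet G} (x : (X.C α).obj T)
    (m : (M.A.C β).obj T) : (X.actU γ).app T (X.tm.f h x m) = X.r.f h x m :=
  Box.lift_tmul _ X.act_balanced h x m

/-- The map `X □_R M → X`, `x ⊗ m ↦ x m`, of bimodules. -/
def act : SHom (Alg.Hom.id M) X.step X where
  u := X.actU
  map_l {α β γ} h T a x := by
    change (X.actU γ).app T (X.stepL.f h a x) = X.l.f h a ((X.actU β).app T x)
    induction x using X.ind with
    | h0 => simp only [map_zero]
    | @ht U k μ ν e x m =>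
      have e₁ : α + μ + ν = γ := by rw [add_assoc, e, h]
      rw [X.stepL.tr_right, (X.actU γ).app_tr, (X.actU β).app_tr, X.l.tr_right,
        X.stepL_tm h e rfl e₁, X.actU_tm, X.actU_tm, X.assoc e₁ rfl h e]
    | hadd x y hx hy => simp only [map_add, hx, hy]
  map_r {α β γ} h T x a := by
    change (X.actU γ).app T (X.stepR.f h x a) = X.r.f h ((X.actU α).app T x) a
    induction x using X.ind with
    | h0 => simp only [map_zero, AddMonoidHom.zero_apply]
    | @ht U k μ ν e x m =>
      have e₁ : μ + (ν + β) = γ := by rw [← add_assoc, e, h]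
      rw [X.stepR.tr_left, (X.actU γ).app_tr, (X.actU α).app_tr, X.r.tr_left,
        X.stepR_tm h e rfl e₁, X.actU_tm, X.actU_tm, X.r_mul e₁ rfl h e]
    | hadd x y hx hy => simp only [map_add, AddMonoidHom.add_apply, hx, hy]

variable [IsMulCommutative G] (g : G)

/-- The pairing `(x, m) ↦ σ(|m|, |x|) (g m) x`. -/
def rotP : Pairing X.C M.A.C X.C :=
  (X.l.compLeft (gHom g M.A.C)).flip.twist fun α β => σ.s β α

theorem rotP_f {α β γ : Γ} (h : α + β = γ) (h' : β + α = γ) {T : FinGSet G} (x : (X.C α).obj T)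
    (m : (M.A.C β).obj T) :
    (X.rotP g).f h x m = σ.s β α • X.l.f h' ((gHom g M.A.C β).app T m) x := rfl

theorem rotP_balanced (hg : GTrivial g R) :
    Box.Balanced (N := X.toRMod) (P := M.toLMod) (X.rotP g) := by
  refine fun {γ T α β δ ε ζ} e e' e₁ e₂ (x : (X.C α).obj T) (s : (R.C δ).obj T)
    (m : (M.A.C β).obj T) => ?_
  change (X.rotP g).f e (X.r.f e₁ x ((M.η δ).app T s)) m =
    (X.rotP g).f e' x (M.A.mul.f e₂ ((M.η δ).app T s) m)
  have f₁ : β + ε = γ := by rw [add_comm, e]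
  have f₂ : ζ + α = γ := by rw [add_comm, e']
  have f₃ : δ + (β + α) = γ := by rw [← add_assoc, e₂, f₂]
  have f₄ : (β + α) + δ = γ := by rw [add_comm, f₃]
  have eη : (gHom g M.A.C δ).app T ((M.η δ).app T s) = (M.η δ).app T s :=
    ((M.η δ).app_res _ _).symm.trans (congrArg _ (hg δ T s))
  have em : (gHom g M.A.C ζ).app T (M.A.mul.f e₂ ((M.η δ).app T s) m) =
      M.A.mul.f e₂ ((M.η δ).app T s) ((gHom g M.A.C β).app T m) :=
    (M.A.mul.res e₂ _ _ m).trans (congrArg (fun y => M.A.mul.f e₂ y _) eη)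
  rw [X.rotP_f g e f₁, X.rotP_f g e' f₂, em, X.mul_l f₂ e₂ f₃ rfl, X.central f₃ f₄, smul_smul,
    X.assoc f₄ rfl f₁ e₁]
  congr 1
  rw [← e₁, ← e₂, σ.add_right, σ.add_left, σ.add_left]
  linear_combination (-(σ.s β α * σ.s β δ)) * σ.symm δ α

/-- The map `X □_R M → X`, `x ⊗ m ↦ σ(|m|, |x|) (g m) x`. -/
def rot (hg : GTrivial g R) : GrHom X.stepC X.C := Box.lift _ (X.rotP_balanced g hg)

theorem rot_tm (hg : GTrivial g R) {α β γ : Γ} (h : α + β = γ) (h' : β + α = γ) {T : FinGSet G}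
    (x : (X.C α).obj T) (m : (M.A.C β).obj T) : (X.rot g hg γ).app T (X.tm.f h x m) =
      σ.s β α • X.l.f h' ((gHom g M.A.C β).app T m) x :=
  Box.lift_tmul _ (X.rotP_balanced g hg) h x m

end

end BiMod

end Bar

section Hochschild

variable {Γ G : Type} [AddCommGroup Γ] [Group G] {σ : SignRule Γ G} {R : GrGreen.{u} Γ G}

namespace Alg

section

variable (M : Alg σ R)

/-- The iterated relative box product `M □_R ⋯ □_R M` with `q + 1` factors. -/
def bar : ℕ → BiMod M
  | 0 => M.self
  | q + 1 => (bar q).step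

/-- The underlying graded Mackey functor of the iterated box product with `q + 1` factors. -/
def barC (q : ℕ) : GrMackey.{u} Γ G := (M.bar q).C

/-- The pairing `(x, m) ↦ x ⊗ m`. -/
def barT (q : ℕ) : Pairing (M.barC q) M.A.C (M.barC (q + 1)) := (M.bar q).tm

/-- The left action on the iterated box product. -/
def barL (q : ℕ) : Pairing M.A.C (M.barC q) (M.barC q) := (M.bar q).l

/-- The right action on the iterated box product. -/
def barR (q : ℕ) : Pairing (M.barC q) M.A.C (M.barC q) := (M.bar q).r

/-- The map that multiplies the factors number `i` and `i + 1` (counted from `0`), for `i ≤ q`. -/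
def innerFace : ∀ q : ℕ, ℕ → BiMod.SHom (Alg.Hom.id M) (M.bar (q + 1)) (M.bar q)
  | 0, _ => (M.bar 0).act
  | q + 1, i => if i = q + 1 then (M.bar (q + 1)).act else (innerFace q i).step

/-- The map that multiplies the factors number `i` and `i + 1` (counted from `0`), for `i ≤ q`. -/
def mulFace (q i : ℕ) : GrHom (M.barC (q + 1)) (M.barC q) := (M.innerFace q i).u

/-- The alternating sum of the maps that multiply two neighbouring factors. -/
def inner (q : ℕ) : GrHom (M.barC (q + 1)) (M.barC q) := GrHom.altSum (q + 1) (M.mulFace q)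

variable {M}

theorem bar_ind (q : ℕ) {γ : Γ} {T : FinGSet G} {P : (M.barC (q + 1) γ).obj T → Prop}
    (x : (M.barC (q + 1) γ).obj T) (h0 : P 0)
    (ht : ∀ {U : FinGSet G} (k : FinGSet.Hom U T) {α β : Γ} (e : α + β = γ)
      (x : (M.barC q α).obj U) (m : (M.A.C β).obj U),
      P ((M.barC (q + 1) γ).tr k ((M.barT q).f e x m)))
    (hadd : ∀ x y, P x → P y → P (x + y)) : P x :=
  (M.bar q).ind x h0 (fun k _ _ e n p => ht k e n p) hadd

theorem barL_tm (q : ℕ) {α β γ δ ε ζ : Γ} (h : α + β = γ) (e : δ + ε = β) (h₁ : α + δ = ζ)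
    (h₂ : ζ + ε = γ) {T : FinGSet G} (a : (M.A.C α).obj T) (x : (M.barC q δ).obj T)
    (m : (M.A.C ε).obj T) :
    (M.barL (q + 1)).f h a ((M.barT q).f e x m) =
      (M.barT q).f h₂ ((M.barL q).f h₁ a x) m :=
  (M.bar q).stepL_tm h e h₁ h₂ a x m

theorem barR_tm (q : ℕ) {α β γ δ ε ζ : Γ} (h : α + β = γ) (e : δ + ε = α) (h₁ : ε + β = ζ)
    (h₂ : δ + ζ = γ) {T : FinGSet G} (x : (M.barC q δ).obj T) (m : (M.A.C ε).obj T)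
    (b : (M.A.C β).obj T) :
    (M.barR (q + 1)).f h ((M.barT q).f e x m) b = (M.barT q).f h₂ x (M.A.mul.f h₁ m b) :=
  (M.bar q).stepR_tm h e h₁ h₂ x m b

theorem barL_mul (q : ℕ) {α β γ δ ε ζ : Γ} (h₁ : δ + γ = ζ) (h₂ : α + β = δ) (h₃ : α + ε = ζ)
    (h₄ : β + γ = ε) {X : FinGSet G} (a : (M.A.C α).obj X) (b : (M.A.C β).obj X)
    (x : (M.barC q γ).obj X) : (M.barL q).f h₁ (M.A.mul.f h₂ a b) x =
      (M.barL q).f h₃ a ((M.barL q).f h₄ b x) :=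
  (M.bar q).mul_l h₁ h₂ h₃ h₄ a b x

theorem mulFace_l (q i : ℕ) {α β γ : Γ} (h : α + β = γ) {T : FinGSet G} (a : (M.A.C α).obj T)
    (x : (M.barC (q + 1) β).obj T) : (M.mulFace q i γ).app T ((M.barL (q + 1)).f h a x) =
      (M.barL q).f h a ((M.mulFace q i β).app T x) :=
  (M.innerFace q i).map_l h a x

theorem mulFace_r (q i : ℕ) {α β γ : Γ} (h : α + β = γ) {T : FinGSet G}
    (x : (M.barC (q + 1) α).obj T) (a : (M.A.C β).obj T) :
    (M.mulFace q i γ).app T ((M.barR (q + 1)).f h x a) =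
      (M.barR q).f h ((M.mulFace q i α).app T x) a :=
  (M.innerFace q i).map_r h x a

theorem mulFace_zero_tm {α β γ : Γ} (h : α + β = γ) {T : FinGSet G}
    (x : (M.barC 0 α).obj T) (m : (M.A.C β).obj T) :
    (M.mulFace 0 0 γ).app T ((M.barT 0).f h x m) = (M.barR 0).f h x m :=
  (M.bar 0).actU_tm h x m

theorem mulFace_last_tm (q : ℕ) {α β γ : Γ} (h : α + β = γ) {T : FinGSet G}
    (x : (M.barC (q + 1) α).obj T) (m : (M.A.C β).obj T) :
    (M.mulFace (q + 1) (q + 1) γ).app T ((M.barT (q + 1)).f h x m) =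
      (M.barR (q + 1)).f h x m := by
  have e : M.innerFace (q + 1) (q + 1) = (M.bar (q + 1)).act := if_pos rfl
  rw [mulFace, e]
  exact (M.bar (q + 1)).actU_tm h x m

theorem mulFace_succ_tm (q : ℕ) {i : ℕ} (hi : i ≠ q + 1) {α β γ : Γ} (h : α + β = γ)
    {T : FinGSet G} (x : (M.barC (q + 1) α).obj T) (m : (M.A.C β).obj T) :
    (M.mulFace (q + 1) i γ).app T ((M.barT (q + 1)).f h x m) =
      (M.barT q).f h ((M.mulFace q i α).app T x) m := by
  have e : M.innerFace (q + 1) i = (M.innerFace q i).step := if_neg hi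
  rw [mulFace, e]
  exact (M.innerFace q i).stepU_tm h x m

theorem inner_l (q : ℕ) {α β γ : Γ} (h : α + β = γ) {T : FinGSet G} (a : (M.A.C α).obj T)
    (x : (M.barC (q + 1) β).obj T) : (M.inner q γ).app T ((M.barL (q + 1)).f h a x) =
      (M.barL q).f h a ((M.inner q β).app T x) := by
  rw [inner, GrHom.altSum_app, GrHom.altSum_app, map_sum]
  exact Finset.sum_congr rfl fun i _ => by rw [map_zsmul, mulFace_l]

theorem inner_r (q : ℕ) {α β γ : Γ} (h : α + β = γ) {T : FinGSet G}
    (x : (M.barC (q + 1) α).obj T) (a : (M.A.C β).obj T) :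
    (M.inner q γ).app T ((M.barR (q + 1)).f h x a) =
      (M.barR q).f h ((M.inner q α).app T x) a := by
  rw [inner, GrHom.altSum_app, GrHom.altSum_app, map_sum, AddMonoidHom.finsetSum_apply]
  exact Finset.sum_congr rfl fun i _ => by
    rw [map_zsmul, AddMonoidHom.smul_apply, mulFace_r]

theorem inner_zero_tm {α β γ : Γ} (h : α + β = γ) {T : FinGSet G}
    (x : (M.barC 0 α).obj T) (m : (M.A.C β).obj T) :
    (M.inner 0 γ).app T ((M.barT 0).f h x m) = (M.barR 0).f h x m := by
  rw [inner, GrHom.altSum_app, Finset.sum_range_one, pow_zero, one_smul, mulFace_zero_tm]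

theorem inner_succ_tm (q : ℕ) {α β γ : Γ} (h : α + β = γ) {T : FinGSet G}
    (x : (M.barC (q + 1) α).obj T) (m : (M.A.C β).obj T) :
    (M.inner (q + 1) γ).app T ((M.barT (q + 1)).f h x m) =
      (M.barT q).f h ((M.inner q α).app T x) m +
        (-1 : ℤ) ^ (q + 1) • (M.barR (q + 1)).f h x m := by
  rw [inner, GrHom.altSum_app, Finset.sum_range_succ, mulFace_last_tm]
  congr 1
  rw [inner, GrHom.altSum_app, map_sum, AddMonoidHom.finsetSum_apply]
  refine Finset.sum_congr rfl fun i hi => ?_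
  rw [map_zsmul, AddMonoidHom.smul_apply, mulFace_succ_tm q (Finset.mem_range.1 hi).ne]

theorem inner_inner (q : ℕ) {γ : Γ} {T : FinGSet G} (z : (M.barC (q + 1 + 1) γ).obj T) :
    (M.inner q γ).app T ((M.inner (q + 1) γ).app T z) = 0 := by
  induction q generalizing γ T with
  | zero =>
    induction z using bar_ind with
    | h0 => simp only [map_zero]
    | @ht U k α β e x m =>
      rw [(M.inner (0 + 1) γ).app_tr, (M.inner 0 γ).app_tr, inner_succ_tm, map_add, map_zsmul,
        inner_zero_tm, inner_r]
      simp
    | hadd x y hx hy => rw [map_add, map_add, hx, hy, add_zero]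
  | succ q ih =>
    induction z using bar_ind with
    | h0 => simp only [map_zero]
    | @ht U k α β e x m =>
      rw [(M.inner (q + 1 + 1) γ).app_tr, (M.inner (q + 1) γ).app_tr, inner_succ_tm, map_add,
        map_zsmul, inner_succ_tm, inner_r, ih, map_zero, AddMonoidHom.zero_apply, zero_add,
        ← add_smul, pow_succ (-1 : ℤ) (q + 1)]
      simp
    | hadd x y hx hy => rw [map_add, map_add, hx, hy, add_zero]

end

section

variable (M : Alg σ R) [IsMulCommutative G] (g : G) (hg : GTrivial g R)

/-- The map that rotates the last factor to the front and lets `g` act on it before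
multiplying. -/
def rotFace (q : ℕ) : GrHom (M.barC (q + 1)) (M.barC q) := (M.bar q).rot g hg

/-- The face maps `d_0, …, d_{q+1}` of the twisted cyclic bar construction. -/
def face (q i : ℕ) : GrHom (M.barC (q + 1)) (M.barC q) :=
  if i ≤ q then M.mulFace q i else M.rotFace g hg q

/-- The alternating sum of the face maps. -/
def boundary (q : ℕ) : GrHom (M.barC (q + 1)) (M.barC q) :=
  GrHom.altSum (q + 2) (M.face g hg q)

variable {M}

theorem rotFace_tm (q : ℕ) {α β γ : Γ} (h : α + β = γ) (h' : β + α = γ) {T : FinGSet G}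
    (x : (M.barC q α).obj T) (m : (M.A.C β).obj T) :
    (M.rotFace g hg q γ).app T ((M.barT q).f h x m) =
      σ.s β α • (M.barL q).f h' ((gHom g M.A.C β).app T m) x :=
  (M.bar q).rot_tm g hg h h' x m

theorem boundary_eq (q : ℕ) {γ : Γ} {T : FinGSet G} (z : (M.barC (q + 1) γ).obj T) :
    (M.boundary g hg q γ).app T z = (M.inner q γ).app T z +
      (-1 : ℤ) ^ (q + 1) • (M.rotFace g hg q γ).app T z := by
  rw [boundary, GrHom.altSum_app, Finset.sum_range_succ, inner, GrHom.altSum_app]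
  congr 1
  · refine Finset.sum_congr rfl fun i hi => ?_
    rw [face, if_pos (Nat.lt_succ_iff.1 (Finset.mem_range.1 hi))]
  · rw [face, if_neg (by omega)]

theorem rotFace_r (q : ℕ) {α β γ : Γ} (h : α + β = γ) (h' : β + α = γ) {T : FinGSet G}
    (x : (M.barC (q + 1) α).obj T) (m : (M.A.C β).obj T) :
    (M.rotFace g hg q γ).app T ((M.barR (q + 1)).f h x m) =
      σ.s β α • (M.rotFace g hg q γ).app T
        ((M.barL (q + 1)).f h' ((gHom g M.A.C β).app T m) x) := by
  induction x using bar_ind with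
  | h0 => simp only [map_zero, AddMonoidHom.zero_apply, smul_zero]
  | @ht U k μ ν e x n =>
    have e₁ : μ + (ν + β) = γ := by rw [← add_assoc, e, h]
    have e₂ : ν + β + μ = γ := by rw [← h, ← e]; abel
    have e₃ : β + μ + ν = γ := by rw [← h, ← e]; abel
    have e₄ : ν + (β + μ) = γ := by rw [← h, ← e]; abel
    have em : (gHom g M.A.C (ν + β)).app U (M.A.mul.f rfl n ((M.A.C β).res k m)) =
      M.A.mul.f rfl ((gHom g M.A.C ν).app U n) ((gHom g M.A.C β).app U ((M.A.C β).res k m)) :=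
      M.A.mul.res rfl _ n _
    rw [(M.barR (q + 1)).tr_left, (M.barL (q + 1)).tr_right, (M.rotFace g hg q γ).app_tr,
      (M.rotFace g hg q γ).app_tr, barR_tm q h e rfl e₁, ← (gHom g M.A.C β).app_res,
      barL_tm q h' e rfl e₃, rotFace_tm g hg q e₁ e₂, rotFace_tm g hg q e₃ e₄, em,
      barL_mul q e₂ rfl e₄ rfl, ← Mackey.tr_smul, smul_smul]
    congr 2
    rw [← e, σ.add_left, σ.add_right, σ.add_right]
    linear_combination (-(σ.s ν μ * σ.s β μ)) * σ.symm ν β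
  | hadd x y hx hy => simp only [map_add, AddMonoidHom.add_apply, smul_add, hx, hy]

theorem boundary_boundary (q : ℕ) {γ : Γ} {T : FinGSet G}
    (z : (M.barC (q + 1 + 1) γ).obj T) :
    (M.boundary g hg q γ).app T ((M.boundary g hg (q + 1) γ).app T z) = 0 := by
  induction z using bar_ind with
  | h0 => simp only [map_zero]
  | @ht U k α β e x m =>
    have e' : β + α = γ := by rw [add_comm]; exact e
    have hII := inner_inner q ((M.barT (q + 1)).f e x m)
    rw [Mackey.Hom.app_tr, Mackey.Hom.app_tr, boundary_eq, boundary_eq, map_add ((M.inner q γ).app U), hII,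
      rotFace_tm g hg (q + 1) e e', inner_succ_tm]
    simp only [map_add, map_zsmul]
    rw [Mackey.Hom.map_smul, Mackey.Hom.map_smul, inner_l, rotFace_tm g hg q e e',
      rotFace_r g hg q e e', pow_succ (-1 : ℤ) (q + 1)]
    simp
  | hadd x y hx hy => rw [map_add, map_add, hx, hy, add_zero]

end

end Alg
end Hochschild

/-! ### Complexes and homology -/

section Homology

variable {Γ G : Type} [Group G]

/-- A sub-Mackey functor. -/
structure Mackey.Sub (M : Mackey.{u} G) where
  S : ∀ X : FinGSet G, AddSubgroup (M.obj X)
  res_mem : ∀ {X Y : FinGSet G} (f : FinGSet.Hom X Y) {m : M.obj Y}, m ∈ S Y → M.res f m ∈ S X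
  tr_mem : ∀ {X Y : FinGSet G} (f : FinGSet.Hom X Y) {m : M.obj X}, m ∈ S X → M.tr f m ∈ S Y

/-- The subquotient `Z / (B ∩ Z)` of a Mackey functor. -/
def Mackey.subquot {M : Mackey.{u} G} (Z B : M.Sub) : Mackey.{u} G where
  obj X := Z.S X ⧸ (B.S X).addSubgroupOf (Z.S X)
  res {X Y} f := QuotientAddGroup.map _ _
    (((M.res f).comp (Z.S Y).subtype).codRestrict (Z.S X) fun m => Z.res_mem f m.2)
    fun _ hm => B.res_mem f hm
  tr {X Y} f := QuotientAddGroup.map _ _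
    (((M.tr f).comp (Z.S X).subtype).codRestrict (Z.S Y) fun m => Z.tr_mem f m.2)
    fun _ hm => B.tr_mem f hm
  res_id := by
    rintro X ⟨m⟩
    exact congrArg (QuotientAddGroup.mk' _) (Subtype.ext (M.res_id m.1))
  tr_id := by
    rintro X ⟨m⟩
    exact congrArg (QuotientAddGroup.mk' _) (Subtype.ext (M.tr_id m.1))
  res_comp := by
    rintro X Y T f k ⟨m⟩
    exact congrArg (QuotientAddGroup.mk' _) (Subtype.ext (M.res_comp f k m.1))
  tr_comp := by
    rintro X Y T f k ⟨m⟩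
    exact congrArg (QuotientAddGroup.mk' _) (Subtype.ext (M.tr_comp f k m.1))
  res_tr := by
    rintro W X T Y a b f k h ⟨m⟩
    exact congrArg (QuotientAddGroup.mk' _) (Subtype.ext (M.res_tr a b f k h m.1))
  tr_res_add := by
    rintro X Y T i j h ⟨m⟩
    exact congrArg (QuotientAddGroup.mk' _) (Subtype.ext (M.tr_res_add i j h m.1))

/-- The map of subquotients induced by a map of Mackey functors. -/
def Mackey.subquotMap {M N : Mackey.{u} G} {Z B : M.Sub} {Z' B' : N.Sub} (f : Mackey.Hom M N)
    (hZ : ∀ X, ∀ m ∈ Z.S X, f.app X m ∈ Z'.S X) (hB : ∀ X, ∀ m ∈ B.S X, f.app X m ∈ B'.S X) :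
    Mackey.Hom (Mackey.subquot Z B) (Mackey.subquot Z' B') where
  app X := QuotientAddGroup.map _ _
    (((f.app X).comp (Z.S X).subtype).codRestrict (Z'.S X) fun m => hZ X m m.2)
    fun _ hm => hB X _ hm
  app_res := by
    rintro X Y k ⟨m⟩
    exact congrArg (QuotientAddGroup.mk' _) (Subtype.ext (f.app_res k m.1))
  app_tr := by
    rintro X Y k ⟨m⟩
    exact congrArg (QuotientAddGroup.mk' _) (Subtype.ext (f.app_tr k m.1))

/-- A chain complex of graded Mackey functors, in non-negative homological degrees. -/
structure GrComplex (Γ G : Type) [Group G] where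
  X : ℕ → GrMackey.{u} Γ G
  d : ∀ n : ℕ, GrHom (X (n + 1)) (X n)
  d_d : ∀ (n : ℕ) {α : Γ} {T : FinGSet G} (x : (X (n + 1 + 1) α).obj T),
    (d n α).app T ((d (n + 1) α).app T x) = 0

namespace GrComplex

/-- A chain map. -/
structure Hom (C D : GrComplex.{u} Γ G) where
  u : ∀ n : ℕ, GrHom (C.X n) (D.X n)
  comm : ∀ (n : ℕ) {α : Γ} {T : FinGSet G} (x : (C.X (n + 1) α).obj T),
    (u n α).app T ((C.d n α).app T x) = (D.d n α).app T ((u (n + 1) α).app T x)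

/-- The cycles. -/
def cycles (C : GrComplex.{u} Γ G) : ∀ (n : ℕ) (α : Γ), (C.X n α).Sub
  | 0, _ =>
    { S := fun _ => ⊤
      res_mem := fun _ _ _ => trivial
      tr_mem := fun _ _ _ => trivial }
  | n + 1, α =>
    { S := fun T => ((C.d n α).app T).ker
      res_mem := fun f m hm => by
        rw [AddMonoidHom.mem_ker] at hm ⊢
        rw [(C.d n α).app_res, hm, map_zero]
      tr_mem := fun f m hm => by
        rw [AddMonoidHom.mem_ker] at hm ⊢
        rw [(C.d n α).app_tr, hm, map_zero] }

/-- The boundaries. -/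
def bounds (C : GrComplex.{u} Γ G) (n : ℕ) (α : Γ) : (C.X n α).Sub where
  S T := ((C.d n α).app T).range
  res_mem f m hm := by
    obtain ⟨x, rfl⟩ := hm
    exact ⟨(C.X (n + 1) α).res f x, (C.d n α).app_res f x⟩
  tr_mem f m hm := by
    obtain ⟨x, rfl⟩ := hm
    exact ⟨(C.X (n + 1) α).tr f x, (C.d n α).app_tr f x⟩

/-- The homology of a complex of graded Mackey functors. -/
def homology (C : GrComplex.{u} Γ G) (n : ℕ) : GrMackey.{u} Γ G := fun α =>
  Mackey.subquot (C.cycles n α) (C.bounds n α)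

/-- The map on homology induced by a chain map. -/
def Hom.homologyMap {C D : GrComplex.{u} Γ G} (f : Hom C D) (n : ℕ) :
    GrHom (C.homology n) (D.homology n) := fun α =>
  Mackey.subquotMap (f.u n α)
    (fun T m hm => by
      cases n with
      | zero => trivial
      | succ n =>
        have h : (C.d n α).app T m = 0 := hm
        change (D.d n α).app T _ = 0
        rw [← f.comm, h, map_zero])
    (fun T m hm => by
      obtain ⟨x, rfl⟩ := hm
      exact ⟨(f.u (n + 1) α).app T x, (f.comm n x).symm⟩)

end GrComplex

end Homology

/-! ### Twisted Hochschild homology -/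

section HH

variable {Γ G : Type} [AddCommGroup Γ] [Group G] {σ : SignRule Γ G} {R : GrGreen.{u} Γ G}

/-- The map of iterated box products induced by a map of algebras. -/
def Alg.Hom.bar {M M' : Alg σ R} (φ : Alg.Hom M M') : ∀ q : ℕ, BiMod.SHom φ (M.bar q) (M'.bar q)
  | 0 =>
    { u := φ.u
      map_l := φ.map_mul
      map_r := φ.map_mul }
  | q + 1 => (φ.bar q).step

/-- The underlying map of graded Mackey functors. -/
def Alg.Hom.barU {M M' : Alg σ R} (φ : Alg.Hom M M') (q : ℕ) : GrHom (M.barC q) (M'.barC q) :=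
  (φ.bar q).u

section

variable {M M' : Alg σ R} (φ : Alg.Hom M M')

theorem Alg.Hom.barU_tm (q : ℕ) {α β γ : Γ} (h : α + β = γ) {T : FinGSet G}
    (x : (M.barC q α).obj T) (m : (M.A.C β).obj T) :
    (φ.barU (q + 1) γ).app T ((M.barT q).f h x m) =
      (M'.barT q).f h ((φ.barU q α).app T x) ((φ.u β).app T m) :=
  (φ.bar q).stepU_tm h x m

theorem Alg.Hom.barU_l (q : ℕ) {α β γ : Γ} (h : α + β = γ) {T : FinGSet G}
    (a : (M.A.C α).obj T) (x : (M.barC q β).obj T) :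
    (φ.barU q γ).app T ((M.barL q).f h a x) =
      (M'.barL q).f h ((φ.u α).app T a) ((φ.barU q β).app T x) :=
  (φ.bar q).map_l h a x

theorem Alg.Hom.barU_r (q : ℕ) {α β γ : Γ} (h : α + β = γ) {T : FinGSet G}
    (x : (M.barC q α).obj T) (a : (M.A.C β).obj T) :
    (φ.barU q γ).app T ((M.barR q).f h x a) =
      (M'.barR q).f h ((φ.barU q α).app T x) ((φ.u β).app T a) :=
  (φ.bar q).map_r h x a

theorem Alg.Hom.barU_mulFace (q i : ℕ) (hi : i ≤ q) {γ : Γ} {T : FinGSet G}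
    (z : (M.barC (q + 1) γ).obj T) : (φ.barU q γ).app T ((M.mulFace q i γ).app T z) =
      (M'.mulFace q i γ).app T ((φ.barU (q + 1) γ).app T z) := by
  induction q generalizing γ T with
  | zero =>
    obtain rfl : i = 0 := by omega
    induction z using Alg.bar_ind with
    | h0 => simp only [map_zero]
    | @ht U k α β e x m =>
      simp only [Mackey.Hom.app_tr]
      rw [φ.barU_tm, Alg.mulFace_zero_tm, Alg.mulFace_zero_tm, φ.barU_r]
    | hadd x y hx hy => simp only [map_add, hx, hy]
  | succ q ih =>
    induction z using Alg.bar_ind with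
    | h0 => simp only [map_zero]
    | @ht U k α β e x m =>
      simp only [Mackey.Hom.app_tr]
      rw [φ.barU_tm]
      by_cases h : i = q + 1
      · subst h
        rw [Alg.mulFace_last_tm, Alg.mulFace_last_tm, φ.barU_r]
      · rw [Alg.mulFace_succ_tm q h, Alg.mulFace_succ_tm q h, φ.barU_tm, ih (by omega)]
    | hadd x y hx hy => simp only [map_add, hx, hy]

end

variable [IsMulCommutative G] (g : G) (hg : GTrivial g R)

theorem Alg.Hom.barU_rotFace {M M' : Alg σ R} (φ : Alg.Hom M M') (q : ℕ) {γ : Γ}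
    {T : FinGSet G} (z : (M.barC (q + 1) γ).obj T) :
    (φ.barU q γ).app T ((M.rotFace g hg q γ).app T z) =
      (M'.rotFace g hg q γ).app T ((φ.barU (q + 1) γ).app T z) := by
  induction z using Alg.bar_ind with
  | h0 => simp only [map_zero]
  | @ht U k α β e x m =>
    have e' : β + α = γ := by rw [add_comm]; exact e
    have em : (φ.u β).app U ((gHom g M.A.C β).app U m) =
      (gHom g M'.A.C β).app U ((φ.u β).app U m) := (φ.u β).app_res _ m
    simp only [Mackey.Hom.app_tr]
    rw [φ.barU_tm, Alg.rotFace_tm g hg q e e', Alg.rotFace_tm g hg q e e', Mackey.Hom.map_smul,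
      φ.barU_l, em]
  | hadd x y hx hy => simp only [map_add, hx, hy]

theorem Alg.Hom.barU_boundary {M M' : Alg σ R} (φ : Alg.Hom M M') (q : ℕ) {γ : Γ}
    {T : FinGSet G} (z : (M.barC (q + 1) γ).obj T) :
    (φ.barU q γ).app T ((M.boundary g hg q γ).app T z) =
      (M'.boundary g hg q γ).app T ((φ.barU (q + 1) γ).app T z) := by
  rw [Alg.boundary, Alg.boundary, GrHom.altSum_app, GrHom.altSum_app, map_sum]
  refine Finset.sum_congr rfl fun i _ => ?_
  rw [map_zsmul, Alg.face, Alg.face]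
  split_ifs with h
  · rw [φ.barU_mulFace q i h]
  · rw [φ.barU_rotFace g hg]

/-- The alternating face complex of the twisted cyclic bar construction of `M` over `R`. -/
def Alg.hochschild (M : Alg σ R) : GrComplex.{u} Γ G where
  X := M.barC
  d := M.boundary g hg
  d_d q _ _ z := Alg.boundary_boundary g hg q z

/-- Twisted Hochschild homology of the `R`-algebra `M`. -/
def Alg.HH (M : Alg σ R) (n : ℕ) : GrMackey.{u} Γ G := (M.hochschild g hg).homology n

/-- The map of Hochschild complexes induced by a map of algebras. -/
def Alg.Hom.hochschild {M M' : Alg σ R} (φ : Alg.Hom M M') :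
    GrComplex.Hom (M.hochschild g hg) (M'.hochschild g hg) where
  u := φ.barU
  comm q _ _ z := φ.barU_boundary g hg q z

/-- The map on twisted Hochschild homology induced by a map of algebras. -/
def Alg.Hom.HH {M M' : Alg σ R} (φ : Alg.Hom M M') (n : ℕ) :
    GrHom (M.HH g hg n) (M'.HH g hg n) := (φ.hochschild g hg).homologyMap n

end HH

/-! ### Derived functors of the relative box product -/

section Tor

variable {Γ G : Type} [AddCommGroup Γ] [Group G]

/-- All components are injective. -/
def GrHom.Injective {A B : GrMackey.{u} Γ G} (f : GrHom A B) : Prop :=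
  ∀ (α : Γ) (X : FinGSet G), Function.Injective ((f α).app X)

/-- All components are surjective. -/
def GrHom.Surjective {A B : GrMackey.{u} Γ G} (f : GrHom A B) : Prop :=
  ∀ (α : Γ) (X : FinGSet G), Function.Surjective ((f α).app X)

/-- An isomorphism of graded Mackey functors. -/
def GrHom.IsIso {A B : GrMackey.{u} Γ G} (f : GrHom A B) : Prop :=
  ∀ (α : Γ) (X : FinGSet G), Function.Bijective ((f α).app X)

namespace Box

/-- `u` is semilinear over `ψ`, for right modules. -/
def SemiR {A A' : GrGreen.{u} Γ G} (ψ : GrHom A.C A'.C) (N : RMod A) (N' : RMod A')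
    (u : GrHom N.C N'.C) : Prop :=
  ∀ {α β γ : Γ} (h : α + β = γ) {T : FinGSet G} (n : (N.C α).obj T) (a : (A.C β).obj T),
    (u γ).app T (N.act.f h n a) = N'.act.f h ((u α).app T n) ((ψ β).app T a)

/-- `v` is semilinear over `ψ`, for left modules. -/
def SemiL {A A' : GrGreen.{u} Γ G} (ψ : GrHom A.C A'.C) (P : LMod A) (P' : LMod A')
    (v : GrHom P.C P'.C) : Prop :=
  ∀ {α β γ : Γ} (h : α + β = γ) {T : FinGSet G} (a : (A.C α).obj T) (p : (P.C β).obj T),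
    (v γ).app T (P.act.f h a p) = P'.act.f h ((ψ α).app T a) ((v β).app T p)

section

variable {A A' : GrGreen.{u} Γ G} {ψ : GrHom A.C A'.C} {N : RMod A} {N' : RMod A'}
  {P : LMod A} {P' : LMod A'} {u : GrHom N.C N'.C} {v : GrHom P.C P'.C}

theorem map_balanced (hu : SemiR ψ N N' u) (hv : SemiL ψ P P' v) :
    Balanced (N := N) (P := P) (((tmul N' P').compLeft u).compRight v) := by
  intro γ T α β δ ε ζ e e' e₁ e₂ n a p
  change (tmul N' P').f e ((u ε).app T (N.act.f e₁ n a)) ((v β).app T p) =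
    (tmul N' P').f e' ((u α).app T n) ((v ζ).app T (P.act.f e₂ a p))
  rw [hu, hv, tmul_balanced e e' e₁ e₂]

/-- The map `u □ v` of relative box products. -/
def map (hu : SemiR ψ N N' u) (hv : SemiL ψ P P' v) : GrHom (Box N P) (Box N' P') :=
  lift _ (map_balanced hu hv)

theorem map_tmul (hu : SemiR ψ N N' u) (hv : SemiL ψ P P' v) {α β γ : Γ} (h : α + β = γ)
    {T : FinGSet G} (n : (N.C α).obj T) (p : (P.C β).obj T) :
    (map hu hv γ).app T ((tmul N P).f h n p) =
      (tmul N' P').f h ((u α).app T n) ((v β).app T p) :=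
  lift_tmul _ (map_balanced hu hv) h n p

end

end Box

variable {A : GrGreen.{u} Γ G}

theorem RMod.Hom.semi {N N' : RMod A} (f : N.Hom N') :
    Box.SemiR (GrHom.id A.C) N N' f.u := f.map_act

theorem LMod.semi_id (P : LMod A) : Box.SemiL (GrHom.id A.C) P P (GrHom.id P.C) :=
  fun _ _ _ _ => rfl

/-- The map `f □ P` of relative box products. -/
def RMod.Hom.box {N N' : RMod A} (f : N.Hom N') (P : LMod A) : GrHom (Box N P) (Box N' P) :=
  Box.map f.semi P.semi_id

theorem RMod.Hom.box_tmul {N N' : RMod A} (f : N.Hom N') (P : LMod A) {α β γ : Γ}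
    (h : α + β = γ) {T : FinGSet G} (n : (N.C α).obj T) (p : (P.C β).obj T) :
    (f.box P γ).app T ((Box.tmul N P).f h n p) = (Box.tmul N' P).f h ((f.u α).app T n) p :=
  Box.map_tmul f.semi P.semi_id h n p

/-- A left module `P` is flat if `- □_A P` preserves monomorphisms. -/
def LMod.IsFlat (P : LMod A) : Prop :=
  ∀ (N N' : RMod A) (f : N.Hom N'), f.u.Injective → (f.box P).Injective

/-- A projective right module. -/
def RMod.IsProjective (Q : RMod A) : Prop :=
  ∀ (N N' : RMod A) (f : N.Hom N') (k : Q.Hom N'), f.u.Surjective →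
    ∃ l : Q.Hom N, ∀ (α : Γ) (T : FinGSet G) (x : (Q.C α).obj T),
      (f.u α).app T ((l.u α).app T x) = (k.u α).app T x

/-- A projective resolution `⋯ → X 1 → X 0 → N → 0` of a right module. -/
structure ProjRes (N : RMod A) where
  X : ℕ → RMod A
  d : ∀ n : ℕ, (X (n + 1)).Hom (X n)
  ε : (X 0).Hom N
  projective : ∀ n, (X n).IsProjective
  surjective : ε.u.Surjective
  exact_zero : ∀ {α : Γ} {T : FinGSet G} (x : ((X 0).C α).obj T),
    (ε.u α).app T x = 0 ↔ ∃ y, ((d 0).u α).app T y = x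
  exact_succ : ∀ (n : ℕ) {α : Γ} {T : FinGSet G} (x : ((X (n + 1)).C α).obj T),
    ((d n).u α).app T x = 0 ↔ ∃ y, ((d (n + 1)).u α).app T y = x

/-- The complex `X_• □_A P` for a projective resolution `X_•`. -/
def ProjRes.boxComplex {N : RMod A} (Q : ProjRes N) (P : LMod A) : GrComplex.{u} Γ G where
  X n := Box (Q.X n) P
  d n := (Q.d n).box P
  d_d n α T x := by
    induction x using Box.ind with
    | h0 => simp only [map_zero]
    | ht k e n p =>
      rw [Mackey.Hom.app_tr, Mackey.Hom.app_tr, RMod.Hom.box_tmul, RMod.Hom.box_tmul,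
        (Q.exact_succ _ _).2 ⟨_, rfl⟩, map_zero, AddMonoidHom.zero_apply, map_zero]
    | hadd x y hx hy => rw [map_add, map_add, hx, hy, add_zero]

/-- `Tor_n^A(N, P)`, computed by a projective resolution of `N`. -/
def ProjRes.Tor {N : RMod A} (Q : ProjRes N) (P : LMod A) (n : ℕ) : GrMackey.{u} Γ G :=
  (Q.boxComplex P).homology n

/-- A lift of a map `f : N → N'`, semilinear over `ψ`, to projective resolutions. -/
structure ProjRes.Lift {A' : GrGreen.{u} Γ G} (ψ : GrHom A.C A'.C) {N : RMod A} {N' : RMod A'}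
    (f : GrHom N.C N'.C) (Q : ProjRes N) (Q' : ProjRes N') where
  u : ∀ n, GrHom (Q.X n).C (Q'.X n).C
  semi : ∀ n, Box.SemiR ψ (Q.X n) (Q'.X n) (u n)
  comm : ∀ (n : ℕ) {α : Γ} {T : FinGSet G} (x : ((Q.X (n + 1)).C α).obj T),
    (u n α).app T (((Q.d n).u α).app T x) = ((Q'.d n).u α).app T ((u (n + 1) α).app T x)
  comm_ε : ∀ {α : Γ} {T : FinGSet G} (x : ((Q.X 0).C α).obj T),
    (f α).app T ((Q.ε.u α).app T x) = (Q'.ε.u α).app T ((u 0 α).app T x)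

section

variable {A' : GrGreen.{u} Γ G} {ψ : GrHom A.C A'.C} {N : RMod A} {N' : RMod A'}
  {f : GrHom N.C N'.C} {Q : ProjRes N} {Q' : ProjRes N'} {P : LMod A} {P' : LMod A'}
  {v : GrHom P.C P'.C}

/-- The chain map `X_• □_A P → X'_• □_A' P'` induced by a lift to projective resolutions. -/
def ProjRes.Lift.boxComplex (F : ProjRes.Lift ψ f Q Q') (hv : Box.SemiL ψ P P' v) :
    GrComplex.Hom (Q.boxComplex P) (Q'.boxComplex P') where
  u n := Box.map (F.semi n) hv
  comm n α T x := by
    change (Box.map (F.semi n) hv α).app T (((Q.d n).box P α).app T x) =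
      ((Q'.d n).box P' α).app T ((Box.map (F.semi (n + 1)) hv α).app T x)
    induction x using Box.ind with
    | h0 => simp only [map_zero]
    | ht k e n p =>
      simp only [Mackey.Hom.app_tr]
      rw [RMod.Hom.box_tmul, Box.map_tmul, Box.map_tmul, RMod.Hom.box_tmul, F.comm]
    | hadd x y hx hy => simp only [map_add, hx, hy]

/-- The map `Tor_n^A(N, P) → Tor_n^A'(N', P')`. -/
def ProjRes.Lift.Tor (F : ProjRes.Lift ψ f Q Q') (hv : Box.SemiL ψ P P' v) (n : ℕ) :
    GrHom (Q.Tor P n) (Q'.Tor P' n) := (F.boxComplex hv).homologyMap n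

end

variable {σ : SignRule Γ G} {R : GrGreen.{u} Γ G}

theorem LL.semi {M N M' N' : Alg σ R} {P : LL M N} {P' : LL M' N'} (φ : GrHom M.A.C M'.A.C)
    (χ : GrHom N.A.C N'.A.C) (ψ : GrHom (M.tensorC N) (M'.tensorC N'))
    (hψ : ∀ {α β γ : Γ} (h : α + β = γ) {T : FinGSet G} (m : (M.A.C α).obj T)
      (n : (N.A.C β).obj T), (ψ γ).app T ((M.tt N).f h m n) =
        (M'.tt N').f h ((φ α).app T m) ((χ β).app T n))
    (v : GrHom P.C P'.C)
    (h₁ : ∀ {α β γ : Γ} (h : α + β = γ) {T : FinGSet G} (m : (M.A.C α).obj T)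
      (x : (P.C β).obj T), (v γ).app T (P.l₁.f h m x) =
        P'.l₁.f h ((φ α).app T m) ((v β).app T x))
    (h₂ : ∀ {α β γ : Γ} (h : α + β = γ) {T : FinGSet G} (n : (N.A.C α).obj T)
      (x : (P.C β).obj T), (v γ).app T (P.l₂.f h n x) =
        P'.l₂.f h ((χ α).app T n) ((v β).app T x)) :
    Box.SemiL (A := M.tensor N) (A' := M'.tensor N') ψ P.toLMod P'.toLMod v := by
  intro α β γ h T a p
  change (v γ).app T (P.act.f h a p) = P'.act.f h ((ψ α).app T a) ((v β).app T p)
  induction a using Alg.tensor_ind with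
  | h0 => simp only [map_zero, AddMonoidHom.zero_apply]
  | @ht U k μ ν e m b =>
    have e₁ : μ + (ν + β) = γ := by rw [← add_assoc, e, h]
    rw [P.act.tr_left, (ψ α).app_tr, (v γ).app_tr, P'.act.tr_left, hψ, P.act_tt h e e₁ rfl,
      P'.act_tt h e e₁ rfl, h₁, h₂, (v β).app_res]
  | hadd x y hx hy => simp only [map_add, AddMonoidHom.add_apply, hx, hy]

namespace Alg.Hom

variable {M M' : Alg σ R} (φ : Alg.Hom M M')

theorem semi_right : Box.SemiR (GrHom.id R.C) M.toRMod M'.toRMod φ.u := by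
  intro α β γ h T (n : (M.A.C α).obj T) a
  change (φ.u γ).app T (M.A.mul.f h n ((M.η β).app T a)) =
    M'.A.mul.f h ((φ.u α).app T n) ((M'.η β).app T a)
  rw [φ.map_mul, φ.map_η]

theorem map_opA {α β γ : Γ} (h : α + β = γ) {T : FinGSet G} (a : (M.A.C α).obj T)
    (b : (M.A.C β).obj T) : (φ.u γ).app T (M.opA.mul.f h a b) =
      M'.opA.mul.f h ((φ.u α).app T a) ((φ.u β).app T b) := by
  have h' : β + α = γ := by rw [add_comm]; exact h
  rw [M.opA_mul h h', M'.opA_mul h h', Mackey.Hom.map_smul, φ.map_mul]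

theorem semi_left : Box.SemiL (GrHom.id R.C) M.toLMod M'.toLMod φ.u := by
  intro α β γ h T a (p : (M.A.C β).obj T)
  change (φ.u γ).app T (M.A.mul.f h ((M.η α).app T a) p) =
    M'.A.mul.f h ((M'.η α).app T a) ((φ.u β).app T p)
  rw [φ.map_mul, φ.map_η]

/-- The map `φ □ χ` of box products of algebras. -/
def tensor {N N' : Alg σ R} (χ : Alg.Hom N N') : GrHom (M.tensorC N) (M'.tensorC N') :=
  Box.map (N := M.toRMod) (N' := M'.toRMod) (P := N.toLMod) (P' := N'.toLMod) (u := φ.u)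
    (v := χ.u) φ.semi_right χ.semi_left

theorem tensor_tt {N N' : Alg σ R} (χ : Alg.Hom N N') {α β γ : Γ} (h : α + β = γ)
    {T : FinGSet G} (m : (M.A.C α).obj T) (n : (N.A.C β).obj T) :
    (φ.tensor χ γ).app T ((M.tt N).f h m n) =
      (M'.tt N').f h ((φ.u α).app T m) ((χ.u β).app T n) :=
  Box.map_tmul (N := M.toRMod) (N' := M'.toRMod) (P := N.toLMod) (P' := N'.toLMod) (u := φ.u)
    (v := χ.u) φ.semi_right χ.semi_left h m n

/-- The map of opposite algebras. -/
def op : Alg.Hom M.op M'.op where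
  u := φ.u
  map_one := φ.map_one
  map_mul := φ.map_opA
  map_η := φ.map_η

/-- The map of enveloping algebras induced by a map of algebras. -/
def env : GrHom M.env.C M'.env.C := φ.tensor φ.op

theorem semi_leftEnv [IsMulCommutative G] (g : G) (hg : GTrivial g R) :
    Box.SemiL φ.env (M.leftEnv g hg) (M'.leftEnv g hg) φ.u := by
  refine LL.semi (P := M.ll g hg) (P' := M'.ll g hg) φ.u φ.op.u φ.env (φ.tensor_tt φ.op) φ.u ?_ ?_
  · intro α β γ h T (m : (M.A.C α).obj T) (x : (M.A.C β).obj T)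
    have em : (φ.u α).app T ((gHom g M.A.C α).app T m) =
      (gHom g M'.A.C α).app T ((φ.u α).app T m) := (φ.u α).app_res _ m
    change (φ.u γ).app T (M.A.mul.f h ((gHom g M.A.C α).app T m) x) =
      M'.A.mul.f h ((gHom g M'.A.C α).app T ((φ.u α).app T m)) ((φ.u β).app T x)
    rw [φ.map_mul, em]
  · intro α β γ h T (m : (M.A.C α).obj T) (x : (M.A.C β).obj T)
    exact φ.map_opA h m x

end Alg.Hom

end Tor

/-! ### The representation ring and the signs of the switch maps -/

/-- A finite-dimensional real representation of `G`, on some `ℝⁿ`. -/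
structure RealRep (G : Type) [Group G] where
  dim : ℕ
  ρ : Representation ℝ G (Fin dim → ℝ)

namespace RealRep

variable {G : Type} [Group G]

/-- The fixed space `V^H`. -/
def fixed (V : RealRep G) (H : Subgroup G) : Submodule ℝ (Fin V.dim → ℝ) where
  carrier := {v | ∀ h ∈ H, V.ρ h v = v}
  add_mem' := fun {v w} hv hw h hh => by rw [map_add, hv h hh, hw h hh]
  zero_mem' := fun h _ => map_zero (V.ρ h)
  smul_mem' := fun c v hv h hh => by rw [map_smul, hv h hh]

/-- `U` is isomorphic to the direct sum `V ⊕ W`. -/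
def IsSum (U V W : RealRep G) : Prop :=
  ∃ e : (Fin U.dim → ℝ) ≃ₗ[ℝ] (Fin V.dim → ℝ) × (Fin W.dim → ℝ),
    ∀ (g : G) (x : Fin U.dim → ℝ), e (U.ρ g x) = (V.ρ g (e x).1, W.ρ g (e x).2)

end RealRep

/-- The relations `[V ⊕ W] = [V] + [W]`. -/
def repRelations (G : Type) [Group G] : AddSubgroup (FreeAbelianGroup (RealRep G)) :=
  AddSubgroup.closure {x | ∃ U V W : RealRep G, RealRep.IsSum U V W ∧
    x = FreeAbelianGroup.of U - (FreeAbelianGroup.of V + FreeAbelianGroup.of W)}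

/-- The additive group of the real representation ring `RO(G)`: the group completion of the
isomorphism classes of finite-dimensional real representations. -/
abbrev RO (G : Type) [Group G] : Type := FreeAbelianGroup (RealRep G) ⧸ repRelations G

/-- The class of a representation. -/
def RO.of {G : Type} [Group G] (V : RealRep G) : RO G :=
  QuotientAddGroup.mk' _ (FreeAbelianGroup.of V)

/-- The elements `σ(α, β)` of the Burnside ring `A(G) = π_0^G(S^0)` given by the switch maps
`S^α ∧ S^β → S^β ∧ S^α`. They are bimultiplicative, and `σ(V, V)` is the class of the switch map
of `S^V ∧ S^V`, that is, the element of `A(G)` whose mark at `H` is the degree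
`(-1)^{dim V^H}` of the switch map of `S^{V^H} ∧ S^{V^H}`. To regard the other switch maps as
self-maps of a sphere one chooses compatible identifications `S^α ∧ S^β ≅ S^{α + β}`; any such
choice is allowed here. -/
structure SwitchSign (G : Type) [Group G] extends SignRule (RO G) G where
  mark_self : ∀ (V : RealRep G) (H : Subgroup G),
    BurnsideRing.mark H (s (RO.of V) (RO.of V)) = (-1) ^ Module.finrank ℝ (V.fixed H)

section SwitchSignExists

open Polynomial in
theorem exists_root_of_odd (p : ℝ[X]) (hm : p.Monic) (hd : Odd p.natDegree) :
    ∃ x, p.IsRoot x := by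
  have h0 : p.natDegree ≠ 0 := fun h => by rw [h] at hd; exact absurd hd (by decide)
  have h1 : Filter.Tendsto (fun x => p.eval x) Filter.atTop Filter.atTop :=
    p.tendsto_atTop_of_leadingCoeff_nonneg (natDegree_pos_iff_degree_pos.1 (Nat.pos_of_ne_zero h0))
      (by rw [hm]; exact zero_le_one)
  have hq : (-(p.comp (-X))).natDegree = p.natDegree := by
    rw [natDegree_neg, natDegree_comp, natDegree_neg, natDegree_X, mul_one]
  have h2 : Filter.Tendsto (fun x => (-(p.comp (-X))).eval x) Filter.atTop Filter.atTop := by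
    refine tendsto_atTop_of_leadingCoeff_nonneg _ (natDegree_pos_iff_degree_pos.1 ?_) ?_
    · rw [hq]; exact Nat.pos_of_ne_zero h0
    · rw [leadingCoeff_neg, leadingCoeff_comp (by rw [natDegree_neg, natDegree_X]; exact one_ne_zero),
        leadingCoeff_neg, leadingCoeff_X, hm, hd.neg_one_pow]
      norm_num
  obtain ⟨a, ha⟩ := (h1.eventually_ge_atTop 0).exists
  obtain ⟨b, hb⟩ := (h2.eventually_ge_atTop 0).exists
  have hb' : p.eval (-b) ≤ 0 := by
    have : (-(p.comp (-X))).eval b = -p.eval (-b) := by simp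
    rw [this] at hb
    linarith
  exact mem_range_of_exists_le_of_exists_ge p.continuous ⟨_, hb'⟩ ⟨_, ha⟩

theorem even_finrank_of_no_eigenvalue {W : Type*} [AddCommGroup W] [Module ℝ W]
    [FiniteDimensional ℝ W] (T : W →ₗ[ℝ] W) (h : ∀ (c : ℝ) (x : W), T x = c • x → x = 0) :
    Even (Module.finrank ℝ W) := by
  by_contra ho
  rw [Nat.not_even_iff_odd, ← LinearMap.charpoly_natDegree T] at ho
  obtain ⟨c, hc⟩ := exists_root_of_odd _ (LinearMap.charpoly_monic T) ho
  obtain ⟨x, hx⟩ := ((Module.End.hasEigenvalue_iff_isRoot_charpoly T c).2 hc).exists_hasEigenvector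
  exact hx.2 (h c x hx.apply_eq_smul)

/-- For `T` of finite order, the codimension of the fixed space of `T²` is even. -/
theorem finrank_fixed_sq {V : Type*} [AddCommGroup V] [Module ℝ V] [FiniteDimensional ℝ V]
    (T : V →ₗ[ℝ] V) {n : ℕ} (hn : n ≠ 0) (hT : T ^ n = 1) (W : Submodule ℝ V)
    (hW : ∀ x, x ∈ W ↔ T (T x) = x) :
    (Module.finrank ℝ V : ZMod 2) = Module.finrank ℝ W := by
  set S : V →ₗ[ℝ] V := T * T - 1 with hS
  have hSx : ∀ x, S x = T (T x) - x := fun x => rfl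
  have hker : S.ker = W := by
    ext x
    rw [LinearMap.mem_ker, hSx, sub_eq_zero, hW]
  have hcomm : ∀ x, S (T x) = T (S x) := fun x => by rw [hSx, hSx, map_sub]
  have hpow : ∀ (m : ℕ) (y x : V), T (T y) = y + x → T (T x) = x →
      (T * T) ^ m • y = y + (m : ℝ) • x := by
    intro m y x h1 h2
    induction m with
    | zero => simp
    | succ m ih =>
      rw [pow_succ', mul_smul, ih]
      change T (T (y + (m : ℝ) • x)) = _
      rw [map_add, map_add, map_smul, map_smul, h1, h2]
      push_cast
      module
  have hinj : ∀ y, S (S y) = 0 → S y = 0 := by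
    intro y hy
    have h2 : T (T (S y)) = S y := sub_eq_zero.1 hy
    have h1 : T (T y) = y + S y := by rw [hSx]; abel
    have h3 := hpow n y (S y) h1 h2
    have h4 : (T * T) ^ n = 1 := by rw [← pow_two, ← pow_mul, mul_comm, pow_mul, hT, one_pow]
    rw [h4, one_smul] at h3
    have h5 : (n : ℝ) • S y = 0 := by simpa using h3.symm
    exact (smul_eq_zero.1 h5).resolve_left (by exact_mod_cast hn)
  have hT' : ∀ x ∈ S.range, T x ∈ S.range := by
    rintro _ ⟨y, rfl⟩
    exact ⟨T y, hcomm y⟩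
  have hev := even_finrank_of_no_eigenvalue (T.restrict hT') (by
    rintro c ⟨_, y, rfl⟩ hx
    have hx' : T (S y) = c • S y := congrArg Subtype.val hx
    refine Subtype.ext (?_ : S y = 0)
    by_contra hne
    have hk : ∀ m : ℕ, (T ^ m) (S y) = c ^ m • S y := by
      intro m
      induction m with
      | zero => simp
      | succ m ih =>
        rw [pow_succ']
        change T ((T ^ m) (S y)) = _
        rw [ih, map_smul, hx', smul_smul, pow_succ]
    have hc : c ^ n = 1 := by
      have h6 := hk n
      rw [hT] at h6
      have h7 : (c ^ n - 1) • S y = 0 := by rw [sub_smul, ← h6]; simp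
      exact sub_eq_zero.1 ((smul_eq_zero.1 h7).resolve_right hne)
    have hc2 : c * c = 1 := by
      have : |c| = 1 := by
        have := congrArg abs hc
        rw [abs_pow, abs_one] at this
        exact (pow_eq_one_iff_of_nonneg (abs_nonneg c) hn).1 this
      rw [← abs_mul_abs_self, this, one_mul]
    refine hne (hinj y ?_)
    rw [hSx (S y), hx', map_smul, hx', smul_smul, hc2, one_smul, sub_self])
  have hrank := S.finrank_range_add_finrank_ker
  rw [hker] at hrank
  rw [← hrank, Nat.cast_add, (ZMod.natCast_eq_zero_iff_even).2 hev, zero_add]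

theorem exists_signChar (G : Type) [Group G] [IsCyclic G] [Finite G] :
    ∃ χ : G →* Multiplicative (ZMod 2), ∀ x, χ x = 1 → ∃ k, x = k * k := by
  by_cases h : 2 ∣ Nat.card G
  · let e := zmodCyclicMulEquiv (G := G) inferInstance
    refine ⟨(AddMonoidHom.toMultiplicative (ZMod.castHom h (ZMod 2)).toAddMonoidHom).comp
      e.symm.toMonoidHom, fun x hx => ?_⟩
    have : NeZero (Nat.card G) := ⟨Nat.card_pos.ne'⟩
    obtain ⟨a, rfl⟩ := e.surjective x
    have ha : (ZMod.castHom h (ZMod 2)) (Multiplicative.toAdd a) = 0 := by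
      have : (AddMonoidHom.toMultiplicative (ZMod.castHom h (ZMod 2)).toAddMonoidHom)
        (e.symm (e a)) = 1 := hx
      rw [MulEquiv.symm_apply_apply] at this
      exact this
    rw [← ZMod.natCast_zmod_val (Multiplicative.toAdd a), map_natCast,
      ZMod.natCast_eq_zero_iff_even] at ha
    obtain ⟨m, hm⟩ := ha
    refine ⟨e (Multiplicative.ofAdd (m : ZMod (Nat.card G))), ?_⟩
    rw [← map_mul, ← ofAdd_add, ← Nat.cast_add, ← hm, ZMod.natCast_zmod_val]
    rfl
  · refine ⟨1, fun x _ => ?_⟩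
    have ho : Odd (Nat.card G) := Nat.not_even_iff_odd.1 fun he => h he.two_dvd
    obtain ⟨m, hm⟩ := ho
    refine ⟨x ^ (m + 1), ?_⟩
    have := pow_card_eq_one' (x := x)
    rw [hm] at this
    calc x = x ^ (2 * m + 1) * x := by rw [this, one_mul]
      _ = x ^ (m + 1) * x ^ (m + 1) := by rw [← pow_succ, ← pow_add]; congr 1; ring

variable {G : Type} [Group G]

theorem RealRep.finrank_fixed_of_isSum {U V W : RealRep G} (h : RealRep.IsSum U V W)
    (H : Subgroup G) : Module.finrank ℝ (U.fixed H) =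
      Module.finrank ℝ (V.fixed H) + Module.finrank ℝ (W.fixed H) := by
  obtain ⟨e, he⟩ := h
  have hfix : ∀ u, u ∈ U.fixed H ↔ (e u).1 ∈ V.fixed H ∧ (e u).2 ∈ W.fixed H := by
    intro u
    change (∀ h ∈ H, U.ρ h u = u) ↔
      (∀ h ∈ H, V.ρ h (e u).1 = (e u).1) ∧ (∀ h ∈ H, W.ρ h (e u).2 = (e u).2)
    rw [← forall₂_and]
    refine forall₂_congr fun h _ => ?_
    rw [← e.injective.eq_iff, he, Prod.ext_iff]
  rw [← Module.finrank_prod]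
  refine LinearEquiv.finrank_eq
    { toFun := fun u => (⟨(e u.1).1, ((hfix u.1).1 u.2).1⟩, ⟨(e u.1).2, ((hfix u.1).1 u.2).2⟩)
      map_add' := fun u v => by ext <;> simp
      map_smul' := fun c u => by ext <;> simp
      invFun := fun x => ⟨e.symm (x.1.1, x.2.1), (hfix _).2 (by
        rw [e.apply_symm_apply]
        exact ⟨x.1.2, x.2.2⟩)⟩
      left_inv := fun u => by simp
      right_inv := fun x => by simp }

/-- The parity of the dimension of the `H`-fixed points. -/
def RO.parity (H : Subgroup G) : RO G →+ ZMod 2 :=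
  QuotientAddGroup.lift (repRelations G)
    (FreeAbelianGroup.lift fun V : RealRep G => (Module.finrank ℝ (V.fixed H) : ZMod 2)) (by
      rw [repRelations, AddSubgroup.closure_le]
      rintro _ ⟨U, V, W, h, rfl⟩
      change FreeAbelianGroup.lift _ _ = _
      rw [map_sub, map_add]
      simp only [FreeAbelianGroup.lift_apply_of]
      rw [RealRep.finrank_fixed_of_isSum h H, Nat.cast_add, sub_self])

theorem RO.parity_of (H : Subgroup G) (V : RealRep G) :
    RO.parity H (RO.of V) = (Module.finrank ℝ (V.fixed H) : ZMod 2) :=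
  FreeAbelianGroup.lift_apply_of _ _

/-- The stabilizer of a vector. -/
def RealRep.stab (V : RealRep G) (x : Fin V.dim → ℝ) : Subgroup G where
  carrier := {y | V.ρ y x = x}
  mul_mem' := fun {a b} ha hb => by
    change V.ρ (a * b) x = x
    rw [map_mul]
    change V.ρ a (V.ρ b x) = x
    rw [hb, ha]
  one_mem' := by
    change V.ρ 1 x = x
    rw [map_one]
    rfl
  inv_mem' := fun {a} ha => by
    change V.ρ a⁻¹ x = x
    conv_lhs => rw [← (show V.ρ a x = x from ha)]
    change (V.ρ a⁻¹ * V.ρ a) x = x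
    rw [← map_mul, inv_mul_cancel, map_one]
    rfl

theorem RealRep.mem_fixed_zpowers (V : RealRep G) (k : G) (x : Fin V.dim → ℝ) :
    x ∈ V.fixed (Subgroup.zpowers k) ↔ V.ρ k x = x :=
  ⟨fun h => h _ (Subgroup.mem_zpowers _),
    fun h _ hy => (Subgroup.zpowers_le (H := V.stab x)).2 h hy⟩

theorem RealRep.parity_of_sq [Finite G] (V : RealRep G) (k : G) :
    (Module.finrank ℝ (V.fixed (Subgroup.zpowers (k * k))) : ZMod 2) =
      Module.finrank ℝ (V.fixed ⊥) := by
  have hbot : V.fixed ⊥ = ⊤ := by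
    refine eq_top_iff.2 fun v _ h hh => ?_
    rw [Subgroup.mem_bot.1 hh, map_one]
    rfl
  rw [hbot, finrank_top]
  refine (finrank_fixed_sq (V.ρ k) (orderOf_pos k).ne' (by rw [← map_pow, pow_orderOf_eq_one,
    map_one]) _ fun x => ?_).symm
  rw [V.mem_fixed_zpowers, map_mul]
  rfl

theorem RealRep.parity_of_generator [Finite G] [IsMulCommutative G] (V : RealRep G)
    (H : Subgroup G) {c h k : G} (hc : Subgroup.zpowers c = ⊤) (hh : h ∈ H)
    (hk : c = k * k * h) : (Module.finrank ℝ (V.fixed H) : ZMod 2) =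
      Module.finrank ℝ (V.fixed ⊤) := by
  have hT : ∀ x ∈ V.fixed H, V.ρ k x ∈ V.fixed H := by
    intro x hx y hy
    change (V.ρ y * V.ρ k) x = _
    rw [← map_mul, mul_comm', map_mul]
    change V.ρ k (V.ρ y x) = _
    rw [hx y hy]
  have hle : V.fixed ⊤ ≤ V.fixed H := fun x hx y _ => hx y trivial
  rw [← (Submodule.comapSubtypeEquivOfLe hle).finrank_eq]
  have hpow : ∀ (m : ℕ) (x : V.fixed H), ((((V.ρ k).restrict hT) ^ m) x).1 = V.ρ (k ^ m) x.1 := by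
    intro m x
    induction m with
    | zero => rw [pow_zero, pow_zero, map_one]; rfl
    | succ m ih =>
      rw [pow_succ', pow_succ', map_mul]
      change V.ρ k ((((V.ρ k).restrict hT) ^ m) x).1 = _
      rw [ih]
      rfl
  refine finrank_fixed_sq ((V.ρ k).restrict hT) (orderOf_pos k).ne' ?_ _ fun x => ?_
  · refine LinearMap.ext fun x => Subtype.ext ?_
    rw [hpow, pow_orderOf_eq_one, map_one]
    rfl
  · rw [Submodule.mem_comap, ← hc]
    refine (V.mem_fixed_zpowers c x.1).trans ?_
    have e : V.ρ c x.1 = V.ρ k (V.ρ k x.1) := by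
      rw [hk, map_mul, map_mul]
      change V.ρ k (V.ρ k (V.ρ h x.1)) = _
      rw [x.2 h hh]
    rw [e, Subtype.ext_iff]
    rfl

/-- The finite `G`-set with two elements on which `G` acts through `χ`. -/
def signSet (χ : G →* Multiplicative (ZMod 2)) : FinGSet G where
  card := 2
  act :=
    { smul := fun g (x : ZMod 2) => (χ g).toAdd + x
      one_smul := fun (x : ZMod 2) => by
        change (χ 1).toAdd + x = x
        rw [map_one]
        exact zero_add x
      mul_smul := fun g h (x : ZMod 2) => by
        change (χ (g * h)).toAdd + x = (χ g).toAdd + ((χ h).toAdd + x)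
        rw [map_mul, ← add_assoc]
        rfl }

/-- The unit `[S] - 1` of the Burnside ring. -/
def signUnit (χ : G →* Multiplicative (ZMod 2)) : BurnsideRing G :=
  BurnsideRing.of (signSet χ) - 1

theorem BurnsideRing.of_prod (X Y : FinGSet G) :
    BurnsideRing.of X * BurnsideRing.of Y = BurnsideRing.of (FinGSet.prod X Y) := by
  rw [BurnsideRing.of, BurnsideRing.of, ← map_mul, ← FreeAbelianGroup.of_mul]
  rfl

theorem BurnsideRing.of_disjUnion {X Y Z : FinGSet G} (i : FinGSet.Hom X Z)
    (j : FinGSet.Hom Y Z) (h : FinGSet.IsDisjUnion i j) :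
    BurnsideRing.of Z = BurnsideRing.of X + BurnsideRing.of Y := by
  rw [BurnsideRing.of, BurnsideRing.of, BurnsideRing.of, ← map_add]
  exact Ideal.Quotient.eq.2 (Ideal.subset_span ⟨X, Y, Z, i, j, h, rfl⟩)

theorem signUnit_mul_self (χ : G →* Multiplicative (ZMod 2)) :
    signUnit χ * signUnit χ = 1 := by
  let S := signSet χ
  let t : FinGSet.Hom S S :=
    { toFun := fun x : ZMod 2 => x + 1
      map_smul' := fun g (x : ZMod 2) => add_assoc (χ g).toAdd x 1 }
  obtain ⟨i, hi1, hi2⟩ := (FinGSet.prod_isProd S S).exists_lift (FinGSet.idHom S)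
    (FinGSet.idHom S)
  obtain ⟨j, hj1, hj2⟩ := (FinGSet.prod_isProd S S).exists_lift (FinGSet.idHom S) t
  have ht : ∀ x, t x ≠ x := by
    have : ∀ x : ZMod 2, x + 1 ≠ x := by decide
    exact this
  have hcase : ∀ x y : S.El, y = x ∨ y = t x := by
    have : ∀ x y : ZMod 2, y = x ∨ y = x + 1 := by decide
    exact this
  have hu : FinGSet.IsDisjUnion i j := by
    constructor
    · rintro (x | x) (y | y) e
      · rw [show x = y from (hi1 x).symm.trans ((congrArg _ e).trans (hi1 y))]
      · have e1 : x = y := (hi1 x).symm.trans ((congrArg _ e).trans (hj1 y))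
        have e2 : x = t y := (hi2 x).symm.trans ((congrArg _ e).trans (hj2 y))
        exact absurd (e2.symm.trans e1) (ht y)
      · have e1 : x = y := (hj1 x).symm.trans ((congrArg _ e).trans (hi1 y))
        have e2 : t x = y := (hj2 x).symm.trans ((congrArg _ e).trans (hi2 y))
        exact absurd (e2.trans e1.symm) (ht x)
      · rw [show x = y from (hj1 x).symm.trans ((congrArg _ e).trans (hj1 y))]
    · intro w
      obtain ⟨z, hz, hzu⟩ := FinGSet.prod_isProd S S (FinGSet.fst S S w) (FinGSet.snd S S w)
      rcases hcase (FinGSet.fst S S w) (FinGSet.snd S S w) with e | e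
      · exact ⟨Sum.inl (FinGSet.fst S S w), (hzu _ ⟨hi1 _, (hi2 _).trans e.symm⟩).trans
          (hzu w ⟨rfl, rfl⟩).symm⟩
      · exact ⟨Sum.inr (FinGSet.fst S S w), (hzu _ ⟨hj1 _, (hj2 _).trans e.symm⟩).trans
          (hzu w ⟨rfl, rfl⟩).symm⟩
  have key : BurnsideRing.of S * BurnsideRing.of S = BurnsideRing.of S + BurnsideRing.of S := by
    rw [BurnsideRing.of_prod, BurnsideRing.of_disjUnion i j hu]
  have : signUnit χ = BurnsideRing.of S - 1 := rfl
  rw [this]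
  linear_combination key

open Classical in
theorem mark_signUnit (χ : G →* Multiplicative (ZMod 2)) (H : Subgroup G) :
    BurnsideRing.mark H (signUnit χ) = if ∀ h ∈ H, χ h = 1 then 1 else -1 := by
  have h1 : BurnsideRing.mark H (BurnsideRing.of (signSet χ)) =
      Nat.card {x : ZMod 2 // ∀ h ∈ H, (χ h).toAdd + x = x} := BurnsideRing.lift_of _ _ _
  rw [signUnit, map_sub, map_one, h1]
  split_ifs with h
  · have : Nat.card {x : ZMod 2 // ∀ h ∈ H, (χ h).toAdd + x = x} = 2 := by
      rw [Nat.card_congr (Equiv.subtypeUnivEquiv fun x k hk => by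
        rw [h k hk]; exact zero_add x), Nat.card_zmod]
    rw [this]
    norm_num
  · have : IsEmpty {x : ZMod 2 // ∀ h ∈ H, (χ h).toAdd + x = x} :=
      ⟨fun x => h fun k hk => by
        have := x.2 k hk
        rw [add_eq_right] at this
        exact this⟩
    rw [Nat.card_of_isEmpty]
    norm_num

theorem pow_val_add {S : Type*} [CommRing S] {w : S} (hw : w * w = 1) (a b : ZMod 2) :
    w ^ (a + b).val = w ^ a.val * w ^ b.val := by
  have hab : ∀ a b : ZMod 2, (a + b).val = a.val + b.val ∨
      (a = 1 ∧ b = 1) := by decide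
  rcases hab a b with h | ⟨rfl, rfl⟩
  · rw [h, pow_add]
  · change w ^ 0 = w ^ 1 * w ^ 1
    rw [pow_one, hw, pow_zero]

theorem neg_one_pow_val (n : ℕ) : (-1 : ℤ) ^ (n : ZMod 2).val = (-1) ^ n := by
  rw [ZMod.val_natCast]
  exact (neg_one_pow_eq_pow_mod_two n).symm

/-- Switch signs exist: the mark of `σ(α, β)` at `H` is `(-1)^{dim α^H dim β^H}`. -/
theorem SwitchSign.nonempty [Finite G] [IsCyclic G] : Nonempty (SwitchSign G) := by
  have hcomm : IsMulCommutative G := inferInstance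
  obtain ⟨χ, hχ⟩ := exists_signChar G
  set ω := signUnit χ with hω
  have hω2 : ω * ω = 1 := signUnit_mul_self χ
  have hneg : (-1 : BurnsideRing G) * -1 = 1 := by ring
  let d := RO.parity (G := G) ⊥
  let t := RO.parity (G := G) ⊤
  refine ⟨{
    s := fun α β => (-1) ^ (d α * d β).val * ω ^ (d α * d β + t α * t β).val
    add_left := fun α β γ => ?_
    add_right := fun α β γ => ?_
    symm := fun α β => ?_
    mark_self := fun V H => ?_ }⟩
  · have e : (d α + d β) * d γ + (t α + t β) * t γ =
      (d α * d γ + t α * t γ) + (d β * d γ + t β * t γ) := by ring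
    rw [map_add, map_add, e, add_mul, pow_val_add hneg, pow_val_add hω2]
    ring
  · have e : d α * (d β + d γ) + t α * (t β + t γ) =
      (d α * d β + t α * t β) + (d α * d γ + t α * t γ) := by ring
    rw [map_add, map_add, e, mul_add, pow_val_add hneg, pow_val_add hω2]
    ring
  · rw [mul_comm (d β), mul_comm (t β), mul_mul_mul_comm, ← mul_pow, ← mul_pow, hneg, hω2,
      one_pow, one_pow, one_mul]
  · have hd : d (RO.of V) = (Module.finrank ℝ (V.fixed ⊥) : ZMod 2) := RO.parity_of _ _
    have ht : t (RO.of V) = (Module.finrank ℝ (V.fixed ⊤) : ZMod 2) := RO.parity_of _ _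
    have hsq : ∀ x : ZMod 2, x * x = x := by decide
    rw [map_mul, map_pow, map_pow, map_neg, map_one, hω, mark_signUnit, hsq, hsq,
      ← neg_one_pow_val (Module.finrank ℝ (V.fixed H))]
    split_ifs with h
    · obtain ⟨⟨y, hy⟩, hgen⟩ := IsCyclic.exists_generator (α := H)
      obtain ⟨k, rfl⟩ := hχ y (h y hy)
      have hH : H = Subgroup.zpowers (k * k) := by
        refine le_antisymm (fun z hz => ?_) (Subgroup.zpowers_le.2 hy)
        obtain ⟨m, hm⟩ := hgen ⟨z, hz⟩
        exact ⟨m, congrArg Subtype.val hm⟩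
      rw [one_pow, mul_one, hH, V.parity_of_sq k, hd]
    · push Not at h
      obtain ⟨y, hy, hy1⟩ := h
      obtain ⟨c, hc⟩ := IsCyclic.exists_generator (α := G)
      have hc' : Subgroup.zpowers c = ⊤ := eq_top_iff.2 fun z _ => hc z
      have hcase : ∀ a b : Multiplicative (ZMod 2), a ≠ 1 → b ≠ 1 → b * a⁻¹ = 1 := by decide
      have hc1 : χ c ≠ 1 := by
        intro e
        obtain ⟨m, hm⟩ := hc y
        exact hy1 (by rw [← hm]; exact (map_zpow χ c m).trans (by rw [e, one_zpow]))
      obtain ⟨k, hk⟩ := hχ (c * y⁻¹) (by rw [map_mul, map_inv]; exact hcase _ _ hy1 hc1)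
      rw [V.parity_of_generator H hc' hy (by rw [← hk, inv_mul_cancel_right]), hd, ht,
        ← pow_val_add (by norm_num), ← add_assoc, CharTwo.add_self_eq_zero, zero_add]

end SwitchSignExists

end

noncomputable section

/-! ### Products of finite `G`-sets -/

namespace FinGSet

variable {G : Type} [Group G]

/-! Let `B_n` be the box power of `M` over `R` with `n + 2` factors. It is a bimodule through its
outer factors, hence a right module over the enveloping algebra `M^e`. The alternating sums of the
inner multiplications make `B` a resolution of `M`: appending a unit, `x ↦ x ⊗ 1`, is a contraction
up to sign (`Alg.inner_succ_barS`), and exactness only concerns the underlying graded Mackey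
functors.

The resolution `B` is flat. Its terms have the form `X □_R M`, where `X` has one factor fewer. In a
product `(X □_R M) □_{M^e} N` the last factor `M` can be absorbed into `N`, and what remains is `N
□_M X`, with `N` regarded as a right `M`-module through `M^op` (`BiMod.unstep`,
`BiMod.restep_unstep`). Moreover `N □_M (X □_R M)` embeds naturally into `(N □_M X) □_R M`, and `N
□_M M` into `N`. By induction on the number of factors, flatness of `M` over `R` gives flatness of
every `X` as a left `M`-module and then of every `B_n` over `M^e` (`Alg.bar_left_isFlat`,
`BiMod.step_rr_isFlat`).

A flat resolution computes `Tor`. A projective resolution maps to `B` over the identity of `M`, and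
this chain map stays a quasi-isomorphism after the box product with any left module `N`. The proof
is an induction on the degree of the mapping cone, for all `N` at once (`RMod.Res.Lift.coneExact`).
For free `N` the box product is exact. In general `N` is covered by a free module `F` with kernel
`K`. Since both resolutions are flat (projective modules being retracts of free ones), the cones for
`K`, `F` and `N` form a short exact sequence, and exactness for `K` in degree `n` gives exactness
for `N` in degree `n + 1`. The induction starts with right exactness.

For `N = ᵍM` the product `B_q □_{M^e} ᵍM` is the box power with `q + 1` factors, through `x ↦ (x ⊗
1) ⊗ 1` (`BiMod.cyc`). Under this identification the last face of the bar resolution, which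
multiplies by the appended unit, gives `z ⊗ 1`. Moving the last factor of `z` across the box product
and back through the other side is exactly the rotation followed by the action of `g`
(`BiMod.cyc_rot`). Hence the Hochschild complex is isomorphic to `B □_{M^e} ᵍM` (`Alg.cycHom`).

Naturality is uniqueness up to homotopy of lifts. For a lift of `φ` to projective resolutions, the
two ways from the resolution of `M` to the bar resolution of `M'` are both lifts of `φ` with
projective source, so they induce the same map on homology (`RMod.Res.Lift.homologyMap_eq`).

The homological algebra rests on free modules on cells `(α, X)`, with values `A_{γ - α}(T × X)`. The
transfer of the unit along the diagonal of `X` is a universal element (`GrGreen.free_eq`), which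
yields projectivity, enough projectives and a formula for the box product with a free module. All
signs are handled by expanding with bimultiplicativity and cancelling products `σ(α, β) σ(β, α)`.
Several comparison maps are provided with a one-sided inverse only, which is all that injectivity
and exactness arguments need. -/

theorem prod_el_ext {X Y : FinGSet G} {v w : (prod X Y).El} (h₁ : fst X Y v = fst X Y w)
    (h₂ : snd X Y v = snd X Y w) : v = w := by
  obtain ⟨_, _, hu⟩ := prod_isProd X Y (fst X Y w) (snd X Y w)
  rw [hu v ⟨h₁, h₂⟩, hu w ⟨rfl, rfl⟩]

/-- The map into a product with given components. -/
def pair {V X Y : FinGSet G} (x : Hom V X) (y : Hom V Y) : Hom V (prod X Y) :=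
  Classical.choose ((prod_isProd X Y).exists_lift x y)

theorem fst_pair {V X Y : FinGSet G} (x : Hom V X) (y : Hom V Y) (v : V.El) :
    fst X Y (pair x y v) = x v :=
  (Classical.choose_spec ((prod_isProd X Y).exists_lift x y)).1 v

theorem snd_pair {V X Y : FinGSet G} (x : Hom V X) (y : Hom V Y) (v : V.El) :
    snd X Y (pair x y v) = y v :=
  (Classical.choose_spec ((prod_isProd X Y).exists_lift x y)).2 v

/-- The map `k × X`. -/
def prodMap {T T' : FinGSet G} (k : Hom T T') (X : FinGSet G) : Hom (prod T X) (prod T' X) :=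
  pair (k.comp (fst T X)) (snd T X)

theorem fst_prodMap {T T' : FinGSet G} (k : Hom T T') (X : FinGSet G) (w : (prod T X).El) :
    fst T' X (prodMap k X w) = k (fst T X w) := fst_pair _ _ w

theorem snd_prodMap {T T' : FinGSet G} (k : Hom T T') (X : FinGSet G) (w : (prod T X).El) :
    snd T' X (prodMap k X w) = snd T X w := snd_pair _ _ w

theorem prodMap_id (T X : FinGSet G) : prodMap (idHom T) X = idHom (prod T X) :=
  MulActionHom.ext fun w => prod_el_ext (fst_prodMap _ _ w) (snd_prodMap _ _ w)

theorem prodMap_comp {T T' T'' : FinGSet G} (k : Hom T T') (l : Hom T' T'') (X : FinGSet G) :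
    prodMap (l.comp k) X = (prodMap l X).comp (prodMap k X) :=
  MulActionHom.ext fun w => prod_el_ext
    ((fst_prodMap _ _ w).trans (((fst_prodMap l X _).trans (congrArg l (fst_prodMap k X w))).symm))
    ((snd_prodMap _ _ w).trans (((snd_prodMap l X _).trans (snd_prodMap k X w)).symm))

/-- Together with `IsDisjUnion.prodMap` this makes `T ↦ N(T × S)` a Mackey functor: its base change
and additivity are those of `N` along products with `S`. -/
theorem IsPullbackSq.prodMap {W X Z Y : FinGSet G} {a : Hom W X} {b : Hom W Z} {f : Hom X Y}
    {k : Hom Z Y} (h : IsPullbackSq a b f k) (S : FinGSet G) :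
    IsPullbackSq (prodMap a S) (prodMap b S) (prodMap f S) (prodMap k S) := by
  refine ⟨fun w => prod_el_ext ?_ ?_, fun x z e => ?_⟩
  · rw [fst_prodMap, fst_prodMap, fst_prodMap, fst_prodMap, h.1]
  · rw [snd_prodMap, snd_prodMap, snd_prodMap, snd_prodMap]
  · have e₁ := congrArg (fst Y S) e
    have e₂ := congrArg (snd Y S) e
    rw [fst_prodMap, fst_prodMap] at e₁
    rw [snd_prodMap, snd_prodMap] at e₂
    obtain ⟨w, hw, hu⟩ := h.2 _ _ e₁
    obtain ⟨v, hv, hvu⟩ := prod_isProd W S w (snd X S x)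
    refine ⟨v, ⟨prod_el_ext ?_ ?_, prod_el_ext ?_ ?_⟩, fun y hy => hvu y ⟨hu _ ⟨?_, ?_⟩, ?_⟩⟩
    · rw [fst_prodMap, hv.1, hw.1]
    · rw [snd_prodMap, hv.2]
    · rw [fst_prodMap, hv.1, hw.2]
    · rw [snd_prodMap, hv.2, e₂]
    · rw [← fst_prodMap, hy.1]
    · rw [← fst_prodMap, hy.2]
    · rw [← hy.1, snd_prodMap]

theorem IsDisjUnion.prodMap {X Y Z : FinGSet G} {i : Hom X Z} {j : Hom Y Z} (h : IsDisjUnion i j)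
    (S : FinGSet G) : IsDisjUnion (prodMap i S) (prodMap j S) := by
  have key₁ : ∀ s, fst Z S (Sum.elim (FinGSet.prodMap i S) (FinGSet.prodMap j S) s) =
      Sum.elim i j (Sum.map (fst X S) (fst Y S) s) := by
    rintro (s | s)
    · exact fst_prodMap i S s
    · exact fst_prodMap j S s
  have key₂ : ∀ s, snd Z S (Sum.elim (FinGSet.prodMap i S) (FinGSet.prodMap j S) s) =
      Sum.elim (snd X S) (snd Y S) s := by
    rintro (s | s)
    · exact snd_prodMap i S s
    · exact snd_prodMap j S s
  constructor
  · intro s t e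
    have e₁ := h.1 ((key₁ s).symm.trans ((congrArg _ e).trans (key₁ t)))
    have e₂ := (key₂ s).symm.trans ((congrArg _ e).trans (key₂ t))
    rcases s with s | s <;> rcases t with t | t
    · exact congrArg Sum.inl (prod_el_ext (Sum.inl_injective e₁) e₂)
    · cases e₁
    · cases e₁
    · exact congrArg Sum.inr (prod_el_ext (Sum.inr_injective e₁) e₂)
  · intro w
    obtain ⟨x | y, hx⟩ := h.2 (fst Z S w)
    · obtain ⟨v, hv, _⟩ := prod_isProd X S x (snd Z S w)
      exact ⟨Sum.inl v, prod_el_ext ((key₁ _).trans ((congrArg i hv.1).trans hx))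
        ((key₂ _).trans hv.2)⟩
    · obtain ⟨v, hv, _⟩ := prod_isProd Y S y (snd Z S w)
      exact ⟨Sum.inr v, prod_el_ext ((key₁ _).trans ((congrArg j hv.1).trans hx))
        ((key₂ _).trans hv.2)⟩

/-- A product with `X` is a pullback along the projection. Base change along this square gives
Frobenius reciprocity for the shifted pairings, and it lets the transfer along `T × X → T` commute
with restriction in `T`. -/
theorem isPullbackSq_fst {T T' : FinGSet G} (k : Hom T T') (X : FinGSet G) :
    IsPullbackSq (fst T X) (prodMap k X) k (fst T' X) := by
  refine ⟨fun w => (fst_prodMap k X w).symm, fun x z e => ?_⟩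
  obtain ⟨w, hw, hu⟩ := prod_isProd T X x (snd T' X z)
  refine ⟨w, ⟨hw.1, prod_el_ext ?_ ?_⟩, fun y hy => hu y ⟨hy.1, ?_⟩⟩
  · rw [fst_prodMap, hw.1, e]
  · rw [snd_prodMap, hw.2]
  · rw [← hy.2, snd_prodMap]

/-- The diagonal. -/
def diag (X : FinGSet G) : Hom X (prod X X) := pair (idHom X) (idHom X)

/-- The graph `w ↦ (w, snd w)` of the second projection. -/
def sndGraph (T X : FinGSet G) : Hom (prod T X) (prod (prod T X) X) :=
  pair (idHom _) (snd T X)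

/-- A point `(t, x, x')` lies over the diagonal of `X` exactly when `x = x'`, that is, when it lies
on the graph. By base change, the universal element `tr_diag 1` therefore restricts along `snd × X`
to the transfer of `1` along the graph. -/
theorem sndGraph_square (T X : FinGSet G) :
    IsPullbackSq (snd T X) (sndGraph T X) (diag X) (prodMap (snd T X) X) := by
  refine ⟨fun w => prod_el_ext ?_ ?_, fun x z e => ?_⟩
  · rw [fst_prodMap, sndGraph, fst_pair, diag, fst_pair]
    rfl
  · rw [snd_prodMap, sndGraph, snd_pair, diag, snd_pair]
    rfl
  · have e₁ := congrArg (fst X X) e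
    have e₂ := congrArg (snd X X) e
    rw [fst_prodMap, diag, fst_pair] at e₁
    rw [snd_prodMap, diag, snd_pair] at e₂
    refine ⟨fst _ _ z, ⟨e₁.symm, prod_el_ext (fst_pair _ _ _) ((snd_pair _ _ _).trans ?_)⟩,
      fun y hy => ?_⟩
    · exact e₁.symm.trans e₂
    · rw [← hy.2, sndGraph, fst_pair]
      rfl

theorem fst_comp_sndGraph (T X : FinGSet G) :
    (fst (prod T X) X).comp (sndGraph T X) = idHom _ :=
  MulActionHom.ext fun w => fst_pair _ _ w

/-- After `(t, x) ↦ (t, x, x)` one may forget either copy of `x`. This and `fst_comp_sndGraph` are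
the two cancellations in the Yoneda argument of `GrGreen.free_eq`. -/
theorem prodMap_fst_comp_sndGraph (T X : FinGSet G) :
    (prodMap (fst T X) X).comp (sndGraph T X) = idHom _ :=
  MulActionHom.ext fun w => prod_el_ext
    ((fst_prodMap _ _ _).trans (congrArg (fst T X) (fst_pair _ _ w)))
    ((snd_prodMap _ _ _).trans (snd_pair _ _ w))

theorem fst_comp_diag (X : FinGSet G) : (fst X X).comp (diag X) = idHom _ :=
  MulActionHom.ext fun w => fst_pair _ _ w

theorem snd_comp_diag (X : FinGSet G) : (snd X X).comp (diag X) = idHom _ :=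
  MulActionHom.ext fun w => snd_pair _ _ w

end FinGSet

/-! ### Maps of graded Mackey functors -/

section Maps

variable {Γ G : Type} [Group G]

theorem Mackey.Hom.ext {M N : Mackey.{u} G} {f k : Mackey.Hom M N}
    (h : ∀ X (m : M.obj X), f.app X m = k.app X m) : f = k := by
  cases f
  cases k
  congr
  funext X
  exact AddMonoidHom.ext (h X)

theorem GrHom.ext {A B : GrMackey.{u} Γ G} {f k : GrHom A B}
    (h : ∀ α X (m : (A α).obj X), (f α).app X m = (k α).app X m) : f = k :=
  funext fun α => Mackey.Hom.ext (h α)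

theorem GrHom.comp_app {A B C : GrMackey.{u} Γ G} (f : GrHom B C) (k : GrHom A B) {α : Γ}
    {X : FinGSet G} (a : (A α).obj X) :
    (f.comp k α).app X a = (f α).app X ((k α).app X a) := rfl

/-- The difference of two maps. -/
def GrHom.sub {A B : GrMackey.{u} Γ G} (f k : GrHom A B) : GrHom A B := fun α =>
  { app := fun X => (f α).app X - (k α).app X
    app_res := fun h m => by
      simp only [AddMonoidHom.sub_apply, Mackey.Hom.app_res, map_sub]
    app_tr := fun h m => by
      simp only [AddMonoidHom.sub_apply, Mackey.Hom.app_tr, map_sub] }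

theorem GrHom.sub_app {A B : GrMackey.{u} Γ G} (f k : GrHom A B) {α : Γ} {X : FinGSet G}
    (a : (A α).obj X) : (f.sub k α).app X a = (f α).app X a - (k α).app X a := rfl

/-- The inverse of an isomorphism. -/
def GrHom.IsIso.inv {A B : GrMackey.{u} Γ G} {f : GrHom A B} (hf : f.IsIso) : GrHom B A :=
  fun α =>
  { app := fun X => (AddEquiv.ofBijective ((f α).app X) (hf α X)).symm.toAddMonoidHom
    app_res := fun {X Y} h m => by
      apply (hf α X).1
      refine (AddEquiv.apply_symm_apply (AddEquiv.ofBijective ((f α).app X) (hf α X)) _).trans ?_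
      rw [(f α).app_res]
      exact congrArg _ (AddEquiv.apply_symm_apply
        (AddEquiv.ofBijective ((f α).app Y) (hf α Y)) m).symm
    app_tr := fun {X Y} h m => by
      apply (hf α Y).1
      refine (AddEquiv.apply_symm_apply (AddEquiv.ofBijective ((f α).app Y) (hf α Y)) _).trans ?_
      rw [(f α).app_tr]
      exact congrArg _ (AddEquiv.apply_symm_apply
        (AddEquiv.ofBijective ((f α).app X) (hf α X)) m).symm }

theorem GrHom.IsIso.app_inv {A B : GrMackey.{u} Γ G} {f : GrHom A B} (hf : f.IsIso) {α : Γ}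
    {X : FinGSet G} (b : (B α).obj X) : (f α).app X ((hf.inv α).app X b) = b :=
  AddEquiv.apply_symm_apply (AddEquiv.ofBijective ((f α).app X) (hf α X)) b

theorem GrHom.IsIso.inv_isIso {A B : GrMackey.{u} Γ G} {f : GrHom A B} (hf : f.IsIso) :
    hf.inv.IsIso := fun α X =>
  (AddEquiv.ofBijective ((f α).app X) (hf α X)).symm.bijective

theorem GrHom.IsIso.comp {A B C : GrMackey.{u} Γ G} {f : GrHom B C} {k : GrHom A B}
    (hf : f.IsIso) (hk : k.IsIso) : (f.comp k).IsIso :=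
  fun α X => (hf α X).comp (hk α X)

end Maps

/-! ### Units in degrees that are equal to zero -/

section Degree

variable {Γ G : Type} [AddCommGroup Γ] [Group G]

/-- The unit of a graded Green functor in a degree that is equal to `0`. -/
def GrGreen.oneD (A : GrGreen.{u} Γ G) {κ : Γ} (h : 0 = κ) (X : FinGSet G) : (A.C κ).obj X :=
  h ▸ A.one X

/-- The generator of a free module has a coefficient in degree `α - α`, which equals `0` only
propositionally. The unit is transported to that degree, and this lemma and the next two carry the
unit laws along. -/
theorem GrGreen.res_oneD (A : GrGreen.{u} Γ G) {κ : Γ} (h : 0 = κ) {X Y : FinGSet G}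
    (k : FinGSet.Hom X Y) : (A.C κ).res k (A.oneD h Y) = A.oneD h X := by
  subst h
  exact A.res_one k

theorem GrGreen.mul_oneD (A : GrGreen.{u} Γ G) {κ α : Γ} (h : 0 = κ) (h' : α + κ = α)
    {X : FinGSet G} (a : (A.C α).obj X) : A.mul.f h' a (A.oneD h X) = a := by
  subst h
  exact A.mul_one h' a

theorem LMod.oneD_act {A : GrGreen.{u} Γ G} (P : LMod A) {κ α : Γ} (h : 0 = κ)
    (h' : κ + α = α) {X : FinGSet G} (x : (P.C α).obj X) : P.act.f h' (A.oneD h X) x = x := by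
  subst h
  exact P.one_act h' x

end Degree

end

noncomputable section

/-! ### Free modules -/

section Free

variable {Γ G : Type} [AddCommGroup Γ] [Group G]

/-- A family of cells `(α, X)` with `α ∈ Γ` and `X` a finite `G`-set. -/
structure CellFamily (Γ G : Type) [Group G] where
  I : Type u
  deg : I → Γ
  cell : I → FinGSet G

variable (E : CellFamily.{u} Γ G)

/-- The graded Mackey functor `T ↦ ⨁ᵢ N_{γ - αᵢ}(T × Xᵢ)`. -/
def shiftSum (N : GrMackey.{u} Γ G) : GrMackey.{u} Γ G := fun γ =>
  { obj := fun T => Π₀ i : E.I, (N (γ - E.deg i)).obj (FinGSet.prod T (E.cell i))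
    res := fun k => DFinsupp.mapRange.addMonoidHom fun i =>
      (N (γ - E.deg i)).res (FinGSet.prodMap k (E.cell i))
    tr := fun k => DFinsupp.mapRange.addMonoidHom fun i =>
      (N (γ - E.deg i)).tr (FinGSet.prodMap k (E.cell i))
    res_id := fun m => DFinsupp.ext fun i => by
      rw [DFinsupp.mapRange.addMonoidHom_apply, DFinsupp.mapRange_apply, FinGSet.prodMap_id,
        (N _).res_id]
    tr_id := fun m => DFinsupp.ext fun i => by
      rw [DFinsupp.mapRange.addMonoidHom_apply, DFinsupp.mapRange_apply, FinGSet.prodMap_id,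
        (N _).tr_id]
    res_comp := fun f k m => DFinsupp.ext fun i => by
      simp only [DFinsupp.mapRange.addMonoidHom_apply, DFinsupp.mapRange_apply]
      rw [FinGSet.prodMap_comp, (N _).res_comp]
    tr_comp := fun f k m => DFinsupp.ext fun i => by
      simp only [DFinsupp.mapRange.addMonoidHom_apply, DFinsupp.mapRange_apply]
      rw [FinGSet.prodMap_comp, (N _).tr_comp]
    res_tr := fun a b f k h m => DFinsupp.ext fun i => by
      simp only [DFinsupp.mapRange.addMonoidHom_apply, DFinsupp.mapRange_apply]
      rw [(N _).res_tr _ _ _ _ (h.prodMap _)]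
    tr_res_add := fun i j h m => DFinsupp.ext fun s => by
      simp only [DFinsupp.mapRange.addMonoidHom_apply, DFinsupp.mapRange_apply,
        DFinsupp.add_apply]
      rw [(N _).tr_res_add _ _ (h.prodMap _)] }

variable {E}

/-- The projection to a summand. -/
def shiftProj (N : GrMackey.{u} Γ G) (γ : Γ) (T : FinGSet G) (i : E.I) :
    (shiftSum E N γ).obj T →+ (N (γ - E.deg i)).obj (FinGSet.prod T (E.cell i)) :=
  DFinsupp.evalAddMonoidHom i

theorem shiftProj_res {N : GrMackey.{u} Γ G} {γ : Γ} {S T : FinGSet G} (k : FinGSet.Hom S T)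
    (m : (shiftSum E N γ).obj T) (i : E.I) : shiftProj N γ S i ((shiftSum E N γ).res k m) =
      (N (γ - E.deg i)).res (FinGSet.prodMap k (E.cell i)) (shiftProj N γ T i m) := rfl

theorem shiftProj_tr {N : GrMackey.{u} Γ G} {γ : Γ} {S T : FinGSet G} (k : FinGSet.Hom S T)
    (m : (shiftSum E N γ).obj S) (i : E.I) : shiftProj N γ T i ((shiftSum E N γ).tr k m) =
      (N (γ - E.deg i)).tr (FinGSet.prodMap k (E.cell i)) (shiftProj N γ S i m) := rfl

theorem shiftSum_ext {N : GrMackey.{u} Γ G} {γ : Γ} {T : FinGSet G}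
    {m n : (shiftSum E N γ).obj T} (h : ∀ i, shiftProj N γ T i m = shiftProj N γ T i n) : m = n :=
  DFinsupp.ext h

/-- A map of shifted sums given by additive maps on the summands. -/
def shiftMap {N P : GrMackey.{u} Γ G} {γ δ : Γ} {S T : FinGSet G}
    (f : ∀ i, (N (γ - E.deg i)).obj (FinGSet.prod S (E.cell i)) →+
      (P (δ - E.deg i)).obj (FinGSet.prod T (E.cell i))) :
    (shiftSum E N γ).obj S →+ (shiftSum E P δ).obj T := DFinsupp.mapRange.addMonoidHom f

theorem shiftProj_map {N P : GrMackey.{u} Γ G} {γ δ : Γ} {S T : FinGSet G}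
    (f : ∀ i, (N (γ - E.deg i)).obj (FinGSet.prod S (E.cell i)) →+
      (P (δ - E.deg i)).obj (FinGSet.prod T (E.cell i))) (m : (shiftSum E N γ).obj S) (i : E.I) :
    shiftProj P δ T i (shiftMap f m) = f i (shiftProj N γ S i m) := rfl

open Classical in
/-- The inclusion of a summand. -/
def shiftSingle (N : GrMackey.{u} Γ G) (γ : Γ) (T : FinGSet G) (i : E.I) :
    (N (γ - E.deg i)).obj (FinGSet.prod T (E.cell i)) →+ (shiftSum E N γ).obj T :=
  DFinsupp.singleAddHom (fun i => (N (γ - E.deg i)).obj (FinGSet.prod T (E.cell i))) i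

theorem shiftSum_ind {N : GrMackey.{u} Γ G} {γ : Γ} {T : FinGSet G}
    {P : (shiftSum E N γ).obj T → Prop} (m : (shiftSum E N γ).obj T) (h0 : P 0)
    (hs : ∀ i x, P (shiftSingle N γ T i x)) (hadd : ∀ x y, P x → P y → P (x + y)) : P m := by
  classical
  refine DFinsupp.induction m h0 fun i x f _ _ hf => hadd _ _ ?_ hf
  exact hs i x

open Classical in
/-- Additive maps out of the values of `shiftSum`. -/
def shiftLift {N : GrMackey.{u} Γ G} {γ : Γ} {T : FinGSet G} {B : Type*} [AddCommGroup B]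
    (f : ∀ i, (N (γ - E.deg i)).obj (FinGSet.prod T (E.cell i)) →+ B) :
    (shiftSum E N γ).obj T →+ B := DFinsupp.liftAddHom f

theorem shiftLift_single {N : GrMackey.{u} Γ G} {γ : Γ} {T : FinGSet G} {B : Type*}
    [AddCommGroup B] (f : ∀ i, (N (γ - E.deg i)).obj (FinGSet.prod T (E.cell i)) →+ B) (i : E.I)
    (x : (N (γ - E.deg i)).obj (FinGSet.prod T (E.cell i))) :
    shiftLift f (shiftSingle N γ T i x) = f i x := by
  classical
  exact DFinsupp.liftAddHom_apply_single f i x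

open Classical in
theorem shiftProj_single {N : GrMackey.{u} Γ G} {γ : Γ} {T : FinGSet G} (i j : E.I)
    (x : (N (γ - E.deg i)).obj (FinGSet.prod T (E.cell i))) :
    shiftProj N γ T j (shiftSingle N γ T i x) =
      if h : i = j then Eq.recOn (motive := fun j _ =>
        (N (γ - E.deg j)).obj (FinGSet.prod T (E.cell j))) h x else 0 :=
  DFinsupp.single_apply (β := fun i => (N (γ - E.deg i)).obj (FinGSet.prod T (E.cell i)))

/-- A family of maps that commutes with the inclusions of the summands and is given by additive
maps on the summands. -/
theorem shift_map_single {N P : GrMackey.{u} Γ G} {γ δ : Γ} {S T : FinGSet G} (i : E.I)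
    (x : (N (γ - E.deg i)).obj (FinGSet.prod S (E.cell i)))
    (f : ∀ i, (N (γ - E.deg i)).obj (FinGSet.prod S (E.cell i)) →+
      (P (δ - E.deg i)).obj (FinGSet.prod T (E.cell i)))
    (y : (shiftSum E P δ).obj T)
    (h : ∀ j, shiftProj P δ T j y = f j (shiftProj N γ S j (shiftSingle N γ S i x))) :
    y = shiftSingle P δ T i (f i x) := by
  classical
  refine shiftSum_ext fun j => ?_
  rw [h, shiftProj_single, shiftProj_single]
  by_cases e : i = j
  · subst e
    rw [dif_pos rfl, dif_pos rfl]
  · rw [dif_neg e, dif_neg e, map_zero]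

theorem shiftSingle_res {N : GrMackey.{u} Γ G} {γ : Γ} {S T : FinGSet G} (k : FinGSet.Hom S T)
    (i : E.I) (x : (N (γ - E.deg i)).obj (FinGSet.prod T (E.cell i))) :
    (shiftSum E N γ).res k (shiftSingle N γ T i x) =
      shiftSingle N γ S i ((N _).res (FinGSet.prodMap k _) x) :=
  shift_map_single i x (fun i => (N (γ - E.deg i)).res (FinGSet.prodMap k (E.cell i))) _
    (shiftProj_res k _)

theorem shiftSingle_tr {N : GrMackey.{u} Γ G} {γ : Γ} {S T : FinGSet G} (k : FinGSet.Hom S T)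
    (i : E.I) (x : (N (γ - E.deg i)).obj (FinGSet.prod S (E.cell i))) :
    (shiftSum E N γ).tr k (shiftSingle N γ S i x) =
      shiftSingle N γ T i ((N _).tr (FinGSet.prodMap k _) x) :=
  shift_map_single i x (fun i => (N (γ - E.deg i)).tr (FinGSet.prodMap k (E.cell i))) _
    (shiftProj_tr k _)

/-- The map of shifted sums induced by a map of graded Mackey functors. -/
def GrHom.shift {N P : GrMackey.{u} Γ G} (f : GrHom N P) : GrHom (shiftSum E N) (shiftSum E P) :=
  fun γ =>
  { app := fun T => shiftMap fun i => (f (γ - E.deg i)).app _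
    app_res := fun k m => shiftSum_ext fun i => by
      rw [shiftProj_map, shiftProj_res, shiftProj_res, shiftProj_map, (f _).app_res]
    app_tr := fun k m => shiftSum_ext fun i => by
      rw [shiftProj_map, shiftProj_tr, shiftProj_tr, shiftProj_map, (f _).app_tr] }

theorem GrHom.shift_apply {N P : GrMackey.{u} Γ G} (f : GrHom N P) {γ : Γ} {T : FinGSet G}
    (m : (shiftSum E N γ).obj T) (i : E.I) : shiftProj P γ T i ((f.shift γ).app T m) =
      (f (γ - E.deg i)).app _ (shiftProj N γ T i m) := shiftProj_map _ m i

theorem GrHom.shift_single {N P : GrMackey.{u} Γ G} (f : GrHom N P) {γ : Γ} {T : FinGSet G}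
    (i : E.I) (x : (N (γ - E.deg i)).obj (FinGSet.prod T (E.cell i))) :
    (f.shift γ).app T (shiftSingle N γ T i x) =
      shiftSingle P γ T i ((f (γ - E.deg i)).app _ x) :=
  shift_map_single i x (fun i => (f (γ - E.deg i)).app _) _ (f.shift_apply _)

/-- Preimages are used only on the finite support of `w` and are replaced by zero elsewhere, so that
they form an element of the direct sum. -/
theorem GrHom.shift_lift {N P : GrMackey.{u} Γ G} (f : GrHom N P) {γ : Γ} {T : FinGSet G}
    (w : (shiftSum E P γ).obj T)
    (h : ∀ i, ∃ x, (f (γ - E.deg i)).app _ x = shiftProj P γ T i w) :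
    ∃ m, (f.shift γ).app T m = w := by
  classical
  choose x hx using h
  let v : Π₀ i : E.I, (P (γ - E.deg i)).obj (FinGSet.prod T (E.cell i)) := w
  let m : Π₀ i : E.I, (N (γ - E.deg i)).obj (FinGSet.prod T (E.cell i)) :=
    DFinsupp.mk v.support fun i => x i
  refine ⟨m, shiftSum_ext fun i => ?_⟩
  refine (f.shift_apply (E := E) (γ := γ) (T := T) m i).trans ?_
  change (f (γ - E.deg i)).app _ (m i) = v i
  by_cases hi : i ∈ v.support
  · rw [show m i = x i from DFinsupp.mk_of_mem hi]
    exact hx i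
  · rw [show m i = 0 from DFinsupp.mk_of_notMem hi, map_zero, DFinsupp.notMem_support_iff.1 hi]

theorem add_sub_deg {α β γ : Γ} (h : α + β = γ) (δ : Γ) : α + (β - δ) = γ - δ := by
  rw [← add_sub_assoc, h]

namespace Pairing

variable {N P Q : GrMackey.{u} Γ G}

/-- The pairing `(n, p) ↦ (n pᵢ)ᵢ` with values in a shifted sum. -/
def shift (φ : Pairing N P Q) : Pairing N (shiftSum E P) (shiftSum E Q) where
  f {α β γ} h {T} := addHom₂ (fun n p => shiftMap (fun i =>
      φ.f (add_sub_deg h (E.deg i)) ((N α).res (FinGSet.fst T (E.cell i)) n)) p)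
    (fun n n' p => shiftSum_ext fun i => by
      simp only [map_add, shiftProj_map, AddMonoidHom.add_apply])
    (fun n p p' => map_add _ p p')
  res {α β γ} h S T k n p := shiftSum_ext fun i => by
    rw [shiftProj_res]
    refine (congrArg ((Q (γ - E.deg i)).res _) (shiftProj_map ..)).trans
      (Eq.trans ?_ (shiftProj_map ..).symm)
    have e : (FinGSet.fst T (E.cell i)).comp (FinGSet.prodMap k (E.cell i)) =
      k.comp (FinGSet.fst S (E.cell i)) :=
      (MulActionHom.ext (FinGSet.isPullbackSq_fst k (E.cell i)).1).symm
    rw [shiftProj_res, φ.res, ← (N α).res_comp, ← (N α).res_comp, e]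
  tr_left {α β γ} h S T k n p := shiftSum_ext fun i => by
    rw [shiftProj_tr]
    refine (shiftProj_map ..).trans (Eq.trans ?_
      (congrArg ((Q (γ - E.deg i)).tr _) (shiftProj_map ..)).symm)
    rw [shiftProj_res, (N α).res_tr _ _ _ _ (FinGSet.isPullbackSq_fst k (E.cell i)), φ.tr_left]
  tr_right {α β γ} h S T k n p := shiftSum_ext fun i => by
    rw [shiftProj_tr]
    refine (shiftProj_map ..).trans (Eq.trans ?_
      (congrArg ((Q (γ - E.deg i)).tr _) (shiftProj_map ..)).symm)
    have e : (FinGSet.fst T (E.cell i)).comp (FinGSet.prodMap k (E.cell i)) =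
      k.comp (FinGSet.fst S (E.cell i)) :=
      (MulActionHom.ext (FinGSet.isPullbackSq_fst k (E.cell i)).1).symm
    rw [shiftProj_tr, φ.tr_right, ← (N α).res_comp, ← (N α).res_comp, e]

theorem shift_apply (φ : Pairing N P Q) {α β γ : Γ} (h : α + β = γ) {T : FinGSet G}
    (n : (N α).obj T) (p : (shiftSum E P β).obj T) (i : E.I) :
    shiftProj Q γ T i ((φ.shift (E := E)).f h n p) = φ.f (add_sub_deg h (E.deg i))
      ((N α).res (FinGSet.fst T (E.cell i)) n) (shiftProj P β T i p) :=
  shiftProj_map ..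

theorem shift_single (φ : Pairing N P Q) {α β γ : Γ} (h : α + β = γ) {T : FinGSet G}
    (n : (N α).obj T) (i : E.I) (x : (P (β - E.deg i)).obj (FinGSet.prod T (E.cell i))) :
    (φ.shift (E := E)).f h n (shiftSingle P β T i x) = shiftSingle Q γ T i
      (φ.f (add_sub_deg h (E.deg i)) ((N α).res (FinGSet.fst T (E.cell i)) n) x) :=
  shift_map_single i x (fun i => φ.f (add_sub_deg h (E.deg i))
    ((N α).res (FinGSet.fst T (E.cell i)) n)) _ (φ.shift_apply h n _)

end Pairing

variable (E) in
/-- The free left module `T ↦ ⨁ᵢ A_{γ - αᵢ}(T × Xᵢ)` on a family of cells. -/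
abbrev GrGreen.free (A : GrGreen.{u} Γ G) : LMod A where
  C := shiftSum E A.C
  act := A.mul.shift
  one_act h T n := shiftSum_ext fun i => by
    rw [Pairing.shift_apply, A.res_one, A.one_mul]
  mul_act {α β γ δ ε ζ} h₁ h₂ h₃ h₄ T a b n := shiftSum_ext fun i => by
    rw [Pairing.shift_apply, Pairing.shift_apply, Pairing.shift_apply, A.mul.res,
      A.mul_assoc _ h₂ _ _]

namespace GrGreen

variable (A : GrGreen.{u} Γ G)

/-- The generators of the free module. -/
def freeGen (i : E.I) : (shiftSum E A.C (E.deg i)).obj (E.cell i) :=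
  shiftSingle A.C _ _ i ((A.C _).tr (FinGSet.diag (E.cell i)) (A.oneD (sub_self _).symm _))

/-- The Yoneda lemma for cells. Restricted along the second projection, the generator becomes the
transfer of `1` along the graph of that projection. By Frobenius reciprocity its product with `a` is
the transfer of `a` along the graph, and the final transfer cancels the graph. Hence every element
of a free module is obtained from the generators by restriction, action, transfer and sums. -/
theorem free_eq {γ : Γ} {T : FinGSet G} (i : E.I)
    (a : (A.C (γ - E.deg i)).obj (FinGSet.prod T (E.cell i))) :
    (shiftSum E A.C γ).tr (FinGSet.fst T (E.cell i)) ((A.free E).act.f (sub_add_cancel _ _) a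
      ((shiftSum E A.C (E.deg i)).res (FinGSet.snd T (E.cell i)) (A.freeGen i))) =
      shiftSingle A.C γ T i a := by
  change (shiftSum E A.C γ).tr _ (A.mul.shift.f _ a _) = _
  rw [freeGen, shiftSingle_res, (A.C _).res_tr _ _ _ _ (FinGSet.sndGraph_square T (E.cell i)),
    A.res_oneD, Pairing.shift_single, A.mul.tr_right, ← (A.C _).res_comp,
    FinGSet.fst_comp_sndGraph, (A.C _).res_id, A.mul_oneD, shiftSingle_tr, ← (A.C _).tr_comp,
    FinGSet.prodMap_fst_comp_sndGraph, (A.C _).tr_id]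

end GrGreen

variable {A : GrGreen.{u} Γ G}

/-- The map from a free module that takes prescribed values on the generators. -/
def LMod.ofGens (P : LMod A) (y : ∀ i : E.I, (P.C (E.deg i)).obj (E.cell i)) :
    GrHom (A.free E).C P.C := fun γ =>
  { app := fun T => shiftLift (N := A.C) fun i =>
      ((P.C γ).tr (FinGSet.fst T (E.cell i))).comp ((P.act.f (sub_add_cancel γ (E.deg i))).flip
        ((P.C _).res (FinGSet.snd T (E.cell i)) (y i)))
    app_res := fun {S T} k m => by
      change shiftLift _ ((shiftSum E A.C γ).res k m) = _
      induction m using shiftSum_ind with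
      | h0 => simp only [map_zero]
      | hs i x =>
        have e : (FinGSet.snd T (E.cell i)).comp (FinGSet.prodMap k (E.cell i)) =
          FinGSet.snd S (E.cell i) := MulActionHom.ext fun w => FinGSet.snd_prodMap _ _ w
        rw [shiftSingle_res, shiftLift_single, shiftLift_single]
        simp only [AddMonoidHom.comp_apply, AddMonoidHom.flip_apply]
        rw [(P.C γ).res_tr _ _ _ _ (FinGSet.isPullbackSq_fst k (E.cell i)).symm, P.act.res,
          ← (P.C _).res_comp, e]
      | hadd x y hx hy => simp only [map_add, hx, hy]
    app_tr := fun {S T} k m => by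
      change shiftLift _ ((shiftSum E A.C γ).tr k m) = _
      induction m using shiftSum_ind with
      | h0 => simp only [map_zero]
      | hs i x =>
        have e : (FinGSet.snd T (E.cell i)).comp (FinGSet.prodMap k (E.cell i)) =
          FinGSet.snd S (E.cell i) := MulActionHom.ext fun w => FinGSet.snd_prodMap _ _ w
        have e' : (FinGSet.fst T (E.cell i)).comp (FinGSet.prodMap k (E.cell i)) =
          k.comp (FinGSet.fst S (E.cell i)) := MulActionHom.ext fun w => FinGSet.fst_prodMap _ _ w
        rw [shiftSingle_tr, shiftLift_single, shiftLift_single]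
        simp only [AddMonoidHom.comp_apply, AddMonoidHom.flip_apply]
        rw [P.act.tr_left, ← (P.C _).res_comp, ← (P.C _).tr_comp, e, e', (P.C _).tr_comp]
      | hadd x y hx hy => simp only [map_add, hx, hy] }

theorem LMod.ofGens_single (P : LMod A) (y : ∀ i : E.I, (P.C (E.deg i)).obj (E.cell i))
    {γ : Γ} {T : FinGSet G} (i : E.I)
    (a : (A.C (γ - E.deg i)).obj (FinGSet.prod T (E.cell i))) :
    (P.ofGens y γ).app T (shiftSingle A.C γ T i a) = (P.C γ).tr (FinGSet.fst T (E.cell i))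
      (P.act.f (sub_add_cancel γ (E.deg i)) a
        ((P.C _).res (FinGSet.snd T (E.cell i)) (y i))) := shiftLift_single _ i a

theorem LMod.ofGens_semi (P : LMod A) (y : ∀ i : E.I, (P.C (E.deg i)).obj (E.cell i)) :
    Box.SemiL (GrHom.id A.C) (A.free E) P (P.ofGens y) := by
  intro α β γ h T a m
  change (P.ofGens y γ).app T (A.mul.shift.f h a m) = P.act.f h a _
  induction m using shiftSum_ind with
  | h0 => simp only [map_zero]
  | hs i x =>
    rw [Pairing.shift_single, P.ofGens_single, P.ofGens_single, P.act.tr_right,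
      P.mul_act _ _ h (sub_add_cancel β (E.deg i))]
  | hadd x y hx hy => simp only [map_add, hx, hy]

/-- The generator is a transfer along the diagonal, and both projections of the diagonal are the
identity, so the transfer and the restriction in the definition of `ofGens` disappear. -/
theorem LMod.ofGens_gen (P : LMod A) (y : ∀ i : E.I, (P.C (E.deg i)).obj (E.cell i)) (i : E.I) :
    (P.ofGens y (E.deg i)).app (E.cell i) (A.freeGen i) = y i := by
  rw [GrGreen.freeGen, P.ofGens_single, P.act.tr_left, ← (P.C _).res_comp, ← (P.C _).tr_comp,
    FinGSet.fst_comp_diag, FinGSet.snd_comp_diag, (P.C _).tr_id, (P.C _).res_id, P.oneD_act]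

/-- A linear map commutes with restrictions, transfers and the action, so `GrGreen.free_eq`
expresses its value on every summand through its value on the generator. -/
theorem LMod.free_hom_eq (P : LMod A) {f k : GrHom (A.free E).C P.C}
    (hf : Box.SemiL (GrHom.id A.C) (A.free E) P f) (hk : Box.SemiL (GrHom.id A.C) (A.free E) P k)
    (h : ∀ i : E.I, (f (E.deg i)).app (E.cell i) (A.freeGen i) =
      (k (E.deg i)).app (E.cell i) (A.freeGen i)) : f = k := by
  refine GrHom.ext fun γ T m => ?_
  change (shiftSum E A.C γ).obj T at m
  induction m using shiftSum_ind with
  | h0 => simp only [map_zero]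
  | hs i x =>
    have key : ∀ f : GrHom (A.free E).C P.C, Box.SemiL (GrHom.id A.C) (A.free E) P f →
        (f γ).app T (shiftSingle A.C γ T i x) = (P.C γ).tr (FinGSet.fst T (E.cell i))
          (P.act.f (sub_add_cancel γ (E.deg i)) x ((P.C _).res (FinGSet.snd T (E.cell i))
            ((f (E.deg i)).app (E.cell i) (A.freeGen i)))) := by
      intro f hf
      rw [← A.free_eq]
      refine ((f γ).app_tr _ _).trans (congrArg _ ((hf _ _ _).trans ?_))
      exact congrArg _ ((f _).app_res _ _)
    rw [key f hf, key k hk, h]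
  | hadd x y hx hy => rw [map_add, map_add, hx, hy]

/-! ### Box products with free modules -/

namespace Box

theorem shift_balanced (N : RMod A) :
    Balanced (N := N) (P := A.free E) (N.act.shift (E := E)) := by
  intro γ T α β δ ε ζ e e' e₁ e₂ n a p
  change (N.act.shift (E := E)).f e _ p = N.act.shift.f e' n (A.mul.shift.f e₂ a p)
  refine shiftSum_ext fun i => ?_
  rw [Pairing.shift_apply, Pairing.shift_apply, Pairing.shift_apply, N.act.res,
    ← N.act_mul _ _ _ _]

/-- The map `N □_A F → ⨁ᵢ N_{- αᵢ}(- × Xᵢ)` for a free module `F`. -/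
def freeTo (E : CellFamily.{u} Γ G) (N : RMod A) : GrHom (Box N (A.free E)) (shiftSum E N.C) :=
  lift _ (shift_balanced N)

theorem freeTo_tmul (N : RMod A) {α β γ : Γ} (h : α + β = γ) {T : FinGSet G}
    (n : (N.C α).obj T) (p : (shiftSum E A.C β).obj T) :
    (freeTo E N γ).app T ((tmul N (A.free E)).f h n p) = N.act.shift.f h n p :=
  lift_tmul _ (shift_balanced N) h n p

/-- The inverse of `freeTo`, on values. -/
def freeInv (E : CellFamily.{u} Γ G) (N : RMod A) (γ : Γ) (T : FinGSet G) :
    (shiftSum E N.C γ).obj T →+ (Box N (A.free E) γ).obj T :=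
  shiftLift fun i => ((Box N (A.free E) γ).tr (FinGSet.fst T (E.cell i))).comp
    (((tmul N (A.free E)).f (sub_add_cancel γ (E.deg i))).flip
      ((shiftSum E A.C (E.deg i)).res (FinGSet.snd T (E.cell i)) (A.freeGen i)))

theorem freeInv_single (N : RMod A) {γ : Γ} {T : FinGSet G} (i : E.I)
    (n : (N.C (γ - E.deg i)).obj (FinGSet.prod T (E.cell i))) :
    freeInv E N γ T (shiftSingle N.C γ T i n) =
      (Box N (A.free E) γ).tr (FinGSet.fst T (E.cell i))
        ((tmul N (A.free E)).f (sub_add_cancel γ (E.deg i)) n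
          ((shiftSum E A.C (E.deg i)).res (FinGSet.snd T (E.cell i)) (A.freeGen i))) :=
  shiftLift_single _ i n

/-- In `n ⊗ p` the second factor may be taken in a single summand, where it is `tr (a x)` with `x` a
restricted generator. Balancing moves `a` to `n`, and Frobenius reciprocity moves the transfer
outside. Only this composite is needed: it makes `freeTo` injective and `freeInv` surjective. -/
theorem freeInv_freeTo (N : RMod A) {γ : Γ} {T : FinGSet G} (z : (Box N (A.free E) γ).obj T) :
    freeInv E N γ T ((freeTo E N γ).app T z) = z := by
  -- `freeInv` is only a family of additive maps; compatibility with transfers is what reduces the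
  -- claim to pure tensors.
  have key : ∀ {S T : FinGSet G} (k : FinGSet.Hom S T) (m : (shiftSum E N.C γ).obj S),
      freeInv E N γ T ((shiftSum E N.C γ).tr k m) =
        (Box N (A.free E) γ).tr k (freeInv E N γ S m) := by
    intro S T k m
    induction m using shiftSum_ind with
    | h0 => simp only [map_zero]
    | hs i x =>
      have e : (FinGSet.snd T (E.cell i)).comp (FinGSet.prodMap k (E.cell i)) =
        FinGSet.snd S (E.cell i) := MulActionHom.ext fun w => FinGSet.snd_prodMap _ _ w
      have e' : (FinGSet.fst T (E.cell i)).comp (FinGSet.prodMap k (E.cell i)) =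
        k.comp (FinGSet.fst S (E.cell i)) := MulActionHom.ext fun w => FinGSet.fst_prodMap _ _ w
      rw [shiftSingle_tr, freeInv_single, freeInv_single, (tmul N (A.free E)).tr_left,
        ← Mackey.tr_comp, ← Mackey.tr_comp, e']
      congr 2
      exact ((shiftSum E A.C _).res_comp _ _ _).symm.trans (by rw [e])
    | hadd x y hx hy => simp only [map_add, hx, hy]
  induction z using ind with
  | h0 => simp only [map_zero]
  | @ht U k α β e n p =>
    rw [(freeTo E N γ).app_tr, key, freeTo_tmul]
    congr 1
    change (shiftSum E A.C β).obj U at p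
    induction p using shiftSum_ind with
    | h0 => simp only [map_zero]
    | hs i a =>
      have e₁ : α + (β - E.deg i) + E.deg i = γ := by rw [← e]; abel
      have e₂ : β - E.deg i + E.deg i = β := by abel
      rw [Pairing.shift_single, freeInv_single, tmul_balanced _ e _ e₂, ← (tmul N _).tr_right]
      exact congrArg _ (A.free_eq i a)
    | hadd x y hx hy => simp only [map_add, hx, hy]
  | hadd x y hx hy => simp only [map_add, hx, hy]

/-- Together with `freeInv_shift`, this naturality in `N` turns questions about `f □ F` with `F`
free into questions about `f` on each summand. -/
theorem freeTo_box {N N' : RMod A} (f : N.Hom N') {γ : Γ} {T : FinGSet G}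
    (z : (Box N (A.free E) γ).obj T) : (freeTo E N' γ).app T ((f.box (A.free E) γ).app T z) =
      (f.u.shift γ).app T ((freeTo E N γ).app T z) := by
  induction z using ind with
  | h0 => simp only [map_zero]
  | ht k e n p =>
    simp only [Mackey.Hom.app_tr]
    rw [RMod.Hom.box_tmul, freeTo_tmul, freeTo_tmul]
    congr 1
    refine shiftSum_ext fun i => ?_
    rw [GrHom.shift_apply, Pairing.shift_apply, Pairing.shift_apply, f.map_act, (f.u _).app_res]
  | hadd x y hx hy => simp only [map_add, hx, hy]

theorem freeInv_shift {N N' : RMod A} (f : N.Hom N') {γ : Γ} {T : FinGSet G}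
    (m : (shiftSum E N.C γ).obj T) : freeInv E N' γ T ((f.u.shift γ).app T m) =
      (f.box (A.free E) γ).app T (freeInv E N γ T m) := by
  induction m using shiftSum_ind with
  | h0 => simp only [map_zero]
  | hs i x =>
    rw [GrHom.shift_single, freeInv_single, freeInv_single, Mackey.Hom.app_tr, RMod.Hom.box_tmul]
  | hadd x y hx hy => simp only [map_add, hx, hy]

/-- Box products with free modules preserve monomorphisms. -/
theorem free_isFlat (E : CellFamily.{u} Γ G) (A : GrGreen.{u} Γ G) : (A.free E).IsFlat := by
  intro N N' f hf γ T
  refine (injective_iff_map_eq_zero _).2 fun z hz => ?_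
  rw [← freeInv_freeTo N z]
  have h : (f.u.shift γ).app T ((freeTo E N γ).app T z) = 0 := by
    rw [← freeTo_box, hz, map_zero]
  -- On the shifted sum `f` acts summand by summand, so injectivity of `f` suffices.
  have h0 : (freeTo E N γ).app T z = 0 := by
    refine shiftSum_ext fun i => hf _ _ ?_
    rw [← GrHom.shift_apply, h]
    exact (map_zero _).symm
  rw [h0, map_zero]

/-- Box products with free modules preserve exactness. -/
theorem free_exact (E : CellFamily.{u} Γ G) {X Y Z : RMod A} (f : X.Hom Y) (k : Y.Hom Z)
    (hfk : ∀ {α : Γ} {T : FinGSet G} (y : (Y.C α).obj T), (k.u α).app T y = 0 →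
      ∃ x, (f.u α).app T x = y) {γ : Γ} {T : FinGSet G} (y : (Box Y (A.free E) γ).obj T)
    (hy : (k.box (A.free E) γ).app T y = 0) : ∃ x, (f.box (A.free E) γ).app T x = y := by
  have h : (k.u.shift γ).app T ((freeTo E Y γ).app T y) = 0 := by
    rw [← freeTo_box, hy, map_zero]
  obtain ⟨m, hm⟩ : ∃ m, (f.u.shift γ).app T m = (freeTo E Y γ).app T y := by
    have h' : ∀ i, (k.u _).app _ (shiftProj Y.C γ T i ((freeTo E Y γ).app T y)) = 0 := fun i => by
      rw [← GrHom.shift_apply, h]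
      rfl
    -- Exactness holds on each summand, and the preimages assemble to an element of the direct sum.
    exact GrHom.shift_lift f.u _ fun i => hfk _ (h' i)
  refine ⟨freeInv E X γ T m, ?_⟩
  rw [← freeInv_shift, hm, freeInv_freeTo]

end Box

end Free

end

noncomputable section

section Modules

variable {Γ G : Type} [AddCommGroup Γ] [Group G] {A : GrGreen.{u} Γ G}

/-! ### Maps of modules -/

/-- A map of left modules. -/
structure LMod.Hom (P P' : LMod A) where
  u : GrHom P.C P'.C
  semi : Box.SemiL (GrHom.id A.C) P P' u

theorem RMod.semi_id (N : RMod A) : Box.SemiR (GrHom.id A.C) N N (GrHom.id N.C) :=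
  fun _ _ _ _ => rfl

/-- The map `N □ v` of relative box products. -/
def LMod.Hom.box {P P' : LMod A} (v : P.Hom P') (N : RMod A) : GrHom (Box N P) (Box N P') :=
  Box.map N.semi_id v.semi

theorem LMod.Hom.box_tmul {P P' : LMod A} (v : P.Hom P') (N : RMod A) {α β γ : Γ}
    (h : α + β = γ) {T : FinGSet G} (n : (N.C α).obj T) (p : (P.C β).obj T) :
    (v.box N γ).app T ((Box.tmul N P).f h n p) = (Box.tmul N P').f h n ((v.u β).app T p) :=
  Box.map_tmul N.semi_id v.semi h n p

/-- A right module `N` is flat if `N □_A -` preserves monomorphisms. -/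
def RMod.IsFlat (N : RMod A) : Prop :=
  ∀ (P P' : LMod A) (v : P.Hom P'), v.u.Injective → (v.box N).Injective

namespace RMod.Hom

/-- The composite of two maps. -/
def comp {X Y Z : RMod A} (f : Y.Hom Z) (k : X.Hom Y) : X.Hom Z where
  u := f.u.comp k.u
  map_act h T n a := by
    rw [GrHom.comp_app, GrHom.comp_app, k.map_act, f.map_act]

theorem comp_app {X Y Z : RMod A} (f : Y.Hom Z) (k : X.Hom Y) {α : Γ} {T : FinGSet G}
    (x : (X.C α).obj T) : ((f.comp k).u α).app T x = (f.u α).app T ((k.u α).app T x) := rfl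

/-- The identity map. -/
def id (X : RMod A) : X.Hom X where
  u := GrHom.id X.C
  map_act _ _ _ _ := rfl

/-- The difference of two maps. -/
def sub {X Y : RMod A} (f k : X.Hom Y) : X.Hom Y where
  u := f.u.sub k.u
  map_act h T n a := by
    simp only [GrHom.sub_app, f.map_act, k.map_act, map_sub, AddMonoidHom.sub_apply]

theorem sub_app {X Y : RMod A} (f k : X.Hom Y) {α : Γ} {T : FinGSet G} (x : (X.C α).obj T) :
    ((f.sub k).u α).app T x = (f.u α).app T x - (k.u α).app T x := rfl

theorem box_surjective {X Y : RMod A} (f : X.Hom Y) (hf : f.u.Surjective) (P : LMod A) :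
    (f.box P).Surjective := by
  intro γ T z
  induction z using Box.ind with
  | h0 => exact ⟨0, map_zero _⟩
  | ht k e n p =>
    obtain ⟨x, rfl⟩ := hf _ _ n
    exact ⟨(Box X P γ).tr k ((Box.tmul X P).f e x p), by rw [Mackey.Hom.app_tr, f.box_tmul]⟩
  | hadd x y hx hy =>
    obtain ⟨x, rfl⟩ := hx
    obtain ⟨y, rfl⟩ := hy
    exact ⟨x + y, map_add _ _ _⟩

/-- Right exactness of the relative box product. -/
theorem box_exact {X Y Z : RMod A} (f : X.Hom Y) (k : Y.Hom Z) (hk : k.u.Surjective)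
    (hfk : ∀ {α : Γ} {T : FinGSet G} (y : (Y.C α).obj T), (k.u α).app T y = 0 →
      ∃ x, (f.u α).app T x = y) (P : LMod A) {γ : Γ} {T : FinGSet G} (z : (Box Y P γ).obj T)
    (hz : (k.box P γ).app T z = 0) : ∃ x, (f.box P γ).app T x = z := by
  let S := ((f.box P γ).app T).range
  let q : (Box Y P γ).obj T →+ (Box Y P γ).obj T ⧸ S := QuotientAddGroup.mk' S
  have hq : ∀ x, q ((f.box P γ).app T x) = 0 := fun x =>
    (QuotientAddGroup.eq_zero_iff _).2 ⟨x, rfl⟩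
  -- In the cokernel of `f □ P` the class of `y ⊗ p` depends on `y` only through its image under
  -- `k`, since two choices differ by an element in the image of `f`.
  have key : ∀ {U : FinGSet G} (h : FinGSet.Hom U T) {α β : Γ} (e : α + β = γ)
      (y y' : (Y.C α).obj U) (p : (P.C β).obj U), (k.u α).app U y = (k.u α).app U y' →
      q ((Box Y P γ).tr h ((Box.tmul Y P).f e y p)) =
        q ((Box Y P γ).tr h ((Box.tmul Y P).f e y' p)) := by
    intro U h α β e y y' p hy
    obtain ⟨x, hx⟩ := hfk (y - y') (by rw [map_sub, hy, sub_self])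
    rw [← sub_eq_zero, ← map_sub, ← map_sub, ← AddMonoidHom.sub_apply, ← map_sub, ← hx,
      ← f.box_tmul, ← Mackey.Hom.app_tr, hq]
  -- A merely set-theoretic section of `k`, with no compatibility whatsoever. By `key` every failure
  -- of `s` to be additive or to commute with restrictions, transfers and the action is invisible in
  -- the cokernel, so `z ⊗ p ↦ [s(z) ⊗ p]` respects all relations of the box product.
  let s : ∀ {α : Γ} {U : FinGSet G}, (Z.C α).obj U → (Y.C α).obj U := fun {α U} =>
    Function.surjInv (hk α U)
  have hs : ∀ {α : Γ} {U : FinGSet G} (z : (Z.C α).obj U), (k.u α).app U (s z) = z :=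
    fun {α U} z => Function.surjInv_eq (hk α U) z
  let ψ : (Box Z P γ).obj T →+ (Box Y P γ).obj T ⧸ S := Box.liftB (N := Z) (P := P)
    (fun h _ _ e n p => q ((Box Y P γ).tr h ((Box.tmul Y P).f e (s n) p)))
    (fun h _ _ e n n' p => by
      rw [key h e _ (s n + s n') p (by rw [map_add, hs, hs, hs]), map_add, AddMonoidHom.add_apply,
        map_add, map_add])
    (fun h _ _ e n p p' => by rw [map_add, map_add, map_add])
    (fun l h α β e n p => by
      rw [key h e _ ((Y.C α).tr l (s n)) p (by rw [hs, Mackey.Hom.app_tr, hs]),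
        (Box.tmul Y P).tr_left, ← Mackey.tr_comp])
    (fun l h α β e n p => by
      rw [(Box.tmul Y P).tr_right, ← Mackey.tr_comp, key (h.comp l) e _ (s ((Z.C α).res l n)) p
        (by rw [hs, Mackey.Hom.app_res, hs])])
    (fun h α β δ ε ζ e e' e₁ e₂ n a p => by
      rw [key h e _ (Y.act.f e₁ (s n) a) p (by rw [hs, k.map_act, hs]),
        Box.tmul_balanced e e' e₁ e₂])
  -- Thus `ψ` factors the projection to the cokernel through `k □ P`, and an element killed by `k □
  -- P` has class zero.
  have hψ : ∀ z, ψ ((k.box P γ).app T z) = q z := by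
    intro z
    induction z using Box.ind with
    | h0 => simp only [map_zero]
    | ht h e n p =>
      rw [Mackey.Hom.app_tr, k.box_tmul]
      exact (Box.liftB_tmul _ _ _ _ _ _ _ _ _ _).trans (key h e _ _ p (hs _))
    | hadd x y hx hy => simp only [map_add, hx, hy]
  have := hψ z
  rw [hz, map_zero] at this
  exact (QuotientAddGroup.eq_zero_iff _).1 this.symm

end RMod.Hom

/-! ### The opposite graded Green functor -/

/-- The opposite graded Green functor (without signs). -/
def GrGreen.opp (A : GrGreen.{u} Γ G) : GrGreen.{u} Γ G where
  C := A.C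
  mul := A.mul.flip
  one := A.one
  res_one := A.res_one
  one_mul _ _ a := A.mul_one _ a
  mul_one _ _ a := A.one_mul _ a
  mul_assoc h₁ h₂ h₃ h₄ _ a b c := (A.mul_assoc ((add_comm _ _).trans h₃)
    ((add_comm _ _).trans h₄) ((add_comm _ _).trans h₁) ((add_comm _ _).trans h₂) c b a).symm

/-- A right module as a left module over the opposite. -/
abbrev RMod.toOpp (N : RMod A) : LMod A.opp where
  C := N.C
  act := N.act.flip
  one_act _ _ n := N.act_one _ n
  mul_act h₁ h₂ h₃ h₄ _ a b n := N.act_mul ((add_comm _ _).trans h₁)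
    ((add_comm _ _).trans h₂) ((add_comm _ _).trans h₃) ((add_comm _ _).trans h₄) n b a

/-- A left module over the opposite as a right module. -/
abbrev LMod.ofOpp (P : LMod A.opp) : RMod A where
  C := P.C
  act := P.act.flip
  act_one _ _ n := P.one_act _ n
  act_mul h₁ h₂ h₃ h₄ _ n a b := P.mul_act ((add_comm _ _).trans h₁)
    ((add_comm _ _).trans h₂) ((add_comm _ _).trans h₃) ((add_comm _ _).trans h₄) b a n

/-- A left module as a right module over the opposite. -/
abbrev LMod.toOpp (P : LMod A) : RMod A.opp where
  C := P.C
  act := P.act.flip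
  act_one _ _ n := P.one_act _ n
  act_mul h₁ h₂ h₃ h₄ _ n a b := P.mul_act ((add_comm _ _).trans h₁)
    ((add_comm _ _).trans h₂) ((add_comm _ _).trans h₃) ((add_comm _ _).trans h₄) b a n

/-- A map of left modules as a map of right modules over the opposite. -/
def LMod.Hom.toOpp {P P' : LMod A} (v : P.Hom P') : P.toOpp.Hom P'.toOpp where
  u := v.u
  map_act _ _ n a := v.semi _ a n

namespace Box

variable (N : RMod A) (P : LMod A)

theorem swap_balanced :
    Balanced (N := N) (P := P) (tmul P.toOpp N.toOpp).flip :=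
  fun _ _ e₁ e₂ n a p => (tmul_balanced (N := P.toOpp) (P := N.toOpp) _ _
    ((add_comm _ _).trans e₂) ((add_comm _ _).trans e₁) p a n).symm

theorem unswap_balanced :
    Balanced (N := P.toOpp) (P := N.toOpp) (tmul N P).flip :=
  fun _ _ e₁ e₂ p a n => (tmul_balanced (N := N) (P := P) _ _
    ((add_comm _ _).trans e₂) ((add_comm _ _).trans e₁) n a p).symm

/-- The interchange of the two factors. -/
def swap : GrHom (Box N P) (Box P.toOpp N.toOpp) := lift _ (swap_balanced N P)

/-- The inverse of `Box.swap`. -/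
def unswap : GrHom (Box P.toOpp N.toOpp) (Box N P) := lift _ (unswap_balanced N P)

variable {N P}

theorem swap_tmul {α β γ : Γ} (h : α + β = γ) (h' : β + α = γ) {T : FinGSet G}
    (n : (N.C α).obj T) (p : (P.C β).obj T) :
    (swap N P γ).app T ((tmul N P).f h n p) = (tmul P.toOpp N.toOpp).f h' p n :=
  lift_tmul _ (swap_balanced N P) h n p

theorem unswap_tmul {α β γ : Γ} (h : α + β = γ) (h' : β + α = γ) {T : FinGSet G}
    (n : (N.C α).obj T) (p : (P.C β).obj T) :
    (unswap N P γ).app T ((tmul P.toOpp N.toOpp).f h' p n) = (tmul N P).f h n p :=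
  lift_tmul _ (unswap_balanced N P) h' p n

theorem unswap_swap {γ : Γ} {T : FinGSet G} (z : (Box N P γ).obj T) :
    (unswap N P γ).app T ((swap N P γ).app T z) = z := by
  induction z using ind with
  | h0 => simp only [map_zero]
  | ht k e n p =>
    simp only [Mackey.Hom.app_tr]
    rw [swap_tmul e ((add_comm _ _).trans e), unswap_tmul e]
  | hadd x y hx hy => simp only [map_add, hx, hy]

theorem swap_box {P' : LMod A} (v : P.Hom P') {γ : Γ} {T : FinGSet G} (z : (Box N P γ).obj T) :
    (swap N P' γ).app T ((v.box N γ).app T z) =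
      (v.toOpp.box N.toOpp γ).app T ((swap N P γ).app T z) := by
  induction z using ind with
  | h0 => simp only [map_zero]
  | ht k e n p =>
    have e' := (add_comm _ _).trans e
    simp only [Mackey.Hom.app_tr]
    rw [v.box_tmul, swap_tmul e e', swap_tmul e e', RMod.Hom.box_tmul]
    rfl
  | hadd x y hx hy => simp only [map_add, hx, hy]

theorem unswap_box {P' : LMod A} (v : P.Hom P') {γ : Γ} {T : FinGSet G}
    (z : (Box P.toOpp N.toOpp γ).obj T) :
    (unswap N P' γ).app T ((v.toOpp.box N.toOpp γ).app T z) =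
      (v.box N γ).app T ((unswap N P γ).app T z) := by
  induction z using ind with
  | h0 => simp only [map_zero]
  | ht k e p n =>
    have e' := (add_comm _ _).trans e
    simp only [Mackey.Hom.app_tr]
    rw [unswap_tmul e' e, v.box_tmul, RMod.Hom.box_tmul]
    exact congrArg _ (unswap_tmul e' e _ _)
  | hadd x y hx hy => simp only [map_add, hx, hy]

end Box

/-- Interchanging the factors turns left modules over `A` into right modules over the opposite. Here
and in `LMod.Hom.box_exact` the statement about the second variable follows from the one about the
first; `unswap` brings the preimage back. -/
theorem LMod.Hom.box_surjective {X Y : LMod A} (f : X.Hom Y) (hf : f.u.Surjective)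
    (N : RMod A) : (f.box N).Surjective := by
  intro γ T z
  obtain ⟨x, hx⟩ := f.toOpp.box_surjective hf N.toOpp γ T ((Box.swap N Y γ).app T z)
  exact ⟨(Box.unswap N X γ).app T x, by rw [← Box.unswap_box, hx, Box.unswap_swap]⟩

theorem LMod.Hom.box_exact {X Y Z : LMod A} (f : X.Hom Y) (k : Y.Hom Z) (hk : k.u.Surjective)
    (hfk : ∀ {α : Γ} {T : FinGSet G} (y : (Y.C α).obj T), (k.u α).app T y = 0 →
      ∃ x, (f.u α).app T x = y) (N : RMod A) {γ : Γ} {T : FinGSet G} (z : (Box N Y γ).obj T)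
    (hz : (k.box N γ).app T z = 0) : ∃ x, (f.box N γ).app T x = z := by
  obtain ⟨x, hx⟩ := f.toOpp.box_exact k.toOpp hk hfk N.toOpp ((Box.swap N Y γ).app T z)
    (by rw [← Box.swap_box, hz, map_zero])
  exact ⟨(Box.unswap N X γ).app T x, by rw [← Box.unswap_box, hx, Box.unswap_swap]⟩

/-! ### Free and projective right modules -/

/-- The free right module on a family of cells. -/
abbrev GrGreen.freeR (E : CellFamily.{u} Γ G) (A : GrGreen.{u} Γ G) : RMod A :=
  (A.opp.free E).ofOpp

/-- The free right module is a free left module over the opposite, so `Box.free_isFlat` applies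
after interchanging the factors. -/
theorem GrGreen.freeR_isFlat (E : CellFamily.{u} Γ G) (A : GrGreen.{u} Γ G) :
    (A.freeR E).IsFlat := by
  intro P P' v hv γ T
  refine (injective_iff_map_eq_zero _).2 fun z hz => ?_
  have h := Box.swap_box v z
  rw [hz, map_zero] at h
  have h0 := (injective_iff_map_eq_zero _).1
    (Box.free_isFlat E A.opp P.toOpp P'.toOpp v.toOpp hv γ T) _ h.symm
  rw [← Box.unswap_swap z]
  exact (congrArg _ h0).trans (map_zero _)

variable {E : CellFamily.{u} Γ G}

/-- The map from a free right module that takes prescribed values on the generators. -/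
def RMod.ofGens (N : RMod A) (y : ∀ i : E.I, (N.C (E.deg i)).obj (E.cell i)) :
    (A.freeR E).Hom N where
  u := N.toOpp.ofGens y
  map_act h _ n a := N.toOpp.ofGens_semi y ((add_comm _ _).trans h) a n

theorem RMod.ofGens_gen (N : RMod A) (y : ∀ i : E.I, (N.C (E.deg i)).obj (E.cell i)) (i : E.I) :
    ((N.ofGens y).u (E.deg i)).app (E.cell i) (A.opp.freeGen i) = y i :=
  N.toOpp.ofGens_gen y i

theorem RMod.free_hom_eq {N : RMod A} {f k : (A.freeR E).Hom N}
    (h : ∀ i : E.I, (f.u (E.deg i)).app (E.cell i) (A.opp.freeGen i) =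
      (k.u (E.deg i)).app (E.cell i) (A.opp.freeGen i)) : f.u = k.u :=
  N.toOpp.free_hom_eq (fun _ _ a n => f.map_act _ n a) (fun _ _ a n => k.map_act _ n a) h

/-- Maps from a free module can be lifted. -/
theorem RMod.exists_free_lift {X Y : RMod A} (f : X.Hom Y) (k : (A.freeR E).Hom Y)
    (h : ∀ {α : Γ} {T : FinGSet G} (x : ((A.freeR E).C α).obj T),
      ∃ y, (f.u α).app T y = (k.u α).app T x) :
    ∃ l : (A.freeR E).Hom X, ∀ {α : Γ} {T : FinGSet G} (x : ((A.freeR E).C α).obj T),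
      (f.u α).app T ((l.u α).app T x) = (k.u α).app T x := by
  choose y hy using fun i : E.I => h (A.opp.freeGen i)
  have e : (f.comp (X.ofGens y)).u = k.u := RMod.free_hom_eq fun i => by
    rw [RMod.Hom.comp_app, X.ofGens_gen, hy]
  refine ⟨X.ofGens y, fun {α T} x => ?_⟩
  rw [← e]
  rfl

theorem GrGreen.freeR_isProjective (E : CellFamily.{u} Γ G) (A : GrGreen.{u} Γ G) :
    (A.freeR E).IsProjective := fun _ _ f k hf => by
  obtain ⟨l, hl⟩ := RMod.exists_free_lift f k fun x => hf _ _ _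
  exact ⟨l, fun _ _ x => hl x⟩

/-- The family of all elements of the kernel of a map. -/
def RMod.Hom.kerCells {Y Z : RMod A} (f : Y.Hom Z) : CellFamily.{u} Γ G where
  -- Because finite `G`-sets form a small type, the family of all kernel elements is still indexed
  -- by a type in `Type u`.
  I := Σ (α : Γ) (X : FinGSet G), {y : (Y.C α).obj X // (f.u α).app X y = 0}
  deg i := i.1
  cell i := i.2.1

/-- A map from a free module onto the kernel of a map. -/
def RMod.Hom.kerCover {Y Z : RMod A} (f : Y.Hom Z) : (A.freeR f.kerCells).Hom Y :=
  Y.ofGens fun i => i.2.2.1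

theorem RMod.Hom.kerCover_exact {Y Z : RMod A} (f : Y.Hom Z) {α : Γ} {T : FinGSet G}
    (y : (Y.C α).obj T) : (f.u α).app T y = 0 ↔ ∃ x, (f.kerCover.u α).app T x = y := by
  constructor
  · intro h
    exact ⟨A.opp.freeGen (E := f.kerCells) ⟨α, T, y, h⟩,
      Y.ofGens_gen (fun i : f.kerCells.I => i.2.2.1) ⟨α, T, y, h⟩⟩
  · rintro ⟨x, rfl⟩
    -- The difference of `f ∘ kerCover` with itself serves as the zero map. The two maps agree on
    -- the generators, because each generator goes to an element of the kernel.
    have e : (f.comp f.kerCover).u = ((f.comp f.kerCover).sub (f.comp f.kerCover)).u :=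
      RMod.free_hom_eq fun i => by
        rw [RMod.Hom.sub_app, sub_self, RMod.Hom.comp_app]
        exact (congrArg _ (Y.ofGens_gen (fun i : f.kerCells.I => i.2.2.1) i)).trans i.2.2.2
    rw [← RMod.Hom.comp_app, e, RMod.Hom.sub_app, sub_self]

/-- The family of all elements of a graded Mackey functor. -/
def GrMackey.cells (N : GrMackey.{u} Γ G) : CellFamily.{u} Γ G where
  I := Σ (α : Γ) (X : FinGSet G), (N α).obj X
  deg i := i.1
  cell i := i.2.1

/-- A map from a free module onto a given module. -/
def RMod.cover (N : RMod A) : (A.freeR (GrMackey.cells N.C)).Hom N := N.ofGens fun i => i.2.2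

theorem RMod.cover_surjective (N : RMod A) : N.cover.u.Surjective := fun α T n =>
  ⟨A.opp.freeGen (E := GrMackey.cells N.C) ⟨α, T, n⟩,
    N.ofGens_gen (fun i : (GrMackey.cells N.C).I => i.2.2) ⟨α, T, n⟩⟩

/-- A projective module is a retract of the free module on all its elements. Flatness and the
general lifting property pass to retracts. -/
theorem RMod.IsProjective.exists_section {P : RMod A} (hP : P.IsProjective) :
    ∃ s : P.Hom (A.freeR (GrMackey.cells P.C)), ∀ {α : Γ} {T : FinGSet G} (x : (P.C α).obj T),
      (P.cover.u α).app T ((s.u α).app T x) = x := by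
  obtain ⟨s, hs⟩ := hP _ _ P.cover (RMod.Hom.id P) P.cover_surjective
  exact ⟨s, fun x => hs _ _ x⟩

/-- Here `f` need not be surjective; it is enough that its image contains the image of `k`. This is
the form used to lift through differentials, without forming images as modules. On a free module
preimages are chosen for the generators, and the retraction transfers the result to `P`. -/
theorem RMod.IsProjective.exists_lift {P X Y : RMod A} (hP : P.IsProjective) (f : X.Hom Y)
    (k : P.Hom Y) (h : ∀ {α : Γ} {T : FinGSet G} (x : (P.C α).obj T),
      ∃ y, (f.u α).app T y = (k.u α).app T x) :
    ∃ l : P.Hom X, ∀ {α : Γ} {T : FinGSet G} (x : (P.C α).obj T),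
      (f.u α).app T ((l.u α).app T x) = (k.u α).app T x := by
  obtain ⟨s, hs⟩ := hP.exists_section
  obtain ⟨l, hl⟩ := RMod.exists_free_lift f (k.comp P.cover) fun x => h _
  refine ⟨l.comp s, fun x => ?_⟩
  rw [RMod.Hom.comp_app, hl, RMod.Hom.comp_app, hs]

theorem RMod.Hom.box_comp_box {X Y : RMod A} (f : X.Hom Y) {P P' : LMod A} (v : P.Hom P') {γ : Γ}
    {T : FinGSet G} (z : (Box X P γ).obj T) : (v.box Y γ).app T ((f.box P γ).app T z) =
      (f.box P' γ).app T ((v.box X γ).app T z) := by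
  induction z using Box.ind with
  | h0 => simp only [map_zero]
  | ht k e n p =>
    simp only [Mackey.Hom.app_tr]
    rw [f.box_tmul, v.box_tmul, v.box_tmul, f.box_tmul]
  | hadd x y hx hy => simp only [map_add, hx, hy]

/-- Flatness is inherited from the free cover: the map induced by the section commutes with `v` and
has a left inverse, so it detects zero. -/
theorem RMod.IsProjective.isFlat {Q : RMod A} (hQ : Q.IsProjective) : Q.IsFlat := by
  intro P P' v hv γ T
  obtain ⟨s, hs⟩ := hQ.exists_section
  refine (injective_iff_map_eq_zero _).2 fun z hz => ?_
  have h : (s.box P γ).app T z = 0 := by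
    refine (injective_iff_map_eq_zero _).1 (A.freeR_isFlat _ P P' v hv γ T) _ ?_
    rw [s.box_comp_box, hz, map_zero]
  have hz' : (Q.cover.box P γ).app T ((s.box P γ).app T z) = z := by
    -- The retraction identity holds for every `z`; the facts about this particular `z` are dropped
    -- so that the induction can run.
    clear hz h
    induction z using Box.ind with
    | h0 => simp only [map_zero]
    | ht k e n p =>
      simp only [Mackey.Hom.app_tr]
      rw [s.box_tmul, Q.cover.box_tmul, hs]
    | hadd x y hx hy => simp only [map_add, hx, hy]
  rw [← hz', h, map_zero]

/-- A map of right modules together with its source and target. -/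
structure RMod.Arrow (A : GrGreen.{u} Γ G) where
  src : RMod A
  tgt : RMod A
  hom : src.Hom tgt

/-- The maps of a free resolution. -/
def RMod.freeRes (N : RMod A) : ℕ → RMod.Arrow A
  | 0 => ⟨_, N, N.cover⟩
  | n + 1 => ⟨_, (freeRes N n).src, (freeRes N n).hom.kerCover⟩

/-- Projective resolutions exist. -/
theorem ProjRes.nonempty (N : RMod A) : Nonempty (ProjRes N) :=
  ⟨{  X := fun n => (N.freeRes n).src
      d := fun n => (N.freeRes (n + 1)).hom
      ε := N.cover
      projective := fun n => by
        cases n with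
        | zero => exact A.freeR_isProjective _
        | succ n => exact A.freeR_isProjective _
      surjective := N.cover_surjective
      exact_zero := fun x => N.cover.kerCover_exact x
      exact_succ := fun n _ _ x => (N.freeRes (n + 1)).hom.kerCover_exact x }⟩

end Modules

end

noncomputable section

/-! ### Chain maps and homology -/

namespace GrComplex

variable {Γ G : Type} [Group G]

namespace Hom

variable {C D E : GrComplex.{u} Γ G}

/-- The composite of two chain maps. -/
def comp (f : Hom D E) (k : Hom C D) : Hom C E where
  u n := (f.u n).comp (k.u n)
  comm n α T x := by rw [GrHom.comp_app, GrHom.comp_app, k.comm, f.comm]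

theorem homologyMap_comp (f : Hom D E) (k : Hom C D) (n : ℕ) :
    (f.comp k).homologyMap n = (f.homologyMap n).comp (k.homologyMap n) :=
  GrHom.ext fun α T => by
    rintro ⟨x⟩
    rfl

/-- Homotopic chain maps induce the same map on homology. -/
theorem homologyMap_eq {a b : Hom C D} (s : ∀ n, GrHom (C.X n) (D.X (n + 1)))
    (h₀ : ∀ {α : Γ} {T : FinGSet G} (x : (C.X 0 α).obj T),
      (a.u 0 α).app T x - (b.u 0 α).app T x = (D.d 0 α).app T ((s 0 α).app T x))
    (hs : ∀ (n : ℕ) {α : Γ} {T : FinGSet G} (x : (C.X (n + 1) α).obj T),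
      (a.u (n + 1) α).app T x - (b.u (n + 1) α).app T x =
        (D.d (n + 1) α).app T ((s (n + 1) α).app T x) + (s n α).app T ((C.d n α).app T x))
    (n : ℕ) : a.homologyMap n = b.homologyMap n := by
  refine GrHom.ext fun α T => ?_
  rintro ⟨x, hx⟩
  refine (QuotientAddGroup.eq_iff_sub_mem).2 ?_
  change (a.u n α).app T x - (b.u n α).app T x ∈ ((D.d n α).app T).range
  cases n with
  | zero => exact ⟨_, (h₀ x).symm⟩
  | succ n =>
    have hx' : (C.d n α).app T x = 0 := hx
    refine ⟨(s (n + 1) α).app T x, ?_⟩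
    rw [hs, hx', map_zero, add_zero]

/-- Exactness of the mapping cone of a chain map in degree `n`. -/
def ConeExact (f : Hom C D) (α : Γ) (T : FinGSet G) : ℕ → Prop
  -- In degree `n` the cone consists of pairs `(p, b)` with `p` in `C_{n-1}` and `b` in `D_n`. With
  -- the sign convention used here a cone cycle has `d p = 0` and `f p = d b`, and a boundary has
  -- the form `(d p', f p' + d b')`. In degree `0` there is no `p`.
  | 0 => ∀ b, ∃ p' b', b = (f.u 0 α).app T p' + (D.d 0 α).app T b'
  | n + 1 => ∀ p ∈ (C.cycles n α).S T, ∀ b, (f.u n α).app T p = (D.d n α).app T b →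
      ∃ p' b', (C.d n α).app T p' = p ∧
        b = (f.u (n + 1) α).app T p' + (D.d (n + 1) α).app T b'

/-- Injectivity on `H_n` is exactness of the cone in degree `n + 1`: a cycle `p` with `f p = d b` is
a boundary. Surjectivity on `H_n` is exactness in degree `n`, applied to the pairs `(0, b)` with `b`
a cycle. -/
theorem homologyMap_isIso (f : Hom C D) (h : ∀ α T n, f.ConeExact α T n) (n : ℕ) :
    (f.homologyMap n).IsIso := by
  intro α T
  constructor
  · refine (injective_iff_map_eq_zero _).2 ?_
    rintro ⟨p, hp⟩ hz
    obtain ⟨b, hb⟩ := (QuotientAddGroup.eq_zero_iff _).1 hz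
    obtain ⟨p', b', hp', -⟩ := h α T (n + 1) p hp b hb.symm
    exact (QuotientAddGroup.eq_zero_iff _).2 ⟨p', hp'⟩
  · rintro ⟨b, hb⟩
    obtain ⟨p, hp, b', hb'⟩ : ∃ p, p ∈ (C.cycles n α).S T ∧
        ∃ b', b = (f.u n α).app T p + (D.d n α).app T b' := by
      cases n with
      | zero =>
        obtain ⟨p, b', hb'⟩ := h α T 0 b
        exact ⟨p, trivial, b', hb'⟩
      | succ n =>
        have hb0 : (D.d n α).app T b = 0 := hb
        -- The pair `(0, b)` is a cone cycle, and writing it as a boundary produces a `p` with `d p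
        -- = 0`.
        obtain ⟨p, b', hp, hb'⟩ := h α T (n + 1) 0 (zero_mem _) b (by rw [hb0, map_zero])
        exact ⟨p, hp, b', hb'⟩
    refine ⟨QuotientAddGroup.mk ⟨p, hp⟩, ?_⟩
    refine (QuotientAddGroup.eq_iff_sub_mem).2 ?_
    change (f.u n α).app T p - b ∈ ((D.d n α).app T).range
    exact ⟨-b', by rw [hb', map_neg]; abel⟩

/-- The mapping cone of a map of augmented exact complexes is exact. -/
theorem coneExact_of_augmented (f : Hom C D) {E : GrMackey.{u} Γ G} (εC : GrHom (C.X 0) E)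
    (εD : GrHom (D.X 0) E) (hε : εC.Surjective) (hf : ∀ {α T} (x : (C.X 0 α).obj T),
      (εD α).app T ((f.u 0 α).app T x) = (εC α).app T x)
    (hD : ∀ {α T} (x : (D.X 1 α).obj T), (εD α).app T ((D.d 0 α).app T x) = 0)
    (hC₀ : ∀ {α T} (x : (C.X 0 α).obj T), (εC α).app T x = 0 → ∃ y, (C.d 0 α).app T y = x)
    (hD₀ : ∀ {α T} (x : (D.X 0 α).obj T), (εD α).app T x = 0 → ∃ y, (D.d 0 α).app T y = x)
    (hC : ∀ n {α T} (x : (C.X (n + 1) α).obj T), (C.d n α).app T x = 0 →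
      ∃ y, (C.d (n + 1) α).app T y = x)
    (hD' : ∀ n {α T} (x : (D.X (n + 1) α).obj T), (D.d n α).app T x = 0 →
      ∃ y, (D.d (n + 1) α).app T y = x) (α : Γ) (T : FinGSet G) (n : ℕ) :
    f.ConeExact α T n := by
  cases n with
  | zero =>
    intro b
    -- A `p` with the same augmentation as `b`; then `b - f p` is augmented to zero and hence is a
    -- boundary.
    obtain ⟨p, hp⟩ := hε α T ((εD α).app T b)
    obtain ⟨b', hb'⟩ := hD₀ (b - (f.u 0 α).app T p) (by rw [map_sub, hf, hp, sub_self])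
    exact ⟨p, b', by rw [hb']; abel⟩
  | succ n =>
    intro p hp b hb
    obtain ⟨p', rfl⟩ : ∃ p', (C.d n α).app T p' = p := by
      cases n with
      -- In the lowest degree `p` is arbitrary; its augmentation vanishes because it equals that of
      -- `f p = d b`.
      | zero => exact hC₀ p (by rw [← hf, hb, hD])
      | succ n => exact hC n p hp
    obtain ⟨b', hb'⟩ := hD' n (b - (f.u (n + 1) α).app T p') (by
      rw [map_sub, ← hb, f.comm, sub_self])
    exact ⟨p', b', rfl, by rw [hb']; abel⟩

/-- Dimension shifting: for a short exact sequence of mapping cones of which the middle one is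
exact, exactness of the first one in degree `n` implies exactness of the last one in degree
`n + 1`. -/
theorem ConeExact.shift {C₁ C₂ C₃ D₁ D₂ D₃ : GrComplex.{u} Γ G} {f₁ : Hom C₁ D₁}
    {f₂ : Hom C₂ D₂} {f₃ : Hom C₃ D₃} (i : Hom C₁ C₂) (j : Hom C₂ C₃) (i' : Hom D₁ D₂)
    (j' : Hom D₂ D₃) {α : Γ} {T : FinGSet G}
    (hi : ∀ n, Function.Injective ((i.u n α).app T))
    (hi' : ∀ n, Function.Injective ((i'.u n α).app T))
    (hj : ∀ n, Function.Surjective ((j.u n α).app T))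
    (hj' : ∀ n, Function.Surjective ((j'.u n α).app T))
    (hji : ∀ n x, (j.u n α).app T ((i.u n α).app T x) = 0)
    (hji' : ∀ n x, (j'.u n α).app T ((i'.u n α).app T x) = 0)
    (hij : ∀ n x, (j.u n α).app T x = 0 → ∃ y, (i.u n α).app T y = x)
    (hij' : ∀ n x, (j'.u n α).app T x = 0 → ∃ y, (i'.u n α).app T y = x)
    (h₁₂ : ∀ n x, (f₂.u n α).app T ((i.u n α).app T x) = (i'.u n α).app T ((f₁.u n α).app T x))
    (h₂₃ : ∀ n x, (f₃.u n α).app T ((j.u n α).app T x) = (j'.u n α).app T ((f₂.u n α).app T x))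
    (n : ℕ) (H₁ : f₁.ConeExact α T n) (H₂ : f₂.ConeExact α T (n + 1)) :
    f₃.ConeExact α T (n + 1) := by
  intro p hp b hb
  obtain ⟨p, rfl⟩ := hj n p
  obtain ⟨b, rfl⟩ := hj' (n + 1) b
  -- The lift `(p, b)` to the middle cone need not be a cycle. Its defect `f₂ p - d b` dies in the
  -- last complex and therefore comes from an element `k₂` of the first one.
  obtain ⟨k₂, hk₂⟩ := hij' n ((f₂.u n α).app T p - (D₂.d n α).app T b) (by
    rw [map_sub, ← h₂₃, hb, j'.comm, sub_self])
  -- The whole defect comes from a cycle `(k₁, k₂)` of the first cone, with `k₁` lying over `d p`;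
  -- in degree `0` there is no `k₁`. Exactness there gives `k₁ = d k` and `k₂ = f₁ k + d k'`.
  obtain ⟨k, k', hk, hk'⟩ : ∃ k k', (i.u n α).app T k - p ∈ (C₂.cycles n α).S T ∧
      k₂ = (f₁.u n α).app T k + (D₁.d n α).app T k' := by
    cases n with
    | zero =>
      obtain ⟨k, k', h⟩ := H₁ k₂
      exact ⟨k, k', trivial, h⟩
    | succ n =>
      have hp' : (C₃.d n α).app T ((j.u (n + 1) α).app T p) = 0 := hp
      obtain ⟨k₁, hk₁⟩ := hij n ((C₂.d n α).app T p) (by rw [j.comm, hp'])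
      obtain ⟨k, k', h, h'⟩ := H₁ k₁ (by
        cases n with
        | zero => trivial
        | succ n =>
          change (C₁.d n α).app T k₁ = 0
          apply hi n
          rw [i.comm, hk₁, C₂.d_d, map_zero]) k₂ (by
        apply hi' n
        rw [← h₁₂, hk₁, i'.comm, hk₂, map_sub, D₂.d_d, sub_zero, f₂.comm])
      refine ⟨k, k', ?_, h'⟩
      change (C₂.d n α).app T _ = 0
      rw [map_sub, ← i.comm, h, hk₁, sub_self]
  -- The corrected pair `(p - i k, b + i' k')` is a cycle of the middle cone with the same image in
  -- the last one. It is a boundary there, and its bounding element is pushed forward.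
  obtain ⟨p', b', hp', hb'⟩ := H₂ (p - (i.u n α).app T k)
    (by rw [← neg_sub]; exact neg_mem hk) (b + (i'.u (n + 1) α).app T k') (by
      rw [map_add, ← i'.comm, map_sub, h₁₂]
      rw [hk', map_add] at hk₂
      rw [← sub_eq_zero, ← sub_eq_zero.2 hk₂.symm]
      abel)
  refine ⟨(j.u (n + 1) α).app T p', (j'.u (n + 1 + 1) α).app T b', ?_, ?_⟩
  · rw [← j.comm, hp', map_sub, hji, sub_zero]
  · rw [h₂₃, ← j'.comm, ← map_add, ← hb', map_add, hji', add_zero]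

end Hom

end GrComplex

section Resolutions

variable {Γ G : Type} [AddCommGroup Γ] [Group G] {A A' : GrGreen.{u} Γ G}

/-! ### Restriction of scalars -/

/-- A map of graded Green functors. -/
structure GrGreen.Hom (A A' : GrGreen.{u} Γ G) where
  u : GrHom A.C A'.C
  map_one : ∀ X : FinGSet G, (u 0).app X (A.one X) = A'.one X
  map_mul : ∀ {α β γ : Γ} (h : α + β = γ) {X : FinGSet G} (a : (A.C α).obj X)
    (b : (A.C β).obj X),
    (u γ).app X (A.mul.f h a b) = A'.mul.f h ((u α).app X a) ((u β).app X b)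

/-- The identity map. -/
def GrGreen.Hom.id (A : GrGreen.{u} Γ G) : GrGreen.Hom A A where
  u := GrHom.id A.C
  map_one _ := rfl
  map_mul _ _ _ _ := rfl

/-- Restriction of scalars. -/
def RMod.restrict (ψ : GrGreen.Hom A A') (N : RMod A') : RMod A where
  C := N.C
  act := N.act.compRight ψ.u
  act_one h T n := by rw [Pairing.compRight_f, ψ.map_one, N.act_one]
  act_mul h₁ h₂ h₃ h₄ T n a b := by
    rw [Pairing.compRight_f, ψ.map_mul, N.act_mul h₁ h₂ h₃ h₄]
    rfl

/-- Restriction of scalars for a map. -/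
def RMod.Hom.restrict (ψ : GrGreen.Hom A A') {X Y : RMod A'} (f : X.Hom Y) :
    (X.restrict ψ).Hom (Y.restrict ψ) where
  u := f.u
  map_act h _ n a := f.map_act h n ((ψ.u _).app _ a)

/-- A map that is semilinear over `ψ` is a linear map into the restriction of scalars, so the
lifting property over `A` applies. -/
theorem RMod.IsProjective.exists_semi_lift {P : RMod A} (hP : P.IsProjective)
    (ψ : GrGreen.Hom A A') {X Y : RMod A'} (f : X.Hom Y) (k : GrHom P.C Y.C)
    (hk : Box.SemiR ψ.u P Y k)
    (h : ∀ {α : Γ} {T : FinGSet G} (x : (P.C α).obj T), ∃ y, (f.u α).app T y = (k α).app T x) :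
    ∃ l : GrHom P.C X.C, Box.SemiR ψ.u P X l ∧ ∀ {α : Γ} {T : FinGSet G} (x : (P.C α).obj T),
      (f.u α).app T ((l α).app T x) = (k α).app T x := by
  obtain ⟨l, hl⟩ := hP.exists_lift (f.restrict ψ) ⟨k, hk⟩ h
  exact ⟨l.u, l.map_act, hl⟩

/-! ### Resolutions and their comparison -/

/-- A resolution `⋯ → X 1 → X 0 → N → 0` of a right module. -/
structure RMod.Res (N : RMod A) where
  X : ℕ → RMod A
  d : ∀ n : ℕ, (X (n + 1)).Hom (X n)
  ε : (X 0).Hom N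
  surjective : ε.u.Surjective
  exact_zero : ∀ {α : Γ} {T : FinGSet G} (x : ((X 0).C α).obj T),
    (ε.u α).app T x = 0 ↔ ∃ y, ((d 0).u α).app T y = x
  exact_succ : ∀ (n : ℕ) {α : Γ} {T : FinGSet G} (x : ((X (n + 1)).C α).obj T),
    ((d n).u α).app T x = 0 ↔ ∃ y, ((d (n + 1)).u α).app T y = x

/-- The resolution underlying a projective resolution. -/
def ProjRes.toRes {N : RMod A} (Q : ProjRes N) : N.Res where
  X := Q.X
  d := Q.d
  ε := Q.ε
  surjective := Q.surjective
  exact_zero := Q.exact_zero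
  exact_succ := Q.exact_succ

namespace RMod.Res

variable {N : RMod A} {N' : RMod A'}

theorem d_d (Q : N.Res) (n : ℕ) {α : Γ} {T : FinGSet G} (x : ((Q.X (n + 1 + 1)).C α).obj T) :
    ((Q.d n).u α).app T (((Q.d (n + 1)).u α).app T x) = 0 := (Q.exact_succ _ _).2 ⟨_, rfl⟩

theorem ε_d (Q : N.Res) {α : Γ} {T : FinGSet G} (x : ((Q.X 1).C α).obj T) :
    (Q.ε.u α).app T (((Q.d 0).u α).app T x) = 0 := (Q.exact_zero _).2 ⟨_, rfl⟩

/-- The cycles of the augmented complex of a resolution. -/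
def IsCycle (Q : N.Res) : ∀ (n : ℕ) {α : Γ} {T : FinGSet G}, ((Q.X n).C α).obj T → Prop
  | 0, _, _, x => (Q.ε.u _).app _ x = 0
  | n + 1, _, _, x => ((Q.d n).u _).app _ x = 0

/-- Treating the augmentation and the differentials uniformly lets the inductive step of the
comparison theorems be the same in all degrees. -/
theorem isCycle_iff (Q : N.Res) (n : ℕ) {α : Γ} {T : FinGSet G} (x : ((Q.X n).C α).obj T) :
    Q.IsCycle n x ↔ ∃ y, ((Q.d n).u α).app T y = x := by
  cases n with
  | zero => exact Q.exact_zero x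
  | succ n => exact Q.exact_succ n x

/-- The complex `X_• □_A P`. -/
def boxComplex (Q : N.Res) (P : LMod A) : GrComplex.{u} Γ G where
  X n := Box (Q.X n) P
  d n := (Q.d n).box P
  d_d n α T x := by
    induction x using Box.ind with
    | h0 => simp only [map_zero]
    | ht k e x p =>
      rw [Mackey.Hom.app_tr, Mackey.Hom.app_tr, RMod.Hom.box_tmul, RMod.Hom.box_tmul,
        Q.d_d, map_zero, AddMonoidHom.zero_apply, map_zero]
    | hadd x y hx hy => rw [map_add, map_add, hx, hy, add_zero]

/-- A lift of a map `f : N → N'`, semilinear over `ψ`, to resolutions. -/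
structure Lift (ψ : GrHom A.C A'.C) (f : GrHom N.C N'.C) (Q : N.Res) (Q' : N'.Res) where
  u : ∀ n, GrHom (Q.X n).C (Q'.X n).C
  semi : ∀ n, Box.SemiR ψ (Q.X n) (Q'.X n) (u n)
  comm : ∀ (n : ℕ) {α : Γ} {T : FinGSet G} (x : ((Q.X (n + 1)).C α).obj T),
    (u n α).app T (((Q.d n).u α).app T x) = ((Q'.d n).u α).app T ((u (n + 1) α).app T x)
  comm_ε : ∀ {α : Γ} {T : FinGSet G} (x : ((Q.X 0).C α).obj T),
    (f α).app T ((Q.ε.u α).app T x) = (Q'.ε.u α).app T ((u 0 α).app T x)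

end RMod.Res

/-- A sequence constructed by successive choices. -/
theorem exists_seq_of_step {S : ℕ → Type*} (init : S 0 → Prop) (good : ∀ n, S n → Prop)
    (r : ∀ n, S n → S (n + 1) → Prop) (h₀ : ∃ s, init s ∧ good 0 s)
    (hs : ∀ n s, good n s → ∃ s', r n s s' ∧ good (n + 1) s') {C : Prop}
    (hC : ∀ f : ∀ n, S n, init (f 0) → (∀ n, r n (f n) (f (n + 1))) → (∀ n, good n (f n)) → C) :
    C := by
  obtain ⟨s₀, hi, hg⟩ := h₀
  choose t ht using hs
  let f : ∀ n, {s : S n // good n s} := fun n =>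
    Nat.rec ⟨s₀, hg⟩ (fun n s => ⟨t n s.1 s.2, (ht n s.1 s.2).2⟩) n
  exact hC (fun n => (f n).1) hi (fun n => (ht n (f n).1 (f n).2).1) fun n => (f n).2

/-! ### The comparison theorem: existence of lifts and uniqueness up to homotopy. -/

namespace RMod.Res

variable {N : RMod A} {N' : RMod A'}

/-- Only the source has to consist of projectives; the target may be any resolution, for instance
the bar resolution. The invariant of the recursion is that `u n` takes cycles to cycles: then `u n ∘
d` lands in cycles of the target, which are boundaries, and projectivity provides `u (n + 1)`. -/
theorem exists_lift (ψ : GrGreen.Hom A A') (f : GrHom N.C N'.C) (hf : Box.SemiR ψ.u N N' f)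
    (Q : N.Res) (Q' : N'.Res) (hQ : ∀ n, (Q.X n).IsProjective) : Nonempty (Lift ψ.u f Q Q') := by
  refine exists_seq_of_step
    (S := fun n => GrHom (Q.X n).C (Q'.X n).C)
    (fun u => ∀ {α : Γ} {T : FinGSet G} (x : ((Q.X 0).C α).obj T),
      (f α).app T ((Q.ε.u α).app T x) = (Q'.ε.u α).app T ((u α).app T x))
    (fun n u => Box.SemiR ψ.u (Q.X n) (Q'.X n) u ∧ ∀ {α : Γ} {T : FinGSet G}
      (x : ((Q.X n).C α).obj T), Q.IsCycle n x → Q'.IsCycle n ((u α).app T x))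
    (fun n u v => ∀ {α : Γ} {T : FinGSet G} (x : ((Q.X (n + 1)).C α).obj T),
      (u α).app T (((Q.d n).u α).app T x) = ((Q'.d n).u α).app T ((v α).app T x)) ?_ ?_
    fun u h₀ hs hg => ⟨⟨u, fun n => (hg n).1, fun n => hs n, h₀⟩⟩
  · obtain ⟨l, hl, hl'⟩ := (hQ 0).exists_semi_lift ψ Q'.ε (f.comp Q.ε.u) (fun h _ n a => by
      rw [GrHom.comp_app, GrHom.comp_app, Q.ε.map_act, hf]) (fun x => Q'.surjective _ _ _)
    refine ⟨l, fun x => (hl' x).symm, hl, fun x hx => ?_⟩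
    change (Q'.ε.u _).app _ _ = 0
    have hx' : (Q.ε.u _).app _ x = 0 := hx
    rw [hl', GrHom.comp_app, hx', map_zero]
  · rintro n u ⟨hu, hc⟩
    obtain ⟨l, hl, hl'⟩ := (hQ (n + 1)).exists_semi_lift ψ (Q'.d n) (u.comp (Q.d n).u)
      (fun h _ n a => by rw [GrHom.comp_app, GrHom.comp_app, (Q.d _).map_act, hu])
      (fun x => (Q'.isCycle_iff n _).1 (hc _ ((Q.isCycle_iff n _).2 ⟨x, rfl⟩)))
    refine ⟨l, fun x => (hl' x).symm, hl, fun x hx => ?_⟩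
    change ((Q'.d n).u _).app _ _ = 0
    have hx' : ((Q.d n).u _).app _ x = 0 := hx
    rw [hl', GrHom.comp_app, hx', map_zero]

/-- Two lifts of the same map are homotopic. -/
theorem Lift.exists_homotopy (ψ : GrGreen.Hom A A') {f : GrHom N.C N'.C} {Q : N.Res}
    {Q' : N'.Res} (hQ : ∀ n, (Q.X n).IsProjective) (F F' : Lift ψ.u f Q Q') :
    ∃ s : ∀ n, GrHom (Q.X n).C (Q'.X (n + 1)).C,
      (∀ n, Box.SemiR ψ.u (Q.X n) (Q'.X (n + 1)) (s n)) ∧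
      (∀ {α : Γ} {T : FinGSet G} (x : ((Q.X 0).C α).obj T),
        (F.u 0 α).app T x - (F'.u 0 α).app T x = ((Q'.d 0).u α).app T ((s 0 α).app T x)) ∧
      ∀ (n : ℕ) {α : Γ} {T : FinGSet G} (x : ((Q.X (n + 1)).C α).obj T),
        (F.u (n + 1) α).app T x - (F'.u (n + 1) α).app T x =
          ((Q'.d (n + 1)).u α).app T ((s (n + 1) α).app T x) +
            (s n α).app T (((Q.d n).u α).app T x) := by
  have hsub : ∀ n, Box.SemiR ψ.u (Q.X n) (Q'.X n) ((F.u n).sub (F'.u n)) :=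
    fun n _ _ _ h _ x a => by
    simp only [GrHom.sub_app]
    rw [F.semi, F'.semi, map_sub, AddMonoidHom.sub_apply]
  refine exists_seq_of_step
    (S := fun n => GrHom (Q.X n).C (Q'.X (n + 1)).C)
    (fun s => ∀ {α : Γ} {T : FinGSet G} (x : ((Q.X 0).C α).obj T),
        (F.u 0 α).app T x - (F'.u 0 α).app T x = ((Q'.d 0).u α).app T ((s α).app T x))
    -- The invariant requires `d' s = F - F'` on cycles only. There the term `s d` of the homotopy
    -- formula vanishes, so the same condition makes sense in degree `0` and in higher degrees.
    (fun n s => Box.SemiR ψ.u (Q.X n) (Q'.X (n + 1)) s ∧ ∀ {α : Γ} {T : FinGSet G}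
      (x : ((Q.X n).C α).obj T), Q.IsCycle n x →
        ((Q'.d n).u α).app T ((s α).app T x) = (F.u n α).app T x - (F'.u n α).app T x)
    (fun n s t => ∀ {α : Γ} {T : FinGSet G} (x : ((Q.X (n + 1)).C α).obj T),
        (F.u (n + 1) α).app T x - (F'.u (n + 1) α).app T x =
          ((Q'.d (n + 1)).u α).app T ((t α).app T x) +
            (s α).app T (((Q.d n).u α).app T x)) ?_ ?_
    fun s h₀ hs hg => ⟨s, fun n => (hg n).1, h₀, fun n => hs n⟩
  -- Both lifts cover `f`, so their difference in degree `0` is augmented to zero and hence consists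
  -- of boundaries.
  · obtain ⟨l, hl, hl'⟩ := (hQ 0).exists_semi_lift ψ (Q'.d 0) _ (hsub 0) (fun x =>
      (Q'.exact_zero _).1 (by rw [GrHom.sub_app, map_sub, ← F.comm_ε, ← F'.comm_ε, sub_self]))
    exact ⟨l, fun x => (hl' x).symm, hl, fun x _ => hl' x⟩
  · rintro n s ⟨hu, hc⟩
    -- The map to be lifted is `F - F' - s d`. It consists of cycles: `d'(F - F') x = (F - F')(d
    -- x)`, and the invariant applied to the cycle `d x` identifies this with `d' s (d x)`.
    obtain ⟨l, hl, hl'⟩ := (hQ (n + 1)).exists_semi_lift ψ (Q'.d (n + 1))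
      (((F.u (n + 1)).sub (F'.u (n + 1))).sub (s.comp (Q.d n).u))
      (fun h _ x a => by
        simp only [GrHom.sub_app, GrHom.comp_app, (Q.d n).map_act]
        rw [F.semi, F'.semi, hu]
        simp only [map_sub, AddMonoidHom.sub_apply])
      (fun x => (Q'.exact_succ n _).1 (by
        rw [GrHom.sub_app, GrHom.sub_app, GrHom.comp_app, map_sub, map_sub, ← F.comm, ← F'.comm,
          hc _ ((Q.isCycle_iff n _).2 ⟨x, rfl⟩), sub_self]))
    have hl'' : ∀ {α : Γ} {T : FinGSet G} (x : ((Q.X (n + 1)).C α).obj T),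
        ((Q'.d (n + 1)).u α).app T ((l α).app T x) = (F.u (n + 1) α).app T x -
          (F'.u (n + 1) α).app T x - (s α).app T (((Q.d n).u α).app T x) := hl'
    refine ⟨l, fun x => by rw [hl'', sub_add_cancel], hl, fun x hx => ?_⟩
    have hx' : ((Q.d n).u _).app _ x = 0 := hx
    rw [hl'', hx', map_zero, sub_zero]

variable {ψ : GrHom A.C A'.C} {f : GrHom N.C N'.C} {Q : N.Res} {Q' : N'.Res} {P : LMod A}
  {P' : LMod A'} {v : GrHom P.C P'.C}

/-- The chain map `X_• □_A P → X'_• □_A' P'` induced by a lift to resolutions. -/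
def Lift.boxHom (F : Lift ψ f Q Q') (hv : Box.SemiL ψ P P' v) :
    GrComplex.Hom (Q.boxComplex P) (Q'.boxComplex P') where
  u n := Box.map (F.semi n) hv
  comm n α T x := by
    change (Box.map (F.semi n) hv α).app T (((Q.d n).box P α).app T x) =
      ((Q'.d n).box P' α).app T ((Box.map (F.semi (n + 1)) hv α).app T x)
    induction x using Box.ind with
    | h0 => simp only [map_zero]
    | ht k e n p =>
      simp only [Mackey.Hom.app_tr]
      rw [RMod.Hom.box_tmul, Box.map_tmul, Box.map_tmul, RMod.Hom.box_tmul, F.comm]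
    | hadd x y hx hy => simp only [map_add, hx, hy]

/-- The composite of two lifts. -/
def Lift.comp {A'' : GrGreen.{u} Γ G} {N'' : RMod A''} {ψ' : GrHom A'.C A''.C}
    {f' : GrHom N'.C N''.C} {Q'' : N''.Res} (F' : Lift ψ' f' Q' Q'') (F : Lift ψ f Q Q') :
    Lift (ψ'.comp ψ) (f'.comp f) Q Q'' where
  u n := (F'.u n).comp (F.u n)
  semi n _ _ _ h _ x a := by
    rw [GrHom.comp_app, F.semi, F'.semi]
    rfl
  comm n _ _ x := by rw [GrHom.comp_app, F.comm, F'.comm]; rfl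
  comm_ε x := by rw [GrHom.comp_app, F.comm_ε, F'.comm_ε]; rfl

/-- The homotopy between the lifts is semilinear over `ψ`, so its box product with `v` is defined
and is a homotopy between the induced chain maps. -/
theorem Lift.homologyMap_eq (ψ : GrGreen.Hom A A') (hQ : ∀ n, (Q.X n).IsProjective)
    (F F' : Lift ψ.u f Q Q') (hv : Box.SemiL ψ.u P P' v) (n : ℕ) :
    (F.boxHom hv).homologyMap n = (F'.boxHom hv).homologyMap n := by
  obtain ⟨s, hs, h₀, h₁⟩ := Lift.exists_homotopy ψ hQ F F'
  refine GrComplex.Hom.homologyMap_eq (fun n => Box.map (hs n) hv) ?_ ?_ n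
  · intro α T x
    change (Box.map (F.semi 0) hv α).app T x - (Box.map (F'.semi 0) hv α).app T x =
      ((Q'.d 0).box P' α).app T ((Box.map (hs 0) hv α).app T x)
    induction x using Box.ind with
    | h0 => simp only [map_zero, sub_zero]
    | ht k e n p =>
      simp only [Mackey.Hom.app_tr]
      rw [Box.map_tmul, Box.map_tmul, Box.map_tmul, RMod.Hom.box_tmul, ← h₀, ← map_sub,
        map_sub ((Box.tmul _ _).f _), AddMonoidHom.sub_apply]
    | hadd x y hx hy => simp only [map_add, ← hx, ← hy]; abel
  · intro n α T x
    change (Box.map (F.semi (n + 1)) hv α).app T x - (Box.map (F'.semi (n + 1)) hv α).app T x =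
      ((Q'.d (n + 1)).box P' α).app T ((Box.map (hs (n + 1)) hv α).app T x) +
        (Box.map (hs n) hv α).app T (((Q.d n).box P α).app T x)
    induction x using Box.ind with
    | h0 => simp only [map_zero, sub_zero, add_zero]
    | ht k e x p =>
      simp only [Mackey.Hom.app_tr]
      rw [Box.map_tmul, Box.map_tmul, Box.map_tmul, RMod.Hom.box_tmul, RMod.Hom.box_tmul,
        Box.map_tmul, ← map_sub, ← map_add, ← AddMonoidHom.add_apply, ← map_add, ← h₁,
        map_sub ((Box.tmul _ _).f _), AddMonoidHom.sub_apply]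
    | hadd x y hx hy =>
      simp only [map_add]
      rw [add_sub_add_comm, hx, hy]
      abel

end RMod.Res

end Resolutions

end

noncomputable section

section Kernels

/-! ### Kernels of maps of left modules -/

/-- A sub-Mackey functor as a Mackey functor. -/
def Mackey.Sub.toMackey {G : Type} [Group G] {M : Mackey.{u} G} (Z : M.Sub) : Mackey.{u} G where
  obj X := Z.S X
  res {X Y} f := ((M.res f).comp (Z.S Y).subtype).codRestrict (Z.S X) fun m => Z.res_mem f m.2
  tr {X Y} f := ((M.tr f).comp (Z.S X).subtype).codRestrict (Z.S Y) fun m => Z.tr_mem f m.2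
  res_id m := Subtype.ext (M.res_id m.1)
  tr_id m := Subtype.ext (M.tr_id m.1)
  res_comp f k m := Subtype.ext (M.res_comp f k m.1)
  tr_comp f k m := Subtype.ext (M.tr_comp f k m.1)
  res_tr a b f k h m := Subtype.ext (M.res_tr a b f k h m.1)
  tr_res_add i j h m := Subtype.ext (M.tr_res_add i j h m.1)

/-- The kernel of a map of Mackey functors. -/
def Mackey.Hom.kerSub {G : Type} [Group G] {M N : Mackey.{u} G} (f : Mackey.Hom M N) : M.Sub where
  S T := (f.app T).ker
  res_mem k m hm := by
    rw [AddMonoidHom.mem_ker] at hm ⊢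
    rw [f.app_res, hm, map_zero]
  tr_mem k m hm := by
    rw [AddMonoidHom.mem_ker] at hm ⊢
    rw [f.app_tr, hm, map_zero]

variable {Γ G : Type} [AddCommGroup Γ] [Group G] {A : GrGreen.{u} Γ G}

namespace LMod.Hom

variable {P P' : LMod A} (v : P.Hom P')

/-- The action on the kernel of a map. -/
def kerAct : Pairing A.C (fun α => (v.u α).kerSub.toMackey) fun α => (v.u α).kerSub.toMackey where
  f {α β γ} h {T} := addHom₂ (fun a x => ⟨P.act.f h a x.1, by
      have hx : (v.u β).app T x.1 = 0 := x.2
      change (v.u γ).app T _ = 0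
      rw [v.semi, hx, map_zero]⟩)
    (fun a a' x => Subtype.ext (by
      change P.act.f h (a + a') x.1 = P.act.f h a x.1 + P.act.f h a' x.1
      rw [map_add, AddMonoidHom.add_apply]))
    (fun a x x' => Subtype.ext (map_add (P.act.f h a) x.1 x'.1))
  res h _ _ k a x := Subtype.ext (P.act.res h k a x.1)
  tr_left h _ _ k a x := Subtype.ext (P.act.tr_left h k a x.1)
  tr_right h _ _ k a x := Subtype.ext (P.act.tr_right h k a x.1)

/-- The kernel of a map of left modules. -/
abbrev ker : LMod A where
  C := fun α => (v.u α).kerSub.toMackey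
  act := v.kerAct
  one_act h _ x := Subtype.ext (P.one_act h x.1)
  mul_act h₁ h₂ h₃ h₄ _ a b x := Subtype.ext (P.mul_act h₁ h₂ h₃ h₄ a b x.1)

/-- The inclusion of the kernel. -/
def kerIncl : v.ker.Hom P where
  u := fun α =>
    { app := fun T => ((v.u α).app T).ker.subtype
      app_res := fun _ _ => rfl
      app_tr := fun _ _ => rfl }
  semi _ _ _ _ := rfl

theorem kerIncl_injective : v.kerIncl.u.Injective := fun _ _ => Subtype.val_injective

theorem app_kerIncl {α : Γ} {T : FinGSet G} (x : (v.ker.C α).obj T) :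
    (v.u α).app T ((v.kerIncl.u α).app T x) = 0 := x.2

theorem exists_kerIncl {α : Γ} {T : FinGSet G} (y : (P.C α).obj T) (hy : (v.u α).app T y = 0) :
    ∃ x, (v.kerIncl.u α).app T x = y := ⟨⟨y, hy⟩, rfl⟩

end LMod.Hom

/-- A map from a free module onto a given module. -/
def LMod.cover (P : LMod A) : LMod.Hom (A.free (GrMackey.cells P.C)) P where
  u := P.ofGens fun i => i.2.2
  semi := P.ofGens_semi _

theorem LMod.cover_surjective (P : LMod A) : P.cover.u.Surjective := fun α T n =>
  ⟨A.freeGen (E := GrMackey.cells P.C) ⟨α, T, n⟩,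
    P.ofGens_gen (fun i : (GrMackey.cells P.C).I => i.2.2) ⟨α, T, n⟩⟩

/-! ### Comparison of flat resolutions -/

namespace RMod.Res

variable {N : RMod A}

/-- The chain map `X_• □_A P → X_• □_A P'` induced by a map of left modules. -/
def boxComplexMap (Q : N.Res) {P P' : LMod A} (v : P.Hom P') :
    GrComplex.Hom (Q.boxComplex P) (Q.boxComplex P') where
  u n := v.box (Q.X n)
  comm n _ _ x := RMod.Hom.box_comp_box (Q.d n) v x

variable {Q Q' : N.Res} (c : Lift (GrHom.id A.C) (GrHom.id N.C) Q Q')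

theorem Lift.boxHom_boxComplexMap {P P' : LMod A} (v : P.Hom P') (n : ℕ) {γ : Γ} {T : FinGSet G}
    (z : (Box (Q.X n) P γ).obj T) :
    ((c.boxHom P'.semi_id).u n γ).app T (((Q.boxComplexMap v).u n γ).app T z) =
      ((Q'.boxComplexMap v).u n γ).app T (((c.boxHom P.semi_id).u n γ).app T z) :=
  (RMod.Hom.box_comp_box (X := Q.X n) (Y := Q'.X n) ⟨c.u n, c.semi n⟩ v z).symm

theorem box_ε_d (Q : N.Res) (P : LMod A) {α : Γ} {T : FinGSet G}
    (x : ((Q.boxComplex P).X 1 α).obj T) :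
    (Q.ε.box P α).app T (((Q.boxComplex P).d 0 α).app T x) = 0 := by
  change (Q.ε.box P α).app T (((Q.d 0).box P α).app T x) = 0
  induction x using Box.ind with
  | h0 => simp only [map_zero]
  | ht k e n p =>
    simp only [Mackey.Hom.app_tr]
    rw [RMod.Hom.box_tmul, RMod.Hom.box_tmul, Q.ε_d, map_zero, AddMonoidHom.zero_apply, map_zero]
  | hadd x y hx hy => simp only [map_add, hx, hy, add_zero]

theorem Lift.box_ε {P : LMod A} {α : Γ} {T : FinGSet G} (x : ((Q.boxComplex P).X 0 α).obj T) :
    (Q'.ε.box P α).app T (((c.boxHom P.semi_id).u 0 α).app T x) = (Q.ε.box P α).app T x := by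
  change (Q'.ε.box P α).app T ((Box.map (c.semi 0) P.semi_id α).app T x) = _
  induction x using Box.ind with
  | h0 => simp only [map_zero]
  | ht k e n p =>
    simp only [Mackey.Hom.app_tr]
    rw [Box.map_tmul, RMod.Hom.box_tmul, RMod.Hom.box_tmul, ← c.comm_ε]
    rfl
  | hadd x y hx hy => simp only [map_add, hx, hy]

/-- The box product with a free module `F` is exact, so both complexes are resolutions of `N □ F`
and the comparison map respects the augmentations. -/
theorem Lift.free_coneExact (E : CellFamily.{u} Γ G) (α : Γ) (T : FinGSet G) (n : ℕ) :
    (c.boxHom (A.free E).semi_id).ConeExact α T n := by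
  refine GrComplex.Hom.coneExact_of_augmented _ (Q.ε.box (A.free E)) (Q'.ε.box (A.free E))
    (Q.ε.box_surjective Q.surjective _) c.box_ε (Q'.box_ε_d _) ?_ ?_ ?_ ?_ α T n
  · exact fun x hx => Box.free_exact E _ _ (fun y hy => (Q.exact_zero y).1 hy) x hx
  · exact fun x hx => Box.free_exact E _ _ (fun y hy => (Q'.exact_zero y).1 hy) x hx
  · exact fun n _ _ x hx => Box.free_exact E _ _ (fun y hy => (Q.exact_succ n y).1 hy) x hx
  · exact fun n _ _ x hx => Box.free_exact E _ _ (fun y hy => (Q'.exact_succ n y).1 hy) x hx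

/-- A map of flat resolutions remains a quasi-isomorphism after taking box products with a left
module. -/
theorem Lift.coneExact (hQ : ∀ n, (Q.X n).IsFlat) (hQ' : ∀ n, (Q'.X n).IsFlat) (n : ℕ) :
    ∀ (P : LMod A) (α : Γ) (T : FinGSet G), (c.boxHom P.semi_id).ConeExact α T n := by
  induction n with
  | zero =>
    -- The bottom degree needs only right exactness: both sides have `N □ P` as cokernel.
    intro P α T b
    obtain ⟨p, hp⟩ := Q.ε.box_surjective Q.surjective P α T ((Q'.ε.box P α).app T b)
    obtain ⟨b', hb'⟩ := (Q'.d 0).box_exact Q'.ε Q'.surjective (fun y hy => (Q'.exact_zero y).1 hy)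
      P (b - ((c.boxHom P.semi_id).u 0 α).app T p) ((map_sub ((Q'.ε.box P α).app T) _ _).trans
        (sub_eq_zero.2 (hp.symm.trans (c.box_ε p).symm)))
    exact ⟨p, b', eq_add_of_sub_eq' hb'.symm⟩
  | succ n ih =>
    intro P α T
    -- For the free cover of `P` with its kernel, the composite of the inclusion and the cover is
    -- zero after any box product.
    have hz : ∀ {Q : N.Res} (n : ℕ) (x : (Box (Q.X n) P.cover.ker α).obj T),
        (P.cover.box (Q.X n) α).app T ((P.cover.kerIncl.box (Q.X n) α).app T x) = 0 := by
      intro Q n x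
      induction x using Box.ind with
      | h0 => simp only [map_zero]
      | ht k e m p =>
        simp only [Mackey.Hom.app_tr]
        rw [LMod.Hom.box_tmul, LMod.Hom.box_tmul, P.cover.app_kerIncl, map_zero, map_zero]
      | hadd x y hx hy => simp only [map_add, hx, hy, add_zero]
    -- Dimension shifting along kernel, free cover and `P`. Flatness of the terms of both
    -- resolutions is used exactly for injectivity on the left. The induction hypothesis is applied
    -- to the kernel, which is why the statement is proved for all left modules at once.
    exact GrComplex.Hom.ConeExact.shift (f₁ := c.boxHom P.cover.ker.semi_id)
      (f₂ := c.boxHom (A.free _).semi_id) (Q.boxComplexMap P.cover.kerIncl)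
      (Q.boxComplexMap P.cover) (Q'.boxComplexMap P.cover.kerIncl) (Q'.boxComplexMap P.cover)
      (fun n => hQ n _ _ _ P.cover.kerIncl_injective α T)
      (fun n => hQ' n _ _ _ P.cover.kerIncl_injective α T)
      (fun n => P.cover.box_surjective P.cover_surjective (Q.X n) α T)
      (fun n => P.cover.box_surjective P.cover_surjective (Q'.X n) α T)
      (fun n x => hz n x) (fun n x => hz n x)
      (fun n x hx => P.cover.kerIncl.box_exact P.cover P.cover_surjective
        (fun y hy => P.cover.exists_kerIncl y hy) (Q.X n) x hx)
      (fun n x hx => P.cover.kerIncl.box_exact P.cover P.cover_surjective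
        (fun y hy => P.cover.exists_kerIncl y hy) (Q'.X n) x hx)
      (fun n x => c.boxHom_boxComplexMap P.cover.kerIncl n x)
      (fun n x => c.boxHom_boxComplexMap P.cover n x) n (ih _ α T)
      (c.free_coneExact _ α T (n + 1))

theorem Lift.homologyMap_isIso (hQ : ∀ n, (Q.X n).IsFlat) (hQ' : ∀ n, (Q'.X n).IsFlat)
    (P : LMod A) (n : ℕ) : ((c.boxHom P.semi_id).homologyMap n).IsIso :=
  GrComplex.Hom.homologyMap_isIso _ (fun α T n => c.coneExact hQ hQ' n P α T) n

end RMod.Res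

end Kernels

end

noncomputable section

section BarResolution

variable {Γ G : Type} [AddCommGroup Γ] [Group G] {σ : SignRule Γ G} {R : GrGreen.{u} Γ G}

/-! ### Bimodules as right modules over the enveloping algebra -/

/-- A bimodule as a right module over `M □_R M^op`, by `x (m ⊗ b) = σ(|b|, |x| + |m|) b x m`. -/
abbrev BiMod.rr {M : Alg σ R} (X : BiMod M) : RR M M.op where
  C := X.C
  r₁ := X.r
  r₂ := X.l.flip.twist fun α β => σ.s β α
  r₁_one := X.r_one
  r₁_mul := X.r_mul
  r₂_one {α} h T x := by
    change σ.s 0 α • X.l.f ((add_comm _ _).trans h) (M.A.one T) x = x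
    rw [X.one_l, σ.zero_left, one_smul]
  r₂_mul {α β γ δ ε ζ} h₁ h₂ h₃ h₄ T x a b := by
    change (M.A.C β).obj T at a
    change (M.A.C γ).obj T at b
    have e₁ : ε + α = ζ := by rw [add_comm, h₁]
    have e₂ : γ + β = ε := by rw [add_comm, h₂]
    have e₃ : γ + δ = ζ := by rw [add_comm, h₃]
    have e₄ : β + α = δ := by rw [add_comm, h₄]
    change σ.s ε α • X.l.f e₁ (σ.s γ β • M.A.mul.f e₂ b a) x =
      σ.s γ δ • X.l.f e₃ b (σ.s β α • X.l.f e₄ a x)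
    rw [X.l.smul_left, X.l.smul_right, X.mul_l e₁ e₂ e₃ e₄, smul_smul, smul_smul]
    congr 1
    rw [← h₂, ← h₄, σ.add_left, σ.add_right]
    ring
  comm {α β γ δ ε ζ} h₁ h₂ h₃ h₄ T m n x := by
    have h₂' : β + γ = δ := by rw [add_comm]; exact h₂
    have h₃' : β + ε = ζ := by rw [add_comm]; exact h₃
    change (M.A.C β).obj T at n
    change X.r.f h₁ (σ.s β γ • X.l.f h₂' n x) m =
      σ.s α β • σ.s β ε • X.l.f h₃' n (X.r.f h₄ x m)
    rw [X.r.smul_left, X.assoc h₁ h₂' h₃' h₄, smul_smul]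
    congr 1
    rw [← h₄, σ.add_right, mul_left_comm, σ.symm, mul_one]
  agree {α β γ} h T s x := by
    have h' : α + β = γ := by rw [add_comm]; exact h
    change X.r.f h x ((M.η α).app T s) = σ.s α β • X.l.f h' ((M.η α).app T s) x
    rw [X.central h' h, smul_smul, σ.symm, one_smul]

/-- The elements `m ⊗ n`, their transfers and sums exhaust `M □_R N`, and `m ⊗ n` acts as `m`
followed by `n`. So semilinearity over the box product is semilinearity for each of the two actions.
-/
theorem RR.semi {M N M' N' : Alg σ R} {P : RR M N} {P' : RR M' N'} (φ : GrHom M.A.C M'.A.C)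
    (χ : GrHom N.A.C N'.A.C) (ψ : GrHom (M.tensorC N) (M'.tensorC N'))
    (hψ : ∀ {α β γ : Γ} (h : α + β = γ) {T : FinGSet G} (m : (M.A.C α).obj T)
      (n : (N.A.C β).obj T), (ψ γ).app T ((M.tt N).f h m n) =
        (M'.tt N').f h ((φ α).app T m) ((χ β).app T n))
    (v : GrHom P.C P'.C)
    (h₁ : ∀ {α β γ : Γ} (h : α + β = γ) {T : FinGSet G} (x : (P.C α).obj T)
      (m : (M.A.C β).obj T), (v γ).app T (P.r₁.f h x m) =
        P'.r₁.f h ((v α).app T x) ((φ β).app T m))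
    (h₂ : ∀ {α β γ : Γ} (h : α + β = γ) {T : FinGSet G} (x : (P.C α).obj T)
      (n : (N.A.C β).obj T), (v γ).app T (P.r₂.f h x n) =
        P'.r₂.f h ((v α).app T x) ((χ β).app T n)) :
    Box.SemiR (A := M.tensor N) (A' := M'.tensor N') ψ P.toRMod P'.toRMod v := by
  intro α β γ h T p a
  change (v γ).app T (P.act.f h p a) = P'.act.f h ((v α).app T p) ((ψ β).app T a)
  induction a using Alg.tensor_ind with
  | h0 => simp only [map_zero]
  | @ht U k μ ν e m b =>
    have e₁ : α + μ + ν = γ := by rw [add_assoc, e, h]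
    rw [P.act.tr_right, (ψ β).app_tr, (v γ).app_tr, P'.act.tr_right, hψ, P.act_tt h e rfl e₁,
      P'.act_tt h e rfl e₁, h₂, h₁, (v α).app_res]
  | hadd x y hx hy => simp only [map_add, hx, hy]

theorem BiMod.rr_semi {M M' : Alg σ R} (φ : Alg.Hom M M') {X : BiMod M} {Y : BiMod M'}
    (u : GrHom X.C Y.C)
    (hl : ∀ {α β γ : Γ} (h : α + β = γ) {T : FinGSet G} (a : (M.A.C α).obj T)
      (x : (X.C β).obj T), (u γ).app T (X.l.f h a x) = Y.l.f h ((φ.u α).app T a) ((u β).app T x))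
    (hr : ∀ {α β γ : Γ} (h : α + β = γ) {T : FinGSet G} (x : (X.C α).obj T)
      (a : (M.A.C β).obj T), (u γ).app T (X.r.f h x a) =
        Y.r.f h ((u α).app T x) ((φ.u β).app T a)) :
    Box.SemiR φ.env X.rr.toRMod Y.rr.toRMod u := by
  refine RR.semi (P := X.rr) (P' := Y.rr) φ.u φ.op.u φ.env (φ.tensor_tt φ.op) u hr ?_
  intro α β γ h T x n
  have h' : β + α = γ := by rw [add_comm]; exact h
  change (M.A.C β).obj T at n
  change (X.C α).obj T at x
  change (u γ).app T (σ.s β α • X.l.f h' n x) =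
    σ.s β α • Y.l.f h' ((φ.u β).app T n) ((u α).app T x)
  rw [Mackey.Hom.map_smul, hl]

/-- A map of bimodules as a map of right modules over the enveloping algebra. -/
def BiMod.rrHom {M : Alg σ R} {X Y : BiMod M} (u : GrHom X.C Y.C)
    (hl : ∀ {α β γ : Γ} (h : α + β = γ) {T : FinGSet G} (a : (M.A.C α).obj T)
      (x : (X.C β).obj T), (u γ).app T (X.l.f h a x) = Y.l.f h a ((u β).app T x))
    (hr : ∀ {α β γ : Γ} (h : α + β = γ) {T : FinGSet G} (x : (X.C α).obj T)
      (a : (M.A.C β).obj T), (u γ).app T (X.r.f h x a) = Y.r.f h ((u α).app T x) a) :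
    X.rr.toRMod.Hom Y.rr.toRMod where
  u := u
  map_act := by
    refine RR.semi (P := X.rr) (P' := Y.rr) (GrHom.id _) (GrHom.id _) (GrHom.id _)
      (fun _ _ _ _ => rfl) u hr ?_
    intro α β γ h T x n
    have h' : β + α = γ := by rw [add_comm]; exact h
    change (M.A.C β).obj T at n
    change (X.C α).obj T at x
    change (u γ).app T (σ.s β α • X.l.f h' n x) = σ.s β α • Y.l.f h' n ((u α).app T x)
    rw [Mackey.Hom.map_smul, hl]

/-- With `Alg.Hom.tensor₂_tensor` this says that `φ □ χ` is semilinear for the two left actions on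
`M □_R N`. Through `LL.semi` that is multiplicativity, since the product of `M □_R N` is built from
these actions. -/
theorem Alg.Hom.tensor₁_tensor {M N M' N' : Alg σ R} (φ : Alg.Hom M M') (χ : Alg.Hom N N')
    {α β γ : Γ} (h : α + β = γ) {T : FinGSet G} (a : (M.A.C α).obj T)
    (x : (M.tensorC N β).obj T) : (φ.tensor χ γ).app T ((M.tensor₁ N).f h a x) =
      (M'.tensor₁ N').f h ((φ.u α).app T a) ((φ.tensor χ β).app T x) := by
  induction x using Alg.tensor_ind with
  | h0 => simp only [map_zero]
  | @ht U k μ ν e m n =>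
    have e₁ : α + μ + ν = γ := by rw [add_assoc, e, h]
    rw [(M.tensor₁ N).tr_right, Mackey.Hom.app_tr, Mackey.Hom.app_tr, (M'.tensor₁ N').tr_right,
      Alg.tensor₁_tt h e rfl e₁, φ.tensor_tt, φ.tensor_tt, Alg.tensor₁_tt h e rfl e₁, φ.map_mul,
      (φ.u α).app_res]
  | hadd x y hx hy => simp only [map_add, hx, hy]

theorem Alg.Hom.tensor₂_tensor {M N M' N' : Alg σ R} (φ : Alg.Hom M M') (χ : Alg.Hom N N')
    {α β γ : Γ} (h : α + β = γ) {T : FinGSet G} (a : (N.A.C α).obj T)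
    (x : (M.tensorC N β).obj T) : (φ.tensor χ γ).app T ((M.tensor₂ N).f h a x) =
      (M'.tensor₂ N').f h ((χ.u α).app T a) ((φ.tensor χ β).app T x) := by
  induction x using Alg.tensor_ind with
  | h0 => simp only [map_zero]
  | @ht U k μ ν e m n =>
    have e₁ : μ + (α + ν) = γ := by rw [← h, ← e]; abel
    rw [(M.tensor₂ N).tr_right, Mackey.Hom.app_tr, Mackey.Hom.app_tr, (M'.tensor₂ N').tr_right,
      Alg.tensor₂_tt h e rfl e₁, Mackey.Hom.map_smul, φ.tensor_tt, φ.tensor_tt,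
      Alg.tensor₂_tt h e rfl e₁, χ.map_mul, (χ.u α).app_res]
  | hadd x y hx hy => simp only [map_add, hx, hy]

/-- The map of enveloping algebras induced by a map of algebras, as a map of graded Green
functors. -/
def Alg.Hom.envHom {M M' : Alg σ R} (φ : Alg.Hom M M') : GrGreen.Hom M.env M'.env where
  u := φ.env
  map_one T := by
    refine (φ.tensor_tt φ.op (add_zero 0) (M.A.one T) (M.A.one T)).trans ?_
    change (M'.tt M'.op).f (add_zero 0) ((φ.u 0).app T (M.A.one T))
      ((φ.u 0).app T (M.A.one T)) = (M'.tt M'.op).f (add_zero 0) (M'.A.one T) (M'.A.one T)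
    rw [φ.map_one]
  map_mul h _ a b :=
    -- Multiplicativity of `φ.env` is its semilinearity over itself, for the enveloping algebras as
    -- left modules over themselves.
    LL.semi (P := LL.self M M.op) (P' := LL.self M' M'.op) φ.u φ.op.u φ.env (φ.tensor_tt φ.op)
      φ.env (φ.tensor₁_tensor φ.op) (φ.tensor₂_tensor φ.op) h a b

/-! ### The bar resolution -/

namespace Alg

variable (M : Alg σ R)

/-- The map `x ↦ x ⊗ 1`, which contracts the bar resolution. -/
def barS (q : ℕ) : GrHom (M.barC q) (M.barC (q + 1)) := fun α =>
  { app := fun T => ((M.barT q).f (add_zero α)).flip (M.A.one T)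
    app_res := fun k m => by
      simp only [AddMonoidHom.flip_apply]
      rw [(M.barT q).res, M.A.res_one]
    app_tr := fun k m => by
      simp only [AddMonoidHom.flip_apply]
      rw [(M.barT q).tr_left, M.A.res_one] }

theorem barS_app (q : ℕ) {α : Γ} {T : FinGSet G} (x : (M.barC q α).obj T) :
    (M.barS q α).app T x = (M.barT q).f (add_zero α) x (M.A.one T) := rfl

theorem inner_zero_barS {α : Γ} {T : FinGSet G} (x : (M.barC 0 α).obj T) :
    (M.inner 0 α).app T ((M.barS 0 α).app T x) = x := by
  rw [barS_app, inner_zero_tm]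
  exact (M.bar 0).r_one _ x

/-- On `x ⊗ 1` every face but the last acts on `x` alone, and the last one multiplies `x` by the
unit, with sign `(-1)^(q+1)`. So appending a unit is a contraction up to this sign. -/
theorem inner_succ_barS (q : ℕ) {α : Γ} {T : FinGSet G} (x : (M.barC (q + 1) α).obj T) :
    (M.inner (q + 1) α).app T ((M.barS (q + 1) α).app T x) =
      (M.barS q α).app T ((M.inner q α).app T x) + (-1 : ℤ) ^ (q + 1) • x := by
  rw [barS_app, inner_succ_tm, ← barS_app]
  congr 2
  exact (M.bar (q + 1)).r_one _ x

/-- If `x` is a cycle, the contraction formula reduces to `d (x ⊗ 1) = ± x`; the sign is absorbed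
into the witness. -/
theorem inner_eq_zero_iff (q : ℕ) {α : Γ} {T : FinGSet G} (x : (M.barC (q + 1) α).obj T) :
    (M.inner q α).app T x = 0 ↔ ∃ y, (M.inner (q + 1) α).app T y = x := by
  constructor
  · intro h
    refine ⟨(-1 : ℤ) ^ (q + 1) • (M.barS (q + 1) α).app T x, ?_⟩
    rw [map_zsmul, inner_succ_barS, h, map_zero, zero_add, smul_smul, ← mul_pow, neg_one_mul,
      neg_neg, one_pow, one_smul]
  · rintro ⟨y, rfl⟩
    exact inner_inner q y

/-- The bar resolution of `M` over its enveloping algebra. -/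
def barRes : M.rightEnv.Res where
  -- Since `M.bar q` has `q + 1` factors, the term in degree `n` has `n + 2`: two outer factors that
  -- carry the bimodule structure and `n` inner ones. The augmentation is the multiplication of `M`.
  X n := (M.bar (n + 1)).rr.toRMod
  d n := BiMod.rrHom (X := M.bar (n + 1 + 1)) (Y := M.bar (n + 1)) (M.inner (n + 1))
    (inner_l (n + 1)) (inner_r (n + 1))
  ε := BiMod.rrHom (X := M.bar 1) (Y := M.bar 0) (M.inner 0) (inner_l 0) (inner_r 0)
  surjective _ _ x := ⟨_, M.inner_zero_barS x⟩
  exact_zero x := M.inner_eq_zero_iff 0 x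
  exact_succ n _ _ x := M.inner_eq_zero_iff (n + 1) x

variable {M}

theorem Hom.barU_inner {M' : Alg σ R} (φ : Hom M M') (q : ℕ) {γ : Γ} {T : FinGSet G}
    (z : (M.barC (q + 1) γ).obj T) : (φ.barU q γ).app T ((M.inner q γ).app T z) =
      (M'.inner q γ).app T ((φ.barU (q + 1) γ).app T z) := by
  rw [inner, inner, GrHom.altSum_app, GrHom.altSum_app, map_sum]
  exact Finset.sum_congr rfl fun i hi => by
    rw [map_zsmul, φ.barU_mulFace q i (Nat.lt_succ_iff.1 (Finset.mem_range.1 hi))]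

/-- The map of bar resolutions induced by a map of algebras. -/
def Hom.barLift {M' : Alg σ R} (φ : Hom M M') :
    RMod.Res.Lift φ.env φ.u M.barRes M'.barRes where
  u n := φ.barU (n + 1)
  semi n := BiMod.rr_semi φ (X := M.bar (n + 1)) (Y := M'.bar (n + 1)) (φ.barU (n + 1))
    (φ.barU_l (n + 1)) (φ.barU_r (n + 1))
  comm n _ _ x := φ.barU_inner (n + 1) x
  comm_ε x := φ.barU_inner 0 x

end Alg

end BarResolution

end

noncomputable section

section TensorModules

variable {Γ G : Type} [AddCommGroup Γ] [Group G] {σ : SignRule Γ G} {R : GrGreen.{u} Γ G}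

/-! ### Modules over a box product of two algebras -/

namespace Alg

variable (M K : Alg σ R)

/-- The map `m ↦ m ⊗ 1`. -/
def inl : GrHom M.A.C (M.tensorC K) := fun α =>
  { app := fun T => ((M.tt K).f (add_zero α)).flip (K.A.one T)
    app_res := fun k m => by
      simp only [AddMonoidHom.flip_apply]
      rw [(M.tt K).res, K.A.res_one]
    app_tr := fun k m => by
      simp only [AddMonoidHom.flip_apply]
      rw [(M.tt K).tr_left, K.A.res_one] }

/-- The map `n ↦ 1 ⊗ n`. -/
def inr : GrHom K.A.C (M.tensorC K) := fun α =>
  { app := fun T => (M.tt K).f (zero_add α) (M.A.one T)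
    app_res := fun k m => by rw [(M.tt K).res, M.A.res_one]
    app_tr := fun k m => by rw [(M.tt K).tr_right, M.A.res_one] }

variable {M K}

theorem inl_app {α : Γ} {T : FinGSet G} (m : (M.A.C α).obj T) :
    (M.inl K α).app T m = (M.tt K).f (add_zero α) m (K.A.one T) := rfl

theorem inr_app {α : Γ} {T : FinGSet G} (n : (K.A.C α).obj T) :
    (M.inr K α).app T n = (M.tt K).f (zero_add α) (M.A.one T) n := rfl

theorem inl_mul {α β γ : Γ} (h : α + β = γ) {T : FinGSet G} (m : (M.A.C α).obj T)
    (m' : (M.A.C β).obj T) : (M.inl K γ).app T (M.A.mul.f h m m') =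
      (M.tensor K).mul.f h ((M.inl K α).app T m) ((M.inl K β).app T m') := by
  rw [inl_app, inl_app, inl_app, tensor_mul_tt h (add_zero α) (add_zero β) h (add_zero 0)
    (add_zero γ), σ.zero_right, one_smul, K.A.one_mul]

theorem inr_mul {α β γ : Γ} (h : α + β = γ) {T : FinGSet G} (n : (K.A.C α).obj T)
    (n' : (K.A.C β).obj T) : (M.inr K γ).app T (K.A.mul.f h n n') =
      (M.tensor K).mul.f h ((M.inr K α).app T n) ((M.inr K β).app T n') := by
  rw [inr_app, inr_app, inr_app, tensor_mul_tt h (zero_add α) (zero_add β) (add_zero 0) h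
    (zero_add γ), σ.zero_left, one_smul, M.A.one_mul]

/-- The factorization `m ⊗ n = (m ⊗ 1)(1 ⊗ n)` shows that `M □_R K` is generated by the images of
the two algebras. In the opposite order a sign appears, see `inr_mul_inl`. -/
theorem inl_mul_inr {α β γ : Γ} (h : α + β = γ) {T : FinGSet G} (m : (M.A.C α).obj T)
    (n : (K.A.C β).obj T) :
    (M.tensor K).mul.f h ((M.inl K α).app T m) ((M.inr K β).app T n) = (M.tt K).f h m n := by
  rw [inl_app, inr_app, tensor_mul_tt h (add_zero α) (zero_add β) (add_zero α) (zero_add β) h,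
    σ.zero_left, one_smul, M.A.mul_one, K.A.one_mul]

theorem inr_mul_inl {α β γ : Γ} (h : β + α = γ) (h' : α + β = γ) {T : FinGSet G}
    (m : (M.A.C α).obj T) (n : (K.A.C β).obj T) :
    (M.tensor K).mul.f h ((M.inr K β).app T n) ((M.inl K α).app T m) =
      σ.s α β • (M.tt K).f h' m n := by
  rw [inl_app, inr_app, tensor_mul_tt h (zero_add β) (add_zero α) (zero_add α) (add_zero β) h',
    M.A.one_mul, K.A.mul_one]

/-- Balancing over `R`, applied to `1 ⊗ 1`: the two algebras induce the same map from the base. This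
gives the axiom `agree` of `LMod.toLL`. -/
theorem inl_η {α : Γ} {T : FinGSet G} (s : (R.C α).obj T) :
    (M.inl K α).app T ((M.η α).app T s) = (M.inr K α).app T ((K.η α).app T s) := by
  have h := tt_balanced (M := M) (N := K) (add_zero α) (zero_add α) (zero_add α) (add_zero α)
    (M.A.one T) s (K.A.one T)
  rw [M.A.one_mul, K.A.mul_one] at h
  exact h

/-- A pairing is balanced over `M □_R K` if it is balanced over `M` and over `K`. -/
theorem tensor_balanced {P : RMod (M.tensor K)} {N : LMod (M.tensor K)}
    {Q : GrMackey.{u} Γ G} (φ : Pairing P.C N.C Q)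
    (h₁ : ∀ {γ : Γ} {X : FinGSet G} {α β δ ε ζ : Γ} (e : ε + β = γ) (e' : α + ζ = γ)
      (e₁ : α + δ = ε) (e₂ : δ + β = ζ) (x : (P.C α).obj X) (m : (M.A.C δ).obj X)
      (n : (N.C β).obj X), φ.f e (P.act.f e₁ x ((M.inl K δ).app X m)) n =
        φ.f e' x (N.act.f e₂ ((M.inl K δ).app X m) n))
    (h₂ : ∀ {γ : Γ} {X : FinGSet G} {α β δ ε ζ : Γ} (e : ε + β = γ) (e' : α + ζ = γ)
      (e₁ : α + δ = ε) (e₂ : δ + β = ζ) (x : (P.C α).obj X) (m : (K.A.C δ).obj X)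
      (n : (N.C β).obj X), φ.f e (P.act.f e₁ x ((M.inr K δ).app X m)) n =
        φ.f e' x (N.act.f e₂ ((M.inr K δ).app X m) n)) :
    Box.Balanced (N := P) (P := N) φ := by
  intro γ T α β δ ε ζ e e' e₁ e₂ x a n
  change (M.tensorC K δ).obj T at a
  induction a using tensor_ind with
  | h0 => simp only [map_zero, AddMonoidHom.zero_apply]
  | @ht U k μ ν d m b =>
    have d₁ : α + μ + ν = ε := by rw [add_assoc, d, e₁]
    have d₂ : μ + (ν + β) = ζ := by rw [← add_assoc, d, e₂]
    have d₃ : α + μ + (ν + β) = γ := by rw [add_assoc, d₂, e']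
    -- With `m ⊗ b = (m ⊗ 1)(1 ⊗ b)` the two factors cross one at a time, first `1 ⊗ b` and then `m
    -- ⊗ 1`.
    rw [P.act.tr_right, N.act.tr_left, φ.tr_left, φ.tr_right, ← inl_mul_inr d,
      P.act_mul e₁ d d₁ rfl, N.mul_act e₂ d d₂ rfl, h₂ e d₃ d₁ rfl, h₁ d₃ e' rfl d₂]
  | hadd x y hx hy => simp only [map_add, AddMonoidHom.add_apply, hx, hy]

end Alg

variable {M K : Alg σ R}

theorem RR.act_inl (P : RR M K) {α β γ : Γ} (h : α + β = γ) {T : FinGSet G} (x : (P.C α).obj T)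
    (m : (M.A.C β).obj T) : P.act.f h x ((M.inl K β).app T m) = P.r₁.f h x m := by
  rw [Alg.inl_app, P.act_tt h (add_zero β) h (add_zero γ), P.r₂_one]

theorem RR.act_inr (P : RR M K) {α β γ : Γ} (h : α + β = γ) {T : FinGSet G} (x : (P.C α).obj T)
    (n : (K.A.C β).obj T) : P.act.f h x ((M.inr K β).app T n) = P.r₂.f h x n := by
  rw [Alg.inr_app, P.act_tt h (zero_add β) (add_zero α) h, P.r₁_one]

theorem LL.act_inl (P : LL M K) {α β γ : Γ} (h : α + β = γ) {T : FinGSet G}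
    (m : (M.A.C α).obj T) (x : (P.C β).obj T) :
    P.act.f h ((M.inl K α).app T m) x = P.l₁.f h m x := by
  rw [Alg.inl_app, P.act_tt h (add_zero α) h (zero_add β), P.one_l₂]

theorem LL.act_inr (P : LL M K) {α β γ : Γ} (h : α + β = γ) {T : FinGSet G}
    (n : (K.A.C α).obj T) (x : (P.C β).obj T) :
    P.act.f h ((M.inr K α).app T n) x = P.l₂.f h n x := by
  rw [Alg.inr_app, P.act_tt h (zero_add α) (zero_add γ) h, P.one_l₁]

/-- The two actions on a left module over `M □_R K`. -/
abbrev LMod.toLL (N : LMod (M.tensor K)) : LL M K where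
  C := N.C
  l₁ := N.act.compLeft (M.inl K)
  l₂ := N.act.compLeft (M.inr K)
  one_l₁ h _ x := N.one_act h x
  mul_l₁ h₁ h₂ h₃ h₄ _ a b x := by
    simp only [Pairing.compLeft_f]
    rw [Alg.inl_mul, N.mul_act h₁ h₂ h₃ h₄]
  one_l₂ h _ x := N.one_act h x
  mul_l₂ h₁ h₂ h₃ h₄ _ a b x := by
    simp only [Pairing.compLeft_f]
    rw [Alg.inr_mul, N.mul_act h₁ h₂ h₃ h₄]
  comm {α β γ δ ε ζ} h₁ h₂ h₃ h₄ T m n x := by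
    have e : β + α + γ = ζ := by rw [add_assoc, h₂, h₁]
    have e' : α + β + γ = ζ := by rw [add_assoc, h₄, h₃]
    simp only [Pairing.compLeft_f]
    rw [← N.mul_act e rfl h₁ h₂, Alg.inr_mul_inl rfl (add_comm α β), N.act.smul_left,
      ← Alg.inl_mul_inr, N.mul_act e (add_comm α β) h₃ h₄]
  agree h _ s x := by
    simp only [Pairing.compLeft_f]
    rw [Alg.inl_η]

/-- The left action of the opposite algebra, as a pairing with `M`. -/
def LL.opAct (P : LL M M.op) : Pairing M.A.C P.C P.C := P.l₂

theorem LL.one_opAct (P : LL M M.op) {α : Γ} (h : 0 + α = α) {T : FinGSet G}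
    (x : (P.C α).obj T) : P.opAct.f h (M.A.one T) x = x := P.one_l₂ h x

/-- The product of `M^op` is the reversed product of `M` with a sign, and the inverse of that sign
appears when the action is expressed through the product of `M`. -/
theorem LL.opAct_mul (P : LL M M.op) {α β γ δ ε ζ : Γ} (h₁ : δ + γ = ζ) (h₂ : α + β = δ)
    (h₃ : β + ε = ζ) (h₄ : α + γ = ε) {T : FinGSet G} (a : (M.A.C α).obj T)
    (b : (M.A.C β).obj T) (x : (P.C γ).obj T) : P.opAct.f h₁ (M.A.mul.f h₂ a b) x =
      σ.s β α • P.opAct.f h₃ b (P.opAct.f h₄ a x) := by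
  have key : P.opAct.f h₁ (σ.s α β • M.A.mul.f h₂ a b) x = P.opAct.f h₃ b (P.opAct.f h₄ a x) :=
    P.mul_l₂ h₁ ((add_comm _ _).trans h₂) h₃ h₄ b a x
  rw [← key, P.opAct.smul_left, smul_smul, σ.symm, one_smul]

/-- A left module over the enveloping algebra as a right module over `M`, by
`x b = σ(|b|, |x|) (1 ⊗ b) x`. -/
abbrev LL.right (P : LL M M.op) : RMod M.A where
  C := P.C
  act := P.opAct.flip.twist fun α β => σ.s β α
  act_one {α} h T x := by
    rw [Pairing.twist_f, Pairing.flip_f, P.one_opAct, σ.zero_left, one_smul]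
  act_mul {α β γ δ ε ζ} h₁ h₂ h₃ h₄ T x a b := by
    have e₁ : ε + α = ζ := by rw [add_comm, h₁]
    have e₃ : γ + δ = ζ := by rw [add_comm, h₃]
    have e₄ : β + α = δ := by rw [add_comm, h₄]
    simp only [Pairing.twist_f, Pairing.flip_f]
    rw [P.opAct.smul_right, P.opAct_mul _ h₂ e₃ e₄, smul_smul, smul_smul]
    congr 1
    rw [← h₂, ← h₄, σ.add_left, σ.add_right]
    ring

theorem LL.right_act (P : LL M M.op) {α β γ : Γ} (h : α + β = γ) (h' : β + α = γ)
    {T : FinGSet G} (x : (P.C α).obj T) (b : (M.A.C β).obj T) :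
    P.right.act.f h x b = σ.s β α • P.opAct.f h' b x := rfl

theorem LL.opAct_l₁ (P : LL M M.op) {α β γ δ ε ζ : Γ} (h₁ : β + δ = ζ) (h₂ : α + γ = δ)
    (h₃ : α + ε = ζ) (h₄ : β + γ = ε) {T : FinGSet G} (m : (M.A.C α).obj T)
    (b : (M.A.C β).obj T) (x : (P.C γ).obj T) : P.opAct.f h₁ b (P.l₁.f h₂ m x) =
      σ.s α β • P.l₁.f h₃ m (P.opAct.f h₄ b x) := P.comm h₁ h₂ h₃ h₄ m b x

theorem LL.η_opAct (P : LL M M.op) {α β γ : Γ} (h : α + β = γ) {T : FinGSet G}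
    (s : (R.C α).obj T) (x : (P.C β).obj T) :
    P.l₁.f h ((M.η α).app T s) x = P.opAct.f h ((M.η α).app T s) x := P.agree h s x

/-- The underlying left module of a bimodule. -/
abbrev BiMod.left (X : BiMod M) : LMod M.A where
  C := X.C
  act := X.l
  one_act := X.one_l
  mul_act := X.mul_l

end TensorModules

end

noncomputable section

section InducedModules

variable {Γ G : Type} [AddCommGroup Γ] [Group G] {σ : SignRule Γ G} {R : GrGreen.{u} Γ G}
  {M : Alg σ R}

/-! ### Box products of `X □_R M` with modules over the enveloping algebra -/

namespace BiMod

variable (X : BiMod M)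

theorem central_symm {α β γ : Γ} (h : α + β = γ) (h' : β + α = γ) {T : FinGSet G}
    (s : (R.C α).obj T) (x : (X.C β).obj T) :
    X.r.f h' x ((M.η α).app T s) = σ.s α β • X.l.f h ((M.η α).app T s) x := by
  rw [X.central h h', smul_smul, σ.symm, one_smul]

theorem rr_act_inl {α β γ : Γ} (h : α + β = γ) {T : FinGSet G} (x : (X.C α).obj T)
    (m : (M.A.C β).obj T) :
    X.rr.toRMod.act.f h x ((M.inl M.op β).app T m) = X.r.f h x m := X.rr.act_inl h x m

theorem rr_act_inr {α β γ : Γ} (h : α + β = γ) (h' : β + α = γ) {T : FinGSet G}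
    (x : (X.C α).obj T) (b : (M.A.C β).obj T) :
    X.rr.toRMod.act.f h x ((M.inr M.op β).app T b) = σ.s β α • X.l.f h' b x :=
  X.rr.act_inr h x b

variable (N : LMod M.env)

/-- The triple pairing `(n, x, m) ↦ σ(|m| + |n|, |x|) (m n ⊗ x)`. -/
def unstep₃ : Pairing₃ N.C X.C M.A.C (Box N.toLL.right X.left) :=
  Pairing₃.comp₂ N.toLL.l₁ ((Box.tmul N.toLL.right X.left).flip.twist fun α β => σ.s β α)

theorem unstep₃_f {α β γ δ ε : Γ} (h : α + (β + γ) = δ) (h₁ : γ + α = ε) (h₂ : ε + β = δ)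
    {T : FinGSet G} (n : (N.C α).obj T) (x : (X.C β).obj T) (m : (M.A.C γ).obj T) :
    (X.unstep₃ N).f h n x m =
      σ.s ε β • (Box.tmul N.toLL.right X.left).f h₂ (N.toLL.l₁.f h₁ m n) x := by
  subst h₁
  rfl

/-- A scalar `s` of `R` can travel around: centrality takes it to the left of `x`, the box product
over `M` takes it to the `M^op`-action on `m n`, and there it agrees with the action of `M`, so that
it ends up in front of `m`. -/
theorem unstep₃_balanced :
    Box.Balanced₃ (N := X.toRMod) (P := M.toLMod) (X.unstep₃ N) := by
  refine fun {γ κ T α β δ ε ζ} e e' e₁ e₂ n (x : (X.C α).obj T)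
    (s : (R.C δ).obj T) (m : (M.A.C β).obj T) => ?_
  change (X.unstep₃ N).f e n (X.r.f e₁ x ((M.η δ).app T s)) m =
    (X.unstep₃ N).f e' n x (M.A.mul.f e₂ ((M.η δ).app T s) m)
  have d₁ : β + κ + ε = γ := by rw [← e]; abel
  have d₂ : ζ + κ + α = γ := by rw [← e']; abel
  have d₃ : δ + α = ε := by rw [add_comm, e₁]
  have d₄ : δ + (β + κ) = ζ + κ := by rw [← add_assoc, e₂]
  have d₅ : β + κ + δ = ζ + κ := by rw [add_comm, d₄]
  rw [X.unstep₃_f N e rfl d₁, X.unstep₃_f N e' rfl d₂, X.central_symm d₃ e₁, Pairing.smul_right,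
    ← Box.tmul_balanced (N := N.toLL.right) (P := X.left) d₂ d₁ d₅ d₃, N.toLL.right_act d₅ d₄,
    Pairing.smul_left, ← N.toLL.η_opAct, ← N.toLL.mul_l₁ rfl e₂ d₄ rfl, smul_smul, smul_smul]
  congr 1
  rw [← e₁, ← e₂]
  simp only [σ.add_left, σ.add_right]
  -- After expansion the two signs differ by the factors `σ(β, δ) σ(δ, β)` and `σ(κ, δ) σ(δ, κ)`,
  -- both equal to `1`.
  linear_combination (σ.s β α * σ.s κ α * σ.s δ α) * (σ.s β δ * σ.s δ β) * σ.symm κ δ +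
    (σ.s β α * σ.s κ α * σ.s δ α) * σ.symm β δ

/-- The pairing `((x ⊗ m), n) ↦ σ(|m| + |n|, |x|) (m n ⊗ x)`. -/
def unstepP : Pairing X.stepC N.C (Box N.toLL.right X.left) :=
  (Box.lift₃ _ (X.unstep₃_balanced N)).flip

theorem unstepP_tm {α β γ μ ν ε : Γ} (h : α + β = γ) (e : μ + ν = α) (h₁ : ν + β = ε)
    (h₂ : ε + μ = γ) {T : FinGSet G} (x : (X.C μ).obj T) (m : (M.A.C ν).obj T)
    (n : (N.C β).obj T) : (X.unstepP N).f h (X.tm.f e x m) n =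
      σ.s ε μ • (Box.tmul N.toLL.right X.left).f h₂ (N.toLL.l₁.f h₁ m n) x :=
  (Box.lift₃_tmul _ (X.unstep₃_balanced N) ((add_comm _ _).trans h) e n x m).trans
    (X.unstep₃_f N _ h₁ h₂ n x m)

/-- The factors `M` and `M^op` can be checked separately. For `M` the last factor of `x ⊗ m` is
multiplied by `b`, and associativity of the action on `N` suffices. For `M^op` the element `b` acts
on `x` from the left and crosses the box product over `M` to become the right action on `m n`. -/
theorem unstepP_balanced :
    Box.Balanced (N := X.step.rr.toRMod) (P := N) (X.unstepP N) := by
  refine Alg.tensor_balanced (P := X.step.rr.toRMod) (N := N) (X.unstepP N) ?_ ?_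
  · intro γ T α β δ ε ζ e e' e₁ e₂ z b n
    change (X.stepC α).obj T at z
    refine (congrArg (fun y => (X.unstepP N).f e y n) (X.step.rr_act_inl e₁ z b)).trans ?_
    change (X.unstepP N).f e (X.stepR.f e₁ z b) n = (X.unstepP N).f e' z (N.toLL.l₁.f e₂ b n)
    induction z using X.ind with
    | h0 => simp only [map_zero, AddMonoidHom.zero_apply]
    | @ht U k μ ν d x m =>
      have d₁ : μ + (ν + δ) = ε := by rw [← add_assoc, d, e₁]
      have d₂ : ν + δ + β = ν + ζ := by rw [add_assoc, e₂]
      have d₃ : ν + ζ + μ = γ := by rw [← e', ← d]; abel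
      rw [X.stepR.tr_left, (X.unstepP N).tr_left, (X.unstepP N).tr_left, N.toLL.l₁.res,
        X.stepR_tm e₁ d rfl d₁, X.unstepP_tm N e d₁ d₂ d₃, X.unstepP_tm N e' d rfl d₃,
        N.toLL.mul_l₁ d₂ rfl rfl e₂]
    | hadd x y hx hy => simp only [map_add, AddMonoidHom.add_apply, hx, hy]
  · intro γ T α β δ ε ζ e e' e₁ e₂ z b n
    change (X.stepC α).obj T at z
    change (M.A.C δ).obj T at b
    have e₃ : δ + α = ε := by rw [add_comm, e₁]
    refine (congrArg (fun y => (X.unstepP N).f e y n) (X.step.rr_act_inr e₁ e₃ z b)).trans ?_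
    change (X.unstepP N).f e (σ.s δ α • X.stepL.f e₃ b z) n =
      (X.unstepP N).f e' z (N.toLL.opAct.f e₂ b n)
    rw [Pairing.smul_left]
    induction z using X.ind with
    | h0 => simp only [map_zero, AddMonoidHom.zero_apply, smul_zero]
    | @ht U k μ ν d x m =>
      have d₁ : δ + μ + ν = ε := by rw [add_assoc, d, e₃]
      have d₂ : ν + β + (δ + μ) = γ := by rw [← e, ← d₁]; abel
      have d₃ : ν + ζ + μ = γ := by rw [← e', ← d]; abel
      have d₄ : ν + β + δ = ν + ζ := by rw [← e₂]; abel
      have d₅ : δ + (ν + β) = ν + ζ := by rw [← e₂]; abel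
      rw [X.stepL.tr_right, (X.unstepP N).tr_left, (X.unstepP N).tr_left, N.toLL.opAct.res,
        X.stepL_tm e₃ d rfl d₁, X.unstepP_tm N e d₁ rfl d₂, X.unstepP_tm N e' d rfl d₃,
        ← Box.tmul_balanced (N := N.toLL.right) (P := X.left) d₃ d₂ d₄ rfl,
        N.toLL.right_act d₄ d₅, N.toLL.opAct_l₁ d₅ rfl rfl e₂, Pairing.smul_left,
        Pairing.smul_left, ← Mackey.tr_smul, smul_smul, smul_smul, smul_smul]
      congr 2
      rw [← d, ← e₂]
      simp only [σ.add_left, σ.add_right]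
      -- The signs differ by the square of `σ(δ, ν) σ(ν, δ)` and by `σ(β, δ) σ(δ, β)`.
      linear_combination (σ.s ν μ * σ.s δ μ * σ.s β μ * (σ.s β δ * σ.s δ β)) *
        (σ.s δ ν * σ.s ν δ + 1) * σ.symm δ ν + σ.s ν μ * σ.s δ μ * σ.s β μ * σ.symm β δ
    | hadd x y hx hy => simp only [map_add, AddMonoidHom.add_apply, smul_add, hx, hy]

/-- The map `z ⊗ n` of `(X □_R M) □ N`. -/
def envTm : Pairing X.stepC N.C (Box X.step.rr.toRMod N) := Box.tmul X.step.rr.toRMod N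

/-- The map `(X □_R M) □ N → N □_M X`, `(x ⊗ m) ⊗ n ↦ σ(|m| + |n|, |x|) (m n ⊗ x)`. -/
def unstep : GrHom (Box X.step.rr.toRMod N) (Box N.toLL.right X.left) :=
  Box.lift _ (X.unstepP_balanced N)

theorem unstep_tmul {α β γ : Γ} (h : α + β = γ) {T : FinGSet G} (z : (X.stepC α).obj T)
    (n : (N.C β).obj T) :
    (X.unstep N γ).app T ((X.envTm N).f h z n) = (X.unstepP N).f h z n :=
  Box.lift_tmul _ (X.unstepP_balanced N) h z n

/-- The map `x ↦ x ⊗ 1`. -/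
def unit : GrHom X.C X.stepC := fun α =>
  { app := fun T => (X.tm.f (add_zero α)).flip (M.A.one T)
    app_res := fun k m => by
      simp only [AddMonoidHom.flip_apply]
      rw [X.tm.res, M.A.res_one]
    app_tr := fun k m => by
      simp only [AddMonoidHom.flip_apply]
      rw [X.tm.tr_left, M.A.res_one] }

theorem unit_app {α : Γ} {T : FinGSet G} (x : (X.C α).obj T) :
    (X.unit α).app T x = X.tm.f (add_zero α) x (M.A.one T) := rfl

theorem unit_l {α β γ : Γ} (h : α + β = γ) {T : FinGSet G} (a : (M.A.C α).obj T)
    (x : (X.C β).obj T) : (X.unit γ).app T (X.l.f h a x) = X.stepL.f h a ((X.unit β).app T x) := by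
  rw [unit_app, unit_app, X.stepL_tm h (add_zero β) h (add_zero γ)]

theorem unit_r {α β γ : Γ} (h : α + β = γ) {T : FinGSet G} (x : (X.C α).obj T)
    (m : (M.A.C β).obj T) : X.stepR.f h ((X.unit α).app T x) m = X.tm.f h x m := by
  rw [unit_app, X.stepR_tm h (add_zero α) (zero_add β) h, M.A.one_mul]

theorem envTm_l₁ {α β γ δ ε ζ : Γ} (e : ε + β = γ) (e' : α + ζ = γ) (e₁ : α + δ = ε)
    (e₂ : δ + β = ζ) {T : FinGSet G} (z : (X.stepC α).obj T) (m : (M.A.C δ).obj T)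
    (n : (N.C β).obj T) : (X.envTm N).f e' z (N.toLL.l₁.f e₂ m n) =
      (X.envTm N).f e (X.stepR.f e₁ z m) n :=
  (Box.tmul_balanced (N := X.step.rr.toRMod) (P := N) e e' e₁ e₂ z _ n).symm.trans
    (congrArg (fun y => (X.envTm N).f e y n) (X.step.rr_act_inl e₁ z m))

theorem envTm_opAct {α β γ δ ε ζ : Γ} (e : ε + β = γ) (e' : α + ζ = γ) (e₁ : α + δ = ε)
    (e₁' : δ + α = ε) (e₂ : δ + β = ζ) {T : FinGSet G} (z : (X.stepC α).obj T)
    (b : (M.A.C δ).obj T) (n : (N.C β).obj T) : (X.envTm N).f e' z (N.toLL.opAct.f e₂ b n) =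
      σ.s δ α • (X.envTm N).f e (X.stepL.f e₁' b z) n := by
  rw [← Pairing.smul_left]
  exact (Box.tmul_balanced (N := X.step.rr.toRMod) (P := N) e e' e₁ e₂ z _ n).symm.trans
    (congrArg (fun y => (X.envTm N).f e y n) (X.step.rr_act_inr e₁ e₁' z b))

theorem env_ind {γ : Γ} {T : FinGSet G} {P : (Box X.step.rr.toRMod N γ).obj T → Prop}
    (z : (Box X.step.rr.toRMod N γ).obj T) (h0 : P 0)
    (ht : ∀ {U : FinGSet G} (k : FinGSet.Hom U T) {α β : Γ} (e : α + β = γ)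
      (z : (X.stepC α).obj U) (n : (N.C β).obj U),
      P ((Box X.step.rr.toRMod N γ).tr k ((X.envTm N).f e z n)))
    (hadd : ∀ x y, P x → P y → P (x + y)) : P z :=
  Box.ind z h0 (fun k _ _ e n p => ht k e n p) hadd

/-- Elements `z ⊗ n` are determined by the elements `(x ⊗ 1) ⊗ n`. -/
theorem envTm_tm {α β γ μ ν ε : Γ} (h : α + β = γ) (e : μ + ν = α) (h₁ : ν + β = ε)
    (h₂ : μ + ε = γ) {T : FinGSet G} (x : (X.C μ).obj T) (m : (M.A.C ν).obj T)
    (n : (N.C β).obj T) : (X.envTm N).f h (X.tm.f e x m) n =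
      (X.envTm N).f h₂ ((X.unit μ).app T x) (N.toLL.l₁.f h₁ m n) := by
  rw [X.envTm_l₁ N h h₂ e h₁, X.unit_r]

/-- An element `b` acting on `n` through `M^op` can be moved over the box product to the left action
on `x ⊗ 1`, which is the left action on `x`. The sign left over is `σ(β, δ) σ(δ, β) = 1`. -/
theorem restep_balanced : Box.Balanced (N := N.toLL.right) (P := X.left)
    (((X.envTm N).compLeft X.unit).flip.twist fun α β => σ.s β α) := by
  refine fun {γ T α β δ ε ζ} e e' e₁ e₂ (n : (N.C α).obj T) (b : (M.A.C δ).obj T)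
    (x : (X.C β).obj T) => ?_
  have d₁ : β + ε = γ := by rw [add_comm, e]
  have d₂ : ζ + α = γ := by rw [add_comm, e']
  have d₃ : δ + α = ε := by rw [add_comm, e₁]
  have d₄ : β + δ = ζ := by rw [add_comm, e₂]
  change σ.s β ε • (X.envTm N).f d₁ ((X.unit β).app T x) (σ.s δ α • N.toLL.opAct.f d₃ b n) =
    σ.s ζ α • (X.envTm N).f d₂ ((X.unit ζ).app T (X.l.f e₂ b x)) n
  rw [Pairing.smul_right, X.envTm_opAct N d₂ d₁ d₄ e₂ d₃, X.unit_l, smul_smul, smul_smul]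
  congr 1
  rw [← d₃, ← e₂]
  simp only [σ.add_left, σ.add_right]
  linear_combination (σ.s β α * σ.s δ α) * σ.symm β δ

/-- The map `N □_M X → (X □_R M) □ N`, `n ⊗ x ↦ σ(|x|, |n|) ((x ⊗ 1) ⊗ n)`. -/
def restep : GrHom (Box N.toLL.right X.left) (Box X.step.rr.toRMod N) :=
  Box.lift _ (X.restep_balanced N)

theorem restep_tmul {α β γ : Γ} (h : α + β = γ) (h' : β + α = γ) {T : FinGSet G}
    (n : (N.C α).obj T) (x : (X.C β).obj T) :
    (X.restep N γ).app T ((Box.tmul N.toLL.right X.left).f h n x) =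
      σ.s β α • (X.envTm N).f h' ((X.unit β).app T x) n :=
  Box.lift_tmul _ (X.restep_balanced N) h n x

/-- On `(x ⊗ m) ⊗ n` the composite replaces `x ⊗ m` by `x ⊗ 1` and lets `m` act on `n`, which does
not change the element, by `envTm_tm`; the two interchange signs cancel. The use of this composite
is that `unstep` is injective, so flatness over `M^e` can be tested on `N □_M X`. -/
theorem restep_unstep {γ : Γ} {T : FinGSet G} (z : (Box X.step.rr.toRMod N γ).obj T) :
    (X.restep N γ).app T ((X.unstep N γ).app T z) = z := by
  induction z using X.env_ind N with
  | h0 => simp only [map_zero]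
  | @ht U k α β e z n =>
    rw [Mackey.Hom.app_tr, Mackey.Hom.app_tr]
    congr 1
    rw [X.unstep_tmul]
    induction z using X.ind with
    | h0 => simp only [map_zero, AddMonoidHom.zero_apply]
    | @ht V l μ ν d x m =>
      have d₁ : ν + β + μ = γ := by rw [← e, ← d]; abel
      have d₂ : μ + (ν + β) = γ := by rw [add_comm, d₁]
      rw [(X.unstepP N).tr_left, Mackey.Hom.app_tr, X.unstepP_tm N e d rfl d₁,
        Mackey.Hom.map_smul, X.restep_tmul N d₁ d₂, smul_smul, σ.symm, one_smul,
        (X.envTm N).tr_left, X.envTm_tm N e d rfl d₂]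
    | hadd x y hx hy => simp only [map_add, AddMonoidHom.add_apply, hx, hy]
  | hadd x y hx hy => simp only [map_add, hx, hy]

end BiMod

end InducedModules

end

noncomputable section

section BarFlat

variable {Γ G : Type} [AddCommGroup Γ] [Group G] {σ : SignRule Γ G} {R : GrGreen.{u} Γ G}
  {M : Alg σ R}

/-! ### Flatness of iterated box products -/

/-- A graded Green functor as a left module over itself. -/
abbrev GrGreen.regular (A : GrGreen.{u} Γ G) : LMod A where
  C := A.C
  act := A.mul
  one_act := A.one_mul
  mul_act := A.mul_assoc

theorem RMod.act_balanced {A : GrGreen.{u} Γ G} (N : RMod A) :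
    Box.Balanced (N := N) (P := A.regular) N.act :=
  fun e e' e₁ e₂ n a p => (N.act_mul e' e₂ e e₁ n a p).symm

/-- The map `N □_A A → N`. -/
def RMod.actU {A : GrGreen.{u} Γ G} (N : RMod A) : GrHom (Box N A.regular) N.C :=
  Box.lift _ N.act_balanced

theorem RMod.actU_tmul {A : GrGreen.{u} Γ G} (N : RMod A) {α β γ : Γ} (h : α + β = γ)
    {T : FinGSet G} (n : (N.C α).obj T) (a : (A.C β).obj T) :
    (N.actU γ).app T ((Box.tmul N A.regular).f h n a) = N.act.f h n a :=
  Box.lift_tmul _ N.act_balanced h n a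

/-- Every element of `N □_A A` has the form `n ⊗ 1`, since `n ⊗ a = n a ⊗ 1`; a transfer is absorbed
by Frobenius reciprocity because units restrict to units. -/
theorem RMod.actU_section {A : GrGreen.{u} Γ G} (N : RMod A) {γ : Γ} {T : FinGSet G}
    (z : (Box N A.regular γ).obj T) :
    (Box.tmul N A.regular).f (add_zero γ) ((N.actU γ).app T z) (A.one T) = z := by
  induction z using Box.ind with
  | h0 => simp only [map_zero, AddMonoidHom.zero_apply]
  | @ht U k α β e n m =>
    rw [Mackey.Hom.app_tr, (Box.tmul N A.regular).tr_left, A.res_one, N.actU_tmul,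
      Box.tmul_balanced (N := N) (P := A.regular) (add_zero γ) e e (add_zero β), A.mul_one]
  | hadd x y hx hy => simp only [map_add, AddMonoidHom.add_apply, hx, hy]

theorem RMod.Hom.actU_box {A : GrGreen.{u} Γ G} {N N' : RMod A} (f : N.Hom N') {γ : Γ}
    {T : FinGSet G} (z : (Box N A.regular γ).obj T) :
    (N'.actU γ).app T ((f.box A.regular γ).app T z) = (f.u γ).app T ((N.actU γ).app T z) := by
  induction z using Box.ind with
  | h0 => simp only [map_zero]
  | ht k e n m =>
    simp only [Mackey.Hom.app_tr]
    rw [f.box_tmul, N.actU_tmul, N'.actU_tmul, f.map_act]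
  | hadd x y hx hy => simp only [map_add, hx, hy]

/-- The map `N □_A A → N` is injective and natural in `N`, so injectivity of `f` implies injectivity
of `f □ A`. This starts the induction for the box powers. -/
theorem GrGreen.regular_isFlat (A : GrGreen.{u} Γ G) : A.regular.IsFlat := by
  intro N N' f hf γ T
  refine (injective_iff_map_eq_zero _).2 fun z hz => ?_
  have h := f.actU_box z
  rw [hz, map_zero] at h
  rw [← N.actU_section z, (injective_iff_map_eq_zero _).1 (hf γ T) _ h.symm, map_zero,
    AddMonoidHom.zero_apply]

/-! ### Associativity of the mixed box products over `M` and over `R`. -/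

namespace BiMod

variable (X : BiMod M) (N : RMod M.A)

theorem boxAct_balanced : Box.Balanced₃ (N := N) (P := X.left)
    (Pairing₃.comp₂ X.r (Box.tmul N X.left)) := by
  refine fun {γ κ T α β δ ε ζ} e e' e₁ e₂ (b : (M.A.C κ).obj T) (n : (N.C α).obj T)
    (a : (M.A.C δ).obj T) (x : (X.C β).obj T) => ?_
  have d : ε + (β + κ) = γ := by rw [← e]; abel
  have d' : α + (ζ + κ) = γ := by rw [← e']; abel
  have d₁ : δ + (β + κ) = ζ + κ := by rw [← add_assoc, e₂]
  change (Box.tmul N X.left).f d (N.act.f e₁ n a) (X.r.f rfl x b) =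
    (Box.tmul N X.left).f d' n (X.r.f rfl (X.l.f e₂ a x) b)
  rw [X.assoc rfl e₂ d₁ rfl]
  exact Box.tmul_balanced (N := N) (P := X.left) d d' e₁ d₁ n a _

/-- The right action `(n ⊗ x) b = n ⊗ x b` on `N □_M X`. -/
def boxAct : Pairing (Box N X.left) M.A.C (Box N X.left) :=
  (Box.lift₃ _ (X.boxAct_balanced N)).flip

theorem boxAct_tmul {α β γ δ ε ζ : Γ} (h : α + β = γ) (e : δ + ε = α) (h₁ : ε + β = ζ)
    (h₂ : δ + ζ = γ) {T : FinGSet G} (n : (N.C δ).obj T) (x : (X.C ε).obj T)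
    (b : (M.A.C β).obj T) : (X.boxAct N).f h ((Box.tmul N X.left).f e n x) b =
      (Box.tmul N X.left).f h₂ n (X.r.f h₁ x b) := by
  subst h₁
  exact Box.lift₃_tmul _ (X.boxAct_balanced N) ((add_comm _ _).trans h) e b n x

/-- The right module `N □_M X` over the base. -/
abbrev boxR : RMod R where
  C := Box N X.left
  act := (X.boxAct N).compRight M.η
  act_one {α} h T z := by
    rw [Pairing.compRight_f, M.η_one]
    induction z using Box.ind with
    | h0 => simp only [map_zero, AddMonoidHom.zero_apply]
    | ht k e n x =>
      rw [(X.boxAct N).tr_left, M.A.res_one, X.boxAct_tmul N h e (add_zero _) e, X.r_one]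
    | hadd x y hx hy => simp only [map_add, AddMonoidHom.add_apply, hx, hy]
  act_mul {α β γ δ ε ζ} h₁ h₂ h₃ h₄ T z a b := by
    simp only [Pairing.compRight_f]
    rw [M.η_mul h₂]
    induction z using Box.ind with
    | h0 => simp only [map_zero, AddMonoidHom.zero_apply]
    | @ht U k μ ν e n x =>
      have e₁ : μ + (ν + ε) = ζ := by rw [← add_assoc, e, h₁]
      have e₂ : μ + (ν + β) = δ := by rw [← add_assoc, e, h₄]
      have e₃ : ν + β + γ = ν + ε := by rw [add_assoc, h₂]
      rw [(X.boxAct N).tr_left, (X.boxAct N).tr_left, (X.boxAct N).tr_left, M.A.mul.res,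
        X.boxAct_tmul N h₁ e rfl e₁, X.boxAct_tmul N h₄ e rfl e₂, X.boxAct_tmul N h₃ e₂ e₃ e₁,
        X.r_mul rfl h₂ e₃ rfl]
    | hadd x y hx hy => simp only [map_add, AddMonoidHom.add_apply, hx, hy]

/-- The map `(n ⊗ x) ⊗ m` of `(N □_M X) □_R M`. -/
abbrev boxTm : Pairing (Box N X.left) M.A.C (Box (X.boxR N) M.toLMod) :=
  Box.tmul (X.boxR N) M.toLMod

theorem boxTm_balanced {γ : Γ} {T : FinGSet G} {α β δ ε ζ : Γ} (e : ε + β = γ) (e' : α + ζ = γ)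
    (e₁ : α + δ = ε) (e₂ : δ + β = ζ) (z : (Box N X.left α).obj T) (s : (R.C δ).obj T)
    (m : (M.A.C β).obj T) : (X.boxTm N).f e ((X.boxAct N).f e₁ z ((M.η δ).app T s)) m =
      (X.boxTm N).f e' z (M.A.mul.f e₂ ((M.η δ).app T s) m) :=
  Box.tmul_balanced (N := X.boxR N) (P := M.toLMod) e e' e₁ e₂ z s m

/-- A scalar acting on the right of `x` is by construction the right action on `n ⊗ x`, so it can
cross the outer box product over `R`. -/
theorem assoc₃_balanced : Box.Balanced₃ (N := X.toRMod) (P := M.toLMod)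
    (Pairing₃.comp₁ (Box.tmul N X.left) (X.boxTm N)) := by
  refine fun {γ κ T α β δ ε ζ} e e' e₁ e₂ (n : (N.C κ).obj T) (x : (X.C α).obj T)
    (s : (R.C δ).obj T) (m : (M.A.C β).obj T) => ?_
  subst e₁ e₂ e
  change (X.boxTm N).f _ ((Box.tmul N X.left).f rfl n (X.r.f rfl x ((M.η δ).app T s))) m =
    (X.boxTm N).f _ ((Box.tmul N X.left).f rfl n x) (M.A.mul.f rfl ((M.η δ).app T s) m)
  rw [← X.boxAct_tmul N (add_assoc κ α δ) rfl rfl rfl, X.boxTm_balanced]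

/-- The pairing `(n, x ⊗ m) ↦ (n ⊗ x) ⊗ m`. -/
def assocP : Pairing N.C X.stepC (Box (X.boxR N) M.toLMod) := Box.lift₃ _ (X.assoc₃_balanced N)

theorem assocP_tm {α β γ δ ε ζ : Γ} (h : α + β = γ) (e : δ + ε = β) (h₁ : α + δ = ζ)
    (h₂ : ζ + ε = γ) {T : FinGSet G} (n : (N.C α).obj T) (x : (X.C δ).obj T)
    (m : (M.A.C ε).obj T) : (X.assocP N).f h n (X.tm.f e x m) =
      (X.boxTm N).f h₂ ((Box.tmul N X.left).f h₁ n x) m := by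
  subst h₁
  exact Box.lift₃_tmul _ (X.assoc₃_balanced N) h e n x m

/-- The map `n ⊗ z` of `N □_M (X □_R M)`. -/
def stepTm : Pairing N.C X.stepC (Box N X.step.left) := Box.tmul N X.step.left

theorem assocP_balanced : Box.Balanced (N := N) (P := X.step.left) (X.assocP N) := by
  refine fun {γ T α β δ ε ζ} e e' e₁ e₂ n a (z : (X.stepC β).obj T) => ?_
  change (X.assocP N).f e (N.act.f e₁ n a) z = (X.assocP N).f e' n (X.stepL.f e₂ a z)
  induction z using X.ind with
  | h0 => simp only [map_zero]
  | @ht U k μ ν d x m =>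
    have d₁ : ε + μ + ν = γ := by rw [add_assoc, d, e]
    have d₂ : δ + μ + ν = ζ := by rw [add_assoc, d, e₂]
    have d₃ : α + (δ + μ) = ε + μ := by rw [← add_assoc, e₁]
    rw [X.stepL.tr_right, (X.assocP N).tr_right, (X.assocP N).tr_right, N.act.res,
      X.stepL_tm e₂ d rfl d₂, X.assocP_tm N e d rfl d₁, X.assocP_tm N e' d₂ d₃ d₁]
    congr 1
    exact congrArg (fun y => (X.boxTm N).f d₁ y m)
      (Box.tmul_balanced (N := N) (P := X.left) rfl d₃ e₁ rfl _ _ x)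
  | hadd x y hx hy => simp only [map_add, hx, hy]

/-- The map `N □_M (X □_R M) → (N □_M X) □_R M`. -/
def assocU : GrHom (Box N X.step.left) (Box (X.boxR N) M.toLMod) :=
  Box.lift _ (X.assocP_balanced N)

theorem assocU_tmul {α β γ : Γ} (h : α + β = γ) {T : FinGSet G} (n : (N.C α).obj T)
    (z : (X.stepC β).obj T) : (X.assocU N γ).app T ((X.stepTm N).f h n z) =
      (X.assocP N).f h n z := Box.lift_tmul _ (X.assocP_balanced N) h n z

theorem unassoc₃_balanced : Box.Balanced₃ (N := N) (P := X.left)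
    (Pairing₃.comp₂ X.tm (X.stepTm N)) := by
  refine fun {γ κ T α β δ ε ζ} e e' e₁ e₂ (m : (M.A.C κ).obj T) (n : (N.C α).obj T)
    (a : (M.A.C δ).obj T) (x : (X.C β).obj T) => ?_
  have d : ε + (β + κ) = γ := by rw [← e]; abel
  have d' : α + (ζ + κ) = γ := by rw [← e']; abel
  have d₁ : δ + (β + κ) = ζ + κ := by rw [← add_assoc, e₂]
  change (X.stepTm N).f d (N.act.f e₁ n a) (X.tm.f rfl x m) =
    (X.stepTm N).f d' n (X.tm.f rfl (X.l.f e₂ a x) m)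
  rw [← X.stepL_tm d₁ rfl e₂ rfl]
  exact Box.tmul_balanced (N := N) (P := X.step.left) d d' e₁ d₁ n a _

/-- The pairing `(n ⊗ x, m) ↦ n ⊗ (x ⊗ m)`. -/
def unassocP : Pairing (Box N X.left) M.A.C (Box N X.step.left) :=
  (Box.lift₃ _ (X.unassoc₃_balanced N)).flip

theorem unassocP_tmul {α β γ δ ε ζ : Γ} (h : α + β = γ) (e : δ + ε = α) (h₁ : ε + β = ζ)
    (h₂ : δ + ζ = γ) {T : FinGSet G} (n : (N.C δ).obj T) (x : (X.C ε).obj T)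
    (m : (M.A.C β).obj T) : (X.unassocP N).f h ((Box.tmul N X.left).f e n x) m =
      (X.stepTm N).f h₂ n (X.tm.f h₁ x m) := by
  subst h₁
  exact Box.lift₃_tmul _ (X.unassoc₃_balanced N) ((add_comm _ _).trans h) e m n x

theorem unassocP_balanced :
    Box.Balanced (N := X.boxR N) (P := M.toLMod) (X.unassocP N) := by
  refine fun {γ T α β δ ε ζ} e e' e₁ e₂ z s (m : (M.A.C β).obj T) => ?_
  change (X.unassocP N).f e ((X.boxAct N).f e₁ z ((M.η δ).app T s)) m =
    (X.unassocP N).f e' z (M.A.mul.f e₂ ((M.η δ).app T s) m)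
  induction z using Box.ind with
  | h0 => simp only [map_zero, AddMonoidHom.zero_apply]
  | @ht U k μ ν d n x =>
    have d₁ : μ + (ν + δ) = ε := by rw [← add_assoc, d, e₁]
    have d₂ : μ + (ν + ζ) = γ := by rw [← add_assoc, d, e']
    have d₃ : ν + δ + β = ν + ζ := by rw [add_assoc, e₂]
    rw [(X.boxAct N).tr_left, (X.unassocP N).tr_left, (X.unassocP N).tr_left, M.A.mul.res,
      ← (M.η δ).app_res, X.boxAct_tmul N e₁ d rfl d₁, X.unassocP_tmul N e d₁ d₃ d₂,
      X.unassocP_tmul N e' d rfl d₂, X.tm_balanced d₃ rfl rfl e₂]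
  | hadd x y hx hy => simp only [map_add, AddMonoidHom.add_apply, hx, hy]

/-- The map `(N □_M X) □_R M → N □_M (X □_R M)`. -/
def unassocU : GrHom (Box (X.boxR N) M.toLMod) (Box N X.step.left) :=
  Box.lift _ (X.unassocP_balanced N)

theorem unassocU_tmul {α β γ : Γ} (h : α + β = γ) {T : FinGSet G} (z : (Box N X.left α).obj T)
    (m : (M.A.C β).obj T) : (X.unassocU N γ).app T ((X.boxTm N).f h z m) =
      (X.unassocP N).f h z m := Box.lift_tmul _ (X.unassocP_balanced N) h z m

/-- A transfer inside the second factor is moved to the outside by Frobenius reciprocity, so that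
transfers of triple tensors generate. -/
theorem stepTm_ind {γ : Γ} {T : FinGSet G} {P : (Box N X.step.left γ).obj T → Prop}
    (z : (Box N X.step.left γ).obj T) (h0 : P 0)
    (ht : ∀ {U : FinGSet G} (k : FinGSet.Hom U T) {α β ε μ ν : Γ} (e : α + β = γ)
      (d : μ + ν = β) (_ : α + μ = ε) (_ : ε + ν = γ) (n : (N.C α).obj U)
      (x : (X.C μ).obj U) (m : (M.A.C ν).obj U),
      P ((Box N X.step.left γ).tr k ((X.stepTm N).f e n (X.tm.f d x m))))
    (hadd : ∀ x y, P x → P y → P (x + y)) : P z := by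
  induction z using Box.ind with
  | h0 => exact h0
  | @ht U k α β e n z =>
    change (X.stepC β).obj U at z
    change P ((Box N X.step.left γ).tr k ((X.stepTm N).f e n z))
    induction z using X.ind with
    | h0 => rwa [map_zero, map_zero]
    | @ht V l μ ν d x m =>
      rw [(X.stepTm N).tr_right, ← (Box N X.step.left γ).tr_comp]
      exact ht _ e d rfl (by rw [add_assoc, d, e]) _ x m
    | hadd x y hx hy =>
      rw [map_add, map_add]
      exact hadd _ _ hx hy
  | hadd x y hx hy => exact hadd _ _ hx hy

/-- Both maps rebracket triple tensors, so the composite fixes the generators. This direction gives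
injectivity of `assocU`, which is what flatness uses. -/
theorem unassocU_assocU {γ : Γ} {T : FinGSet G} (z : (Box N X.step.left γ).obj T) :
    (X.unassocU N γ).app T ((X.assocU N γ).app T z) = z := by
  induction z using X.stepTm_ind N with
  | h0 => simp only [map_zero]
  | ht k e d e₁ e₂ n x m =>
    rw [Mackey.Hom.app_tr, Mackey.Hom.app_tr, X.assocU_tmul, X.assocP_tm N e d e₁ e₂,
      X.unassocU_tmul, X.unassocP_tmul N e₂ e₁ d e]
  | hadd x y hx hy => simp only [map_add, hx, hy]

variable {N} {N' : RMod M.A}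

theorem box_stepTm (f : N.Hom N') {α β γ : Γ} (h : α + β = γ) {T : FinGSet G}
    (n : (N.C α).obj T) (z : (X.stepC β).obj T) :
    (f.box X.step.left γ).app T ((X.stepTm N).f h n z) =
      (X.stepTm N').f h ((f.u α).app T n) z := f.box_tmul X.step.left h n z

/-- The map `f □ X` of right modules over the base. -/
def boxRHom (f : N.Hom N') : (X.boxR N).Hom (X.boxR N') where
  u := f.box X.left
  map_act {α β γ} h T z s := by
    simp only [Pairing.compRight_f]
    induction z using Box.ind with
    | h0 => simp only [map_zero, AddMonoidHom.zero_apply]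
    | @ht U k μ ν e n x =>
      have e₁ : μ + (ν + β) = γ := by rw [← add_assoc, e, h]
      rw [(X.boxAct N).tr_left, Mackey.Hom.app_tr, Mackey.Hom.app_tr, (X.boxAct N').tr_left,
        X.boxAct_tmul N h e rfl e₁, f.box_tmul, f.box_tmul, X.boxAct_tmul N' h e rfl e₁]
    | hadd x y hx hy => simp only [map_add, AddMonoidHom.add_apply, hx, hy]

theorem assocU_box (f : N.Hom N') {γ : Γ} {T : FinGSet G} (z : (Box N X.step.left γ).obj T) :
    (X.assocU N' γ).app T ((f.box X.step.left γ).app T z) =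
      ((X.boxRHom f).box M.toLMod γ).app T ((X.assocU N γ).app T z) := by
  induction z using X.stepTm_ind N with
  | h0 => simp only [map_zero]
  | ht k e d e₁ e₂ n x m =>
    simp only [Mackey.Hom.app_tr]
    rw [X.box_stepTm, X.assocU_tmul, X.assocU_tmul, X.assocP_tm N e d e₁ e₂,
      X.assocP_tm N' e d e₁ e₂, RMod.Hom.box_tmul]
    exact congrArg (fun y => (Box _ _ _).tr k ((X.boxTm N').f e₂ y m))
      (f.box_tmul X.left e₁ n x).symm
  | hadd x y hx hy => simp only [map_add, hx, hy]

/-- By associativity the box product over `M` with `X □_R M` embeds naturally into the composite of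
the box product with `X` over `M` and the one with `M` over `R`. Both of these preserve
monomorphisms. -/
theorem step_left_isFlat (hM : M.toLMod.IsFlat) (hX : X.left.IsFlat) : X.step.left.IsFlat := by
  intro N N' f hf γ T
  refine (injective_iff_map_eq_zero _).2 fun z hz => ?_
  have h := X.assocU_box f z
  rw [hz, map_zero] at h
  have h0 := (injective_iff_map_eq_zero _).1
    (hM _ _ (X.boxRHom f) (hX _ _ f hf) γ T) _ h.symm
  rw [← X.unassocU_assocU N z, h0, map_zero]

end BiMod

namespace Alg

/-- Induction on the number of factors: one factor is the regular module, and each further factor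
uses flatness of `M` over `R` once more. -/
theorem bar_left_isFlat (hM : M.toLMod.IsFlat) (q : ℕ) : (M.bar q).left.IsFlat := by
  induction q with
  | zero => exact M.A.regular_isFlat
  | succ q ih => exact (M.bar q).step_left_isFlat hM ih

end Alg

/-! ### Flatness of the bar resolution over the enveloping algebra. -/

namespace BiMod

variable (X : BiMod M) {N N' : LMod M.env}

/-- A map of left modules over the enveloping algebra as a map of right modules over `M`. -/
def rightHom (v : N.Hom N') : N.toLL.right.Hom N'.toLL.right where
  u := v.u
  map_act {α β γ} h T n b := by
    have h' : β + α = γ := by rw [add_comm, h]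
    rw [N.toLL.right_act h h', N'.toLL.right_act h h', Mackey.Hom.map_smul]
    congr 1
    exact v.semi h' _ n

/-- Naturality of `unstep` in `N`: a map of left modules over `M^e` commutes with the action of `m`
on `n`, which is the only place where `N` enters the formula. -/
theorem unstep_box (v : N.Hom N') {γ : Γ} {T : FinGSet G}
    (z : (Box X.step.rr.toRMod N γ).obj T) :
    (X.unstep N' γ).app T ((v.box X.step.rr.toRMod γ).app T z) =
      ((rightHom v).box X.left γ).app T ((X.unstep N γ).app T z) := by
  induction z using X.env_ind N with
  | h0 => simp only [map_zero]
  | @ht U k α β e z n =>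
    simp only [Mackey.Hom.app_tr]
    congr 1
    refine (congrArg ((X.unstep N' γ).app U) (v.box_tmul X.step.rr.toRMod e z n)).trans ?_
    refine (X.unstep_tmul N' e z _).trans ?_
    rw [X.unstep_tmul]
    induction z using X.ind with
    | h0 => simp only [map_zero, AddMonoidHom.zero_apply]
    | @ht V l μ ν d x m =>
      have d₁ : ν + β + μ = γ := by rw [← e, ← d]; abel
      rw [(X.unstepP N).tr_left, (X.unstepP N').tr_left, Mackey.Hom.app_tr,
        X.unstepP_tm N e d rfl d₁, X.unstepP_tm N' e d rfl d₁, Mackey.Hom.map_smul,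
        RMod.Hom.box_tmul, ← (v.u β).app_res]
      congr 2
      exact congrArg (fun y => (Box.tmul N'.toLL.right X.left).f d₁ y x) (v.semi rfl _ _).symm
    | hadd x y hx hy => simp only [map_add, AddMonoidHom.add_apply, hx, hy]
  | hadd x y hx hy => simp only [map_add, hx, hy]

/-- By `unstep` the functor `(X □_R M) □_{M^e} -` embeds naturally into `- □_M X`, which preserves
monomorphisms by assumption. The last factor `M` of the product costs nothing here. -/
theorem step_rr_isFlat (hX : X.left.IsFlat) : X.step.rr.toRMod.IsFlat := by
  intro N N' v hv γ T
  refine (injective_iff_map_eq_zero _).2 fun z hz => ?_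
  have h := X.unstep_box v z
  rw [hz, map_zero] at h
  have h0 := (injective_iff_map_eq_zero _).1 (hX _ _ (rightHom v) hv γ T) _ h.symm
  rw [← X.restep_unstep N z, h0, map_zero]

end BiMod

/-- The term in degree `n` is `M.bar (n + 1)`, which is by definition `X □_R M` for `X = M.bar n`.
-/
theorem Alg.barRes_isFlat (hM : M.toLMod.IsFlat) (n : ℕ) : (M.barRes.X n).IsFlat :=
  (M.bar n).step_rr_isFlat (bar_left_isFlat hM n)

end BarFlat

end

noncomputable section

/-! ### Equality of chain maps and isomorphisms of complexes. -/

namespace GrComplex.Hom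

variable {Γ G : Type} [Group G] {C D : GrComplex.{u} Γ G}

theorem ext {f k : Hom C D} (h : ∀ (n : ℕ) (α : Γ) (T : FinGSet G) (x : (C.X n α).obj T),
    (f.u n α).app T x = (k.u n α).app T x) : f = k := by
  obtain ⟨u, hu⟩ := f
  obtain ⟨v, hv⟩ := k
  obtain rfl : u = v := funext fun n => GrHom.ext fun α T x => h n α T x
  rfl

/-- The cone is exact for a direct reason: if `f p = d b`, write `b = f p'`; then `f (d p') = d b =
f p`, and injectivity gives `d p' = p`. -/
theorem homologyMap_isIso_of_bijective (f : Hom C D) (hf : ∀ n, (f.u n).IsIso) (n : ℕ) :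
    (f.homologyMap n).IsIso := by
  refine f.homologyMap_isIso (fun α T n => ?_) n
  cases n with
  | zero =>
    intro b
    obtain ⟨p, rfl⟩ := (hf 0 α T).2 b
    exact ⟨p, 0, by rw [map_zero, add_zero]⟩
  | succ n =>
    intro p _ b hb
    obtain ⟨p', rfl⟩ := (hf (n + 1) α T).2 b
    exact ⟨p', 0, (hf n α T).1 ((f.comm n p').trans hb.symm), by rw [map_zero, add_zero]⟩

end GrComplex.Hom

section CyclicBar

variable {Γ G : Type} [AddCommGroup Γ] [Group G] {σ : SignRule Γ G} {R : GrGreen.{u} Γ G}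
  {M : Alg σ R} [IsMulCommutative G] (g : G) (hg : GTrivial g R)

/-! ### The cyclic bar construction as a box product over the enveloping algebra -/

/-- The twist by `g` enters through the `M`-action only. The action of `M^op`, computed in
`leftEnv_opAct`, is ordinary right multiplication up to sign. -/
theorem Alg.leftEnv_l₁ {α β γ : Γ} (h : α + β = γ) {T : FinGSet G} (m : (M.A.C α).obj T)
    (y : (M.A.C β).obj T) : (M.leftEnv g hg).toLL.l₁.f h m y =
      M.A.mul.f h ((gHom g M.A.C α).app T m) y := (M.ll g hg).act_inl h m y

theorem Alg.leftEnv_opAct {α β γ : Γ} (h : α + β = γ) (h' : β + α = γ) {T : FinGSet G}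
    (b : (M.A.C α).obj T) (y : (M.A.C β).obj T) :
    (M.leftEnv g hg).toLL.opAct.f h b y = σ.s β α • M.A.mul.f h' y b :=
  (M.ll g hg).act_inr h b y

namespace BiMod

variable (X : BiMod M)

/-- Viewed as a right `M`-module through `M^op`, `ᵍM` is `M` with its usual right multiplication, as
two inverse signs cancel. So the left action of `M` on `X` is balanced, and the twist plays no role.
-/
theorem l_balanced :
    Box.Balanced (N := (M.leftEnv g hg).toLL.right) (P := X.left) X.l := by
  refine fun {γ T α β δ ε ζ} e e' e₁ e₂ (n : (M.A.C α).obj T) (b : (M.A.C δ).obj T)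
    (x : (X.C β).obj T) => ?_
  have e₃ : δ + α = ε := by rw [add_comm, e₁]
  have key : (M.leftEnv g hg).toLL.right.act.f e₁ n b = M.A.mul.f e₁ n b := by
    refine (congrArg (σ.s δ α • ·) (Alg.leftEnv_opAct g hg e₃ e₁ b n)).trans ?_
    change σ.s δ α • σ.s α δ • M.A.mul.f e₁ n b = _
    rw [smul_smul, σ.symm, one_smul]
  exact (congrArg (fun y => X.l.f e y x) key).trans (X.mul_l e e₁ e' e₂ n b x)

/-- The map `y ⊗ x ↦ y x` from `ᵍM □_M X`. -/
def lU : GrHom (Box (M.leftEnv g hg).toLL.right X.left) X.C := Box.lift _ (X.l_balanced g hg)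

theorem lU_tmul {α β γ : Γ} (h : α + β = γ) {T : FinGSet G} (y : (M.A.C α).obj T)
    (x : (X.C β).obj T) : (X.lU g hg γ).app T
      ((Box.tmul (M.leftEnv g hg).toLL.right X.left).f h y x) = X.l.f h y x :=
  Box.lift_tmul _ (X.l_balanced g hg) h y x

/-- The map `z ⊗ y` of `(X □_R M) □ ᵍM`. -/
def cycTm : Pairing X.stepC M.A.C (Box X.step.rr.toRMod (M.leftEnv g hg)) :=
  X.envTm (M.leftEnv g hg)

/-- The map `x ↦ (x ⊗ 1) ⊗ 1`. -/
def cyc : GrHom X.C (Box X.step.rr.toRMod (M.leftEnv g hg)) := fun α =>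
  { app := fun T => (((X.cycTm g hg).f (add_zero α)).flip (M.A.one T)).comp ((X.unit α).app T)
    app_res := fun k m => by
      simp only [AddMonoidHom.comp_apply, AddMonoidHom.flip_apply]
      rw [(X.cycTm g hg).res, M.A.res_one, (X.unit α).app_res]
    app_tr := fun k m => by
      simp only [AddMonoidHom.comp_apply, AddMonoidHom.flip_apply]
      rw [(X.unit α).app_tr, (X.cycTm g hg).tr_left, M.A.res_one] }

theorem cyc_app {α : Γ} {T : FinGSet G} (x : (X.C α).obj T) : (X.cyc g hg α).app T x =
    (X.cycTm g hg).f (add_zero α) ((X.unit α).app T x) (M.A.one T) := rfl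

/-- `unstep` followed by the left action of `M` on `X` is a left inverse: `(x ⊗ 1) ⊗ 1` goes to `1 ⊗
x` and then to `x`. The twist is harmless because `1` is fixed by `g`, and the sign is `σ(0, α) =
1`. -/
theorem cyc_injective : (X.cyc g hg).Injective := by
  intro α T
  refine Function.LeftInverse.injective
    (g := fun z => (X.lU g hg α).app T ((X.unstep (M.leftEnv g hg) α).app T z)) fun x => ?_
  have h₂ : (M.leftEnv g hg).toLL.l₁.f (add_zero 0) (M.A.one T) (M.A.one T) = M.A.one T :=
    (M.leftEnv g hg).toLL.one_l₁ (add_zero 0) _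
  have h₁ : (X.unstep (M.leftEnv g hg) α).app T ((X.cyc g hg α).app T x) = σ.s 0 α •
      (Box.tmul (M.leftEnv g hg).toLL.right X.left).f (zero_add α) (M.A.one T) x :=
    (X.unstep_tmul _ _ _ _).trans ((X.unstepP_tm (M.leftEnv g hg) (add_zero α) (add_zero α)
      (add_zero 0) (zero_add α) x _ _).trans (congrArg (fun y => σ.s 0 α •
        (Box.tmul (M.leftEnv g hg).toLL.right X.left).f (zero_add α) y x) h₂))
  change (X.lU g hg α).app T ((X.unstep (M.leftEnv g hg) α).app T ((X.cyc g hg α).app T x)) = x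
  rw [h₁, σ.zero_left, one_smul]
  exact (X.lU_tmul g hg (zero_add α) (M.A.one T) x).trans (X.one_l _ x)

/-- In `ᵍM` one has `y = (1 ⊗ y) 1`. Moving `1 ⊗ y` across the box product over `M^e` makes `y` act
from the left on `x ⊗ 1`, hence on `x`, at the cost of the interchange sign. -/
theorem cycTm_unit {α β γ : Γ} (h : α + β = γ) (h' : β + α = γ) {T : FinGSet G}
    (x : (X.C α).obj T) (y : (M.A.C β).obj T) :
    (X.cycTm g hg).f h ((X.unit α).app T x) y =
      σ.s β α • (X.cyc g hg γ).app T (X.l.f h' y x) := by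
  have e : (M.leftEnv g hg).toLL.opAct.f (add_zero β) y (M.A.one T) = y := by
    refine (Alg.leftEnv_opAct g hg (add_zero β) (zero_add β) y (M.A.one T)).trans ?_
    rw [σ.zero_left, one_smul, M.A.one_mul]
  rw [X.cyc_app, X.unit_l]
  exact (congrArg ((X.cycTm g hg).f h ((X.unit α).app T x)) e.symm).trans
    (X.envTm_opAct (M.leftEnv g hg) (add_zero γ) h h h' (add_zero β) _ y (M.A.one T))

/-- Crossing over the `M`-factor, `m` acts on `y` as `(g m) y`; the result is then brought around to
the left of `x` by `cycTm_unit`. This is where the rotation and the action of `g` in the last face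
originate. -/
theorem cycTm_tm {α β γ μ ν ε : Γ} (h : α + β = γ) (e : μ + ν = α) (h₁ : ν + β = ε)
    (h₂ : ε + μ = γ) {T : FinGSet G} (x : (X.C μ).obj T) (m : (M.A.C ν).obj T)
    (y : (M.A.C β).obj T) : (X.cycTm g hg).f h (X.tm.f e x m) y =
      σ.s ε μ • (X.cyc g hg γ).app T
        (X.l.f h₂ (M.A.mul.f h₁ ((gHom g M.A.C ν).app T m) y) x) := by
  have h₃ : μ + ε = γ := by rw [add_comm, h₂]
  rw [← X.cycTm_unit g hg h₃ h₂, ← Alg.leftEnv_l₁ g hg h₁ m y]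
  exact X.envTm_tm (M.leftEnv g hg) h e h₁ h₃ x m y

/-- The range of `cyc` is closed under sums, transfers and the Burnside ring action, and by
`cycTm_tm` it contains all generators. -/
theorem cyc_surjective : (X.cyc g hg).Surjective := by
  intro γ T z
  change z ∈ ((X.cyc g hg γ).app T).range
  induction z using X.env_ind (M.leftEnv g hg) with
  | h0 => exact zero_mem _
  | @ht U k α β e z y =>
    change (M.A.C β).obj U at y
    change (Box _ _ _).tr k ((X.cycTm g hg).f e z y) ∈ _
    induction z using X.ind with
    | h0 =>
      rw [map_zero, AddMonoidHom.zero_apply, map_zero]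
      exact zero_mem _
    | @ht V l μ ν d x m =>
      have d₁ : ν + β + μ = γ := by rw [← e, ← d]; abel
      rw [(X.cycTm g hg).tr_left, ← Mackey.tr_comp, X.cycTm_tm g hg e d rfl d₁,
        ← Mackey.Hom.map_smul, ← Mackey.Hom.app_tr]
      exact ⟨_, rfl⟩
    | hadd x y hx hy =>
      rw [map_add, AddMonoidHom.add_apply, map_add]
      exact add_mem hx hy
  | hadd x y hx hy => exact add_mem hx hy

/-- The face map that rotates the last factor to the front corresponds to `z ↦ z ⊗ 1`. -/
theorem cyc_rot {γ : Γ} {T : FinGSet G} (z : (X.stepC γ).obj T) :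
    (X.cyc g hg γ).app T ((X.rot g hg γ).app T z) =
      (X.cycTm g hg).f (add_zero γ) z (M.A.one T) := by
  induction z using X.ind with
  | h0 => simp only [map_zero, AddMonoidHom.zero_apply]
  | @ht U k α β e x m =>
    have e' : β + α = γ := by rw [add_comm, e]
    rw [Mackey.Hom.app_tr, Mackey.Hom.app_tr, (X.cycTm g hg).tr_left, M.A.res_one,
      X.rot_tm g hg e e', X.cycTm_tm g hg (add_zero γ) e (add_zero β) e', M.A.mul_one,
      Mackey.Hom.map_smul]
  | hadd x y hx hy => simp only [map_add, AddMonoidHom.add_apply, hx, hy]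

/-- Maps of algebras preserve the units that `cyc` appends. This gives naturality of the
identification with the Hochschild complex. -/
theorem SHom.map_cyc {M' : Alg σ R} {φ : Alg.Hom M M'} {X : BiMod M} {Y : BiMod M'}
    (f : SHom φ X Y) (hf : Box.SemiR φ.env X.step.rr.toRMod Y.step.rr.toRMod f.stepU) {α : Γ}
    {T : FinGSet G} (x : (X.C α).obj T) :
    (Box.map hf (φ.semi_leftEnv g hg) α).app T ((X.cyc g hg α).app T x) =
      (Y.cyc g hg α).app T ((f.u α).app T x) := by
  have h : (Box.map hf (φ.semi_leftEnv g hg) α).app T ((X.cyc g hg α).app T x) =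
      (Y.cycTm g hg).f (add_zero α) ((f.stepU α).app T ((X.unit α).app T x))
        ((φ.u 0).app T (M.A.one T)) :=
    Box.map_tmul (N := X.step.rr.toRMod) (N' := Y.step.rr.toRMod) (P := M.leftEnv g hg)
      (P' := M'.leftEnv g hg) hf (φ.semi_leftEnv g hg) (add_zero α) _ _
  rw [h, X.unit_app, f.stepU_tm, φ.map_one]
  rfl

end BiMod

namespace Alg

variable (M) in
/-- The Hochschild complex as a box product with the bar resolution. -/
def cycHom : GrComplex.Hom (M.hochschild g hg) (M.barRes.boxComplex (M.leftEnv g hg)) where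
  u q := (M.bar q).cyc g hg
  comm q α T z := by
    have h₁ : ((M.barRes.boxComplex (M.leftEnv g hg)).d q α).app T
        (((M.bar (q + 1)).cyc g hg α).app T z) = ((M.bar q).cycTm g hg).f (add_zero α)
          ((M.inner (q + 1) α).app T ((M.barS (q + 1) α).app T z)) (M.A.one T) :=
      (M.barRes.d q).box_tmul (M.leftEnv g hg) (add_zero α) _ _
    have h₂ : ((M.bar q).cyc g hg α).app T ((M.rotFace g hg q α).app T z) =
        ((M.bar q).cycTm g hg).f (add_zero α) z (M.A.one T) := (M.bar q).cyc_rot g hg z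
    have h₃ : ((M.bar q).cyc g hg α).app T ((M.inner q α).app T z) =
        ((M.bar q).cycTm g hg).f (add_zero α) ((M.barS q α).app T ((M.inner q α).app T z))
          (M.A.one T) := rfl
    refine Eq.trans ?_ h₁.symm
    change (M.barC (q + 1) α).obj T at z
    change ((M.bar q).cyc g hg α).app T ((M.boundary g hg q α).app T z) = _
    -- Both differentials split in the same way. The Hochschild one is the inner part plus
    -- `(-1)^(q+1)` times the rotation. The bar differential of `z ⊗ 1` is the inner part with a
    -- unit appended plus `(-1)^(q+1) z`. The inner parts correspond by definition of `cyc`, and the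
    -- remaining terms by `cyc_rot`.
    rw [boundary_eq, inner_succ_barS]
    refine (map_add (((M.bar q).cyc g hg α).app T) _ _).trans ?_
    refine (congrArg₂ (· + ·) h₃ ((map_zsmul (((M.bar q).cyc g hg α).app T) _ _).trans
      (congrArg _ h₂))).trans ?_
    let ψ : (M.barC (q + 1) α).obj T →+
        (Box (M.bar q).step.rr.toRMod (M.leftEnv g hg) α).obj T :=
      (((M.bar q).cycTm g hg).f (add_zero α)).flip (M.A.one T)
    exact ((map_add ψ _ _).trans (congrArg _ (map_zsmul ψ _ _))).symm

theorem cycHom_isIso (n : ℕ) : ((M.cycHom g hg).homologyMap n).IsIso :=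
  GrComplex.Hom.homologyMap_isIso_of_bijective _
    (fun q α T => ⟨(M.bar q).cyc_injective g hg α T, (M.bar q).cyc_surjective g hg α T⟩) n

/-- In each degree this is `BiMod.SHom.map_cyc`: the map of bar resolutions in degree `q` is the map
of box powers with `q + 1` factors, extended by `φ` on one more factor. -/
theorem Hom.cycHom_comp {M' : Alg σ R} (φ : Hom M M') :
    (M'.cycHom g hg).comp (φ.hochschild g hg) =
      (φ.barLift.boxHom (φ.semi_leftEnv g hg)).comp (M.cycHom g hg) := by
  refine GrComplex.Hom.ext fun q α T x => ?_
  exact ((φ.bar q).map_cyc g hg (φ.barLift.semi q) x).symm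

end Alg

end CyclicBar

end

noncomputable section

theorem GrHom.IsIso.comp_inv_comp {Γ G : Type} [Group G]
    {A B C : GrMackey.{u} Γ G} {f : GrHom A B} (hf : f.IsIso) (k : GrHom C B) :
    f.comp (hf.inv.comp k) = k :=
  GrHom.ext fun _ _ _ => hf.app_inv _

section Comparison

variable {Γ G : Type} [AddCommGroup Γ] [Group G] {σ : SignRule Γ G} {R : GrGreen.{u} Γ G}

/-! ### Hochschild homology as a derived functor -/

/-- A lift to projective resolutions as a lift to resolutions. -/
def ProjRes.Lift.toRes {A A' : GrGreen.{u} Γ G} {ψ : GrHom A.C A'.C} {N : RMod A} {N' : RMod A'}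
    {f : GrHom N.C N'.C} {Q : ProjRes N} {Q' : ProjRes N'} (F : ProjRes.Lift ψ f Q Q') :
    RMod.Res.Lift ψ f Q.toRes Q'.toRes where
  u := F.u
  semi := F.semi
  comm := F.comm
  comm_ε := F.comm_ε

/-- A lift to resolutions as a lift to projective resolutions. -/
def RMod.Res.Lift.toProj {A A' : GrGreen.{u} Γ G} {ψ : GrHom A.C A'.C} {N : RMod A}
    {N' : RMod A'} {f : GrHom N.C N'.C} {Q : ProjRes N} {Q' : ProjRes N'}
    (F : RMod.Res.Lift ψ f Q.toRes Q'.toRes) : ProjRes.Lift ψ f Q Q' where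
  u := F.u
  semi := F.semi
  comm := F.comm
  comm_ε := F.comm_ε

/-- The semilinear map `w` is kept separate from the composite `v' ∘ v`, so that composites with
identity maps can be stated with the original map instead. -/
theorem RMod.Res.Lift.boxHom_comp {A A' A'' : GrGreen.{u} Γ G} {N : RMod A} {N' : RMod A'}
    {N'' : RMod A''} {ψ : GrHom A.C A'.C} {ψ' : GrHom A'.C A''.C} {f : GrHom N.C N'.C}
    {f' : GrHom N'.C N''.C} {Q : N.Res} {Q' : N'.Res} {Q'' : N''.Res} {P : LMod A} {P' : LMod A'}
    {P'' : LMod A''} {v : GrHom P.C P'.C} {v' : GrHom P'.C P''.C} {w : GrHom P.C P''.C}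
    (F' : Lift ψ' f' Q' Q'') (F : Lift ψ f Q Q') (hv' : Box.SemiL ψ' P' P'' v')
    (hv : Box.SemiL ψ P P' v) (hw : Box.SemiL (ψ'.comp ψ) P P'' w) (h : v'.comp v = w) :
    (F'.boxHom hv').comp (F.boxHom hv) = (F'.comp F).boxHom hw := by
  subst h
  refine GrComplex.Hom.ext fun n α T x => ?_
  change (Box.map (F'.semi n) hv' α).app T ((Box.map (F.semi n) hv α).app T x) =
    (Box.map ((F'.comp F).semi n) hw α).app T x
  induction x using Box.ind with
  | h0 => simp only [map_zero]
  | ht k e x p =>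
    simp only [Mackey.Hom.app_tr]
    rw [Box.map_tmul, Box.map_tmul, Box.map_tmul]
    rfl
  | hadd x y hx hy => simp only [map_add, hx, hy]

/-! ### The comparison of `Tor` with Hochschild homology and its naturality. -/

namespace Alg

variable {M M' : Alg σ R}

theorem Hom.semi_rightEnv (φ : Hom M M') : Box.SemiR φ.env M.rightEnv M'.rightEnv φ.u :=
  BiMod.rr_semi φ (X := M.self) (Y := M'.self) φ.u φ.map_mul φ.map_mul

/-- The comparison theorem over the map of enveloping algebras: `φ` is semilinear over `φ.env` as a
map of right modules, and the source resolution is projective. -/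
theorem Hom.exists_lift (φ : Hom M M') (P : ProjRes M.rightEnv) (P' : ProjRes M'.rightEnv) :
    Nonempty (ProjRes.Lift φ.env φ.u P P') :=
  (RMod.Res.exists_lift (N := M.rightEnv) (N' := M'.rightEnv) φ.envHom φ.u φ.semi_rightEnv P.toRes
    P'.toRes P.projective).map fun F => RMod.Res.Lift.toProj (ψ := φ.env) F

/-- A comparison map from a projective resolution to the bar resolution. -/
def toBar (P : ProjRes M.rightEnv) :
    RMod.Res.Lift (GrHom.id M.env.C) (GrHom.id M.rightEnv.C) P.toRes M.barRes :=
  (RMod.Res.exists_lift (GrGreen.Hom.id M.env) (GrHom.id M.rightEnv.C) M.rightEnv.semi_id P.toRes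
    M.barRes P.projective).some

variable [IsMulCommutative G] (g : G) (hg : GTrivial g R)

/-- The map from `Tor` to the homology of the bar resolution. -/
def torToBar (P : ProjRes M.rightEnv) (n : ℕ) : GrHom (P.Tor (M.leftEnv g hg) n)
    ((M.barRes.boxComplex (M.leftEnv g hg)).homology n) :=
  ((toBar P).boxHom (M.leftEnv g hg).semi_id).homologyMap n

theorem torToBar_isIso (hM : M.toLMod.IsFlat) (P : ProjRes M.rightEnv) (n : ℕ) :
    (torToBar g hg P n).IsIso :=
  (toBar P).homologyMap_isIso (fun n => (P.projective n).isFlat) (barRes_isFlat hM) _ n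

/-- The isomorphism from twisted Hochschild homology to `Tor` over the enveloping algebra. -/
def hhToTor (hM : M.toLMod.IsFlat) (P : ProjRes M.rightEnv) (n : ℕ) :
    GrHom (M.HH g hg n) (P.Tor (M.leftEnv g hg) n) :=
  (torToBar_isIso g hg hM P n).inv.comp ((M.cycHom g hg).homologyMap n)

theorem hhToTor_isIso (hM : M.toLMod.IsFlat) (P : ProjRes M.rightEnv) (n : ℕ) :
    (hhToTor g hg hM P n).IsIso :=
  (torToBar_isIso g hg hM P n).inv_isIso.comp (cycHom_isIso g hg n)

theorem torToBar_hhToTor (hM : M.toLMod.IsFlat) (P : ProjRes M.rightEnv) (n : ℕ) :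
    (torToBar g hg P n).comp (hhToTor g hg hM P n) = (M.cycHom g hg).homologyMap n :=
  (torToBar_isIso g hg hM P n).comp_inv_comp _

/-- Going first along `F` and then to the bar resolution of `M'`, or first to the bar resolution of
`M` and then along `φ`, gives two lifts of the same map `φ` out of a projective resolution. They are
homotopic, so this holds for every choice of `F` and of the comparison maps. -/
theorem Hom.torToBar_naturality (φ : Hom M M') {P : ProjRes M.rightEnv}
    {P' : ProjRes M'.rightEnv} (F : ProjRes.Lift φ.env φ.u P P') (n : ℕ) :
    (torToBar g hg P' n).comp (F.Tor (φ.semi_leftEnv g hg) n) =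
      ((φ.barLift.boxHom (φ.semi_leftEnv g hg)).homologyMap n).comp (torToBar g hg P n) := by
  -- Composites with identity maps reduce definitionally, so both composed lifts are lifts of `φ.u`
  -- over `φ.env`.
  have h := RMod.Res.Lift.homologyMap_eq (P := M.leftEnv g hg) (P' := M'.leftEnv g hg) (v := φ.u)
    (N := M.rightEnv) (N' := M'.rightEnv) (f := φ.u) φ.envHom P.projective ((toBar P').comp F.toRes)
    (φ.barLift.comp (toBar P)) (φ.semi_leftEnv g hg) n
  have h₁ := congrArg (fun f => f.homologyMap n) (RMod.Res.Lift.boxHom_comp (toBar P') F.toRes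
    (M'.leftEnv g hg).semi_id (φ.semi_leftEnv g hg) (φ.semi_leftEnv g hg) rfl)
  have h₂ := congrArg (fun f => f.homologyMap n) (RMod.Res.Lift.boxHom_comp φ.barLift (toBar P)
    (φ.semi_leftEnv g hg) (M.leftEnv g hg).semi_id (φ.semi_leftEnv g hg) rfl)
  simp only [GrComplex.Hom.homologyMap_comp] at h₁ h₂
  exact h₁.trans (h.trans h₂.symm)

/-- Equality is tested after the injective map `torToBar` of `M'`. There both sides become maps into
the homology of `B □_{M^e} ᵍM` for `M'`, and they agree by naturality of `torToBar` and of `cycHom`.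
-/
theorem Hom.hhToTor_naturality (φ : Hom M M') (hM : M.toLMod.IsFlat) (hM' : M'.toLMod.IsFlat)
    {P : ProjRes M.rightEnv} {P' : ProjRes M'.rightEnv} (F : ProjRes.Lift φ.env φ.u P P')
    (n : ℕ) : (F.Tor (φ.semi_leftEnv g hg) n).comp (hhToTor g hg hM P n) =
      (hhToTor g hg hM' P' n).comp (φ.HH g hg n) := by
  have h₁ := φ.torToBar_naturality g hg F n
  have h₂ := congrArg (fun f => f.homologyMap n) (φ.cycHom_comp g hg)
  simp only [GrComplex.Hom.homologyMap_comp] at h₂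
  have h₃ := torToBar_hhToTor g hg hM P n
  have h₄ := torToBar_hhToTor g hg hM' P' n
  refine GrHom.ext fun α T x => (torToBar_isIso g hg hM' P' n α T).1 ?_
  have e₁ := congrArg (fun f => (f α).app T ((hhToTor g hg hM P n α).app T x)) h₁
  have e₂ := congrArg (fun f => (f α).app T x) h₂
  have e₃ := congrArg (fun f => (f α).app T x) h₃
  have e₄ := congrArg (fun f => (f α).app T ((φ.HH g hg n α).app T x)) h₄
  exact e₁.trans ((congrArg _ e₃).trans (e₂.symm.trans e₄.symm))

end Alg

end Comparison

/-! ### The main theorem. -/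

theorem mainTheorem10 (G : Subgroup Circle) [Finite G] (g : G)
    (hg : (g : Circle) = Circle.exp (2 * Real.pi / Nat.card G))
    (σ : SwitchSign G) (R : GrGreen.{u} (RO G) G) (hR : R.IsComm σ.toSignRule)
    (hgR : GTrivial g R) :
    (∀ M : Alg σ.toSignRule R, Nonempty (ProjRes M.rightEnv)) ∧
    ∃ Φ : ∀ (M : Alg σ.toSignRule R), M.toLMod.IsFlat → ∀ (P : ProjRes M.rightEnv) (n : ℕ),
        GrHom (M.HH g hgR n) (P.Tor (M.leftEnv g hgR) n),
      (∀ (M : Alg σ.toSignRule R) (hM : M.toLMod.IsFlat) (P : ProjRes M.rightEnv) (n : ℕ),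
        (Φ M hM P n).IsIso) ∧
      ∀ (M M' : Alg σ.toSignRule R) (hM : M.toLMod.IsFlat) (hM' : M'.toLMod.IsFlat)
        (φ : Alg.Hom M M') (P : ProjRes M.rightEnv) (P' : ProjRes M'.rightEnv),
        Nonempty (ProjRes.Lift φ.env φ.u P P') ∧
        ∀ (F : ProjRes.Lift φ.env φ.u P P') (n : ℕ),
          (F.Tor (φ.semi_leftEnv g hgR) n).comp (Φ M hM P n) =
            (Φ M' hM' P' n).comp (φ.HH g hgR n) :=
  ⟨fun M => ProjRes.nonempty M.rightEnv, fun _ hM P n => Alg.hhToTor g hgR hM P n,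
    fun _ hM P n => Alg.hhToTor_isIso g hgR hM P n, fun _ _ hM hM' φ P P' =>
      ⟨φ.exists_lift P P', fun F n => φ.hhToTor_naturality g hgR hM hM' F n⟩⟩

end
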